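/- Let $M$ be a smooth manifold of dimension $m$, and let $E,F\to M$ be smooth real vector bundles of ranks $r,s$. Let $\mathcal M=\Pi E\oplus\Pi F$ be the supermanifold with coordinates $\phi^A=(x^i,\eta^a,c^\alpha)$ ($x^i$ on $M$ even, $\eta^a,c^\alpha$ odd linear fibre coordinates), let $\mathcal N=\Pi T^*\mathcal M$ with momenta $\phi^*_A$ of parity $A+1$ and canonical odd Poisson bracket $(-,-)$, $(\phi^*_A,\phi^B)=\delta_A^B$, and let $\Pi T\mathcal N$ have the additional coordinates $d\phi^A$, $d\phi^*_A$ (of parity $A+1$ and $A$). The ghost numbers are $0,-1,1$ for $x,\eta,c$, $\mathrm{gh}(\phi^*_A)=1-\mathrm{gh}(\phi^A)$, and $d$ lowers the ghost number by one. Let $\{-,-\}$ be the canonical even Poisson bracket on $\Pi T\mathcal N$, which in terms of right derivatives of $F$ and left derivatives of $G$ is $$\{F,G\}=\sum_A\Big(\tfrac{\partial F}{\partial d\phi^*_A}\tfrac{\partial G}{\partial\phi^A}-(-1)^A\tfrac{\partial F}{\partial\phi^A}\tfrac{\partial G}{\partial d\phi^*_A}-\tfrac{\partial F}{\partial d\phi^A}\tfrac{\partial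 G}{\partial\phi^*_A}-(-1)^A\tfrac{\partial F}{\partial\phi^*_A}\tfrac{\partial G}{\partial d\phi^A}\Big),$$ let $\Delta=\sum_A(-1)^Ad\phi^Ad\phi^*_A$, and let $\mathcal L=\{\phi^*=0=d\phi^*\}\subset\Pi T\mathcal N$. Functions on $\mathcal L$ are taken fibrewise polynomial in $d\phi$ (they are the differential forms on $\mathcal M$). Let $S=\sum_{k\ge1}S^k$ be a master function: a function on $\mathcal N$, formal in the momenta, with $S^k$ homogeneous of degree $k$ in $\phi^*$, even, of ghost number $2$, with $(S,S)=0$. Put $\Psi=\{\Delta,S\}$, $\hat Q=\{\Psi,-\}|_{\mathcal L}$, $[\omega,\tau]=\{\{\Psi,\omega\},\tau\}|_{\mathcal L}$ and $QX=(S^1,X)$. A differential form $\omega\in C^\infty(\Pi TM)$ on $M$ is projectible if it has an extension to $\mathcal L$, with ghost number $-k$ in each form degree $k$, that is a $\hat Q$-cocycle. A projectible vector field on $M$ is a vector field $V=V^ix^*_i$ that has an extension to a $Q$-cocycle $X=X^A(\phi)\phi^*_A$ of ghost number $1$ on $\mathcal N$. The interior product is $\imath_X\omega=(-1)^X\{X,\omega\}|_{\mathcal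 L}$, and the exterior differential is $d=\sum_A(-1)^Ad\phi^A\,\partial/\partial\phi^A$. The weak Koszul bracket of forms on $M$ is $[\omega,\tau]|_{\Pi TM}$. Then the following hold, both for the $\hat Q$-cocycles on $\mathcal L$ (with the bracket $[-,-]$, the $\hat Q$-coboundaries, and all $Q$-cocycles $X=X^A(\phi)\phi^*_A$ as vector fields) and for the projectible forms on $M$ (with the weak Koszul bracket, the restrictions to $\Pi TM$ of coboundaries $\hat Q\lambda$ with $\lambda$ of ghost number $-k-1$ in form degree $k$, and the projectible vector fields on $M$): 1. They form a unital subalgebra which is closed under the bracket. On it the bracket is bilinear, odd, supersymmetric, $[\omega,\tau]=(-1)^{\omega\tau}[\tau,\omega]$, satisfies the Leibniz rule $[\omega,\tau\sigma]=[\omega,\tau]\sigma+(-1)^{(\omega+1)\tau}\tau[\omega,\sigma]$, and satisfies the Jacobi identity $[[\omega,\tau],\sigma]+(-1)^{\tau\sigma}[[\omega,\sigma],\tau]+(-1)^{\omega(\tau+\sigma)}[[\tau,\sigma],\omega]=0$ modulo the coboundaries (respectively, their restrictions). The latter form an ideal for the product and the bracket. 2. They are closed under $d$. 3. They form a module over the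 corresponding vector fields with respect to the interior product: $\imath_X\omega$ is again a cocycle (respectively, projectible), $\imath_X\omega$ is bilinear in $X$ and $\omega$, $\imath_X\imath_Y=(-1)^{XY}\imath_Y\imath_X$, and for a cocycle (respectively, projectible) function $f$ the field $fX$ is again of the same type and $\imath_{fX}\omega=(-1)^f f\,\imath_X\omega$. -/

import Mathlib

open scoped Manifold

namespace WeakKoszul

noncomputable section

/-! ### Coordinates

`𝓜 = ΠE ⊕ ΠF → M` has coordinates `φ^A = (x^i, η^a, c^α)`; the index `A` ranges over `Idx m r s`.
`𝓝 = ΠT*𝓜` adds the momenta `φ*_A`, and `ΠT𝓝` adds the velocities `dφ^A`, `dφ*_A`. -/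

abbrev Idx (m r s : ℕ) := Fin m ⊕ (Fin r ⊕ Fin s)

/-- The four kinds of coordinates on `ΠT𝓝`: `φ`, `φ*`, `dφ`, `dφ*`. -/
inductive Kind where
  | fld | mom | vel | mvel
  deriving DecidableEq

instance : Fintype Kind where
  elems := {.fld, .mom, .vel, .mvel}
  complete k := by cases k <;> decide

/-- A coordinate of `ΠT𝓝`. -/
abbrev Var (m r s : ℕ) := Kind × Idx m r s

variable {m r s : ℕ}

/-- Grassmann parity of `φ^A`: `x` is even, `η` and `c` are odd. -/
def Idx.odd : Idx m r s → Bool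
  | .inl _ => false
  | .inr _ => true

/-- The sign `(-1)^A`. -/
def Idx.sign (A : Idx m r s) : ℤ := if Idx.odd A then -1 else 1

/-- Grassmann parity of the coordinates of `ΠT𝓝`. -/
def Var.odd : Var m r s → Bool
  | (.fld, A) => Idx.odd A
  | (.mom, A) => !Idx.odd A
  | (.vel, A) => !Idx.odd A
  | (.mvel, A) => Idx.odd A

/-- The coordinates `x^i` of `M`, on which functions depend smoothly. -/
def Var.base : Var m r s → Bool
  | (.fld, .inl _) => true
  | _ => false

abbrev OddVar (m r s : ℕ) := {v : Var m r s // Var.odd v = true}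

/-- The even fibre coordinates `η*`, `c*`, `dη`, `dc`, `dx*`. -/
abbrev EvenVar (m r s : ℕ) := {v : Var m r s // Var.odd v = false ∧ Var.base v = false}

/-- Ghost number of `φ^A`. -/
def Idx.ghost : Idx m r s → ℤ
  | .inl _ => 0
  | .inr (.inl _) => -1
  | .inr (.inr _) => 1

/-- Ghost number. -/
def ghost : Var m r s → ℤ
  | (.fld, A) => Idx.ghost A
  | (.mom, A) => 1 - Idx.ghost A
  | (.vel, A) => Idx.ghost A - 1
  | (.mvel, A) => - Idx.ghost A

/-- Momentum degree (number of factors `φ*`, `dφ*`). -/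
def momDeg : Var m r s → ℤ
  | (.mom, _) => 1
  | (.mvel, _) => 1
  | _ => 0

/-- Form degree (number of factors `dφ`). -/
def formDeg : Var m r s → ℤ
  | (.vel, _) => 1
  | _ => 0

/-- Coordinates of the Lagrangian submanifold `𝓛 = {φ* = 0 = dφ*}`. -/
def OnL : Var m r s → Prop
  | (.fld, _) => True
  | (.vel, _) => True
  | _ => False

/-- Coordinates of `𝓝`. -/
def OnN : Var m r s → Prop
  | (.fld, _) => True
  | (.mom, _) => True
  | _ => False

/-- Coordinates of `𝓜`. -/
def OnExt : Var m r s → Prop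
  | (.fld, _) => True
  | _ => False

/-- Coordinates of `ΠTM`. -/
def OnTM : Var m r s → Prop
  | (.fld, .inl _) => True
  | (.vel, .inl _) => True
  | _ => False

/-- Coordinates of `ΠT*M`. -/
def OnTsM : Var m r s → Prop
  | (.fld, .inl _) => True
  | (.mom, .inl _) => True
  | _ => False

/-! ### The local algebra of functions

Over a coordinate domain with ring of coefficient functions `K`, the fibrewise polynomial functions
are `K[even fibre coordinates] ⊗ Λ[odd coordinates]`. An element is stored as the family of
coefficients of the ordered odd monomials, in a fixed order of the odd coordinates. -/

def Loc (m r s : ℕ) (K : Type*) [CommRing K] :=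
  Finset (OddVar m r s) → MvPolynomial (EvenVar m r s) K

/-- The position of an odd coordinate in the fixed order. -/
def pos (v : OddVar m r s) : Fin (Fintype.card (OddVar m r s)) := Fintype.equivFin _ v

section Algebra

variable {K : Type*} [CommRing K]

instance : AddCommGroup (Loc m r s K) :=
  inferInstanceAs (AddCommGroup (Finset (OddVar m r s) → MvPolynomial (EvenVar m r s) K))

instance [Module ℝ K] : Module ℝ (Loc m r s K) :=
  inferInstanceAs (Module ℝ (Finset (OddVar m r s) → MvPolynomial (EvenVar m r s) K))

/-- The sign in `θ_I θ_J = ± θ_{I ∪ J}`. -/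
def shuffleSign (I J : Finset (OddVar m r s)) : ℤ :=
  (-1) ^ ((I ×ˢ J).filter fun q => pos q.2 < pos q.1).card

instance : Mul (Loc m r s K) where
  mul F G := fun L => ∑ I ∈ L.powerset, shuffleSign I (L \ I) • (F I * G (L \ I))

/-- A coefficient function as an element of the algebra. -/
def coef (a : K) : Loc m r s K := fun I => if I = ∅ then MvPolynomial.C a else 0

instance : One (Loc m r s K) where
  one := coef 1

/-- An odd coordinate as an element of the algebra. -/
def genOdd (v : OddVar m r s) : Loc m r s K := fun I => if I = {v} then 1 else 0

/-- An even fibre coordinate as an element of the algebra. -/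
def genEven (e : EvenVar m r s) : Loc m r s K := fun I => if I = ∅ then MvPolynomial.X e else 0

/-- The fibre coordinates as elements of the algebra (the value at `x^i` is not used). -/
def gen (v : Var m r s) : Loc m r s K :=
  if ho : Var.odd v = true then genOdd ⟨v, ho⟩
  else if hb : Var.base v = false then genEven ⟨v, by simpa using ho, hb⟩
  else 0

/-- The parity involution `F ↦ (-1)^F F`. -/
def inv (F : Loc m r s K) : Loc m r s K := fun I => (-1 : ℤ) ^ I.card • F I

/-- The left derivative with respect to an odd coordinate. -/
def pdOdd (v : OddVar m r s) (F : Loc m r s K) : Loc m r s K := fun I =>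
  if v ∈ I then 0 else (-1 : ℤ) ^ (I.filter fun w => pos w < pos v).card • F (insert v I)

/-- The derivative with respect to an even fibre coordinate. -/
def pdEven (e : EvenVar m r s) (F : Loc m r s K) : Loc m r s K := fun I =>
  MvPolynomial.pderiv e (F I)

/-- The derivative with respect to `x^i`, where `D i` is `∂/∂x^i` on coefficient functions. -/
def pdBase (D : Fin m → K → K) : Var m r s → Loc m r s K → Loc m r s K
  | (.fld, .inl i), F => fun I =>
      ∑ n ∈ (F I).support, MvPolynomial.monomial n (D i ((F I).coeff n))
  | _, _ => 0

/-- Left partial derivatives. -/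
def pd (D : Fin m → K → K) (v : Var m r s) (F : Loc m r s K) : Loc m r s K :=
  if ho : Var.odd v = true then pdOdd ⟨v, ho⟩ F
  else if hb : Var.base v = false then pdEven ⟨v, by simpa using ho, hb⟩ F
  else pdBase D v F

/-- Right partial derivatives, `(-1)^{v(F+1)} ∂F/∂v`. -/
def rpd (D : Fin m → K → K) (v : Var m r s) (F : Loc m r s K) : Loc m r s K :=
  if Var.odd v then inv (pd D v F) else pd D v F

/-- The even Poisson bracket `{F, G}` on `ΠT𝓝`. Written with right derivatives of `F` it is
`∂F/∂dφ*_A ∂G/∂φ^A - (-1)^A ∂F/∂φ^A ∂G/∂dφ*_A - ∂F/∂dφ^A ∂G/∂φ*_A - (-1)^A ∂F/∂φ*_A ∂G/∂dφ^A`. -/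
def evenBr (D : Fin m → K → K) (F G : Loc m r s K) : Loc m r s K :=
  ∑ A : Idx m r s,
    (rpd D (.mvel, A) F * pd D (.fld, A) G
      - Idx.sign A • (rpd D (.fld, A) F * pd D (.mvel, A) G)
      - rpd D (.vel, A) F * pd D (.mom, A) G
      - Idx.sign A • (rpd D (.mom, A) F * pd D (.vel, A) G))

/-- The canonical odd Poisson bracket `(F, G)` on `𝓝 = ΠT*𝓜`, with `(φ*_A, φ^B) = δ_A^B`. -/
def oddBr (D : Fin m → K → K) (F G : Loc m r s K) : Loc m r s K :=
  ∑ A : Idx m r s,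
    (rpd D (.mom, A) F * pd D (.fld, A) G - rpd D (.fld, A) F * pd D (.mom, A) G)

/-- `Δ = (-1)^A dφ^A dφ*_A`. -/
def delta : Loc m r s K :=
  ∑ A : Idx m r s, Idx.sign A • (gen (.vel, A) * gen (.mvel, A))

/-- The exterior differential `(-1)^A dφ^A ∂/∂φ^A`. -/
def extD (D : Fin m → K → K) (F : Loc m r s K) : Loc m r s K :=
  ∑ A : Idx m r s, Idx.sign A • (gen (.vel, A) * pd D (.fld, A) F)

/-- The weighted degree of the monomial `θ_I y^n`. -/
def wt (w : Var m r s → ℤ) (I : Finset (OddVar m r s)) (n : EvenVar m r s →₀ ℕ) : ℤ :=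
  ∑ v ∈ I, w v.1 + n.sum fun e k => (k : ℤ) * w e.1

/-- The monomial `θ_I y^n` only contains coordinates that satisfy `P`. -/
def Involves (P : Var m r s → Prop) (I : Finset (OddVar m r s)) (n : EvenVar m r s →₀ ℕ) : Prop :=
  (∀ v ∈ I, P v.1) ∧ ∀ e ∈ n.support, P e.1

open Classical in
/-- Restriction to the submanifold on which the fibre coordinates that violate `P` vanish. -/
def restr (P : Var m r s → Prop) (F : Loc m r s K) : Loc m r s K := fun I =>
  ∑ n ∈ (F I).support with Involves P I n, MvPolynomial.monomial n ((F I).coeff n)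

/-- Substitution of `θ v` for each fibre coordinate `v`; coefficients are left unchanged. -/
def subst (θ : Var m r s → Loc m r s K) (F : Loc m r s K) : Loc m r s K :=
  ∑ I : Finset (OddVar m r s), ∑ n ∈ (F I).support,
    coef ((F I).coeff n)
      * ((List.finRange (Fintype.card (OddVar m r s))).map fun j =>
          let v := (Fintype.equivFin (OddVar m r s)).symm j
          if v ∈ I then θ v.1 else 1).prod
      * ((Finset.univ : Finset (EvenVar m r s)).toList.flatMap fun e =>
          List.replicate (n e) (θ e.1)).prod

/-! Functions that are formal power series in the momenta `φ*`, `dφ*` are sequences whose `k`-th term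
is the component of momentum degree `k`. Both brackets lower the momentum degree by one. -/

/-- The even bracket of formal series in the momenta. -/
def evenBrF (D : Fin m → K → K) (F G : ℕ → Loc m r s K) : ℕ → Loc m r s K :=
  fun n => ∑ q ∈ Finset.HasAntidiagonal.antidiagonal (n + 1), evenBr D (F q.1) (G q.2)

/-- The odd bracket of formal series in the momenta. -/
def oddBrF (D : Fin m → K → K) (F G : ℕ → Loc m r s K) : ℕ → Loc m r s K :=
  fun n => ∑ q ∈ Finset.HasAntidiagonal.antidiagonal (n + 1), oddBr D (F q.1) (G q.2)

/-- A function of momentum degree `k` as a formal series. -/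
def homog (k : ℕ) (F : Loc m r s K) : ℕ → Loc m r s K := Pi.single k F

/-- Restriction of a formal series to `𝓛`. -/
def toL (F : ℕ → Loc m r s K) : Loc m r s K := restr OnL (F 0)

/-- `Ψ = {Δ, S}`. -/
def psi (D : Fin m → K → K) (S : ℕ → Loc m r s K) : ℕ → Loc m r s K :=
  evenBrF D (homog 1 delta) S

/-- `Q̂ω = {Ψ, ω}|_𝓛`. -/
def qHat (D : Fin m → K → K) (S : ℕ → Loc m r s K) (ω : Loc m r s K) : Loc m r s K :=
  toL (evenBrF D (psi D S) (homog 0 ω))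

/-- The odd binary bracket `[ω, τ] = {{Ψ, ω}, τ}|_𝓛`. -/
def koszul (D : Fin m → K → K) (S : ℕ → Loc m r s K) (ω τ : Loc m r s K) : Loc m r s K :=
  toL (evenBrF D (evenBrF D (psi D S) (homog 0 ω)) (homog 0 τ))

/-- The interior product `ι_X ω = (-1)^X {X, ω}|_𝓛` with a function `X` of momentum degree one. -/
def interior (D : Fin m → K → K) (X ω : Loc m r s K) : Loc m r s K :=
  toL (evenBrF D (homog 1 (inv X)) (homog 0 ω))

end Algebra

/-! ### Charts and global functions -/

section Global

variable (M : Type*) [TopologicalSpace M] [ChartedSpace (EuclideanSpace ℝ (Fin m)) M]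
  (E : M → Type*) [TopologicalSpace (Bundle.TotalSpace (Fin r → ℝ) E)]
  [∀ p, TopologicalSpace (E p)] [FiberBundle (Fin r → ℝ) E]
  (F : M → Type*) [TopologicalSpace (Bundle.TotalSpace (Fin s → ℝ) F)]
  [∀ p, TopologicalSpace (F p)] [FiberBundle (Fin s → ℝ) F]

/-- A chart of `M` with trivializations of `E` and `F`. -/
structure Chart where
  /-- the coordinates `x^i` -/
  x : OpenPartialHomeomorph M (EuclideanSpace ℝ (Fin m))
  mem_x : x ∈ atlas (EuclideanSpace ℝ (Fin m)) M
  /-- the fibre coordinates `η^a` -/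
  trE : Bundle.Trivialization (Fin r → ℝ) (Bundle.TotalSpace.proj : Bundle.TotalSpace (Fin r → ℝ) E → M)
  mem_trE : MemTrivializationAtlas trE
  /-- the fibre coordinates `c^α` -/
  trF : Bundle.Trivialization (Fin s → ℝ) (Bundle.TotalSpace.proj : Bundle.TotalSpace (Fin s → ℝ) F → M)
  mem_trF : MemTrivializationAtlas trF

variable {M E F}

/-- The open set of `M` on which the coordinates are defined. -/
def Chart.dom (c : Chart (m := m) (r := r) (s := s) M E F) : Set M :=
  c.x.source ∩ c.trE.baseSet ∩ c.trF.baseSet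

/-- The coordinate function `x^i`. -/
def Chart.coord (c : Chart (m := m) (r := r) (s := s) M E F) (i : Fin m) : M → ℝ :=
  fun p => c.x p i

/-- The partial derivatives `∂/∂x^i` of functions on `M`. -/
def Chart.D (c : Chart (m := m) (r := r) (s := s) M E F) (i : Fin m) (f : M → ℝ) : M → ℝ :=
  fun p => fderiv ℝ (f ∘ c.x.symm) (c.x p) (EuclideanSpace.single i 1)

/-- The matrix in `z'^A = T^A_B z^B`, where `z = (η, c)` and the primed chart is `c'`. -/
def Chart.trans (c c' : Chart (m := m) (r := r) (s := s) M E F) :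
    Fin r ⊕ Fin s → Fin r ⊕ Fin s → M → ℝ
  | .inl a, .inl b => fun p => c.trE.coordChange c'.trE p (Pi.single b 1) a
  | .inr a, .inr b => fun p => c.trF.coordChange c'.trF p (Pi.single b 1) a
  | _, _ => 0

/-- `φ'^A` in the coordinates of `c`. -/
def Chart.newFld (c c' : Chart (m := m) (r := r) (s := s) M E F) :
    Idx m r s → Loc m r s (M → ℝ)
  | .inl i => coef (c'.coord i)
  | .inr A => ∑ B, coef (c.trans c' A B) * gen (.fld, .inr B)

/-- `φ*'_A = (∂φ^B/∂φ'^A) φ*_B` in the coordinates of `c`. -/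
def Chart.newMom (c c' : Chart (m := m) (r := r) (s := s) M E F) :
    Idx m r s → Loc m r s (M → ℝ)
  | .inl i => ∑ j, coef (c'.D i (c.coord j)) * gen (.mom, .inl j)
      + ∑ B, ∑ A, coef (c'.D i (c'.trans c B A)) * c.newFld c' (.inr A) * gen (.mom, .inr B)
  | .inr A => ∑ B, coef (c'.trans c B A) * gen (.mom, .inr B)

/-- The coordinates of `c'` on `ΠT𝓝` in the coordinates of `c`. The differential `{Δ, -}` sends a
coordinate `u` of `𝓝` to `(-1)^u du`. -/
def Chart.newVar (c c' : Chart (m := m) (r := r) (s := s) M E F) :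
    Var m r s → Loc m r s (M → ℝ)
  | (.fld, A) => c.newFld c' A
  | (.mom, A) => c.newMom c' A
  | (.vel, A) => Idx.sign A • evenBr c.D delta (c.newFld c' A)
  | (.mvel, A) => (-Idx.sign A) • evenBr c.D delta (c.newMom c' A)

/-- Equality of local functions over a subset of `M`. -/
def EqOver (U : Set M) (f g : Loc m r s (M → ℝ)) : Prop :=
  ∀ I n, ∀ p ∈ U, (f I).coeff n p = (g I).coeff n p

/-- Over `U`, all monomials that occur in `f` satisfy `P`. -/
def SuppOver (U : Set M) (P : Finset (OddVar m r s) → (EvenVar m r s →₀ ℕ) → Prop)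
    (f : Loc m r s (M → ℝ)) : Prop :=
  ∀ I n, ∀ p ∈ U, (f I).coeff n p ≠ 0 → P I n

variable (m r s M E F) in
/-- A family of local functions, one for each chart; only the values over the domain of the chart
matter. -/
abbrev Fam := Chart (m := m) (r := r) (s := s) M E F → Loc m r s (M → ℝ)

/-- Equality as functions. -/
def Same (f g : Fam m r s M E F) : Prop := ∀ c, EqOver c.dom (f c) (g c)

/-- The family consists of the local expressions of one smooth, fibrewise polynomial function on
`ΠT𝓝`. -/
def IsGlobal (f : Fam m r s M E F) : Prop :=
  (∀ c I n, ContMDiffOn (𝓡 m) 𝓘(ℝ, ℝ) ((⊤ : ℕ∞) : WithTop ℕ∞) ((f c I).coeff n) c.dom) ∧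
  ∀ c c', EqOver (c.dom ∩ c'.dom) (f c) (subst (c.newVar c') (f c'))

/-- All monomials of `f` satisfy `P`. -/
def Supp (P : Finset (OddVar m r s) → (EvenVar m r s →₀ ℕ) → Prop) (f : Fam m r s M E F) : Prop :=
  ∀ c, SuppOver c.dom P (f c)

/-- `f` has Grassmann parity `e` modulo 2. -/
def HasParity (f : Fam m r s M E F) (e : ℕ) : Prop := Supp (fun I _ => I.card % 2 = e % 2) f

/-- A global function on the submanifold of `ΠT𝓝` with coordinates `P`. -/
def IsFun (P : Var m r s → Prop) (f : Fam m r s M E F) : Prop :=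
  IsGlobal f ∧ Supp (Involves P) f

/-- Product of functions. -/
def fmul (f g : Fam m r s M E F) : Fam m r s M E F := fun c => f c * g c

/-- Constant function one. -/
def fone : Fam m r s M E F := fun _ => 1

/-- Parity involution. -/
def finv (f : Fam m r s M E F) : Fam m r s M E F := fun c => inv (f c)

/-- Restriction. -/
def frestr (P : Var m r s → Prop) (f : Fam m r s M E F) : Fam m r s M E F :=
  fun c => restr P (f c)

/-- Exterior differential. -/
def fd (f : Fam m r s M E F) : Fam m r s M E F := fun c => extD c.D (f c)

/-- Interior product. -/
def finner (X f : Fam m r s M E F) : Fam m r s M E F := fun c => interior c.D (X c) (f c)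

/-! ### The master function and projectible objects -/

/-- A master function `S = ∑ S^k` on `𝓝`: even, of ghost number 2, of positive momentum degree,
with `(S, S) = 0`. Here `S k` is the component of momentum degree `k`. -/
structure IsMaster (S : ℕ → Fam m r s M E F) : Prop where
  isFun : ∀ k, IsFun OnN (S k)
  parity_eq : ∀ k, HasParity (S k) 0
  ghost_eq : ∀ k, Supp (fun I n => wt ghost I n = 2) (S k)
  momDeg_eq : ∀ k : ℕ, Supp (fun I n => wt momDeg I n = (k : ℤ)) (S k)
  momDeg_pos : Same (S 0) 0
  master : ∀ n, Same (fun c => oddBrF c.D (fun k => S k c) (fun k => S k c) n) 0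

/-- The homological vector field `Q̂ = {Ψ, -}|_𝓛`. -/
def Qhat (S : ℕ → Fam m r s M E F) (ω : Fam m r s M E F) : Fam m r s M E F :=
  fun c => qHat c.D (fun k => S k c) (ω c)

/-- The odd binary bracket on `C^∞(𝓛)`. -/
def bracketL (S : ℕ → Fam m r s M E F) (ω τ : Fam m r s M E F) : Fam m r s M E F :=
  fun c => koszul c.D (fun k => S k c) (ω c) (τ c)

/-- The weak Koszul bracket of differential forms on `M`. -/
def bracketM (S : ℕ → Fam m r s M E F) (ω τ : Fam m r s M E F) : Fam m r s M E F :=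
  frestr OnTM (bracketL S ω τ)

/-- `QX = (S^1, X)`. -/
def Qop (S : ℕ → Fam m r s M E F) (X : Fam m r s M E F) : Fam m r s M E F :=
  fun c => oddBr c.D (S 1 c) (X c)

/-- `Q̂`-cocycles on `𝓛`. -/
def cocyclesL (S : ℕ → Fam m r s M E F) : Set (Fam m r s M E F) :=
  {ω | IsFun OnL ω ∧ Same (Qhat S ω) 0}

/-- `Q̂`-coboundaries on `𝓛`. -/
def coboundariesL (S : ℕ → Fam m r s M E F) : Set (Fam m r s M E F) :=
  {ω | ∃ lam, IsFun OnL lam ∧ Same ω (Qhat S lam)}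

/-- Vector fields on `𝓜` (functions on `𝓝` of momentum degree one) that are `Q`-cocycles. -/
def vectorsL (S : ℕ → Fam m r s M E F) : Set (Fam m r s M E F) :=
  {X | IsFun OnN X ∧ Supp (fun I n => wt momDeg I n = 1) X ∧ Same (Qop S X) 0}

/-- `Ω` is an extension to `𝓛` of the form `ω` on `M`: the terms of form degree `k` have ghost number
`-k`, as `dx^{i_1} ⋯ dx^{i_k}` has. -/
structure IsExtension (ω Ω : Fam m r s M E F) : Prop where
  isFun : IsFun OnL Ω
  ghost_eq : Supp (fun I n => wt ghost I n = - wt formDeg I n) Ω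
  restr_eq : Same (frestr OnTM Ω) ω

/-- Projectible differential forms on `M`. -/
def formsM (S : ℕ → Fam m r s M E F) : Set (Fam m r s M E F) :=
  {ω | IsFun OnTM ω ∧ ∃ Ω, IsExtension ω Ω ∧ Same (Qhat S Ω) 0}

/-- Restrictions to `ΠTM` of the coboundaries `Q̂λ`, of ghost number `-k` in form degree `k`. -/
def trivialM (S : ℕ → Fam m r s M E F) : Set (Fam m r s M E F) :=
  {ω | ∃ lam, IsFun OnL lam ∧ Supp (fun I n => wt ghost I n = - wt formDeg I n - 1) lam ∧
    Same ω (frestr OnTM (Qhat S lam))}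

/-- Projectible vector fields on `M`, as functions `V^i x*_i` on `ΠT*M`: they extend to `Q`-cocycles
of momentum degree one and ghost number one. -/
def vectorsM (S : ℕ → Fam m r s M E F) : Set (Fam m r s M E F) :=
  {V | ∃ X ∈ vectorsL S, Supp (fun I n => wt ghost I n = 1) X ∧ Same V (frestr OnTsM X)}

/-- `Z` is closed under the algebra operations and under `B`; on `Z` the bracket `B` is an odd
Poisson bracket, the Jacobi identity being understood modulo `T`; and `T` is an ideal
for the product and for `B`. -/
structure IsWeakOddPoisson (Z T : Set (Fam m r s M E F))
    (B : Fam m r s M E F → Fam m r s M E F → Fam m r s M E F) : Prop where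
  one_mem : fone ∈ Z
  add_mem : ∀ ω ∈ Z, ∀ τ ∈ Z, ω + τ ∈ Z
  smul_mem : ∀ (a : ℝ), ∀ ω ∈ Z, a • ω ∈ Z
  mul_mem : ∀ ω ∈ Z, ∀ τ ∈ Z, fmul ω τ ∈ Z
  bracket_mem : ∀ ω ∈ Z, ∀ τ ∈ Z, B ω τ ∈ Z
  bracket_add : ∀ ω ∈ Z, ∀ τ ∈ Z, ∀ σ ∈ Z, Same (B ω (τ + σ)) (B ω τ + B ω σ)
  bracket_smul : ∀ (a : ℝ), ∀ ω ∈ Z, ∀ τ ∈ Z, Same (B ω (a • τ)) (a • B ω τ)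
  bracket_odd : ∀ ω ∈ Z, ∀ τ ∈ Z, ∀ e f : ℕ, HasParity ω e → HasParity τ f →
    HasParity (B ω τ) (e + f + 1)
  bracket_symm : ∀ ω ∈ Z, ∀ τ ∈ Z, ∀ e f : ℕ, HasParity ω e → HasParity τ f →
    Same (B ω τ) ((-1 : ℝ) ^ (e * f) • B τ ω)
  leibniz : ∀ ω ∈ Z, ∀ τ ∈ Z, ∀ σ ∈ Z, ∀ e f : ℕ, HasParity ω e → HasParity τ f →
    Same (B ω (fmul τ σ)) (fmul (B ω τ) σ + (-1 : ℝ) ^ ((e + 1) * f) • fmul τ (B ω σ))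
  jacobi : ∀ ω ∈ Z, ∀ τ ∈ Z, ∀ σ ∈ Z, ∀ e f g : ℕ,
    HasParity ω e → HasParity τ f → HasParity σ g →
    B (B ω τ) σ + (-1 : ℝ) ^ (f * g) • B (B ω σ) τ + (-1 : ℝ) ^ (e * (f + g)) • B (B τ σ) ω ∈ T
  trivial_mem : T ⊆ Z
  trivial_add : ∀ ω ∈ T, ∀ τ ∈ T, ω + τ ∈ T
  trivial_mul : ∀ ω ∈ T, ∀ τ ∈ Z, fmul ω τ ∈ T
  trivial_bracket : ∀ ω ∈ T, ∀ τ ∈ Z, B ω τ ∈ T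

/-- `Z` is a module over the vector fields in `V` with respect to the operation `i X ω`. The set `V`
is itself a module over the functions in `R`. -/
structure IsInnerModule (V R Z : Set (Fam m r s M E F))
    (i : Fam m r s M E F → Fam m r s M E F → Fam m r s M E F) : Prop where
  inner_mem : ∀ X ∈ V, ∀ ω ∈ Z, i X ω ∈ Z
  vec_add_mem : ∀ X ∈ V, ∀ Y ∈ V, X + Y ∈ V
  vec_smul_mem : ∀ (a : ℝ), ∀ X ∈ V, a • X ∈ V
  vec_mul_mem : ∀ f ∈ R, ∀ X ∈ V, fmul f X ∈ V
  add_inner : ∀ X ∈ V, ∀ Y ∈ V, ∀ ω ∈ Z, Same (i (X + Y) ω) (i X ω + i Y ω)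
  inner_add : ∀ X ∈ V, ∀ ω ∈ Z, ∀ τ ∈ Z, Same (i X (ω + τ)) (i X ω + i X τ)
  smul_inner : ∀ (a : ℝ), ∀ X ∈ V, ∀ ω ∈ Z, Same (i (a • X) ω) (a • i X ω)
  inner_smul : ∀ (a : ℝ), ∀ X ∈ V, ∀ ω ∈ Z, Same (i X (a • ω)) (a • i X ω)
  mul_inner : ∀ f ∈ R, ∀ X ∈ V, ∀ ω ∈ Z, Same (i (fmul f X) ω) (fmul (finv f) (i X ω))
  inner_comm : ∀ X ∈ V, ∀ Y ∈ V, ∀ ω ∈ Z, ∀ e f : ℕ, HasParity X e → HasParity Y f →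
    Same (i X (i Y ω)) ((-1 : ℝ) ^ (e * f) • i Y (i X ω))

end Global

end

end WeakKoszul

open scoped Manifold

namespace WeakKoszul

noncomputable section

variable {m r s : ℕ} {K : Type*} [CommRing K]

/-! ### The ring structure -/

/-! The proof is a derived-bracket argument, carried out in local coordinates and then glued.

In a chart, put Ψ_k = {Δ, S^k} (`psiAt`). Since {Δ, Δ} = 0 and the odd bracket on 𝓝 is itself
derived, (F, G) = {{Δ, F}, G} for even F (`oddBr_eq`), applying {Δ, -} to the master equation gives
∑ {Ψ_k, Ψ_l} = 0 for each fixed k + l. The relations needed are {Ψ_1, Ψ_1} = 0, {Ψ_1, Ψ_2} = 0 and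
2{Ψ_1, Ψ_3} + {Ψ_2, Ψ_2} = 0. The even bracket lowers the momentum degree by one; hence on functions
on 𝓛 only Ψ_1 enters Q̂ and only Ψ_2 enters the binary bracket, and the final restriction to 𝓛
changes nothing. So Q̂ = {Ψ_1, -} and [ω, τ] = {{Ψ_2, ω}, τ} exactly, and everything follows from
the Leibniz rule and the Jacobi identity of the even bracket (`evenBr_mul_right`, `evenBr_jacobi`):
Q̂ is a differential and a derivation of product and bracket; the bracket is symmetric because
functions on the Lagrangian 𝓛 commute; the Jacobiator of cocycles is Q̂ of minus the ternary bracket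
{{{Ψ_3, ω}, τ}, σ} (`koszul_jacobi`); d = {Δ, -} preserves cocycles since {Δ, Ψ_1} = 0, and ι_X does
since {Ψ_1, X} = QX = 0.

For forms on M, the degree `totDeg` (ghost number plus number of differentials) is the key. An
extension has total degree zero. On 𝓛 the coordinates η, dη have total degree -1, c, dc have +1 and
x, dx have 0, so every monomial of an extension contains equally many of the two kinds: the
extension differs from its restriction to ΠTM only in second order in the transverse coordinates.
Bracket, d and ι_X differentiate each form once, so their values on ΠTM depend only on the
restrictions (`restr_koszul`, `restr_extD`, `restr_interior`). Statements about projectible objects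
then follow by lifting to 𝓛, with a lift of the same parity where parity matters.

Globally, the operations must commute with changes of charts. This amounts to the new coordinates
being canonical for the even bracket (`Transition.evenBr_newVar`), which yields
`Transition.evenBr_subst` and `Transition.evenBr_delta_subst`. Arbitrary functions on M with
`fderiv` do not form a differential algebra, so each chart computation takes place over the algebra
`smoothAlg` of functions smooth on an open set, and `Rep` translates back and forth. -/

theorem Loc.ext' {F G : Loc m r s K} (h : ∀ I, F I = G I) : F = G := funext h

theorem Loc.add_apply (F G : Loc m r s K) (I) : (F + G) I = F I + G I := rfl
theorem Loc.zero_apply (I) : (0 : Loc m r s K) I = 0 := rfl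
theorem Loc.neg_apply (F : Loc m r s K) (I) : (-F) I = -F I := rfl
theorem Loc.sub_apply (F G : Loc m r s K) (I) : (F - G) I = F I - G I := rfl
theorem Loc.zsmul_apply (k : ℤ) (F : Loc m r s K) (I) : (k • F) I = k • F I := rfl
theorem Loc.smul_apply [Module ℝ K] (k : ℝ) (F : Loc m r s K) (I) : (k • F) I = k • F I := rfl
theorem Loc.mul_apply (F G : Loc m r s K) (L) :
    (F * G) L = ∑ I ∈ L.powerset, shuffleSign I (L \ I) • (F I * G (L \ I)) := rfl
theorem Loc.one_def : (1 : Loc m r s K) = coef 1 := rfl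

theorem Loc.sum_apply {ι : Type*} (t : Finset ι) (f : ι → Loc m r s K) (I) :
    (∑ i ∈ t, f i) I = ∑ i ∈ t, f i I := Finset.sum_apply I t f

/-- As a product over pairs the sign is visibly multiplicative under disjoint unions in either
argument, which is what associativity needs. -/
theorem shuffleSign_eq_prod (I J : Finset (OddVar m r s)) :
    shuffleSign I J = ∏ i ∈ I, ∏ j ∈ J, if pos j < pos i then (-1 : ℤ) else 1 := by
  rw [shuffleSign, ← Finset.prod_product', Finset.prod_ite]
  simp

theorem shuffleSign_union_left {I J : Finset (OddVar m r s)} (h : Disjoint I J) (L) :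
    shuffleSign (I ∪ J) L = shuffleSign I L * shuffleSign J L := by
  simp only [shuffleSign_eq_prod, Finset.prod_union h]

theorem shuffleSign_union_right {I J : Finset (OddVar m r s)} (h : Disjoint I J) (L) :
    shuffleSign L (I ∪ J) = shuffleSign L I * shuffleSign L J := by
  simp only [shuffleSign_eq_prod, Finset.prod_union h, Finset.prod_mul_distrib]

@[simp] theorem shuffleSign_empty_left (J : Finset (OddVar m r s)) : shuffleSign ∅ J = 1 := by
  simp [shuffleSign]

@[simp] theorem shuffleSign_empty_right (J : Finset (OddVar m r s)) : shuffleSign J ∅ = 1 := by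
  simp [shuffleSign]

theorem pos_injective : Function.Injective (pos : OddVar m r s → _) :=
  (Fintype.equivFin (OddVar m r s)).injective

theorem shuffleSign_mul_self (I J : Finset (OddVar m r s)) :
    shuffleSign I J * shuffleSign I J = 1 := by
  simp only [shuffleSign, ← pow_add, ← two_mul]
  simp

/-- Each pair of elements is inverted in exactly one of the two orders, so it contributes one factor
-1. -/
theorem shuffleSign_mul_swap {I J : Finset (OddVar m r s)} (h : Disjoint I J) :
    shuffleSign I J * shuffleSign J I = (-1) ^ (I.card * J.card) := by
  rw [shuffleSign_eq_prod J I, Finset.prod_comm, shuffleSign_eq_prod, ← Finset.prod_mul_distrib]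
  simp only [← Finset.prod_mul_distrib]
  rw [Finset.prod_congr rfl (g := fun _ => (-1 : ℤ) ^ J.card)]
  · rw [Finset.prod_const, ← pow_mul, mul_comm]
  · intro i hi
    rw [Finset.prod_congr rfl (g := fun _ => (-1 : ℤ)), Finset.prod_const]
    intro j hj
    have hij : pos i ≠ pos j := fun e =>
      Finset.disjoint_left.1 h hi (pos_injective e ▸ hj)
    rcases lt_or_gt_of_ne hij with h1 | h1
    · simp [h1, h1.not_gt]
    · simp [h1, h1.not_gt]

theorem shuffleSign_swap {I J : Finset (OddVar m r s)} (h : Disjoint I J) :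
    shuffleSign I J = (-1) ^ (I.card * J.card) * shuffleSign J I := by
  rw [← shuffleSign_mul_swap h, mul_assoc, shuffleSign_mul_self, mul_one]

/-- Both sides sum over the ways to cut `L` into three ordered pieces. On the left the cut is a
chain I ⊆ A ⊆ L, on the right a pair of disjoint sets I, J; the bijection is J = A \ I, and the
signs agree by multiplicativity. -/
theorem Loc.mul_assoc' (F G H : Loc m r s K) : F * G * H = F * (G * H) := by
  refine Loc.ext' fun L => ?_
  simp only [Loc.mul_apply, Finset.sum_mul, Finset.mul_sum, Finset.smul_sum]
  rw [Finset.sum_sigma', Finset.sum_sigma']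
  refine Finset.sum_bij' (fun a _ => ⟨a.2, a.1 \ a.2⟩) (fun a _ => ⟨a.1 ∪ a.2, a.1⟩) ?_ ?_ ?_ ?_ ?_
  · rintro ⟨A, I⟩ h
    simp only [Finset.mem_sigma, Finset.mem_powerset] at h ⊢
    exact ⟨h.2.trans h.1, Finset.sdiff_subset_sdiff h.1 le_rfl⟩
  · rintro ⟨I, J⟩ h
    simp only [Finset.mem_sigma, Finset.mem_powerset] at h ⊢
    exact ⟨Finset.union_subset h.1 (h.2.trans Finset.sdiff_subset), Finset.subset_union_left⟩
  · rintro ⟨A, I⟩ h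
    simp only [Finset.mem_sigma, Finset.mem_powerset] at h
    simp [h.2]
  · rintro ⟨I, J⟩ h
    simp only [Finset.mem_sigma, Finset.mem_powerset] at h
    have : Disjoint J I := Finset.disjoint_of_subset_left h.2 Finset.sdiff_disjoint
    simp [Finset.union_sdiff_left, this]
  · rintro ⟨A, I⟩ h
    simp only [Finset.mem_sigma, Finset.mem_powerset] at h
    have e1 : L \ I = (A \ I) ∪ (L \ A) := by
      ext x; simp only [Finset.mem_sdiff, Finset.mem_union]
      have := @h.1 x; have := @h.2 x; tauto
    have e2 : (L \ I) \ (A \ I) = L \ A := by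
      ext x; simp only [Finset.mem_sdiff]
      have := @h.1 x; have := @h.2 x; tauto
    have d1 : Disjoint I (A \ I) := Finset.disjoint_sdiff
    have d2 : Disjoint (A \ I) (L \ A) :=
      Finset.disjoint_of_subset_left Finset.sdiff_subset Finset.disjoint_sdiff
    have e3 : shuffleSign A (L \ A) = shuffleSign I (L \ A) * shuffleSign (A \ I) (L \ A) := by
      rw [← shuffleSign_union_left d1, Finset.union_sdiff_of_subset h.2]
    simp only [e2]
    rw [e3, e1, shuffleSign_union_right d2]
    simp only [smul_mul_assoc, mul_smul_comm, smul_smul, mul_assoc]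
    congr 1
    ring

instance : Ring (Loc m r s K) :=
  { (inferInstance : AddCommGroup (Loc m r s K)) with
    mul := (· * ·)
    one := 1
    left_distrib := fun F G H => Loc.ext' fun L => by
      simp only [Loc.mul_apply, Loc.add_apply, mul_add, smul_add, Finset.sum_add_distrib]
    right_distrib := fun F G H => Loc.ext' fun L => by
      simp only [Loc.mul_apply, Loc.add_apply, add_mul, smul_add, Finset.sum_add_distrib]
    zero_mul := fun F => Loc.ext' fun L => by
      simp only [Loc.mul_apply, Loc.zero_apply, zero_mul, smul_zero, Finset.sum_const_zero]
    mul_zero := fun F => Loc.ext' fun L => by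
      simp only [Loc.mul_apply, Loc.zero_apply, mul_zero, smul_zero, Finset.sum_const_zero]
    mul_assoc := Loc.mul_assoc'
    one_mul := fun F => Loc.ext' fun L => by
      rw [Loc.mul_apply, Finset.sum_eq_single ∅]
      · simp [Loc.one_def, coef]
      · intro I _ hI
        simp [Loc.one_def, coef, hI]
      · intro h; simp at h
    mul_one := fun F => Loc.ext' fun L => by
      rw [Loc.mul_apply, Finset.sum_eq_single L]
      · simp [Loc.one_def, coef]
      · intro I hI hI'
        have : L \ I ≠ ∅ := fun h => hI' ((Finset.mem_powerset.1 hI).antisymm (by simpa using h))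
        simp [Loc.one_def, coef, this]
      · intro h; simp at h }

instance [Algebra ℝ K] : IsScalarTower ℝ (Loc m r s K) (Loc m r s K) where
  smul_assoc a F G := Loc.ext' fun L => by
    simp only [Loc.mul_apply, Loc.smul_apply, smul_eq_mul, Finset.smul_sum, smul_mul_assoc]
    exact Finset.sum_congr rfl fun I _ => smul_comm _ _ _

instance [Algebra ℝ K] : SMulCommClass ℝ (Loc m r s K) (Loc m r s K) where
  smul_comm a F G := Loc.ext' fun L => by
    simp only [Loc.mul_apply, Loc.smul_apply, smul_eq_mul, Finset.smul_sum, mul_smul_comm]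
    exact Finset.sum_congr rfl fun I _ => smul_comm _ _ _

/-! ### Multiplication by generators -/

theorem coef_mul_apply (a : K) (F : Loc m r s K) (L : Finset (OddVar m r s)) :
    (coef a * F : Loc m r s K) L = MvPolynomial.C a * F L := by
  rw [Loc.mul_apply, Finset.sum_eq_single ∅]
  · simp [coef]
  · intro I _ hI
    simp [coef, hI]
  · intro h; simp at h

theorem genEven_mul_apply (e : EvenVar m r s) (F : Loc m r s K) (L : Finset (OddVar m r s)) :
    (genEven e * F : Loc m r s K) L = MvPolynomial.X e * F L := by
  rw [Loc.mul_apply, Finset.sum_eq_single ∅]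
  · simp [genEven]
  · intro I _ hI
    simp [genEven, hI]
  · intro h; simp at h

theorem shuffleSign_singleton (v : OddVar m r s) (J : Finset (OddVar m r s)) :
    shuffleSign {v} J = (-1) ^ (J.filter fun w => pos w < pos v).card := by
  rw [shuffleSign_eq_prod]
  simp [Finset.prod_ite]

theorem genOdd_mul_apply (v : OddVar m r s) (F : Loc m r s K) (L : Finset (OddVar m r s)) :
    (genOdd v * F : Loc m r s K) L = if v ∈ L then
      (-1 : ℤ) ^ (L.filter fun w => pos w < pos v).card • F (L.erase v) else 0 := by
  rw [Loc.mul_apply]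
  split_ifs with h
  · rw [Finset.sum_eq_single {v}]
    · have e : (L.erase v).filter (fun w => pos w < pos v) = L.filter fun w => pos w < pos v := by
        ext w
        simp only [Finset.mem_filter, Finset.mem_erase]
        exact ⟨fun h => ⟨h.1.2, h.2⟩, fun h => ⟨⟨fun e => by simp [e] at h, h.1⟩, h.2⟩⟩
      rw [Finset.sdiff_singleton_eq_erase, shuffleSign_singleton, e]
      simp [genOdd]
    · intro I _ hI
      simp [genOdd, hI]
    · intro h'; simp [h] at h'
  · refine Finset.sum_eq_zero fun I hI => ?_
    have : I ≠ {v} := by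
      rintro rfl
      simp at hI; exact h hI
    simp [genOdd, this]

theorem gen_odd {v : Var m r s} (h : Var.odd v = true) : (gen v : Loc m r s K) = genOdd ⟨v, h⟩ := by
  simp [gen, h]

theorem gen_even {v : Var m r s} (h : Var.odd v = false) (hb : Var.base v = false) :
    (gen v : Loc m r s K) = genEven ⟨v, h, hb⟩ := by
  simp [gen, h, hb]

theorem base_of_odd {v : Var m r s} (h : Var.odd v = true) : Var.base v = false := by
  rcases v with ⟨k, A⟩
  rcases k <;> rcases A with i | A <;> simp_all [Var.odd, Var.base, Idx.odd]

/-- The element `p θ_I`. -/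
def mono (I : Finset (OddVar m r s)) (p : MvPolynomial (EvenVar m r s) K) : Loc m r s K :=
  fun J => if J = I then p else 0

theorem sum_mono (F : Loc m r s K) : F = ∑ I, mono I (F I) := by
  refine Loc.ext' fun J => ?_
  rw [Loc.sum_apply, Finset.sum_eq_single J]
  · simp [mono]
  · intro I _ h
    simp [mono, h.symm]
  · simp

/-- Splits off one odd coordinate, at the cost of the sign for moving it into place; this is the
inductive step of `Loc.induction`. -/
theorem mono_insert {v : OddVar m r s} {I : Finset (OddVar m r s)} (h : v ∉ I)
    (p : MvPolynomial (EvenVar m r s) K) :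
    mono (insert v I) p = genOdd v *
      mono I ((-1 : ℤ) ^ (I.filter fun w => pos w < pos v).card • p) := by
  refine Loc.ext' fun J => ?_
  rw [genOdd_mul_apply]
  by_cases hJ : J = insert v I
  · subst hJ
    have : (insert v I).filter (fun w => pos w < pos v) = I.filter fun w => pos w < pos v := by
      rw [Finset.filter_insert]; simp
    simp only [mono, this, Finset.erase_insert h, if_true, Finset.mem_insert_self, smul_smul,
      ← pow_add, ← two_mul]
    simp
  · rw [mono, if_neg hJ]
    split_ifs with h1
    · have : J.erase v ≠ I := by
        rintro rfl
        exact hJ (Finset.insert_erase h1).symm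
      simp [mono, this]
    · rfl

/-- Induction over the generators. -/
theorem Loc.induction {P : Loc m r s K → Prop} (hc : ∀ a, P (coef a))
    (hadd : ∀ F G, P F → P G → P (F + G))
    (hgen : ∀ v, Var.base v = false → ∀ F, P F → P (gen v * F)) (F : Loc m r s K) : P F := by
  have h0 : P 0 := by
    have : (0 : Loc m r s K) = coef 0 := by
      refine Loc.ext' fun I => ?_
      simp [coef, Loc.zero_apply]
    rw [this]; exact hc 0
  have key : ∀ I p, P (mono I p : Loc m r s K) := by
    intro I
    induction I using Finset.induction_on with
    | empty =>
      intro p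
      induction p using MvPolynomial.induction_on with
      | C a => exact hc a
      | add p q hp hq =>
        have : (mono ∅ (p + q) : Loc m r s K) = mono ∅ p + mono ∅ q := by
          refine Loc.ext' fun I => ?_
          by_cases h : I = ∅ <;> simp [mono, Loc.add_apply, h]
        rw [this]; exact hadd _ _ hp hq
      | mul_X p e hp =>
        have : (mono ∅ (p * MvPolynomial.X e) : Loc m r s K) = gen e.1 * mono ∅ p := by
          rw [gen_even e.2.1 e.2.2]
          refine Loc.ext' fun I => ?_
          rw [genEven_mul_apply]
          by_cases h : I = ∅ <;> simp [mono, h, mul_comm]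
        rw [this]; exact hgen _ e.2.2 _ hp
    | insert v I hv ih =>
      intro p
      rw [mono_insert hv, ← gen_odd v.2]
      exact hgen _ (base_of_odd v.2) _ (ih _)
  rw [sum_mono F]
  exact Finset.sum_induction _ P hadd h0 fun I _ => key I _

theorem coef_add (a b : K) : (coef (a + b) : Loc m r s K) = coef a + coef b := by
  refine Loc.ext' fun I => ?_
  by_cases h : I = ∅ <;> simp [coef, Loc.add_apply, h]

theorem coef_zero : (coef 0 : Loc m r s K) = 0 := by
  refine Loc.ext' fun I => ?_
  simp [coef, Loc.zero_apply]

theorem coef_mul (a b : K) : (coef (a * b) : Loc m r s K) = coef a * coef b := by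
  refine Loc.ext' fun I => ?_
  rw [coef_mul_apply]
  by_cases h : I = ∅ <;> simp [coef, h]

theorem coef_one : (coef 1 : Loc m r s K) = 1 := rfl

/-- Coefficients as a ring homomorphism. -/
def coefHom : K →+* Loc m r s K where
  toFun := coef
  map_one' := rfl
  map_mul' := coef_mul
  map_zero' := coef_zero
  map_add' := coef_add

theorem coef_sum {ι : Type*} (t : Finset ι) (f : ι → K) :
    (coef (∑ i ∈ t, f i) : Loc m r s K) = ∑ i ∈ t, coef (f i) :=
  map_sum (coefHom (m := m) (r := r) (s := s)) f t

theorem coef_neg (a : K) : (coef (-a) : Loc m r s K) = -coef a :=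
  map_neg (coefHom (m := m) (r := r) (s := s)) a

/-- An additive map that is multiplicative on generators is multiplicative. -/
theorem map_mul_of_gen {R : Type*} [Ring R] (φ : Loc m r s K →+ R)
    (hc : ∀ a F, φ (coef a * F) = φ (coef a) * φ F)
    (hg : ∀ v, Var.base v = false → ∀ F, φ (gen v * F) = φ (gen v) * φ F) (F G : Loc m r s K) :
    φ (F * G) = φ F * φ G := by
  induction F using Loc.induction with
  | hc a => exact hc a G
  | hadd F₁ F₂ h₁ h₂ => rw [add_mul, map_add, map_add, h₁, h₂, add_mul]
  | hgen v hv F h => rw [mul_assoc, hg v hv, hg v hv, h, mul_assoc]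

/-- Ring homomorphisms that agree on generators are equal. -/
theorem hom_ext {R : Type*} [Ring R] {φ ψ : Loc m r s K →+* R}
    (hc : ∀ a, φ (coef a) = ψ (coef a))
    (hg : ∀ v, Var.base v = false → φ (gen v) = ψ (gen v)) : φ = ψ := by
  ext F
  induction F using Loc.induction with
  | hc a => exact hc a
  | hadd F₁ F₂ h₁ h₂ => rw [map_add, map_add, h₁, h₂]
  | hgen v hv F h => rw [map_mul, map_mul, hg v hv, h]

/-! ### Parity -/

theorem inv_add (F G : Loc m r s K) : inv (F + G) = inv F + inv G :=
  Loc.ext' fun _ => smul_add _ _ _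

theorem inv_inv (F : Loc m r s K) : inv (inv F) = F := Loc.ext' fun I => by
  simp only [inv, smul_smul, ← pow_add, ← two_mul]
  simp

theorem inv_mul (F G : Loc m r s K) : inv (F * G) = inv F * inv G := Loc.ext' fun L => by
  simp only [inv, Loc.mul_apply, Finset.smul_sum]
  refine Finset.sum_congr rfl fun I hI => ?_
  rw [Finset.mem_powerset] at hI
  simp only [smul_mul_assoc, mul_smul_comm, smul_smul]
  rw [← Finset.card_sdiff_add_card_eq_card hI, pow_add]
  congr 1
  ring

/-- The parity involution as a ring homomorphism. -/
def invHom : Loc m r s K →+* Loc m r s K where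
  toFun := inv
  map_one' := Loc.ext' fun I => by
    by_cases h : I = ∅ <;> simp [inv, Loc.one_def, coef, h]
  map_mul' := inv_mul
  map_zero' := Loc.ext' fun I => by simp [inv, Loc.zero_apply]
  map_add' := inv_add

theorem inv_one : inv (1 : Loc m r s K) = 1 := map_one invHom
theorem inv_zero : inv (0 : Loc m r s K) = 0 := map_zero invHom
theorem inv_neg (F : Loc m r s K) : inv (-F) = -inv F := map_neg invHom F
theorem inv_sub (F G : Loc m r s K) : inv (F - G) = inv F - inv G := map_sub invHom F G
theorem inv_zsmul (k : ℤ) (F : Loc m r s K) : inv (k • F) = k • inv F :=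
  map_zsmul invHom k F
theorem inv_sum {ι : Type*} (t : Finset ι) (f : ι → Loc m r s K) :
    inv (∑ i ∈ t, f i) = ∑ i ∈ t, inv (f i) := map_sum invHom f t
theorem inv_smul [Algebra ℝ K] (a : ℝ) (F : Loc m r s K) : inv (a • F) = a • inv F :=
  Loc.ext' fun I => smul_comm ((-1 : ℤ) ^ I.card) a (F I)

theorem inv_coef (a : K) : inv (coef a : Loc m r s K) = coef a := Loc.ext' fun I => by
  by_cases h : I = ∅ <;> simp [inv, coef, h]

/-- `(-1)^b`. -/
def sg (b : Bool) : ℤ := if b then -1 else 1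

@[simp] theorem sg_true : sg true = -1 := rfl
@[simp] theorem sg_false : sg false = 1 := rfl

/-- `F ↦ (-1)^{bF} F`. -/
def tw (b : Bool) (F : Loc m r s K) : Loc m r s K := if b then inv F else F

@[simp] theorem tw_true (F : Loc m r s K) : tw true F = inv F := rfl
@[simp] theorem tw_false (F : Loc m r s K) : tw false F = F := rfl

/-- `F` has parity `b`. -/
def Par (b : Bool) (F : Loc m r s K) : Prop := inv F = sg b • F

theorem inv_gen (v : Var m r s) : inv (gen v : Loc m r s K) = sg (Var.odd v) • gen v := by
  refine Loc.ext' fun I => ?_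
  rw [Loc.zsmul_apply]
  by_cases h : Var.odd v = true
  · rw [gen_odd h, h]
    by_cases hI : I = {⟨v, h⟩} <;> simp [inv, genOdd, hI]
  · rw [Bool.not_eq_true] at h
    by_cases hb : Var.base v = false
    · rw [gen_even h hb]
      simp only [h]
      by_cases hI : I = ∅ <;> simp [inv, genEven, hI]
    · simp [gen, h, hb, inv, Loc.zero_apply]

theorem par_gen (v : Var m r s) : Par (Var.odd v) (gen v : Loc m r s K) := inv_gen v

theorem par_coef (a : K) : Par false (coef a : Loc m r s K) := by
  simp [Par, inv_coef]

theorem Par.add {b : Bool} {F G : Loc m r s K} (hF : Par b F) (hG : Par b G) : Par b (F + G) := by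
  rw [Par, inv_add, hF, hG, smul_add]

theorem Par.mul {b c : Bool} {F G : Loc m r s K} (hF : Par b F) (hG : Par c G) :
    Par (b ^^ c) (F * G) := by
  rw [Par, inv_mul, hF, hG]
  cases b <;> cases c <;> simp

theorem Par.zsmul {b : Bool} {F : Loc m r s K} (hF : Par b F) (k : ℤ) : Par b (k • F) := by
  rw [Par, inv_zsmul, hF, smul_comm]

theorem Par.smul [Algebra ℝ K] {b : Bool} {F : Loc m r s K} (hF : Par b F) (k : ℝ) :
    Par b (k • F) := by
  rw [Par, inv_smul, hF, smul_comm]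

theorem Par.sum {ι : Type*} {b : Bool} {t : Finset ι} {f : ι → Loc m r s K}
    (h : ∀ i ∈ t, Par b (f i)) : Par b (∑ i ∈ t, f i) := by
  rw [Par, inv_sum, Finset.smul_sum]
  exact Finset.sum_congr rfl h

theorem Par.inv {b : Bool} {F : Loc m r s K} (hF : Par b F) : Par b (inv F) := by
  rw [hF]; exact hF.zsmul _

theorem Par.tw_eq {b c : Bool} {F : Loc m r s K} (hF : Par b F) : tw c F = sg (b && c) • F := by
  cases c
  · simp
  · rw [Bool.and_true]
    exact hF

/-- Supercommutativity with a single coordinate, from which `Par.mul_comm` follows by induction. For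
odd `v` the reindexing I ↦ L \ I exchanges the two factors and `shuffleSign_swap` supplies the sign.
-/
theorem gen_mul (v : Var m r s) (F : Loc m r s K) : gen v * F = tw (Var.odd v) F * gen v := by
  refine Loc.ext' fun L => ?_
  have comm : ∀ G : Loc m r s K, (∀ I, I ≠ ∅ → G I = 0) → G * F = F * G := by
    intro G hG
    refine Loc.ext' fun L => ?_
    rw [Loc.mul_apply, Loc.mul_apply, Finset.sum_eq_single ∅, Finset.sum_eq_single L]
    · simp [mul_comm]
    · intro I hI hI'
      have : L \ I ≠ ∅ := fun h => hI' ((Finset.mem_powerset.1 hI).antisymm (by simpa using h))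
      simp [hG _ this]
    · intro h; simp at h
    · intro I _ hI
      simp [hG _ hI]
    · intro h; simp at h
  by_cases h : Var.odd v = true
  · rw [gen_odd h, h, Loc.mul_apply, Loc.mul_apply]
    refine Finset.sum_bij' (fun I _ => L \ I) (fun I _ => L \ I) ?_ ?_ ?_ ?_ ?_
    · intro I _; simp
    · intro I _; simp
    · intro I hI; simpa using hI
    · intro I hI; simpa using hI
    · intro I hI
      rw [Finset.mem_powerset] at hI
      have e : L \ (L \ I) = I := by simpa using hI
      rw [e, shuffleSign_swap Finset.disjoint_sdiff]
      by_cases h1 : I = {⟨v, h⟩}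
      · simp [tw, inv, genOdd, h1]
        ring
      · simp [genOdd, h1]
  · rw [Bool.not_eq_true] at h
    rw [h]
    refine congrFun (comm _ ?_) L
    intro I hI
    by_cases hb : Var.base v = false
    · rw [gen_even h hb]; simp [genEven, hI]
    · simp [gen, h, hb, Loc.zero_apply]

theorem coef_mul_comm (a : K) (F : Loc m r s K) : coef a * F = F * coef a := by
  induction F using Loc.induction with
  | hc b => rw [← coef_mul, ← coef_mul, mul_comm]
  | hadd F₁ F₂ h₁ h₂ => rw [mul_add, add_mul, h₁, h₂]
  | hgen v hv F h =>
    have : coef a * gen v = gen v * coef a := by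
      rw [gen_mul]; cases Var.odd v <;> simp [inv_coef]
    rw [← mul_assoc, this, mul_assoc, h, mul_assoc]

theorem tw_mul (b : Bool) (F G : Loc m r s K) : tw b (F * G) = tw b F * tw b G := by
  cases b <;> simp [inv_mul]

theorem tw_add (b : Bool) (F G : Loc m r s K) : tw b (F + G) = tw b F + tw b G := by
  cases b <;> simp [inv_add]

theorem tw_zero (b : Bool) : tw b (0 : Loc m r s K) = 0 := by
  cases b <;> simp [inv_zero]

theorem tw_zsmul (b : Bool) (k : ℤ) (F : Loc m r s K) : tw b (k • F) = k • tw b F := by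
  cases b <;> simp only [inv_zsmul, tw_true, tw_false]

theorem tw_sum {ι : Type*} (b : Bool) (t : Finset ι) (f : ι → Loc m r s K) :
    tw b (∑ i ∈ t, f i) = ∑ i ∈ t, tw b (f i) := by
  cases b <;> simp [inv_sum]

theorem tw_inv (b : Bool) (F : Loc m r s K) : tw b (inv F) = inv (tw b F) := by
  cases b <;> simp

theorem tw_tw (b c : Bool) (F : Loc m r s K) : tw b (tw c F) = tw (b ^^ c) F := by
  cases b <;> cases c <;> simp [inv_inv]

/-- Supercommutativity. -/
theorem Par.mul_comm {b : Bool} {F : Loc m r s K} (hF : Par b F) (G : Loc m r s K) :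
    F * G = tw b G * F := by
  induction G using Loc.induction generalizing b F with
  | hc a => cases b <;> simp [inv_coef, coef_mul_comm]
  | hadd F₁ F₂ h₁ h₂ => rw [mul_add, tw_add, add_mul, h₁ hF, h₂ hF]
  | hgen v hv G h =>
    have : F * gen v = tw b (gen v) * F := by
      rw [(par_gen v).tw_eq, smul_mul_assoc, gen_mul, hF.tw_eq, smul_mul_assoc, smul_smul]
      cases b <;> cases Var.odd v <;> simp
    rw [← mul_assoc, this, mul_assoc, h hF, tw_mul, mul_assoc]

end

end WeakKoszul


open scoped Manifold

namespace WeakKoszul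

noncomputable section

variable {m r s : ℕ} {K : Type*} [CommRing K] [Algebra ℝ K]

/-! ### Partial derivatives -/

/-- A family of commuting derivations. -/
class IsDer (D : Fin m → K → K) : Prop where
  add : ∀ i a b, D i (a + b) = D i a + D i b
  smul : ∀ i (t : ℝ) a, D i (t • a) = t • D i a
  mul : ∀ i a b, D i (a * b) = D i a * b + a * D i b
  comm : ∀ i j a, D i (D j a) = D j (D i a)

theorem IsDer.zero (D : Fin m → K → K) [IsDer D] (i : Fin m) : D i 0 = 0 := by
  have := IsDer.smul (D := D) i 0 0
  simpa using this

theorem IsDer.one (D : Fin m → K → K) [IsDer D] (i : Fin m) : D i 1 = 0 := by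
  have := IsDer.mul (D := D) i 1 1
  simpa using this

theorem IsDer.neg (D : Fin m → K → K) [IsDer D] (i : Fin m) (a : K) : D i (-a) = -D i a := by
  have := IsDer.add (D := D) i a (-a)
  rw [add_neg_cancel, IsDer.zero D i] at this
  exact eq_neg_of_add_eq_zero_right this.symm

theorem IsDer.sum (D : Fin m → K → K) [IsDer D] (i : Fin m) {ι : Type*} (t : Finset ι)
    (f : ι → K) : D i (∑ j ∈ t, f j) = ∑ j ∈ t, D i (f j) :=
  map_sum (AddMonoidHom.mk' (D i) (IsDer.add i)) f t

omit [Algebra ℝ K] in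
-- The definition sums over the support only, so the coefficientwise formula depends on `D i`
-- vanishing at zero.
theorem coeff_pdBase {D : Fin m → K → K} {i : Fin m} (h0 : D i 0 = 0) (F : Loc m r s K)
    (I : Finset (OddVar m r s)) (n : EvenVar m r s →₀ ℕ) :
    (pdBase D (.fld, .inl i) F I).coeff n = D i ((F I).coeff n) := by
  change MvPolynomial.coeff n
    (∑ k ∈ (F I).support, MvPolynomial.monomial k (D i ((F I).coeff k))) = _
  simp only [MvPolynomial.coeff_sum, MvPolynomial.coeff_monomial]
  rw [Finset.sum_ite_eq']
  split_ifs with h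
  · rfl
  · rw [MvPolynomial.notMem_support_iff.1 h, h0]

omit [Algebra ℝ K] in
theorem pd_fld_inl (D : Fin m → K → K) (i : Fin m) (F : Loc m r s K) :
    pd D (.fld, .inl i) F = pdBase D (.fld, .inl i) F := by
  simp [pd, Var.odd, Idx.odd, Var.base]

theorem eq_fld_inl_of_base {v : Var m r s} (h : Var.base v = true) : ∃ i, v = (.fld, .inl i) := by
  rcases v with ⟨k, A⟩
  rcases k <;> rcases A with i | A <;> simp_all [Var.base]

omit [Algebra ℝ K] in
theorem pd_odd (D : Fin m → K → K) {v : Var m r s} (h : Var.odd v = true) (F : Loc m r s K) :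
    pd D v F = pdOdd ⟨v, h⟩ F := by simp [pd, h]

omit [Algebra ℝ K] in
theorem pd_even (D : Fin m → K → K) {v : Var m r s} (h : Var.odd v = false)
    (hb : Var.base v = false) (F : Loc m r s K) :
    pd D v F = pdEven ⟨v, h, hb⟩ F := by simp [pd, h, hb]

/-- The three kinds of coordinates: odd, even along the fibre, and on the base. -/
theorem var_cases (v : Var m r s) : Var.odd v = true ∨
    (Var.odd v = false ∧ Var.base v = false) ∨ ∃ i, v = (.fld, .inl i) := by
  rcases h : Var.odd v with _ | _
  · rcases hb : Var.base v with _ | _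
    · simp
    · simp [eq_fld_inl_of_base hb]
  · simp

section

variable (D : Fin m → K → K) [IsDer D]

theorem pd_add (v : Var m r s) (F G : Loc m r s K) : pd D v (F + G) = pd D v F + pd D v G := by
  refine Loc.ext' fun I => ?_
  rw [Loc.add_apply]
  rcases var_cases v with h | ⟨h, hb⟩ | ⟨i, rfl⟩
  · simp only [pd_odd D h, pdOdd, Loc.add_apply]
    split_ifs <;> simp
  · simp only [pd_even D h hb, pdEven, Loc.add_apply, map_add]
  · ext n
    simp only [pd_fld_inl, MvPolynomial.coeff_add, coeff_pdBase (IsDer.zero D i), Loc.add_apply,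
      IsDer.add]

/-- Partial derivatives as additive maps. -/
def pdHom (v : Var m r s) : Loc m r s K →+ Loc m r s K :=
  AddMonoidHom.mk' (pd D v) (pd_add D v)

theorem pd_zero (v : Var m r s) : pd D v (0 : Loc m r s K) = 0 := map_zero (pdHom D v)
theorem pd_neg (v : Var m r s) (F : Loc m r s K) : pd D v (-F) = -pd D v F := map_neg (pdHom D v) F
theorem pd_sub (v : Var m r s) (F G : Loc m r s K) : pd D v (F - G) = pd D v F - pd D v G :=
  map_sub (pdHom D v) F G
theorem pd_zsmul (v : Var m r s) (k : ℤ) (F : Loc m r s K) : pd D v (k • F) = k • pd D v F :=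
  map_zsmul (pdHom D v) k F
theorem pd_sum (v : Var m r s) {ι : Type*} (t : Finset ι) (f : ι → Loc m r s K) :
    pd D v (∑ i ∈ t, f i) = ∑ i ∈ t, pd D v (f i) := map_sum (pdHom D v) f t

theorem pd_smul (v : Var m r s) (k : ℝ) (F : Loc m r s K) : pd D v (k • F) = k • pd D v F := by
  refine Loc.ext' fun I => ?_
  rw [Loc.smul_apply]
  rcases var_cases v with h | ⟨h, hb⟩ | ⟨i, rfl⟩
  · simp only [pd_odd D h, pdOdd, Loc.smul_apply]
    split_ifs
    · simp
    · exact smul_comm _ _ _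
  · simp only [pd_even D h hb, pdEven, Loc.smul_apply]
    exact (MvPolynomial.pderiv _).toLinearMap.map_smul_of_tower k (F I)
  · ext n
    simp only [pd_fld_inl, MvPolynomial.coeff_smul, coeff_pdBase (IsDer.zero D i), Loc.smul_apply,
      IsDer.smul]

theorem pd_fld_inl_coef (i : Fin m) (a : K) :
    pd D (.fld, .inl i) (coef a : Loc m r s K) = coef (D i a) := by
  refine Loc.ext' fun I => ?_
  ext n
  rw [pd_fld_inl, coeff_pdBase (IsDer.zero D i)]
  by_cases hI : I = ∅
  · simp only [coef, hI, if_true, MvPolynomial.coeff_C]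
    split_ifs
    · rfl
    · exact IsDer.zero D i
  · simp [coef, hI, IsDer.zero D i]

omit [Algebra ℝ K] [IsDer D] in
theorem pd_coef {v : Var m r s} (hb : Var.base v = false) (a : K) :
    pd D v (coef a : Loc m r s K) = 0 := by
  refine Loc.ext' fun I => ?_
  rcases h : Var.odd v with _ | _
  · rw [pd_even D h hb]
    by_cases hI : I = ∅ <;> simp [pdEven, coef, hI, Loc.zero_apply]
  · rw [pd_odd D h]
    simp [pdOdd, coef, Loc.zero_apply]

/-- The sign `(-1)^k`, where `k` is the number of elements of `I` before `v`. -/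
def before (v : OddVar m r s) (I : Finset (OddVar m r s)) : ℤ :=
  (-1) ^ (I.filter fun w => pos w < pos v).card

theorem before_mul_self (v : OddVar m r s) (I : Finset (OddVar m r s)) :
    before v I * before v I = 1 := by
  simp only [before, ← pow_add, ← two_mul]
  simp

theorem before_insert (u : OddVar m r s) {v : OddVar m r s} {I : Finset (OddVar m r s)}
    (h : v ∉ I) : before u (insert v I) = (if pos v < pos u then -1 else 1) * before u I := by
  rw [before, Finset.filter_insert]
  split_ifs
  · rw [Finset.card_insert_of_notMem (by simp [h]), pow_succ, before]; ring
  · rw [one_mul, before]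

theorem before_insert_self (v : OddVar m r s) (I : Finset (OddVar m r s)) :
    before v (insert v I) = before v I := by
  rw [before, Finset.filter_insert]; simp [before]

omit [Algebra ℝ K] in
theorem pdOdd_apply (v : OddVar m r s) (F : Loc m r s K) (I : Finset (OddVar m r s)) :
    pdOdd v F I = if v ∈ I then 0 else before v I • F (insert v I) := rfl

omit [Algebra ℝ K] in
theorem genOdd_mul_apply' (v : OddVar m r s) (F : Loc m r s K) (L : Finset (OddVar m r s)) :
    (genOdd v * F : Loc m r s K) L = if v ∈ L then before v L • F (L.erase v) else 0 :=
  genOdd_mul_apply v F L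

omit [Algebra ℝ K] in
-- The canonical anticommutation relation ∂θ + θ∂ = 1. Whether or not `v` lies in the monomial, only
-- one of the two terms survives, and its two equal signs cancel.
theorem pdOdd_genOdd_mul_self (v : OddVar m r s) (G : Loc m r s K) :
    pdOdd v (genOdd v * G) = G - genOdd v * pdOdd v G := by
  refine Loc.ext' fun I => ?_
  rw [Loc.sub_apply, pdOdd_apply, genOdd_mul_apply', genOdd_mul_apply', pdOdd_apply]
  by_cases h : v ∈ I
  · obtain ⟨J, hJ, rfl⟩ : ∃ J, v ∉ J ∧ I = insert v J :=
      ⟨I.erase v, by simp, (Finset.insert_erase h).symm⟩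
    rw [if_pos h, if_pos h, Finset.erase_insert hJ, if_neg hJ, before_insert_self, smul_smul,
      before_mul_self, one_smul, sub_self]
  · rw [if_neg h, if_neg h, if_pos (Finset.mem_insert_self _ _), Finset.erase_insert h,
      before_insert_self, smul_smul, before_mul_self, one_smul, sub_zero]

omit [Algebra ℝ K] in
-- Either `u` precedes `v` or conversely, so exactly one of the two position signs changes when the
-- other coordinate is inserted.
theorem pdOdd_genOdd_mul_of_ne {v u : OddVar m r s} (huv : u ≠ v) (G : Loc m r s K) :
    pdOdd v (genOdd u * G) = -(genOdd u * pdOdd v G) := by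
  refine Loc.ext' fun I => ?_
  rw [Loc.neg_apply, pdOdd_apply, genOdd_mul_apply', genOdd_mul_apply', pdOdd_apply]
  by_cases hu : u ∈ I
  · obtain ⟨J, hJ, rfl⟩ : ∃ J, u ∉ J ∧ I = insert u J :=
      ⟨I.erase u, by simp, (Finset.insert_erase hu).symm⟩
    by_cases hv : v ∈ J
    · simp [hv, Finset.erase_insert hJ]
    · have hv' : v ∉ insert u J := by simp [hv, huv.symm]
      have hu' : u ∉ insert v J := by simp [hJ, huv]
      rw [if_neg hv', Finset.insert_comm, if_pos (Finset.mem_insert_self _ _),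
        if_pos (Finset.mem_insert_self _ _), Finset.erase_insert hu', Finset.erase_insert hJ,
        if_neg hv, before_insert_self, before_insert_self, before_insert _ hv, before_insert _ hJ,
        smul_smul, smul_smul, ← neg_smul]
      congr 1
      have hp : pos u ≠ pos v := fun e => huv (pos_injective e)
      rcases lt_or_gt_of_ne hp with h1 | h1
      · simp [h1, h1.not_gt]; ring
      · simp [h1, h1.not_gt]; ring
  · simp [hu, huv]

theorem pd_one (v : Var m r s) : pd D v (1 : Loc m r s K) = 0 := by
  rcases hb : Var.base v with _ | _
  · exact pd_coef D hb 1
  · obtain ⟨i, rfl⟩ := eq_fld_inl_of_base hb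
    rw [← coef_one, pd_fld_inl_coef, IsDer.one D i, coef_zero]

/-- The Leibniz rule for one generator factor is the only place where the kinds of coordinates must
be separated; the general rule `pd_mul` is induction on top of it. -/
theorem pd_gen_mul_aux (v u : Var m r s) (hu : Var.base u = false) (G : Loc m r s K) :
    pd D v (gen u * G) = (if u = v then G else 0) + tw (Var.odd v) (gen u) * pd D v G := by
  rw [(par_gen u).tw_eq]
  rcases var_cases v with h | ⟨h, hb⟩ | ⟨i, rfl⟩
  · rcases hu' : Var.odd u with _ | _
    · have huv : u ≠ v := by rintro rfl; simp [h] at hu'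
      rw [if_neg huv, gen_even hu' hu, pd_odd D h, pd_odd D h]
      refine Loc.ext' fun I => ?_
      simp only [pdOdd_apply, genEven_mul_apply, Bool.false_and, sg_false, one_smul, zero_add]
      split_ifs <;> simp [mul_left_comm]
    · rw [gen_odd hu', pd_odd D h, pd_odd D h, h]
      simp only [Bool.true_and, sg_true, neg_smul, one_smul, neg_mul]
      by_cases huv : u = v
      · subst huv
        rw [if_pos rfl, pdOdd_genOdd_mul_self, sub_eq_add_neg]
      · rw [if_neg huv, pdOdd_genOdd_mul_of_ne (by simpa using huv), zero_add]
  · rw [h, Bool.and_false, sg_false, one_smul, pd_even D h hb, pd_even D h hb]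
    refine Loc.ext' fun I => ?_
    rw [Loc.add_apply]
    rcases hu' : Var.odd u with _ | _
    · rw [gen_even hu' hu, genEven_mul_apply, pdEven, pdEven, genEven_mul_apply]
      by_cases huv : u = v
      · subst huv
        simp [add_comm]
      · rw [MvPolynomial.pderiv_mul, MvPolynomial.pderiv_X_of_ne (by simpa using huv)]
        simp [huv, Loc.zero_apply]
    · have huv : u ≠ v := by rintro rfl; simp [h] at hu'
      rw [gen_odd hu', pdEven, genOdd_mul_apply', genOdd_mul_apply', if_neg huv, Loc.zero_apply,
        zero_add]
      split_ifs
      · rw [map_zsmul]; rfl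
      · simp
  · have huv : u ≠ (.fld, .inl i) := by rintro rfl; simp [Var.base] at hu
    rw [if_neg huv, zero_add, pd_fld_inl, pd_fld_inl]
    refine Loc.ext' fun I => ?_
    ext n
    rw [coeff_pdBase (IsDer.zero D i)]
    have h1 : Var.odd (Kind.fld, (Sum.inl i : Idx m r s)) = false := rfl
    rw [h1, Bool.and_false, sg_false, one_smul]
    rcases hu' : Var.odd u with _ | _
    · rw [gen_even hu' hu, genEven_mul_apply, genEven_mul_apply, MvPolynomial.coeff_X_mul',
        MvPolynomial.coeff_X_mul']
      split_ifs
      · rw [coeff_pdBase (IsDer.zero D i)]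
      · exact IsDer.zero D i
    · rw [gen_odd hu', genOdd_mul_apply', genOdd_mul_apply']
      split_ifs
      · rcases neg_one_pow_eq_or ℤ ((I.filter fun w => pos w < pos ⟨u, hu'⟩).card) with e | e <;>
          simp [before, e, coeff_pdBase (IsDer.zero D i), IsDer.neg]
      · simp [IsDer.zero D i]

theorem pd_gen (v u : Var m r s) (hu : Var.base u = false) :
    pd D v (gen u : Loc m r s K) = if u = v then 1 else 0 := by
  have := pd_gen_mul_aux D v u hu (1 : Loc m r s K)
  rwa [mul_one, pd_one, mul_zero, add_zero] at this

theorem pd_gen_mul (v u : Var m r s) (hu : Var.base u = false) (G : Loc m r s K) :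
    pd D v (gen u * G) = pd D v (gen u) * G + tw (Var.odd v) (gen u) * pd D v G := by
  rw [pd_gen_mul_aux D v u hu, pd_gen D v u hu]
  split_ifs <;> simp

theorem pd_coef_mul (v : Var m r s) (a : K) (G : Loc m r s K) :
    pd D v (coef a * G) = pd D v (coef a) * G + coef a * pd D v G := by
  refine Loc.ext' fun I => ?_
  rcases var_cases v with h | ⟨h, hb⟩ | ⟨i, rfl⟩
  · rw [pd_coef D (base_of_odd h), zero_mul, zero_add, pd_odd D h, pd_odd D h]
    simp only [pdOdd_apply, coef_mul_apply]
    split_ifs <;> simp [mul_left_comm]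
  · rw [pd_coef D hb, zero_mul, zero_add, pd_even D h hb, pd_even D h hb]
    simp [pdEven, coef_mul_apply]
  · ext n
    rw [pd_fld_inl_coef, pd_fld_inl, pd_fld_inl, coeff_pdBase (IsDer.zero D i), coef_mul_apply,
      Loc.add_apply, coef_mul_apply, coef_mul_apply, MvPolynomial.coeff_add]
    simp only [MvPolynomial.coeff_C_mul, coeff_pdBase (IsDer.zero D i), IsDer.mul]

omit [Algebra ℝ K] in
theorem tw_coef (b : Bool) (a : K) : tw b (coef a : Loc m r s K) = coef a := by
  cases b <;> simp [inv_coef]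

/-- The Leibniz rule for partial derivatives. -/
theorem pd_mul (v : Var m r s) (F G : Loc m r s K) :
    pd D v (F * G) = pd D v F * G + tw (Var.odd v) F * pd D v G := by
  induction F using Loc.induction with
  | hc a => rw [pd_coef_mul, tw_coef]
  | hadd F₁ F₂ h₁ h₂ =>
    rw [add_mul, pd_add, h₁, h₂, pd_add, tw_add, add_mul, add_mul]
    abel
  | hgen u hu F h =>
    rw [mul_assoc, pd_gen_mul D v u hu, h, pd_gen_mul D v u hu, tw_mul, add_mul, mul_add]
    simp only [mul_assoc, add_assoc]

/-- Partial derivatives supercommute. -/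
theorem pd_comm (v u : Var m r s) (F : Loc m r s K) :
    pd D v (pd D u F) = sg (Var.odd u && Var.odd v) • pd D u (pd D v F) := by
  induction F using Loc.induction with
  | hc a =>
    rcases hu : Var.base u with _ | _ <;> rcases hv : Var.base v with _ | _
    · simp [pd_coef D hu, pd_coef D hv, pd_zero]
    · obtain ⟨j, rfl⟩ := eq_fld_inl_of_base hv
      simp [pd_coef D hu, pd_fld_inl_coef, pd_zero]
    · obtain ⟨j, rfl⟩ := eq_fld_inl_of_base hu
      simp [pd_coef D hv, pd_fld_inl_coef, pd_zero]
    · obtain ⟨i, rfl⟩ := eq_fld_inl_of_base hu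
      obtain ⟨j, rfl⟩ := eq_fld_inl_of_base hv
      simp [pd_fld_inl_coef, IsDer.comm (D := D) j i, Var.odd, Idx.odd]
  | hadd F₁ F₂ h₁ h₂ => rw [pd_add, pd_add, pd_add, pd_add, h₁, h₂, smul_add]
  | hgen w hw F h =>
    rw [pd_gen_mul D u w hw, pd_gen_mul D v w hw, pd_add, pd_add, (par_gen w).tw_eq,
      (par_gen w).tw_eq, pd_gen D u w hw, pd_gen D v w hw]
    simp only [smul_mul_assoc, pd_zsmul]
    rw [pd_gen_mul D v w hw, pd_gen_mul D u w hw, h, (par_gen w).tw_eq, (par_gen w).tw_eq,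
      pd_gen D u w hw, pd_gen D v w hw]
    by_cases h1 : w = u <;> by_cases h2 : w = v
    · subst h1; subst h2
      cases Var.odd w <;> simp
    · subst h1
      cases Var.odd w <;> cases Var.odd v <;> simp [h2, pd_zero]
    · subst h2
      cases Var.odd w <;> cases Var.odd u <;> simp [h1, pd_zero]
    · cases Var.odd w <;> cases Var.odd v <;> cases Var.odd u <;> simp [h1, h2, pd_zero]

/-- A derivative by an odd coordinate changes parity, so it anticommutes with the parity involution.
-/
theorem inv_pd (v : Var m r s) (F : Loc m r s K) :
    inv (pd D v F) = sg (Var.odd v) • pd D v (inv F) := by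
  induction F using Loc.induction with
  | hc a =>
    rcases hv : Var.base v with _ | _
    · simp [inv_coef, pd_coef D hv, inv_zero]
    · obtain ⟨i, rfl⟩ := eq_fld_inl_of_base hv
      simp [inv_coef, pd_fld_inl_coef, Var.odd, Idx.odd]
  | hadd F₁ F₂ h₁ h₂ => rw [pd_add, inv_add, h₁, h₂, inv_add, pd_add, smul_add]
  | hgen w hw F h =>
    rw [inv_mul, inv_gen, smul_mul_assoc, pd_zsmul, pd_gen_mul D v w hw, pd_gen_mul D v w hw,
      inv_add, inv_mul, inv_mul, h, (par_gen w).tw_eq, inv_zsmul, inv_gen, pd_gen D v w hw]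
    by_cases h1 : w = v
    · subst h1
      cases Var.odd w <;> simp [inv_one]
    · cases Var.odd w <;> cases Var.odd v <;> simp [h1, inv_zero]

theorem tw_pd (b : Bool) (v : Var m r s) (F : Loc m r s K) :
    tw b (pd D v F) = sg (Var.odd v && b) • pd D v (tw b F) := by
  cases b
  · simp
  · rw [Bool.and_true]; exact inv_pd D v F

theorem Par.pd {b : Bool} {F : Loc m r s K} (hF : Par b F) (v : Var m r s) :
    Par (b ^^ Var.odd v) (pd D v F) := by
  rw [Par, inv_pd, hF, pd_zsmul]
  cases b <;> cases Var.odd v <;> simp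

omit [Algebra ℝ K] [IsDer D] in
theorem rpd_eq (v : Var m r s) (F : Loc m r s K) : rpd D v F = tw (Var.odd v) (pd D v F) := rfl

theorem rpd_mul (v : Var m r s) (F G : Loc m r s K) :
    rpd D v (F * G) = F * rpd D v G + rpd D v F * tw (Var.odd v) G := by
  rw [rpd_eq, pd_mul, tw_add, tw_mul, tw_mul, tw_tw, rpd_eq, rpd_eq]
  simp [add_comm]

theorem Par.rpd {b : Bool} {F : Loc m r s K} (hF : Par b F) (v : Var m r s) :
    Par (b ^^ Var.odd v) (rpd D v F) := by
  rw [rpd_eq, (hF.pd D v).tw_eq]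
  exact (hF.pd D v).zsmul _

/-- Left and right derivatives act from opposite sides, so the sign of `pd_comm` cancels against the
twist in the right derivative. -/
theorem rpd_pd (v u : Var m r s) (F : Loc m r s K) :
    rpd D v (pd D u F) = pd D u (rpd D v F) := by
  rw [rpd_eq, rpd_eq, pd_comm, tw_zsmul, tw_pd, smul_smul]
  cases Var.odd u <;> cases Var.odd v <;> simp

theorem rpd_rpd (v u : Var m r s) (F : Loc m r s K) :
    rpd D v (rpd D u F) = sg (Var.odd u && Var.odd v) • rpd D u (rpd D v F) := by
  simp only [rpd_eq]
  have h1 := pd_comm D v u F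
  have h2 := pd_comm D v u (inv F)
  cases hu : Var.odd u <;> cases hv : Var.odd v <;>
    simp [inv_pd, hu, hv, inv_neg, pd_neg, inv_inv] at h1 h2 ⊢ <;> simp only [h1, h2, neg_neg]

end

end

end WeakKoszul


open scoped Manifold

namespace WeakKoszul

noncomputable section

variable {m r s : ℕ} {K : Type*} [CommRing K] [Algebra ℝ K]

/-! ### The even Poisson bracket -/

/-- The coordinate conjugate to `v` for the even bracket. -/
def conj : Var m r s → Var m r s
  | (.fld, A) => (.mvel, A)
  | (.mom, A) => (.vel, A)
  | (.vel, A) => (.mom, A)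
  | (.mvel, A) => (.fld, A)

/-- The sign of the term `∂F/∂v ∂G/∂(conj v)` in the even bracket. -/
def eps : Var m r s → ℤ
  | (.fld, A) => -Idx.sign A
  | (.mom, A) => -Idx.sign A
  | (.vel, _) => -1
  | (.mvel, _) => 1

theorem conj_conj (v : Var m r s) : conj (conj v) = v := by
  rcases v with ⟨_ | _ | _ | _, A⟩ <;> rfl

/-- Conjugation as a permutation of the coordinates. -/
def conjEquiv : Var m r s ≃ Var m r s := ⟨conj, conj, conj_conj, conj_conj⟩

theorem odd_conj (v : Var m r s) : Var.odd (conj v) = Var.odd v := by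
  rcases v with ⟨_ | _ | _ | _, A⟩ <;> rfl

theorem eps_conj (v : Var m r s) : eps (conj v) = -sg (Var.odd v) * eps v := by
  rcases v with ⟨_ | _ | _ | _, _ | _⟩ <;> simp [conj, eps, Var.odd, Idx.odd, Idx.sign]

theorem sum_var {N : Type*} [AddCommMonoid N] (f : Var m r s → N) :
    ∑ v, f v = ∑ A, (f (.fld, A) + (f (.mom, A) + (f (.vel, A) + f (.mvel, A)))) := by
  rw [Fintype.sum_prod_type_right]
  refine Finset.sum_congr rfl fun A _ => ?_
  have : (Finset.univ : Finset Kind) = {.fld, .mom, .vel, .mvel} := rfl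
  rw [this, Finset.sum_insert (by decide), Finset.sum_insert (by decide),
    Finset.sum_insert (by decide), Finset.sum_singleton]

omit [Algebra ℝ K] in
-- With a single sum over all coordinates the four terms of the bracket become one, and exchanging
-- conjugate coordinates becomes a reindexing.
theorem evenBr_eq (D : Fin m → K → K) (F G : Loc m r s K) :
    evenBr D F G = ∑ v, eps v • (rpd D v F * pd D (conj v) G) := by
  rw [sum_var, evenBr]
  refine Finset.sum_congr rfl fun A _ => ?_
  simp only [eps, conj, neg_smul, one_smul]
  abel

section

variable (D : Fin m → K → K) [IsDer D]

theorem evenBr_add_right (F G H : Loc m r s K) :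
    evenBr D F (G + H) = evenBr D F G + evenBr D F H := by
  simp only [evenBr_eq, pd_add, mul_add, smul_add, Finset.sum_add_distrib]

theorem evenBr_add_left (F G H : Loc m r s K) :
    evenBr D (F + G) H = evenBr D F H + evenBr D G H := by
  simp only [evenBr_eq, rpd_eq, pd_add, tw_add, add_mul, smul_add, Finset.sum_add_distrib]

/-- The bracket as a biadditive map. -/
def brHom : Loc m r s K →+ Loc m r s K →+ Loc m r s K :=
  AddMonoidHom.mk' (fun F => AddMonoidHom.mk' (evenBr D F) (evenBr_add_right D F))
    fun F G => AddMonoidHom.ext fun H => evenBr_add_left D F G H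

theorem evenBr_zero_right (F : Loc m r s K) : evenBr D F 0 = 0 := map_zero (brHom D F)
theorem evenBr_neg_right (F G : Loc m r s K) : evenBr D F (-G) = -evenBr D F G :=
  map_neg (brHom D F) G
theorem evenBr_sub_right (F G H : Loc m r s K) :
    evenBr D F (G - H) = evenBr D F G - evenBr D F H := map_sub (brHom D F) G H
theorem evenBr_zsmul_right (k : ℤ) (F G : Loc m r s K) :
    evenBr D F (k • G) = k • evenBr D F G := map_zsmul (brHom D F) k G
theorem evenBr_sum_right {ι : Type*} (t : Finset ι) (F : Loc m r s K) (f : ι → Loc m r s K) :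
    evenBr D F (∑ i ∈ t, f i) = ∑ i ∈ t, evenBr D F (f i) := map_sum (brHom D F) f t
theorem evenBr_zero_left (G : Loc m r s K) : evenBr D 0 G = 0 :=
  DFunLike.congr_fun (map_zero (brHom D)) G
theorem evenBr_neg_left (F G : Loc m r s K) : evenBr D (-F) G = -evenBr D F G :=
  DFunLike.congr_fun (map_neg (brHom D) F) G
theorem evenBr_sub_left (F G H : Loc m r s K) :
    evenBr D (F - G) H = evenBr D F H - evenBr D G H :=
  DFunLike.congr_fun (map_sub (brHom D) F G) H
theorem evenBr_zsmul_left (k : ℤ) (F G : Loc m r s K) :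
    evenBr D (k • F) G = k • evenBr D F G :=
  DFunLike.congr_fun (map_zsmul (brHom D) k F) G
theorem evenBr_sum_left {ι : Type*} (t : Finset ι) (f : ι → Loc m r s K) (G : Loc m r s K) :
    evenBr D (∑ i ∈ t, f i) G = ∑ i ∈ t, evenBr D (f i) G :=
  map_sum (AddMonoidHom.mk' (fun F => evenBr D F G) fun F F' => evenBr_add_left D F F' G) f t

theorem tw_smul (b : Bool) (k : ℝ) (F : Loc m r s K) : tw b (k • F) = k • tw b F := by
  cases b <;> simp [inv_smul]

theorem evenBr_smul_right (k : ℝ) (F G : Loc m r s K) :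
    evenBr D F (k • G) = k • evenBr D F G := by
  simp only [evenBr_eq, pd_smul, mul_smul_comm, Finset.smul_sum]
  exact Finset.sum_congr rfl fun v _ => smul_comm _ _ _

theorem evenBr_smul_left (k : ℝ) (F G : Loc m r s K) :
    evenBr D (k • F) G = k • evenBr D F G := by
  simp only [evenBr_eq, rpd_eq, pd_smul, tw_smul, smul_mul_assoc, Finset.smul_sum]
  exact Finset.sum_congr rfl fun v _ => smul_comm _ _ _

theorem inv_evenBr (F G : Loc m r s K) : inv (evenBr D F G) = evenBr D (inv F) (inv G) := by
  simp only [evenBr_eq, inv_sum, inv_zsmul, inv_mul, rpd_eq, ← tw_inv, inv_pd, odd_conj, tw_zsmul]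
  refine Finset.sum_congr rfl fun v _ => ?_
  cases Var.odd v <;> simp

theorem tw_evenBr (b : Bool) (F G : Loc m r s K) :
    tw b (evenBr D F G) = evenBr D (tw b F) (tw b G) := by
  cases b
  · rfl
  · exact inv_evenBr D F G

theorem Par.evenBr {b c : Bool} {F G : Loc m r s K} (hF : Par b F) (hG : Par c G) :
    Par (b ^^ c) (evenBr D F G) := by
  rw [Par, inv_evenBr, hF, hG, evenBr_zsmul_left, evenBr_zsmul_right, smul_smul]
  cases b <;> cases c <;> simp

/-- The right derivative of `F` by `v` has parity p + v; moving it past `G`, which the derivative on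
the right has already twisted by `v`, leaves the twist by p. -/
theorem evenBr_mul_right {p : Bool} {F : Loc m r s K} (hF : Par p F) (G H : Loc m r s K) :
    evenBr D F (G * H) = evenBr D F G * H + tw p G * evenBr D F H := by
  simp only [evenBr_eq, pd_mul, mul_add, smul_add, Finset.sum_add_distrib, Finset.sum_mul,
    Finset.mul_sum]
  congr 1
  · refine Finset.sum_congr rfl fun v _ => ?_
    rw [smul_mul_assoc, mul_assoc]
  · refine Finset.sum_congr rfl fun v _ => ?_
    rw [← mul_assoc, (hF.rpd D v).mul_comm, tw_tw, odd_conj, mul_assoc, mul_smul_comm]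
    cases p <;> cases Var.odd v <;> rfl

/-- Reindexing by conjugation exchanges the roles of `F` and `G`, and `eps_conj` combines with the
commutation signs to -1. The sign (-1)^{FG} sits in `tw p G`, so that `G` need not be homogeneous.
-/
theorem evenBr_skew {p : Bool} {F : Loc m r s K} (hF : Par p F) (G : Loc m r s K) :
    evenBr D F G = -evenBr D (tw p G) F := by
  rw [evenBr_eq, evenBr_eq, ← Equiv.sum_comp conjEquiv fun v =>
    eps v • (rpd D v (tw p G) * pd D (conj v) F), ← Finset.sum_neg_distrib]
  refine Finset.sum_congr rfl fun v _ => ?_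
  change eps v • _ = -(eps (conj v) • (rpd D (conj v) (tw p G) * pd D (conj (conj v)) F))
  rw [conj_conj, eps_conj, (hF.rpd D v).mul_comm, rpd_eq, rpd_eq, (hF.pd D v).tw_eq, odd_conj,
    tw_pd, tw_pd, tw_tw, odd_conj, Bool.xor_comm p]
  cases p <;> cases Var.odd v <;> simp

theorem rpd_zsmul (v : Var m r s) (k : ℤ) (F : Loc m r s K) : rpd D v (k • F) = k • rpd D v F := by
  rw [rpd_eq, pd_zsmul, tw_zsmul]; rfl

theorem rpd_sum (v : Var m r s) {ι : Type*} (t : Finset ι) (f : ι → Loc m r s K) :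
    rpd D v (∑ i ∈ t, f i) = ∑ i ∈ t, rpd D v (f i) := by
  rw [rpd_eq, pd_sum, tw_sum]; rfl

/-- The bracket has constant coefficients in the coordinates, hence coordinate derivatives are
derivations of it. -/
theorem rpd_evenBr (v : Var m r s) (F G : Loc m r s K) :
    rpd D v (evenBr D F G) = evenBr D F (rpd D v G) + evenBr D (rpd D v F) (tw (Var.odd v) G) := by
  rw [evenBr_eq, evenBr_eq, evenBr_eq, rpd_sum, ← Finset.sum_add_distrib]
  refine Finset.sum_congr rfl fun u _ => ?_
  rw [rpd_zsmul, rpd_mul, smul_add, rpd_pd, rpd_rpd D v u, tw_pd, odd_conj]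
  congr 1
  cases Var.odd v <;> cases Var.odd u <;> simp

theorem evenBr_gen_right (F : Loc m r s K) (v : Var m r s) (hv : Var.base v = false) :
    evenBr D F (gen v) = eps (conj v) • rpd D (conj v) F := by
  rw [evenBr_eq, Finset.sum_eq_single (conj v)]
  · rw [conj_conj, pd_gen D v v hv, if_pos rfl, mul_one]
  · intro u _ hu
    have : v ≠ conj u := fun h => hu (by rw [h, conj_conj])
    rw [pd_gen D _ v hv, if_neg this, mul_zero, smul_zero]
  · simp

theorem evenBr_coef_right (F : Loc m r s K) (a : K) :
    evenBr D F (coef a) = ∑ i : Fin m, rpd D (.mvel, .inl i) F * coef (D i a) := by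
  have h : ∀ (k : Kind) (A : Idx m r s), Var.base (k, A) = false → pd D (k, A) (coef a) = 0 :=
    fun k A h => pd_coef D h a
  rw [evenBr, Fintype.sum_sum_type]
  simp only [pd_fld_inl_coef, h _ _ (show Var.base (.mvel, _) = false from rfl),
    h _ _ (show Var.base (.mom, _) = false from rfl),
    h _ _ (show Var.base (.vel, _) = false from rfl),
    h _ (.inr _) (show Var.base (.fld, .inr _) = false from rfl)]
  simp

theorem mul_coef_evenBr {p : Bool} {F : Loc m r s K} (hF : Par p F) (G : Loc m r s K) (a : K) :
    evenBr D F (G * coef a) = evenBr D F G * coef a +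
      ∑ j : Fin m, tw p G * rpd D (.mvel, .inl j) F * coef (D j a) := by
  rw [evenBr_mul_right D hF, evenBr_coef_right, Finset.mul_sum]
  simp only [mul_assoc]

/-- The Jacobi identity of the even bracket, for homogeneous `F` and `G`. -/
theorem evenBr_jacobi_homogeneous {p q : Bool} {F G : Loc m r s K} (hF : Par p F) (hG : Par q G)
    (H : Loc m r s K) :
    evenBr D (evenBr D F G) H =
      evenBr D F (evenBr D G H) - sg (p && q) • evenBr D G (evenBr D F H) := by
  have hFG := hF.evenBr D hG
  -- Both sides are derivations in `H`, so coefficients and generators suffice.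
  induction H using Loc.induction with
  | hc a =>
    simp only [evenBr_coef_right, evenBr_sum_right, mul_coef_evenBr D hF, mul_coef_evenBr D hG,
      Finset.sum_add_distrib, rpd_evenBr, add_mul]
    have h1 : ∀ i : Fin m, evenBr D (rpd D (.mvel, .inl i) F) (tw false G) =
        -(sg (p && q) • evenBr D G (rpd D (.mvel, .inl i) F)) := by
      intro i
      rw [evenBr_skew D (hF.rpd D _), tw_false, hG.tw_eq, evenBr_zsmul_left]
      cases p <;> cases q <;> rfl
    -- The terms with second derivatives of `a` from the two nested brackets agree up to the parity
    -- sign, because the `D i` commute, and cancel in the difference.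
    have h2 : ∑ i : Fin m, ∑ j : Fin m,
          tw p (rpd D (.mvel, .inl i) G) * rpd D (.mvel, .inl j) F * coef (D j (D i a)) =
        sg (p && q) • ∑ i : Fin m, ∑ j : Fin m,
          tw q (rpd D (.mvel, .inl i) F) * rpd D (.mvel, .inl j) G * coef (D j (D i a)) := by
      rw [Finset.sum_comm, Finset.smul_sum]
      refine Finset.sum_congr rfl fun i _ => ?_
      rw [Finset.smul_sum]
      refine Finset.sum_congr rfl fun j _ => ?_
      have h3 : Par q (rpd D (.mvel, .inl j) G) := by
        have := hG.rpd D (.mvel, .inl j)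
        simpa [Var.odd, Idx.odd] using this
      have h4 : Par p (rpd D (.mvel, .inl i) F) := by
        have := hF.rpd D (.mvel, .inl i)
        simpa [Var.odd, Idx.odd] using this
      rw [IsDer.comm (D := D) i j, ← h4.mul_comm, h4.tw_eq, smul_mul_assoc, smul_mul_assoc,
        smul_smul]
      cases p <;> cases q <;> simp
    rw [h2]
    have h5 : ∀ i : Fin m, Var.odd (Kind.mvel, (Sum.inl i : Idx m r s)) = false := fun _ => rfl
    simp only [h5, h1, neg_mul, smul_mul_assoc, smul_add, Finset.smul_sum, Finset.sum_neg_distrib]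
    abel
  | hadd H₁ H₂ h₁ h₂ =>
    simp only [evenBr_add_right, h₁, h₂, smul_add]
    abel
  | hgen v hv H h =>
    have hgen : evenBr D (evenBr D F G) (gen v) =
        evenBr D F (evenBr D G (gen v)) - sg (p && q) • evenBr D G (evenBr D F (gen v)) := by
      rw [evenBr_gen_right D _ v hv, evenBr_gen_right D _ v hv, evenBr_gen_right D _ v hv,
        rpd_evenBr, evenBr_skew D (hF.rpd D _), evenBr_zsmul_right, evenBr_zsmul_right, tw_tw,
        hG.tw_eq, evenBr_zsmul_left, smul_add, smul_comm (sg (p && q)),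
        ← smul_sub, ← smul_add]
      cases p <;> cases q <;> cases Var.odd (conj v) <;> simp [sub_eq_add_neg]
    rw [evenBr_mul_right D hFG, h, hgen, evenBr_mul_right D hG, evenBr_mul_right D hF,
      evenBr_add_right, evenBr_add_right, evenBr_mul_right D hG, evenBr_mul_right D hF,
      evenBr_mul_right D hG, evenBr_mul_right D hF, tw_evenBr, tw_evenBr, hF.tw_eq, hG.tw_eq,
      (par_gen v).tw_eq, (par_gen v).tw_eq, (par_gen v).tw_eq]
    simp only [evenBr_zsmul_left, evenBr_zsmul_right, tw_zsmul, (par_gen v).tw_eq, smul_add,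
      sub_mul, mul_sub, smul_mul_assoc, mul_smul_comm, smul_smul]
    cases p <;> cases q <;> cases Var.odd v <;> simp <;> abel

omit [Algebra ℝ K] in
-- Every function is the sum of its even and odd parts (F ± inv F)/2; division by two uses the real
-- scalars.
theorem parity_induction {P : Loc m r s K → Prop} [Algebra ℝ K]
    (hadd : ∀ F G, P F → P G → P (F + G)) (hpar : ∀ b F, Par b F → P F) (F : Loc m r s K) : P F := by
  have h : F = (1 / 2 : ℝ) • (F + inv F) + (1 / 2 : ℝ) • (F - inv F) := by
    rw [← smul_add]
    have : F + inv F + (F - inv F) = (2 : ℝ) • F := by rw [two_smul]; abel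
    rw [this, smul_smul]; norm_num
  rw [h]
  refine hadd _ _ (hpar false _ (Par.smul ?_ _)) (hpar true _ (Par.smul ?_ _))
  · rw [Par, inv_add, inv_inv, sg_false, one_smul, add_comm]
  · rw [Par, inv_sub, inv_inv, sg_true, neg_smul, one_smul, neg_sub]

/-- The Jacobi identity of the even bracket. -/
theorem evenBr_jacobi {p : Bool} {F : Loc m r s K} (hF : Par p F) (G H : Loc m r s K) :
    evenBr D F (evenBr D G H) = evenBr D (evenBr D F G) H + evenBr D (tw p G) (evenBr D F H) := by
  induction G using parity_induction with
  | hadd G₁ G₂ h₁ h₂ =>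
    simp only [evenBr_add_left, evenBr_add_right, tw_add, h₁, h₂]
    abel
  | hpar q G hG =>
    rw [evenBr_jacobi_homogeneous D hF hG, hG.tw_eq, evenBr_zsmul_left, Bool.and_comm]
    abel

omit [Algebra ℝ K] [IsDer D] in
/-- Functions of which one is independent of each pair of conjugate coordinates Poisson commute. -/
theorem evenBr_eq_zero {F H : Loc m r s K} (h : ∀ v, pd D v F = 0 ∨ pd D (conj v) H = 0) :
    evenBr D F H = 0 := by
  rw [evenBr_eq]
  refine Finset.sum_eq_zero fun v _ => ?_
  rcases h v with h | h
  · rw [rpd_eq, h, tw_zero, zero_mul, smul_zero]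
  · rw [h, mul_zero, smul_zero]

/-- No derivative of `F` survives, so `F` acts as a scalar on the left. Applied to functions on 𝓛,
it pulls them out of the interior product. -/
theorem evenBr_mul_left {F H : Loc m r s K} (h : ∀ v, pd D v F = 0 ∨ pd D (conj v) H = 0)
    (G : Loc m r s K) : evenBr D (F * G) H = F * evenBr D G H := by
  rw [evenBr_eq, evenBr_eq, Finset.mul_sum]
  refine Finset.sum_congr rfl fun v _ => ?_
  rw [rpd_mul, add_mul, mul_smul_comm, ← mul_assoc]
  rcases h v with h | h
  · rw [rpd_eq D v F, h, tw_zero, zero_mul, zero_mul, add_zero]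
  · rw [h, mul_zero, mul_zero, add_zero]

end

end

end WeakKoszul


open scoped Manifold

namespace WeakKoszul

noncomputable section

variable {m r s : ℕ} {K : Type*} [CommRing K]

/-! ### Supports and degrees -/

/-- All monomials of `F` satisfy `P`. -/
def SuppIn (P : Finset (OddVar m r s) → (EvenVar m r s →₀ ℕ) → Prop) (F : Loc m r s K) : Prop :=
  ∀ I n, (F I).coeff n ≠ 0 → P I n

variable {P Q R : Finset (OddVar m r s) → (EvenVar m r s →₀ ℕ) → Prop} {F G : Loc m r s K}

theorem SuppIn.mono (hF : SuppIn P F) (h : ∀ I n, P I n → Q I n) : SuppIn Q F :=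
  fun I n hn => h I n (hF I n hn)

theorem SuppIn.and (hF : SuppIn P F) (hF' : SuppIn Q F) : SuppIn (fun I n => P I n ∧ Q I n) F :=
  fun I n hn => ⟨hF I n hn, hF' I n hn⟩

theorem SuppIn.zero : SuppIn P (0 : Loc m r s K) := fun I n h => (h (by simp [Loc.zero_apply])).elim

theorem SuppIn.eq_zero (hF : SuppIn P F) (h : ∀ I n, ¬P I n) : F = 0 := by
  refine Loc.ext' fun I => ?_
  ext n
  by_contra hn
  exact h I n (hF I n hn)

theorem SuppIn.add (hF : SuppIn P F) (hG : SuppIn P G) : SuppIn P (F + G) := by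
  intro I n h
  rw [Loc.add_apply, MvPolynomial.coeff_add] at h
  by_cases h1 : (F I).coeff n = 0
  · rw [h1, zero_add] at h
    exact hG I n h
  · exact hF I n h1

theorem SuppIn.neg (hF : SuppIn P F) : SuppIn P (-F) := by
  intro I n h
  rw [Loc.neg_apply, MvPolynomial.coeff_neg] at h
  exact hF I n (neg_ne_zero.1 h)

theorem SuppIn.sub (hF : SuppIn P F) (hG : SuppIn P G) : SuppIn P (F - G) := by
  rw [sub_eq_add_neg]; exact hF.add hG.neg

theorem SuppIn.zsmul (hF : SuppIn P F) (k : ℤ) : SuppIn P (k • F) := by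
  intro I n h
  refine hF I n fun h0 => h ?_
  rw [Loc.zsmul_apply, MvPolynomial.coeff_smul, h0, smul_zero]

theorem SuppIn.smul [Algebra ℝ K] (hF : SuppIn P F) (k : ℝ) : SuppIn P (k • F) := by
  intro I n h
  refine hF I n fun h0 => h ?_
  rw [Loc.smul_apply, MvPolynomial.coeff_smul, h0, smul_zero]

theorem SuppIn.sum {ι : Type*} {t : Finset ι} {f : ι → Loc m r s K}
    (h : ∀ i ∈ t, SuppIn P (f i)) : SuppIn P (∑ i ∈ t, f i) :=
  Finset.sum_induction f (SuppIn P) (fun _ _ => SuppIn.add) SuppIn.zero h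

theorem SuppIn.inv (hF : SuppIn P F) : SuppIn P (inv F) := by
  intro I n h
  refine hF I n fun h0 => h ?_
  rw [WeakKoszul.inv, MvPolynomial.coeff_smul, h0, smul_zero]

theorem SuppIn.tw (hF : SuppIn P F) (b : Bool) : SuppIn P (tw b F) := by
  cases b
  · exact hF
  · exact hF.inv

/-- Each monomial of a product is a product of monomials, and their odd parts must be disjoint since
odd coordinates square to zero. -/
theorem SuppIn.mul (hF : SuppIn P F) (hG : SuppIn Q G)
    (h : ∀ I J n k, Disjoint I J → P I n → Q J k → R (I ∪ J) (n + k)) : SuppIn R (F * G) := by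
  intro L n hn
  rw [Loc.mul_apply, MvPolynomial.coeff_sum] at hn
  obtain ⟨I, hI, hI'⟩ := Finset.exists_ne_zero_of_sum_ne_zero hn
  rw [MvPolynomial.coeff_smul, MvPolynomial.coeff_mul] at hI'
  have h1 := right_ne_zero_of_smul hI'
  obtain ⟨⟨a, b⟩, hab, h2⟩ := Finset.exists_ne_zero_of_sum_ne_zero h1
  rw [Finset.HasAntidiagonal.mem_antidiagonal] at hab
  have := h I (L \ I) a b Finset.disjoint_sdiff (hF _ _ (left_ne_zero_of_mul h2))
    (hG _ _ (right_ne_zero_of_mul h2))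
  rw [Finset.mem_powerset] at hI
  rwa [Finset.union_sdiff_of_subset hI, show a + b = n from hab] at this

theorem wt_union (w : Var m r s → ℤ) {I J : Finset (OddVar m r s)} (h : Disjoint I J)
    (n k : EvenVar m r s →₀ ℕ) : wt w (I ∪ J) (n + k) = wt w I n + wt w J k := by
  rw [wt, wt, wt, Finset.sum_union h, Finsupp.sum_add_index' (by simp)]
  · ring
  · intro a b c; push_cast; ring

theorem involves_union (p : Var m r s → Prop) (I J : Finset (OddVar m r s))
    (n k : EvenVar m r s →₀ ℕ) :
    Involves p (I ∪ J) (n + k) ↔ Involves p I n ∧ Involves p J k := by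
  simp only [Involves, Finset.mem_union, Finsupp.mem_support_iff, Finsupp.add_apply, ne_eq,
    Nat.add_eq_zero_iff]
  constructor
  · rintro ⟨h1, h2⟩
    exact ⟨⟨fun v hv => h1 v (Or.inl hv), fun e he => h2 e (fun h => he h.1)⟩,
      fun v hv => h1 v (Or.inr hv), fun e he => h2 e (fun h => he h.2)⟩
  · rintro ⟨⟨h1, h2⟩, h3, h4⟩
    refine ⟨fun v hv => hv.elim (h1 v) (h3 v), fun e he => ?_⟩
    by_cases h : n e = 0
    · exact h4 e fun h' => he ⟨h, h'⟩
    · exact h2 e h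

theorem SuppIn.mul_wt {w : Var m r s → ℤ} {d e : ℤ} (hF : SuppIn (fun I n => wt w I n = d) F)
    (hG : SuppIn (fun I n => wt w I n = e) G) : SuppIn (fun I n => wt w I n = d + e) (F * G) :=
  hF.mul hG fun I J n k h h1 h2 => by rw [wt_union w h, h1, h2]

theorem SuppIn.mul_wt_ge {w : Var m r s → ℤ} {d e : ℤ} (hF : SuppIn (fun I n => d ≤ wt w I n) F)
    (hG : SuppIn (fun I n => e ≤ wt w I n) G) : SuppIn (fun I n => d + e ≤ wt w I n) (F * G) :=
  hF.mul hG fun I J n k h h1 h2 => by rw [wt_union w h]; exact add_le_add h1 h2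

theorem SuppIn.mul_involves {p : Var m r s → Prop} (hF : SuppIn (Involves p) F)
    (hG : SuppIn (Involves p) G) : SuppIn (Involves p) (F * G) :=
  hF.mul hG fun I J n k _ h1 h2 => (involves_union p I J n k).2 ⟨h1, h2⟩

theorem SuppIn.coef (a : K) (h : P ∅ 0) : SuppIn P (coef a : Loc m r s K) := by
  intro I n hn
  by_cases hI : I = ∅
  · simp only [WeakKoszul.coef, hI, if_true, MvPolynomial.coeff_C] at hn
    split_ifs at hn with h0
    · rw [hI, ← h0]; exact h
    · exact (hn rfl).elim
  · simp [WeakKoszul.coef, hI] at hn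

theorem wt_empty (w : Var m r s → ℤ) : wt w ∅ 0 = 0 := by simp [wt]

theorem involves_empty (p : Var m r s → Prop) : Involves p ∅ 0 := by simp [Involves]

theorem SuppIn.gen {v : Var m r s}
    (ho : ∀ h : Var.odd v = true, P {⟨v, h⟩} 0)
    (he : ∀ (h : Var.odd v = false) (hb : Var.base v = false),
      P ∅ (Finsupp.single ⟨v, h, hb⟩ 1)) :
    SuppIn P (gen v : Loc m r s K) := by
  intro I n hn
  by_cases h : Var.odd v = true
  · rw [gen_odd h] at hn
    by_cases hI : I = {⟨v, h⟩}
    · simp only [genOdd, hI, if_true, MvPolynomial.coeff_one] at hn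
      split_ifs at hn with h0
      · rw [hI, ← h0]; exact ho h
      · exact (hn rfl).elim
    · simp [genOdd, hI] at hn
  · rw [Bool.not_eq_true] at h
    by_cases hb : Var.base v = false
    · rw [gen_even h hb] at hn
      by_cases hI : I = ∅
      · simp only [genEven, hI, if_true, MvPolynomial.coeff_X] at hn
        split_ifs at hn with h0
        · rw [hI, ← h0]; exact he h hb
        · exact (hn rfl).elim
      · simp [genEven, hI] at hn
    · simp [WeakKoszul.gen, h, hb, Loc.zero_apply] at hn

theorem SuppIn.gen_wt (w : Var m r s → ℤ) (v : Var m r s) :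
    SuppIn (fun I n => wt w I n = w v) (WeakKoszul.gen v : Loc m r s K) :=
  SuppIn.gen (fun h => by simp [wt]) fun h hb => by simp [wt]

theorem SuppIn.gen_involves {p : Var m r s → Prop} {v : Var m r s} (hp : p v) :
    SuppIn (Involves p) (WeakKoszul.gen v : Loc m r s K) :=
  SuppIn.gen (fun h => by simp [Involves, hp]) fun h hb => by
    refine ⟨by simp, fun e he => ?_⟩
    have := Finsupp.support_single_subset he
    rw [Finset.mem_singleton] at this
    rw [this]; exact hp

section

variable (D : Fin m → K → K)

/-- A derivative removes one factor `v` from a monomial or, for a base coordinate, changes only its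
coefficient. The hypothesis records what this says of the monomial (J, k) that produces (I, n), for
any weight that ignores the base coordinates. -/
theorem SuppIn.pd (hD : ∀ i, D i 0 = 0) (hF : SuppIn P F) (v : Var m r s)
    (h : ∀ I J n k, I ⊆ J → n ≤ k →
      (∀ w : Var m r s → ℤ, (∀ i, w (.fld, .inl i) = 0) → wt w J k = wt w I n + w v) →
      P J k → Q I n) : SuppIn Q (pd D v F) := by
  intro I n hn
  rcases var_cases v with ho | ⟨he, hb⟩ | ⟨i, rfl⟩
  · rw [pd_odd D ho, pdOdd_apply] at hn
    split_ifs at hn with hv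
    · simp at hn
    · rw [MvPolynomial.coeff_smul] at hn
      refine h I _ n n (Finset.subset_insert _ _) le_rfl (fun w _ => ?_)
        (hF _ _ (right_ne_zero_of_smul hn))
      rw [wt, wt, Finset.sum_insert hv]; ring
  · rw [pd_even D he hb, pdEven, MvPolynomial.coeff_pderiv] at hn
    refine h I I n (n + Finsupp.single ⟨v, he, hb⟩ 1) le_rfl (by simp) (fun w _ => ?_)
      (hF _ _ (left_ne_zero_of_mul hn))
    rw [wt, wt, Finsupp.sum_add_index' (by simp) (by intro a b c; push_cast; ring)]
    simp; ring
  · rw [pd_fld_inl, coeff_pdBase (hD i)] at hn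
    refine h I I n n le_rfl le_rfl (fun w hw => by rw [hw, add_zero])
      (hF I n fun h0 => hn ?_)
    rw [h0, hD]

theorem SuppIn.pd_wt (hD : ∀ i, D i 0 = 0) {w : Var m r s → ℤ} (hw : ∀ i, w (.fld, .inl i) = 0)
    {d : ℤ} (hF : SuppIn (fun I n => wt w I n = d) F) (v : Var m r s) :
    SuppIn (fun I n => wt w I n = d - w v) (WeakKoszul.pd D v F) :=
  hF.pd D hD v fun I J n k _ _ h h1 => by
    have := h w hw; rw [h1] at this; exact eq_sub_of_add_eq this.symm

theorem SuppIn.pd_wt_ge (hD : ∀ i, D i 0 = 0) {w : Var m r s → ℤ} (hw : ∀ i, w (.fld, .inl i) = 0)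
    {d : ℤ} (hF : SuppIn (fun I n => d ≤ wt w I n) F) (v : Var m r s) :
    SuppIn (fun I n => d - w v ≤ wt w I n) (WeakKoszul.pd D v F) :=
  hF.pd D hD v fun I J n k _ _ h h1 => by
    have := h w hw; rw [this] at h1; linarith

theorem SuppIn.pd_involves (hD : ∀ i, D i 0 = 0) {p : Var m r s → Prop}
    (hF : SuppIn (Involves p) F) (v : Var m r s) : SuppIn (Involves p) (WeakKoszul.pd D v F) :=
  hF.pd D hD v fun I J n k h1 h2 _ h => ⟨fun v hv => h.1 v (h1 hv), fun e he => h.2 e (by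
    have := h2 e
    rw [Finsupp.mem_support_iff] at he ⊢
    omega)⟩

/-- The coordinate `v` does not occur in `F`. Base coordinates are excluded because the coefficients
may depend on them whatever `p` says. -/
theorem pd_eq_zero_of_involves {p : Var m r s → Prop} (hF : SuppIn (Involves p) F) {v : Var m r s}
    (hb : Var.base v = false) (hp : ¬p v) : pd D v F = 0 := by
  refine Loc.ext' fun I => ?_
  ext n
  rcases h : Var.odd v with _ | _
  · rw [pd_even D h hb, pdEven, MvPolynomial.coeff_pderiv]
    by_contra hn
    exact hp ((hF _ _ (left_ne_zero_of_mul hn)).2 ⟨v, h, hb⟩ (by simp))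
  · rw [pd_odd D h, pdOdd_apply]
    split_ifs with hv
    · rfl
    · by_contra hn
      rw [MvPolynomial.coeff_smul] at hn
      exact hp ((hF _ _ (right_ne_zero_of_smul hn)).1 ⟨v, h⟩ (by simp))

/-- Each term of the bracket removes a conjugate pair of coordinates, of total weight κ. -/
theorem SuppIn.evenBr_wt (hD : ∀ i, D i 0 = 0) {w : Var m r s → ℤ}
    (hw : ∀ i, w (.fld, .inl i) = 0) {κ : ℤ} (hκ : ∀ v, w v + w (conj v) = κ) {d e f : ℤ}
    (hF : SuppIn (fun I n => wt w I n = d) F) (hG : SuppIn (fun I n => wt w I n = e) G)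
    (hf : f = d + e - κ) : SuppIn (fun I n => wt w I n = f) (evenBr D F G) := by
  rw [evenBr_eq]
  refine SuppIn.sum fun v _ => SuppIn.zsmul ?_ _
  refine (((hF.pd_wt D hD hw v).tw _).mul_wt (hG.pd_wt D hD hw (conj v))).mono fun I n h => ?_
  rw [h, hf, ← hκ v]; ring

end

/-- Nonnegative weights that add up to zero all vanish; this converts degree conditions into
conditions on the coordinates that occur. -/
theorem involves_of_wt_eq_zero {w : Var m r s → ℤ} (hw : ∀ v, 0 ≤ w v)
    {I : Finset (OddVar m r s)} {n : EvenVar m r s →₀ ℕ} (h : wt w I n = 0) :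
    Involves (fun v => w v = 0) I n := by
  have h1 : 0 ≤ ∑ v ∈ I, w v.1 := Finset.sum_nonneg fun v _ => hw _
  have h2 : 0 ≤ n.sum fun e k => (k : ℤ) * w e.1 :=
    Finset.sum_nonneg fun e _ => mul_nonneg (by positivity) (hw _)
  rw [wt] at h
  have h3 : ∑ v ∈ I, w v.1 = 0 := by linarith
  have h4 : n.sum (fun e k => (k : ℤ) * w e.1) = 0 := by linarith
  refine ⟨(Finset.sum_eq_zero_iff_of_nonneg fun v _ => hw _).1 h3, fun e he => ?_⟩
  have := (Finset.sum_eq_zero_iff_of_nonneg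
    fun e _ => mul_nonneg (by positivity) (hw _)).1 h4 e he
  rcases mul_eq_zero.1 this with h5 | h5
  · rw [Finsupp.mem_support_iff] at he
    exact (he (by exact_mod_cast h5)).elim
  · exact h5

theorem wt_eq_zero_of_involves {w : Var m r s → ℤ} {p : Var m r s → Prop}
    (hp : ∀ v, p v → w v = 0) {I : Finset (OddVar m r s)} {n : EvenVar m r s →₀ ℕ}
    (h : Involves p I n) : wt w I n = 0 := by
  rw [wt, Finset.sum_eq_zero fun v hv => hp _ (h.1 v hv), Finsupp.sum,
    Finset.sum_eq_zero fun e he => by rw [hp _ (h.2 e he), mul_zero], add_zero]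

theorem wt_add (w w' : Var m r s → ℤ) (I : Finset (OddVar m r s)) (n : EvenVar m r s →₀ ℕ) :
    wt (fun v => w v + w' v) I n = wt w I n + wt w' I n := by
  simp only [wt, Finset.sum_add_distrib, Finsupp.sum, mul_add]
  ring

theorem wt_congr {w w' : Var m r s → ℤ} {p : Var m r s → Prop} (hp : ∀ v, p v → w v = w' v)
    {I : Finset (OddVar m r s)} {n : EvenVar m r s →₀ ℕ} (h : Involves p I n) :
    wt w I n = wt w' I n := by
  rw [wt, wt, Finsupp.sum, Finsupp.sum]
  congr 1
  · exact Finset.sum_congr rfl fun v hv => hp _ (h.1 v hv)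
  · exact Finset.sum_congr rfl fun e he => by rw [hp _ (h.2 e he)]

theorem wt_le_wt {w w' : Var m r s → ℤ} {p : Var m r s → Prop} (hp : ∀ v, p v → w v ≤ w' v)
    {I : Finset (OddVar m r s)} {n : EvenVar m r s →₀ ℕ} (h : Involves p I n) :
    wt w I n ≤ wt w' I n :=
  add_le_add (Finset.sum_le_sum fun v hv => hp _ (h.1 v hv))
    (Finset.sum_le_sum fun e he => mul_le_mul_of_nonneg_left (hp _ (h.2 e he)) (by positivity))

theorem Involves.imp {p q : Var m r s → Prop} {I : Finset (OddVar m r s)}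
    {n : EvenVar m r s →₀ ℕ} (h : Involves p I n) (hpq : ∀ v, p v → q v) : Involves q I n :=
  ⟨fun v hv => hpq _ (h.1 v hv), fun e he => hpq _ (h.2 e he)⟩

/-! ### Restriction -/

open Classical in
theorem coeff_restr (p : Var m r s → Prop) (F : Loc m r s K) (I : Finset (OddVar m r s))
    (n : EvenVar m r s →₀ ℕ) :
    (restr p F I).coeff n = if Involves p I n then (F I).coeff n else 0 := by
  rw [restr, MvPolynomial.coeff_sum]
  simp only [MvPolynomial.coeff_monomial]
  rw [Finset.sum_ite_eq']
  by_cases h : Involves p I n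
  · by_cases h' : n ∈ (F I).support
    · rw [if_pos (Finset.mem_filter.2 ⟨h', h⟩), if_pos h]
    · rw [if_neg fun h'' => h' (Finset.mem_filter.1 h'').1, if_pos h,
        MvPolynomial.notMem_support_iff.1 h']
  · rw [if_neg fun h'' => h (Finset.mem_filter.1 h'').2, if_neg h]

theorem SuppIn.restr (hF : SuppIn P F) (p : Var m r s → Prop) :
    SuppIn (fun I n => P I n ∧ Involves p I n) (restr p F) := by
  classical
  intro I n hn
  rw [coeff_restr] at hn
  split_ifs at hn with h
  · exact ⟨hF I n hn, h⟩
  · exact (hn rfl).elim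

theorem suppIn_restr (p : Var m r s → Prop) (F : Loc m r s K) :
    SuppIn (Involves p) (restr p F) :=
  (SuppIn.restr (P := fun _ _ => True) (fun _ _ _ => trivial) p).mono fun _ _ h => h.2

theorem SuppIn.restr_eq_self {p : Var m r s → Prop} (hF : SuppIn (Involves p) F) :
    WeakKoszul.restr p F = F := by
  classical
  refine Loc.ext' fun I => ?_
  ext n
  rw [coeff_restr]
  split_ifs with h
  · rfl
  · by_contra h'
    exact h (hF I n (Ne.symm h'))

theorem SuppIn.restr_eq_zero {p : Var m r s → Prop} (hF : SuppIn (fun I n => ¬Involves p I n) F) :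
    WeakKoszul.restr p F = 0 := by
  classical
  refine Loc.ext' fun I => ?_
  ext n
  rw [coeff_restr]
  split_ifs with h
  · by_contra h'
    exact hF I n h' h
  · rfl

theorem restr_add (p : Var m r s → Prop) (F G : Loc m r s K) :
    restr p (F + G) = restr p F + restr p G := by
  classical
  refine Loc.ext' fun I => ?_
  ext n
  rw [coeff_restr, Loc.add_apply, Loc.add_apply, MvPolynomial.coeff_add, MvPolynomial.coeff_add,
    coeff_restr, coeff_restr]
  split_ifs <;> simp

theorem suppIn_sub_restr (p : Var m r s → Prop) (F : Loc m r s K) :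
    SuppIn (fun I n => ¬Involves p I n) (F - restr p F) := by
  classical
  intro I n hn h
  rw [Loc.sub_apply, MvPolynomial.coeff_sub, coeff_restr, if_pos h, sub_self] at hn
  exact hn rfl

theorem SuppIn.sub_restr (hF : SuppIn P F) (p : Var m r s → Prop) :
    SuppIn (fun I n => P I n ∧ ¬Involves p I n) (F - WeakKoszul.restr p F) :=
  (hF.sub ((hF.restr p).mono fun _ _ h => h.1)).and (suppIn_sub_restr p F)

/-- A product of monomials survives the restriction exactly when both factors do, so all terms with
a vanishing factor drop out. -/
theorem restr_mul (p : Var m r s → Prop) (F G : Loc m r s K) :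
    restr p (F * G) = restr p F * restr p G := by
  have e : F * G = restr p F * restr p G +
      (restr p F * (G - restr p G) + (F - restr p F) * G) := by noncomm_ring
  have hT : ∀ F : Loc m r s K, SuppIn (fun _ _ => True) F := fun _ _ _ _ => trivial
  rw [e, restr_add, ((suppIn_restr p F).mul_involves (suppIn_restr p G)).restr_eq_self,
    SuppIn.restr_eq_zero (F := _ + _), add_zero]
  refine SuppIn.add ?_ ?_
  · exact (hT _).mul (suppIn_sub_restr p G) fun I J n k _ _ h h' =>
      h ((involves_union p I J n k).1 h').2
  · exact (suppIn_sub_restr p F).mul (hT _) fun I J n k _ h _ h' =>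
      h ((involves_union p I J n k).1 h').1

/-- Restriction as a ring homomorphism. -/
def restrHom (p : Var m r s → Prop) : Loc m r s K →+* Loc m r s K where
  toFun := restr p
  map_one' := SuppIn.restr_eq_self (SuppIn.coef 1 (involves_empty p))
  map_mul' := restr_mul p
  map_zero' := SuppIn.zero.restr_eq_self
  map_add' := restr_add p

theorem restr_sub (p : Var m r s → Prop) (F G : Loc m r s K) :
    restr p (F - G) = restr p F - restr p G := map_sub (restrHom p) F G

theorem restr_neg (p : Var m r s → Prop) (F : Loc m r s K) :
    restr p (-F) = -restr p F := map_neg (restrHom p) F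

theorem restr_zero (p : Var m r s → Prop) : restr p (0 : Loc m r s K) = 0 :=
  map_zero (restrHom p)

theorem restr_smul [Algebra ℝ K] (p : Var m r s → Prop) (a : ℝ) (F : Loc m r s K) :
    restr p (a • F) = a • restr p F := by
  classical
  refine Loc.ext' fun I => ?_
  ext n
  rw [coeff_restr, Loc.smul_apply, Loc.smul_apply, MvPolynomial.coeff_smul,
    MvPolynomial.coeff_smul, coeff_restr]
  split_ifs <;> simp

theorem inv_restr (p : Var m r s → Prop) (F : Loc m r s K) :
    inv (restr p F) = restr p (inv F) := by
  classical
  refine Loc.ext' fun I => ?_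
  ext n
  rw [coeff_restr, inv, inv, MvPolynomial.coeff_smul, MvPolynomial.coeff_smul, coeff_restr]
  split_ifs <;> simp

theorem restr_coef (p : Var m r s → Prop) (a : K) : restr p (coef a : Loc m r s K) = coef a :=
  (SuppIn.coef a (involves_empty p)).restr_eq_self

theorem restr_gen (p : Var m r s → Prop) (v : Var m r s) (hp : p v) :
    restr p (gen v : Loc m r s K) = gen v := (SuppIn.gen_involves hp).restr_eq_self

theorem restr_gen_eq_zero (p : Var m r s → Prop) (v : Var m r s) (hp : ¬p v) :
    restr p (gen v : Loc m r s K) = 0 :=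
  SuppIn.restr_eq_zero <| SuppIn.gen (fun h h' => hp (h'.1 _ (Finset.mem_singleton_self _)))
    fun h hb h' => hp (h'.2 ⟨v, h, hb⟩ (by simp))

/-! ### Change of coefficients and substitution -/

/-- Change of the coefficient ring. -/
def locMap {K' : Type*} [CommRing K'] (φ : K →+* K') : Loc m r s K →+* Loc m r s K' where
  toFun F := fun I => MvPolynomial.map φ (F I)
  map_one' := Loc.ext' fun I => by by_cases h : I = ∅ <;> simp [Loc.one_def, coef, h]
  map_mul' F G := Loc.ext' fun I => by
    simp only [Loc.mul_apply, map_sum, map_zsmul, map_mul]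
    rfl
  map_zero' := Loc.ext' fun I => by simp [Loc.zero_apply]
  map_add' F G := Loc.ext' fun I => map_add (MvPolynomial.map φ) (F I) (G I)

section

variable {K' : Type*} [CommRing K'] (φ : K →+* K')

theorem locMap_apply (F : Loc m r s K) (I : Finset (OddVar m r s)) :
    locMap φ F I = MvPolynomial.map φ (F I) := rfl

theorem coeff_locMap (F : Loc m r s K) (I : Finset (OddVar m r s)) (n : EvenVar m r s →₀ ℕ) :
    (locMap φ F I).coeff n = φ ((F I).coeff n) := by
  rw [locMap_apply, MvPolynomial.coeff_map]

theorem locMap_coef (a : K) : locMap φ (coef a : Loc m r s K) = coef (φ a) := Loc.ext' fun I => by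
  rw [locMap_apply]
  by_cases h : I = ∅ <;> simp [coef, h]

theorem locMap_gen (v : Var m r s) : locMap φ (gen v : Loc m r s K) = gen v := by
  refine Loc.ext' fun I => ?_
  rw [locMap_apply]
  by_cases h : Var.odd v = true
  · rw [gen_odd h, gen_odd h]
    by_cases hI : I = {⟨v, h⟩} <;> simp [genOdd, hI]
  · rw [Bool.not_eq_true] at h
    by_cases hb : Var.base v = false
    · rw [gen_even h hb, gen_even h hb]
      by_cases hI : I = ∅ <;> simp [genEven, hI]
    · simp [gen, h, hb, Loc.zero_apply]

theorem locMap_inv (F : Loc m r s K) : locMap φ (inv F) = inv (locMap φ F) :=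
  Loc.ext' fun I => by simp only [locMap_apply, inv, map_zsmul]

theorem locMap_restr (p : Var m r s → Prop) (F : Loc m r s K) :
    locMap φ (restr p F) = restr p (locMap φ F) := by
  classical
  refine Loc.ext' fun I => ?_
  ext n
  rw [coeff_locMap, coeff_restr, coeff_restr, coeff_locMap]
  split_ifs <;> simp

end

/-- The odd part of the image of a monomial under a substitution. -/
def substOdd (θ : Var m r s → Loc m r s K) (I : Finset (OddVar m r s)) : Loc m r s K :=
  ((List.finRange (Fintype.card (OddVar m r s))).map fun j =>
    let v := (Fintype.equivFin (OddVar m r s)).symm j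
    if v ∈ I then θ v.1 else 1).prod

/-- The even part of the image of a monomial under a substitution. -/
def substEven (θ : Var m r s → Loc m r s K) (n : EvenVar m r s →₀ ℕ) : Loc m r s K :=
  ((Finset.univ : Finset (EvenVar m r s)).toList.flatMap fun e =>
    List.replicate (n e) (θ e.1)).prod

theorem sum_support_eq {N : Type*} [AddCommMonoid N] (p : MvPolynomial (EvenVar m r s) K)
    (t : Finset (EvenVar m r s →₀ ℕ)) (ht : p.support ⊆ t) (g : (EvenVar m r s →₀ ℕ) → K → N)
    (hg : ∀ n, g n 0 = 0) : ∑ n ∈ p.support, g n (p.coeff n) = ∑ n ∈ t, g n (p.coeff n) := by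
  refine Finset.sum_subset ht fun n _ hn => ?_
  rw [MvPolynomial.notMem_support_iff.1 hn, hg]

/-- Enlarging the index set beyond the support costs nothing and lets several functions be summed
over the same monomials. -/
theorem subst_eq (θ : Var m r s → Loc m r s K) (F : Loc m r s K)
    (t : Finset (OddVar m r s) → Finset (EvenVar m r s →₀ ℕ)) (ht : ∀ I, (F I).support ⊆ t I) :
    subst θ F = ∑ I, ∑ n ∈ t I, coef ((F I).coeff n) * substOdd θ I * substEven θ n := by
  refine Finset.sum_congr rfl fun I _ => ?_
  exact sum_support_eq (F I) (t I) (ht I) (fun n a => coef a * substOdd θ I * substEven θ n)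
    fun n => by rw [coef_zero, zero_mul, zero_mul]

theorem subst_add (θ : Var m r s → Loc m r s K) (F G : Loc m r s K) :
    subst θ (F + G) = subst θ F + subst θ G := by
  rw [subst_eq θ (F + G) (fun I => (F I).support ∪ (G I).support)
      fun I => MvPolynomial.support_add,
    subst_eq θ F (fun I => (F I).support ∪ (G I).support) fun I => Finset.subset_union_left,
    subst_eq θ G (fun I => (F I).support ∪ (G I).support) fun I => Finset.subset_union_right,
    ← Finset.sum_add_distrib]
  refine Finset.sum_congr rfl fun I _ => ?_
  rw [← Finset.sum_add_distrib]
  refine Finset.sum_congr rfl fun n _ => ?_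
  rw [Loc.add_apply, MvPolynomial.coeff_add, coef_add, add_mul, add_mul]

theorem locMap_subst {K' : Type*} [CommRing K'] (φ : K →+* K') (θ : Var m r s → Loc m r s K)
    (F : Loc m r s K) :
    locMap φ (subst θ F) = subst (fun v => locMap φ (θ v)) (locMap φ F) := by
  rw [subst_eq (fun v => locMap φ (θ v)) (locMap φ F) (fun I => (F I).support) fun I => ?_, subst,
    map_sum]
  · refine Finset.sum_congr rfl fun I _ => ?_
    rw [map_sum]
    refine Finset.sum_congr rfl fun n _ => ?_
    rw [map_mul, map_mul, locMap_coef, coeff_locMap, map_list_prod, map_list_prod, substOdd,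
      substEven, List.map_map, List.map_flatMap]
    congr 3
    · refine List.map_congr_left fun j _ => ?_
      simp only [Function.comp]
      split_ifs <;> simp
    · simp only [List.map_replicate]
  · intro n hn
    rw [MvPolynomial.mem_support_iff, coeff_locMap] at hn
    rw [MvPolynomial.mem_support_iff]
    intro h; rw [h, map_zero] at hn; exact hn rfl

theorem subst_mono (θ : Var m r s → Loc m r s K) (I : Finset (OddVar m r s))
    (n : EvenVar m r s →₀ ℕ) (a : K) :
    subst θ (mono I (MvPolynomial.monomial n a)) = coef a * substOdd θ I * substEven θ n := by
  rw [subst_eq θ _ (fun _ => {n})]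
  · rw [Finset.sum_eq_single I]
    · simp [mono]
    · intro J _ hJ
      simp [mono, hJ, coef_zero]
    · simp
  · intro J
    by_cases h : J = I
    · simp only [mono, h, if_true]
      exact MvPolynomial.support_monomial_subset
    · simp [mono, h]

theorem Loc.mono_induction {P : Loc m r s K → Prop}
    (hm : ∀ I n a, P (WeakKoszul.mono I (MvPolynomial.monomial n a)))
    (hadd : ∀ F G, P F → P G → P (F + G)) (F : Loc m r s K) : P F := by
  have h0 : P 0 := by
    have := hm ∅ 0 0
    rw [MvPolynomial.monomial_zero] at this
    convert this
    refine Loc.ext' fun I => ?_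
    by_cases h : I = ∅ <;> simp [WeakKoszul.mono, Loc.zero_apply]
  rw [sum_mono F]
  refine Finset.sum_induction _ P hadd h0 fun I _ => ?_
  induction F I using MvPolynomial.induction_on' with
  | monomial n a => exact hm I n a
  | add p q hp hq =>
    have : (WeakKoszul.mono I (p + q) : Loc m r s K) =
        WeakKoszul.mono I p + WeakKoszul.mono I q := by
      refine Loc.ext' fun J => ?_
      by_cases h : J = I <;> simp [WeakKoszul.mono, Loc.add_apply, h]
    rw [this]; exact hadd _ _ hp hq

/-- An odd function anticommutes with itself, and two is invertible. -/
theorem Par.mul_self [Algebra ℝ K] {F : Loc m r s K} (hF : Par true F) : F * F = 0 := by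
  have h := hF.mul_comm F
  rw [tw_true, hF, sg_true, neg_smul, one_smul, neg_mul] at h
  have h2 : (2 : ℝ) • (F * F) = 0 := by
    rw [two_smul]
    nth_rewrite 1 [h]
    simp
  have := congrArg (fun x => (1 / 2 : ℝ) • x) h2
  simpa [smul_smul] using this

section

variable [Algebra ℝ K] {θ : Var m r s → Loc m r s K}
  (hθ : ∀ v, Var.base v = false → Par (Var.odd v) (θ v))

include hθ

omit [Algebra ℝ K] in
-- The images of even coordinates are central, so the place of `e` in the list is immaterial.
theorem mul_substEven (e : EvenVar m r s) (n : EvenVar m r s →₀ ℕ) :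
    θ e.1 * substEven θ n = substEven θ (n + Finsupp.single e 1) := by
  classical
  have he : ∀ F, F * θ e.1 = θ e.1 * F := fun F => by
    have := hθ _ e.2.2
    rw [e.2.1] at this
    exact (this.mul_comm F).symm
  have key : ∀ l : List (EvenVar m r s), l.Nodup →
      (l.flatMap fun e' => List.replicate ((n + Finsupp.single e 1 : EvenVar m r s →₀ ℕ) e') (θ e'.1)).prod =
        (if e ∈ l then θ e.1 else 1) * (l.flatMap fun e' => List.replicate (n e') (θ e'.1)).prod := by
    intro l hl
    induction l with
    | nil => simp
    | cons a l ih =>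
      rw [List.nodup_cons] at hl
      simp only [List.flatMap_cons, List.prod_append, ih hl.2, List.prod_replicate]
      by_cases h : a = e
      · subst h
        simp [hl.1, pow_succ', mul_assoc]
      · have h' : e ≠ a := fun h' => h h'.symm
        rw [Finsupp.add_apply, Finsupp.single_eq_of_ne h, add_zero]
        simp only [List.mem_cons, h', false_or]
        split_ifs
        · rw [← mul_assoc, he, mul_assoc]
        · simp
  rw [substEven, substEven, key _ (Finset.nodup_toList _)]
  simp

omit [Algebra ℝ K] in
-- To reach its place in the ordered product, `θ v` passes the factors of `I` before `v`, and it
-- anticommutes with each.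
theorem mul_substOdd {v : OddVar m r s} {I : Finset (OddVar m r s)} (hv : v ∉ I) :
    θ v.1 * substOdd θ I = before v I • substOdd θ (insert v I) := by
  have hsw : ∀ w : OddVar m r s, θ v.1 * θ w.1 = -(θ w.1 * θ v.1) := fun w => by
    have h1 := hθ _ (base_of_odd v.2)
    have h2 := hθ _ (base_of_odd w.2)
    rw [v.2] at h1
    rw [w.2] at h2
    rw [h1.mul_comm, tw_true, h2, sg_true, neg_smul, one_smul, neg_mul]
  have key : ∀ l : List (OddVar m r s), l.Pairwise (fun a b => pos a < pos b) → v ∈ l →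
      θ v.1 * (l.map fun w => if w ∈ I then θ w.1 else 1).prod =
        (-1 : ℤ) ^ (l.filter fun w => w ∈ I ∧ pos w < pos v).length •
          (l.map fun w => if w ∈ insert v I then θ w.1 else 1).prod := by
    intro l hl hvl
    induction l with
    | nil => simp at hvl
    | cons a l ih =>
      rw [List.pairwise_cons] at hl
      by_cases h : a = v
      · subst h
        have h1 : ∀ w ∈ l, ¬ pos w < pos a := fun w hw => (hl.1 w hw).not_gt
        have h2 : (l.filter fun w => w ∈ I ∧ pos w < pos a) = [] := by
          rw [List.filter_eq_nil_iff]
          intro w hw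
          simp [h1 w hw]
        rw [List.filter_cons_of_neg (by simp), h2, List.map_cons, List.map_cons, List.prod_cons,
          List.prod_cons, if_neg hv, if_pos (Finset.mem_insert_self _ _), one_mul]
        simp only [List.length_nil, pow_zero, one_smul]
        congr 2
        refine List.map_congr_left fun w hw => ?_
        have : w ≠ a := fun e => by have := hl.1 w hw; rw [e] at this; exact lt_irrefl _ this
        simp [this]
      · have hvl' : v ∈ l := by
          rcases List.mem_cons.1 hvl with h' | h'
          · exact (h h'.symm).elim
          · exact h'
        have hlt : pos a < pos v := hl.1 v hvl'
        have ih' := ih hl.2 hvl'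
        rw [List.map_cons, List.map_cons, List.prod_cons, List.prod_cons]
        by_cases ha : a ∈ I
        · rw [List.filter_cons_of_pos (by simp [ha, hlt]), List.length_cons, if_pos ha,
            if_pos (Finset.mem_insert_of_mem ha), ← mul_assoc, hsw, neg_mul, mul_assoc, ih', pow_succ,
            mul_neg_one, neg_smul, mul_smul_comm]
        · rw [List.filter_cons_of_neg (by simp [ha]), if_neg ha,
            if_neg (by simp [ha, h]), one_mul, one_mul, ih']
  have hmap : ∀ J, substOdd θ J = (((List.finRange _).map (Fintype.equivFin (OddVar m r s)).symm).map
      fun w => if w ∈ J then θ w.1 else 1).prod := fun J => by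
    rw [List.map_map]; rfl
  rw [hmap, hmap, key]
  · congr 1
    rw [before]
    congr 1
    rw [← List.toFinset_card_of_nodup]
    · congr 1
      ext w
      simp only [List.mem_toFinset, List.mem_filter, List.mem_map, List.mem_finRange, true_and,
        decide_eq_true_eq, Finset.mem_filter, and_iff_right_iff_imp]
      exact fun _ => ⟨Fintype.equivFin _ w, by simp⟩
    · exact ((List.nodup_finRange _).map (Equiv.injective _)).filter _
  · rw [List.pairwise_map]
    simpa [pos] using List.pairwise_lt_finRange _
  · rw [List.mem_map]
    exact ⟨Fintype.equivFin _ v, by simp⟩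

/-- Multiplicativity for one generator, from which `subst_mul` follows by induction. Parity of `θ`
is essential: images must obey the same commutation rules as the coordinates. -/
theorem subst_gen_mul (v : Var m r s) (hv : Var.base v = false) (F : Loc m r s K) :
    subst θ (gen v * F) = θ v * subst θ F := by
  induction F using Loc.mono_induction with
  | hadd F₁ F₂ h₁ h₂ => rw [mul_add, subst_add, subst_add, h₁, h₂, mul_add]
  | hm I n a =>
    rw [subst_mono]
    rcases h : Var.odd v with _ | _
    · have : (gen v * mono I (MvPolynomial.monomial n a) : Loc m r s K) =
          mono I (MvPolynomial.monomial (n + Finsupp.single ⟨v, h, hv⟩ 1) a) := by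
        rw [gen_even h hv]
        refine Loc.ext' fun J => ?_
        rw [genEven_mul_apply]
        by_cases hJ : J = I
        · simp [mono, hJ, MvPolynomial.X, MvPolynomial.monomial_mul, add_comm]
        · simp [mono, hJ]
      have hpar := hθ v hv
      rw [h] at hpar
      rw [this, subst_mono, ← mul_substEven hθ, ← mul_assoc, ← mul_assoc, ← mul_assoc,
        mul_assoc (θ v), hpar.mul_comm, tw_false]
    · rw [gen_odd h]
      have hθv := hθ v hv
      -- A repeated odd coordinate gives zero on the left; on the right it produces the square of
      -- the odd element `θ v`.
      by_cases hI : (⟨v, h⟩ : OddVar m r s) ∈ I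
      · have : (genOdd ⟨v, h⟩ * mono I (MvPolynomial.monomial n a) : Loc m r s K) = 0 := by
          refine Loc.ext' fun J => ?_
          rw [genOdd_mul_apply', Loc.zero_apply]
          split_ifs with hJ
          · have : J.erase ⟨v, h⟩ ≠ I := by rintro rfl; simp at hI
            simp [mono, this]
          · rfl
        obtain ⟨J, hJ, rfl⟩ : ∃ J, (⟨v, h⟩ : OddVar m r s) ∉ J ∧ I = insert ⟨v, h⟩ J :=
          ⟨I.erase _, by simp, (Finset.insert_erase hI).symm⟩
        have h1 := mul_substOdd hθ hJ
        have h2 : substOdd θ (insert ⟨v, h⟩ J) = before ⟨v, h⟩ J • (θ v * substOdd θ J) := by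
          rw [h1, smul_smul, before_mul_self, one_smul]
        rw [h] at hθv
        rw [this, h2, mul_smul_comm, smul_mul_assoc, mul_smul_comm, ← mul_assoc, ← mul_assoc,
          ← mul_assoc, ← coef_mul_comm, mul_assoc (coef a), hθv.mul_self, mul_zero, zero_mul,
          zero_mul, smul_zero]
        exact map_zero (AddMonoidHom.mk' (subst θ) (subst_add θ))
      · have h1 : (genOdd ⟨v, h⟩ * mono I (MvPolynomial.monomial n a) : Loc m r s K) =
            mono (insert ⟨v, h⟩ I) (MvPolynomial.monomial n (before ⟨v, h⟩ I • a)) := by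
          rw [mono_insert hI]
          change _ = genOdd _ * mono I (before ⟨v, h⟩ I • _)
          rw [map_zsmul, smul_smul, before_mul_self, one_smul]
        have h2 : (coef (before ⟨v, h⟩ I • a) : Loc m r s K) = before ⟨v, h⟩ I • coef a :=
          map_zsmul coefHom _ a
        rw [h1, subst_mono, h2, ← mul_assoc, ← mul_assoc, ← coef_mul_comm, mul_assoc (coef a),
          mul_substOdd hθ hI, smul_mul_assoc, mul_smul_comm]

omit [Algebra ℝ K] hθ in
theorem subst_coef_mul (a : K) (F : Loc m r s K) : subst θ (coef a * F) = coef a * subst θ F := by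
  induction F using Loc.mono_induction with
  | hadd F₁ F₂ h₁ h₂ => rw [mul_add, subst_add, subst_add, h₁, h₂, mul_add]
  | hm I n b =>
    have : (coef a * mono I (MvPolynomial.monomial n b) : Loc m r s K) =
        mono I (MvPolynomial.monomial n (a * b)) := by
      refine Loc.ext' fun J => ?_
      rw [coef_mul_apply]
      by_cases hJ : J = I <;> simp [mono, hJ, MvPolynomial.C_mul_monomial]
    rw [this, subst_mono, subst_mono, coef_mul, mul_assoc, mul_assoc, mul_assoc]

omit [Algebra ℝ K] hθ in
theorem subst_coef (a : K) : subst θ (coef a) = coef a := by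
  have h1 : (coef a : Loc m r s K) = mono ∅ (MvPolynomial.monomial 0 a) := rfl
  have h2 : substOdd θ ∅ = 1 := by
    rw [substOdd]; exact List.prod_eq_one (by simp)
  have h3 : substEven θ 0 = 1 := by
    rw [substEven]; exact List.prod_eq_one (by simp)
  conv_lhs => rw [h1]
  rw [subst_mono, h2, h3, mul_one, mul_one]

theorem subst_gen (v : Var m r s) (hv : Var.base v = false) : subst θ (gen v) = θ v := by
  have := subst_gen_mul hθ v hv 1
  rwa [mul_one, ← coef_one, subst_coef, coef_one, mul_one] at this

theorem subst_mul (F G : Loc m r s K) : subst θ (F * G) = subst θ F * subst θ G :=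
  map_mul_of_gen (AddMonoidHom.mk' (subst θ) (subst_add θ))
    (fun a F => by
      change subst θ (coef a * F) = subst θ (coef a) * subst θ F
      rw [subst_coef_mul, subst_coef])
    (fun v hv F => by
      change subst θ (gen v * F) = subst θ (gen v) * subst θ F
      rw [subst_gen_mul hθ v hv, subst_gen hθ v hv]) F G

omit hθ in
/-- Substitution as a ring homomorphism. -/
def substHom (θ : Var m r s → Loc m r s K)
    (hθ : ∀ v, Var.base v = false → Par (Var.odd v) (θ v)) : Loc m r s K →+* Loc m r s K where
  toFun := subst θ
  map_one' := subst_coef 1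
  map_mul' := subst_mul hθ
  map_zero' := map_zero (AddMonoidHom.mk' (subst θ) (subst_add θ))
  map_add' := subst_add θ

theorem inv_subst (F : Loc m r s K) : inv (subst θ F) = subst θ (inv F) := by
  have : (invHom.comp (substHom θ hθ)) = (substHom θ hθ).comp invHom := by
    refine hom_ext (fun a => ?_) fun v hv => ?_
    · change inv (subst θ (coef a)) = subst θ (inv (coef a))
      rw [subst_coef, inv_coef, subst_coef]
    · change inv (subst θ (gen v)) = subst θ (inv (gen v))
      rw [subst_gen hθ v hv, inv_gen, hθ v hv, ← subst_gen hθ v hv]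
      exact (map_zsmul (substHom θ hθ) _ _).symm
  exact RingHom.congr_fun this F

/-- Restriction commutes with a substitution that preserves the submanifold. -/
theorem restr_subst (p : Var m r s → Prop)
    (h1 : ∀ v, Var.base v = false → p v → restr p (θ v) = θ v)
    (h2 : ∀ v, Var.base v = false → ¬p v → restr p (θ v) = 0) (F : Loc m r s K) :
    restr p (subst θ F) = subst θ (restr p F) := by
  have : (restrHom p).comp (substHom θ hθ) = (substHom θ hθ).comp (restrHom p) := by
    refine hom_ext (fun a => ?_) fun v hv => ?_
    · change restr p (subst θ (coef a)) = subst θ (restr p (coef a))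
      rw [subst_coef, restr_coef, subst_coef]
    · change restr p (subst θ (gen v)) = subst θ (restr p (gen v))
      by_cases hp : p v
      · rw [restr_gen p v hp, subst_gen hθ v hv, h1 v hv hp]
      · rw [restr_gen_eq_zero p v hp, subst_gen hθ v hv, h2 v hv hp]
        exact (map_zero (substHom θ hθ)).symm
  exact RingHom.congr_fun this F

end

end

end WeakKoszul


open scoped Manifold

namespace WeakKoszul

noncomputable section

set_option linter.unusedSectionVars false

variable {m r s : ℕ} {K : Type*} [CommRing K] [Algebra ℝ K]

/-! ### The local calculus of derived brackets -/

/-- The number of differentials `dφ`, `dφ*`. -/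
def dDeg : Var m r s → ℤ
  | (.vel, _) => 1
  | (.mvel, _) => 1
  | _ => 0

/-- Ghost number plus the number of differentials. -/
def totDeg (v : Var m r s) : ℤ := ghost v + dDeg v

/-- The number of factors `η`, `c`, `dη`, `dc`. -/
def trDeg : Var m r s → ℤ
  | (.fld, .inr _) => 1
  | (.vel, .inr _) => 1
  | _ => 0

/-- For momentum degree, number of differentials and total degree alike, a conjugate pair has weight
one, so by `SuppIn.evenBr_wt` the even bracket lowers each of these degrees by one. -/
theorem momDeg_conj (v : Var m r s) : momDeg v + momDeg (conj v) = 1 := by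
  rcases v with ⟨_ | _ | _ | _, A⟩ <;> rfl

theorem dDeg_conj (v : Var m r s) : dDeg v + dDeg (conj v) = 1 := by
  rcases v with ⟨_ | _ | _ | _, A⟩ <;> rfl

theorem totDeg_conj (v : Var m r s) : totDeg v + totDeg (conj v) = 1 := by
  rcases v with ⟨_ | _ | _ | _, A⟩ <;> simp [conj, totDeg, ghost, dDeg]

theorem momDeg_nonneg (v : Var m r s) : 0 ≤ momDeg v := by
  rcases v with ⟨_ | _ | _ | _, A⟩ <;> simp [momDeg]

theorem trDeg_nonneg (v : Var m r s) : 0 ≤ trDeg v := by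
  rcases v with ⟨_ | _ | _ | _, _ | _⟩ <;> simp [trDeg]

theorem momDeg_eq_zero_iff (v : Var m r s) : momDeg v = 0 ↔ OnL v := by
  rcases v with ⟨_ | _ | _ | _, A⟩ <;> simp [momDeg, OnL]

theorem totDeg_base (i : Fin m) : totDeg ((.fld, .inl i) : Var m r s) = 0 := rfl
theorem momDeg_base (i : Fin m) : momDeg ((.fld, .inl i) : Var m r s) = 0 := rfl
theorem dDeg_base (i : Fin m) : dDeg ((.fld, .inl i) : Var m r s) = 0 := rfl
theorem trDeg_base (i : Fin m) : trDeg ((.fld, .inl i) : Var m r s) = 0 := rfl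

omit [Algebra ℝ K] in
theorem SuppIn.momDeg_zero {F : Loc m r s K} (hF : SuppIn (Involves OnL) F) :
    SuppIn (fun I n => wt momDeg I n = 0) F :=
  hF.mono fun _ _ h => wt_eq_zero_of_involves (fun v hv => (momDeg_eq_zero_iff v).2 hv) h

omit [Algebra ℝ K] in
theorem SuppIn.involves_onL {F : Loc m r s K} (hF : SuppIn (fun I n => wt momDeg I n = 0) F) :
    SuppIn (Involves OnL) F :=
  hF.mono fun _ _ h => (involves_of_wt_eq_zero momDeg_nonneg h).imp
    fun v hv => (momDeg_eq_zero_iff v).1 hv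

/-! ### Lagrangian submanifolds, the differential {Δ, -} and the components of Ψ -/

section

variable (D : Fin m → K → K) [IsDer D]

omit [Algebra ℝ K] [IsDer D] in
theorem pd_onL {F : Loc m r s K} (hF : SuppIn (Involves OnL) F) (v : Var m r s) (hv : ¬OnL v) :
    pd D v F = 0 := by
  refine pd_eq_zero_of_involves D hF ?_ hv
  rcases v with ⟨_ | _ | _ | _, _ | _⟩ <;> simp_all [OnL, Var.base]

omit [Algebra ℝ K] [IsDer D] in
theorem pd_onN {F : Loc m r s K} (hF : SuppIn (Involves OnN) F) (v : Var m r s) (hv : ¬OnN v) :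
    pd D v F = 0 := by
  refine pd_eq_zero_of_involves D hF ?_ hv
  rcases v with ⟨_ | _ | _ | _, _ | _⟩ <;> simp_all [OnN, Var.base]

/-- 𝓛 is Lagrangian: of two conjugate coordinates exactly one is a coordinate of 𝓛. -/
theorem pd_onL_or {F G : Loc m r s K} (hF : SuppIn (Involves OnL) F)
    (hG : SuppIn (Involves OnL) G) (v : Var m r s) : pd D v F = 0 ∨ pd D (conj v) G = 0 := by
  by_cases h : OnL v
  · right
    refine pd_onL D hG _ ?_
    rcases v with ⟨_ | _ | _ | _, A⟩ <;> simp_all [OnL, conj]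
  · exact Or.inl (pd_onL D hF v h)

theorem evenBr_onL {F G : Loc m r s K} (hF : SuppIn (Involves OnL) F)
    (hG : SuppIn (Involves OnL) G) : evenBr D F G = 0 :=
  evenBr_eq_zero D (pd_onL_or D hF hG)

/-- 𝓝, the locus dφ = 0 = dφ*, is Lagrangian as well. -/
theorem evenBr_onN {F G : Loc m r s K} (hF : SuppIn (Involves OnN) F)
    (hG : SuppIn (Involves OnN) G) : evenBr D F G = 0 := by
  refine evenBr_eq_zero D fun v => ?_
  by_cases h : OnN v
  · right
    refine pd_onN D hG _ ?_
    rcases v with ⟨_ | _ | _ | _, A⟩ <;> simp_all [OnN, conj]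
  · exact Or.inl (pd_onN D hF v h)

theorem evenBr_gen_left (v : Var m r s) (hv : Var.base v = false) (G : Loc m r s K) :
    evenBr D (gen v) G = eps v • pd D (conj v) G := by
  rw [evenBr_eq, Finset.sum_eq_single v]
  · rw [rpd_eq, pd_gen D v v hv, if_pos rfl, ← coef_one, tw_coef, coef_one, one_mul]
  · intro u _ hu
    rw [rpd_eq, pd_gen D u v hv, if_neg hu.symm, tw_zero, zero_mul, smul_zero]
  · simp

omit [Algebra ℝ K] in
theorem par_delta : Par true (delta : Loc m r s K) := by
  refine Par.sum fun A _ => Par.zsmul ?_ _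
  have := (par_gen (K := K) (.vel, A)).mul (par_gen (K := K) (.mvel, A))
  convert this
  simp only [Var.odd]
  cases Idx.odd A <;> rfl

theorem sign_eq_sg (A : Idx m r s) : Idx.sign A = sg (Idx.odd A) := rfl

/-- Skew-symmetry moves the quadratic function Δ to the right slot, where the Leibniz rule reduces
the bracket to coordinate derivatives. -/
theorem evenBr_delta (F : Loc m r s K) :
    evenBr D delta F = ∑ A : Idx m r s, Idx.sign A •
      (gen (.vel, A) * pd D (.fld, A) F - gen (.mvel, A) * pd D (.mom, A) F) := by
  rw [delta, evenBr_sum_left]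
  refine Finset.sum_congr rfl fun A _ => ?_
  have hp : Par (!Idx.odd A ^^ Idx.odd A) (gen (.vel, A) * gen (.mvel, A) : Loc m r s K) :=
    (par_gen (K := K) (.vel, A)).mul (par_gen (K := K) (.mvel, A))
  rw [evenBr_zsmul_left]
  congr 1
  induction F using parity_induction with
  | hadd F₁ F₂ h₁ h₂ =>
    rw [evenBr_add_right, h₁, h₂, pd_add, pd_add, mul_add, mul_add]; abel
  | hpar b F hF =>
    have e : (!Idx.odd A ^^ Idx.odd A) = true := by cases Idx.odd A <;> rfl
    have h1 := gen_mul (K := K) (.vel, A) (pd D (.fld, A) F)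
    have h2 := gen_mul (K := K) (.mvel, A) (pd D (.mom, A) F)
    rw [evenBr_skew D hp, e, tw_true, hF, evenBr_zsmul_left, evenBr_mul_right D hF,
      evenBr_gen_right D _ _ rfl, evenBr_gen_right D _ _ rfl]
    simp only [conj, eps, rpd_eq]
    rw [h1, h2, (par_gen _).tw_eq, (hF.pd D _).tw_eq, (hF.pd D _).tw_eq, (hF.pd D _).tw_eq,
      (hF.pd D _).tw_eq]
    simp only [Var.odd, sign_eq_sg, smul_mul_assoc, mul_smul_comm, smul_smul]
    rw [show gen (.vel, A) * pd D (.fld, A) F = _ from h1, (hF.pd D _).tw_eq]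
    simp only [Var.odd, smul_mul_assoc, smul_add, smul_smul, sub_eq_add_neg, ← neg_smul]
    cases b <;> cases Idx.odd A <;> simp

/-- Δ depends only on dφ and dφ*, whereas {Δ, -} differentiates only by φ and φ*. -/
theorem evenBr_delta_delta : evenBr D (delta : Loc m r s K) delta = 0 := by
  have h : ∀ A : Idx m r s, ∀ k : Kind, k = .fld ∨ k = .mom → pd D (k, A) (delta : Loc m r s K) = 0 := by
    intro A k hk
    rw [delta, pd_sum]
    refine Finset.sum_eq_zero fun B _ => ?_
    rw [pd_zsmul, pd_mul, pd_gen D _ _ rfl, pd_gen D _ _ rfl]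
    rcases hk with rfl | rfl <;> simp
  rw [evenBr_delta]
  refine Finset.sum_eq_zero fun A _ => ?_
  rw [h A .fld (Or.inl rfl), h A .mom (Or.inr rfl)]
  simp

theorem eq_zero_of_add_self {F : Loc m r s K} (h : F + F = 0) : F = 0 := by
  rw [← two_smul ℝ] at h
  simpa [smul_smul] using congrArg (fun x => (1 / 2 : ℝ) • x) h

theorem eq_zero_of_eq_neg {F : Loc m r s K} (h : F = -F) : F = 0 :=
  eq_zero_of_add_self (by nth_rewrite 2 [h]; simp)

theorem Par.inv_eq_neg {F : Loc m r s K} (hF : Par true F) : WeakKoszul.inv F = -F := by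
  rw [hF, sg_true, neg_smul, one_smul]

theorem Par.inv_eq_self {F : Loc m r s K} (hF : Par false F) : WeakKoszul.inv F = F := by
  rw [hF, sg_false, one_smul]

/-- The Jacobi identity with an odd first argument. -/
theorem Par.jacobi_odd {F : Loc m r s K} (hF : Par true F) (G H : Loc m r s K) :
    WeakKoszul.evenBr D F (WeakKoszul.evenBr D G H) =
      WeakKoszul.evenBr D (WeakKoszul.evenBr D F G) H +
        WeakKoszul.evenBr D (WeakKoszul.inv G) (WeakKoszul.evenBr D F H) :=
  evenBr_jacobi D hF G H

/-- An odd function that Poisson commutes with itself defines a differential. -/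
theorem Par.evenBr_evenBr_self {F : Loc m r s K} (hF : Par true F)
    (h : WeakKoszul.evenBr D F F = 0) (G : Loc m r s K) :
    WeakKoszul.evenBr D F (WeakKoszul.evenBr D F G) = 0 := by
  have := hF.jacobi_odd D F G
  rw [h, evenBr_zero_left, zero_add, hF.inv_eq_neg, evenBr_neg_left] at this
  exact eq_zero_of_eq_neg this

theorem extD_eq {F : Loc m r s K} (hF : SuppIn (Involves OnL) F) :
    extD D F = evenBr D delta F := by
  rw [evenBr_delta, extD]
  refine Finset.sum_congr rfl fun A _ => ?_
  rw [pd_onL D hF (.mom, A) (by simp [OnL]), mul_zero, sub_zero]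

theorem rpd_delta_mvel (A : Idx m r s) :
    rpd D (.mvel, A) (delta : Loc m r s K) = Idx.sign A • gen (.vel, A) := by
  rw [delta, rpd_sum, Finset.sum_eq_single A]
  · rw [rpd_zsmul, rpd_mul, rpd_eq, rpd_eq, pd_gen D _ _ rfl, pd_gen D _ _ rfl, if_pos rfl,
      if_neg (by simp), ← coef_one, tw_coef, tw_zero, coef_one, mul_one, zero_mul, add_zero]
  · intro B _ hB
    rw [rpd_zsmul, rpd_mul, rpd_eq, rpd_eq, pd_gen D _ _ rfl, pd_gen D _ _ rfl,
      if_neg (by simp [hB]), if_neg (by simp), tw_zero, mul_zero, zero_mul, add_zero, smul_zero]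
  · simp

theorem rpd_delta_vel (A : Idx m r s) :
    rpd D (.vel, A) (delta : Loc m r s K) = Idx.sign A • gen (.mvel, A) := by
  rw [delta, rpd_sum, Finset.sum_eq_single A]
  · rw [rpd_zsmul, rpd_mul, rpd_eq, rpd_eq, pd_gen D _ _ rfl, pd_gen D _ _ rfl, if_pos rfl,
      if_neg (by simp), ← coef_one, tw_coef, tw_zero, coef_one, one_mul, mul_zero, zero_add,
      (par_gen _).tw_eq]
    simp only [Var.odd]
    cases Idx.odd A <;> simp
  · intro B _ hB
    rw [rpd_zsmul, rpd_mul, rpd_eq, rpd_eq, pd_gen D _ _ rfl, pd_gen D _ _ rfl,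
      if_neg (by simp), if_neg (by simp [hB]), tw_zero, mul_zero, zero_mul, add_zero, smul_zero]
  · simp

/-- As `F` contains no differentials, only Δ is differentiated. Together with `rpd_vel_evenBr_delta`
this matches the two brackets term by term in `oddBr_eq`. -/
theorem rpd_mvel_evenBr_delta {F : Loc m r s K} (hF : SuppIn (Involves OnN) F) (A : Idx m r s) :
    rpd D (.mvel, A) (evenBr D delta F) = -(Idx.sign A • pd D (.mom, A) (tw (Idx.odd A) F)) := by
  rw [rpd_evenBr, rpd_eq D (.mvel, A) F, pd_onN D hF (.mvel, A) (by simp [OnN]), tw_zero,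
    evenBr_zero_right, zero_add, rpd_delta_mvel, evenBr_zsmul_left, evenBr_gen_left D _ rfl]
  simp [conj, eps, Var.odd]

theorem rpd_vel_evenBr_delta {F : Loc m r s K} (hF : SuppIn (Involves OnN) F) (A : Idx m r s) :
    rpd D (.vel, A) (evenBr D delta F) = Idx.sign A • pd D (.fld, A) (tw (!Idx.odd A) F) := by
  rw [rpd_evenBr, rpd_eq D (.vel, A) F, pd_onN D hF (.vel, A) (by simp [OnN]), tw_zero,
    evenBr_zero_right, zero_add, rpd_delta_vel, evenBr_zsmul_left, evenBr_gen_left D _ rfl]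
  simp [conj, eps, Var.odd]

/-- On functions on `𝓝` the odd bracket is derived from the even one. -/
theorem oddBr_eq {F G : Loc m r s K} (hp : Par false F) (hF : SuppIn (Involves OnN) F)
    (hG : SuppIn (Involves OnN) G) : oddBr D F G = evenBr D (evenBr D delta F) G := by
  rw [oddBr, evenBr]
  refine Finset.sum_congr rfl fun A _ => ?_
  rw [rpd_mvel_evenBr_delta D hF, rpd_vel_evenBr_delta D hF,
    pd_onN D hG (.mvel, A) (by simp [OnN]), pd_onN D hG (.vel, A) (by simp [OnN]), rpd_eq, rpd_eq,
    (hp.pd D _).tw_eq, (hp.pd D _).tw_eq, hp.tw_eq, hp.tw_eq]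
  simp only [Var.odd, sign_eq_sg]
  cases Idx.odd A <;> simp

theorem isDer_zero (i : Fin m) : D i 0 = 0 := IsDer.zero D i

omit [Algebra ℝ K] in
theorem suppIn_delta (w : Var m r s → ℤ) (κ : ℤ) (h : ∀ A, w (.vel, A) + w (.mvel, A) = κ) :
    SuppIn (fun I n => wt w I n = κ) (delta : Loc m r s K) :=
  SuppIn.sum fun A _ => SuppIn.zsmul
    (((SuppIn.gen_wt w _).mul_wt (SuppIn.gen_wt w _)).mono fun _ _ e => by rw [e, h]) _

/-- A master function in a chart. -/
structure LocalMaster (S : ℕ → Loc m r s K) : Prop where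
  par : ∀ k, Par false (S k)
  onN : ∀ k, SuppIn (Involves OnN) (S k)
  ghost_eq : ∀ k, SuppIn (fun I n => wt ghost I n = 2) (S k)
  momDeg_eq : ∀ k : ℕ, SuppIn (fun I n => wt momDeg I n = (k : ℤ)) (S k)
  zero : S 0 = 0
  master : ∀ n, oddBrF D S S n = 0

/-- The component `{Δ, S^k}` of `Ψ`. -/
def psiAt (S : ℕ → Loc m r s K) (k : ℕ) : Loc m r s K := evenBr D delta (S k)

/-- Δ has momentum degree one and the bracket lowers the degree by one, so the n-th term of Ψ comes
from S^n alone. -/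
theorem psi_eq (S : ℕ → Loc m r s K) (n : ℕ) : psi D S n = psiAt D S n := by
  rw [psi, evenBrF, Finset.sum_eq_single (1, n)]
  · simp [homog, psiAt]
  · rintro ⟨a, b⟩ h1 h2
    rw [Finset.HasAntidiagonal.mem_antidiagonal] at h1
    have : a ≠ 1 := by
      rintro rfl
      apply h2
      simp at h1 ⊢
      omega
    simp [homog, this, evenBr_zero_left]
  · intro h
    simp [Finset.HasAntidiagonal.mem_antidiagonal, add_comm] at h

/-- Bracketing with a function free of momenta shifts the index by one. Evaluated at momentum degree
zero, one such bracket selects Ψ_1 (for Q̂) and two select Ψ_2 (for the binary bracket). -/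
theorem evenBrF_homog_zero (F : ℕ → Loc m r s K) (ω : Loc m r s K) (n : ℕ) :
    evenBrF D F (homog 0 ω) n = evenBr D (F (n + 1)) ω := by
  rw [evenBrF, Finset.sum_eq_single (n + 1, 0)]
  · simp [homog]
  · rintro ⟨a, b⟩ h1 h2
    rw [Finset.HasAntidiagonal.mem_antidiagonal] at h1
    have : b ≠ 0 := by
      rintro rfl
      apply h2
      simp at h1 ⊢
      omega
    simp [homog, this, evenBr_zero_right]
  · intro h
    simp [Finset.HasAntidiagonal.mem_antidiagonal] at h

theorem qHat_eq_restr (S : ℕ → Loc m r s K) (ω : Loc m r s K) :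
    qHat D S ω = restr OnL (evenBr D (psiAt D S 1) ω) := by
  rw [qHat, toL, evenBrF_homog_zero, psi_eq]

theorem koszul_eq_restr (S : ℕ → Loc m r s K) (ω τ : Loc m r s K) :
    koszul D S ω τ = restr OnL (evenBr D (evenBr D (psiAt D S 2) ω) τ) := by
  rw [koszul, toL, evenBrF_homog_zero, evenBrF_homog_zero, psi_eq]

theorem interior_eq_restr (X ω : Loc m r s K) :
    interior D X ω = restr OnL (evenBr D (inv X) ω) := by
  rw [interior, toL, evenBrF_homog_zero]
  simp [homog]

theorem suppIn_qHat (S : ℕ → Loc m r s K) (ω : Loc m r s K) :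
    SuppIn (Involves OnL) (qHat D S ω) := by
  rw [qHat_eq_restr]; exact suppIn_restr _ _

theorem suppIn_koszul (S : ℕ → Loc m r s K) (ω τ : Loc m r s K) :
    SuppIn (Involves OnL) (koszul D S ω τ) := by
  rw [koszul_eq_restr]; exact suppIn_restr _ _

theorem suppIn_interior (X ω : Loc m r s K) :
    SuppIn (Involves OnL) (interior D X ω) := by
  rw [interior_eq_restr]; exact suppIn_restr _ _

/-- The ternary bracket `{{{Ψ, ω}, τ}, σ}`. -/
def ternary (S : ℕ → Loc m r s K) (ω τ σ : Loc m r s K) : Loc m r s K :=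
  evenBr D (evenBr D (evenBr D (psiAt D S 3) ω) τ) σ

/-! ### Consequences of the master equation for the components of Ψ -/

section Master

variable {D} {S : ℕ → Loc m r s K} (hS : LocalMaster D S)

include hS

theorem par_psi (k : ℕ) : Par true (psiAt D S k) := par_delta.evenBr D (hS.par k)

theorem momDeg_psi (k : ℕ) : SuppIn (fun I n => wt momDeg I n = (k : ℤ)) (psiAt D S k) :=
  (suppIn_delta momDeg 1 fun _ => rfl).evenBr_wt D (isDer_zero D) momDeg_base momDeg_conj
    (hS.momDeg_eq k) (by ring)

theorem dDeg_master (k : ℕ) : SuppIn (fun I n => wt dDeg I n = 0) (S k) :=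
  (hS.onN k).mono fun _ _ h => wt_eq_zero_of_involves (fun v hv => by
    rcases v with ⟨_ | _ | _ | _, A⟩ <;> simp_all [OnN, dDeg]) h

/-- Functions on 𝓝 contain no differentials, so their total degree is the ghost number. -/
theorem totDeg_master (k : ℕ) : SuppIn (fun I n => wt totDeg I n = 2) (S k) :=
  ((hS.ghost_eq k).and (dDeg_master hS k)).mono fun I n h => by
    rw [show totDeg = fun v : Var m r s => ghost v + dDeg v from rfl, wt_add, h.1, h.2, add_zero]

theorem totDeg_psi (k : ℕ) : SuppIn (fun I n => wt totDeg I n = 2) (psiAt D S k) :=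
  (suppIn_delta totDeg 1 fun A => by simp [totDeg, ghost, dDeg]).evenBr_wt D (isDer_zero D)
    totDeg_base totDeg_conj (totDeg_master hS k) (by ring)

theorem dDeg_psi (k : ℕ) : SuppIn (fun I n => wt dDeg I n = 1) (psiAt D S k) :=
  (suppIn_delta dDeg 2 fun _ => rfl).evenBr_wt D (isDer_zero D)
    dDeg_base dDeg_conj (dDeg_master hS k) (by ring)

omit hS in
theorem evenBr_delta_psi (k : ℕ) : evenBr D delta (psiAt D S k) = 0 :=
  par_delta.evenBr_evenBr_self D (evenBr_delta_delta D) _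

/-- Apply {Δ, -} to {Ψ_k, S^l} = (S^k, S^l) and use {Δ, Ψ_k} = 0; the sign comes from moving the odd
Δ past the odd Ψ_k. -/
theorem evenBr_psi_psi (k l : ℕ) :
    evenBr D (psiAt D S k) (psiAt D S l) = -evenBr D delta (oddBr D (S k) (S l)) := by
  rw [oddBr_eq D (hS.par k) (hS.onN k) (hS.onN l)]
  have := par_delta.jacobi_odd D (psiAt D S k) (S l)
  rw [evenBr_delta_psi, evenBr_zero_left, zero_add, (par_psi hS k).inv_eq_neg,
    evenBr_neg_left] at this
  change evenBr D delta (evenBr D (psiAt D S k) (S l)) =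
    -evenBr D (psiAt D S k) (psiAt D S l) at this
  change _ = -evenBr D delta (evenBr D (psiAt D S k) (S l))
  rw [this, neg_neg]

theorem sum_evenBr_psi (n : ℕ) :
    ∑ q ∈ Finset.HasAntidiagonal.antidiagonal (n + 1),
      evenBr D (psiAt D S q.1) (psiAt D S q.2) = 0 := by
  have := congrArg (evenBr D delta) (hS.master n)
  rw [oddBrF, evenBr_sum_right, evenBr_zero_right] at this
  simp only [evenBr_psi_psi hS, Finset.sum_neg_distrib, this, neg_zero]

theorem psi_zero : psiAt D S 0 = 0 := by rw [psiAt, hS.zero, evenBr_zero_right]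

theorem evenBr_psi_comm (k l : ℕ) :
    evenBr D (psiAt D S k) (psiAt D S l) = evenBr D (psiAt D S l) (psiAt D S k) := by
  rw [evenBr_skew D (par_psi hS k), tw_true, (par_psi hS l).inv_eq_neg, evenBr_neg_left, neg_neg]

theorem psi_one_one : evenBr D (psiAt D S 1) (psiAt D S 1) = 0 := by
  have := sum_evenBr_psi hS 1
  simpa [Finset.Nat.antidiagonal_succ, psi_zero hS, evenBr_zero_left, evenBr_zero_right] using this

theorem psi_one_two : evenBr D (psiAt D S 1) (psiAt D S 2) = 0 := by
  have := sum_evenBr_psi hS 2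
  simp [Finset.Nat.antidiagonal_succ, psi_zero hS, evenBr_zero_left, evenBr_zero_right] at this
  rw [evenBr_psi_comm hS 2 1] at this
  exact eq_zero_of_add_self this

/-- The relation that makes the failure of the Jacobi identity exact: {Ψ_2, Ψ_2} is a bracket with
Ψ_1. -/
theorem psi_one_three : evenBr D (psiAt D S 1) (psiAt D S 3) + evenBr D (psiAt D S 1) (psiAt D S 3)
    + evenBr D (psiAt D S 2) (psiAt D S 2) = 0 := by
  have := sum_evenBr_psi hS 3
  simp [Finset.Nat.antidiagonal_succ, psi_zero hS, evenBr_zero_left, evenBr_zero_right] at this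
  rw [evenBr_psi_comm hS 3 1] at this
  rw [← this]; abel

end Master

end

end

end WeakKoszul


open scoped Manifold

namespace WeakKoszul

noncomputable section

set_option linter.unusedSectionVars false

variable {m r s : ℕ} {K : Type*} [CommRing K] [Algebra ℝ K]

/-! ### The differential, the derived binary bracket and its Jacobi identity in a chart -/

section Cocycles

variable {D : Fin m → K → K} [IsDer D] {S : ℕ → Loc m r s K} (hS : LocalMaster D S)
  {ω τ σ X Y : Loc m r s K}

theorem koszul_add (ω τ σ : Loc m r s K) :
    koszul D S ω (τ + σ) = koszul D S ω τ + koszul D S ω σ := by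
  simp only [koszul_eq_restr, evenBr_add_right, restr_add]

theorem koszul_smul (a : ℝ) (ω τ : Loc m r s K) :
    koszul D S ω (a • τ) = a • koszul D S ω τ := by
  simp only [koszul_eq_restr, evenBr_smul_right, restr_smul]

theorem koszul_zero_right (ω : Loc m r s K) : koszul D S ω 0 = 0 := by
  rw [koszul_eq_restr, evenBr_zero_right, restr_zero]

theorem koszul_zero_left (ω : Loc m r s K) : koszul D S 0 ω = 0 := by
  rw [koszul_eq_restr, evenBr_zero_right, evenBr_zero_left, restr_zero]

theorem qHat_add (ω τ : Loc m r s K) : qHat D S (ω + τ) = qHat D S ω + qHat D S τ := by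
  simp only [qHat_eq_restr, evenBr_add_right, restr_add]

theorem qHat_smul (a : ℝ) (ω : Loc m r s K) : qHat D S (a • ω) = a • qHat D S ω := by
  simp only [qHat_eq_restr, evenBr_smul_right, restr_smul]

theorem qHat_neg (ω : Loc m r s K) : qHat D S (-ω) = -qHat D S ω := by
  simp only [qHat_eq_restr, evenBr_neg_right, restr_neg]

theorem suppIn_one (p : Var m r s → Prop) : SuppIn (Involves p) (1 : Loc m r s K) :=
  SuppIn.coef 1 (involves_empty p)

include hS

/-- {Ψ_1, ω} already has momentum degree zero, so the restriction to 𝓛 can be dropped. The same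
count applies to the binary bracket. -/
theorem qHat_eq (hω : SuppIn (Involves OnL) ω) : qHat D S ω = evenBr D (psiAt D S 1) ω := by
  rw [qHat_eq_restr]
  exact ((momDeg_psi hS 1).evenBr_wt D (isDer_zero D) momDeg_base momDeg_conj hω.momDeg_zero
    (by norm_num)).involves_onL.restr_eq_self

theorem koszul_eq (hω : SuppIn (Involves OnL) ω) (hτ : SuppIn (Involves OnL) τ) :
    koszul D S ω τ = evenBr D (evenBr D (psiAt D S 2) ω) τ := by
  rw [koszul_eq_restr]
  have h1 := (momDeg_psi hS 2).evenBr_wt D (isDer_zero D) momDeg_base momDeg_conj hω.momDeg_zero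
    (f := 1) (by norm_num)
  exact (h1.evenBr_wt D (isDer_zero D) momDeg_base momDeg_conj hτ.momDeg_zero
    (by norm_num)).involves_onL.restr_eq_self

theorem suppIn_ternary (hω : SuppIn (Involves OnL) ω) (hτ : SuppIn (Involves OnL) τ)
    (hσ : SuppIn (Involves OnL) σ) : SuppIn (Involves OnL) (ternary D S ω τ σ) := by
  have h1 := (momDeg_psi hS 3).evenBr_wt D (isDer_zero D) momDeg_base momDeg_conj hω.momDeg_zero
    (f := 2) (by norm_num)
  have h2 := h1.evenBr_wt D (isDer_zero D) momDeg_base momDeg_conj hτ.momDeg_zero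
    (f := 1) (by norm_num)
  exact (h2.evenBr_wt D (isDer_zero D) momDeg_base momDeg_conj hσ.momDeg_zero
    (by norm_num)).involves_onL

theorem totDeg_qHat (hω : SuppIn (Involves OnL) ω) {d : ℤ}
    (h : SuppIn (fun I n => wt totDeg I n = d) ω) :
    SuppIn (fun I n => wt totDeg I n = d + 1) (qHat D S ω) := by
  rw [qHat_eq hS hω]
  exact (totDeg_psi hS 1).evenBr_wt D (isDer_zero D) totDeg_base totDeg_conj h (by ring)

theorem totDeg_koszul (hω : SuppIn (Involves OnL) ω) (hτ : SuppIn (Involves OnL) τ) {d e : ℤ}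
    (h : SuppIn (fun I n => wt totDeg I n = d) ω) (h' : SuppIn (fun I n => wt totDeg I n = e) τ) :
    SuppIn (fun I n => wt totDeg I n = d + e) (koszul D S ω τ) := by
  rw [koszul_eq hS hω hτ]
  exact ((totDeg_psi hS 2).evenBr_wt D (isDer_zero D) totDeg_base totDeg_conj h rfl).evenBr_wt D
    (isDer_zero D) totDeg_base totDeg_conj h' (by ring)

/-- Ψ_3 has total degree two and each of the three brackets takes one away. The result -1 is the
degree that `trivialM` requires of λ. -/
theorem totDeg_ternary (h : SuppIn (fun I n => wt totDeg I n = 0) ω)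
    (h' : SuppIn (fun I n => wt totDeg I n = 0) τ)
    (h'' : SuppIn (fun I n => wt totDeg I n = 0) σ) :
    SuppIn (fun I n => wt totDeg I n = -1) (ternary D S ω τ σ) :=
  (((totDeg_psi hS 3).evenBr_wt D (isDer_zero D) totDeg_base totDeg_conj h rfl).evenBr_wt D
    (isDer_zero D) totDeg_base totDeg_conj h' rfl).evenBr_wt D
    (isDer_zero D) totDeg_base totDeg_conj h'' (by ring)

theorem inv_qHat (ω : Loc m r s K) : inv (qHat D S ω) = -qHat D S (inv ω) := by
  rw [qHat_eq_restr, qHat_eq_restr, inv_restr, inv_evenBr, (par_psi hS 1).inv_eq_neg,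
    evenBr_neg_left, restr_neg]

theorem par_koszul {e f : Bool} (hω : Par e ω) (hτ : Par f τ) :
    Par (e ^^ f ^^ true) (koszul D S ω τ) := by
  have := ((par_psi hS 2).evenBr D hω).evenBr D hτ
  rw [Par, koszul_eq_restr, inv_restr, this]
  rw [show (true ^^ e ^^ f) = (e ^^ f ^^ true) by cases e <;> cases f <;> rfl]
  exact map_zsmul (restrHom OnL) _ _

theorem qHat_one : qHat D S 1 = 0 := by
  rw [qHat_eq hS (suppIn_one _), ← coef_one, evenBr_coef_right]
  exact Finset.sum_eq_zero fun i _ => by rw [IsDer.one D i, coef_zero, mul_zero]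

theorem qHat_qHat (hω : SuppIn (Involves OnL) ω) : qHat D S (qHat D S ω) = 0 := by
  rw [qHat_eq hS (suppIn_qHat D S ω), qHat_eq hS hω]
  exact (par_psi hS 1).evenBr_evenBr_self D (psi_one_one hS) ω

theorem qHat_mul (hω : SuppIn (Involves OnL) ω) (hτ : SuppIn (Involves OnL) τ) :
    qHat D S (ω * τ) = qHat D S ω * τ + inv ω * qHat D S τ := by
  rw [qHat_eq hS (hω.mul_involves hτ), qHat_eq hS hω, qHat_eq hS hτ,
    evenBr_mul_right D (par_psi hS 1), tw_true]

/-- Since {Ψ_1, Ψ_2} = 0, the Jacobi identity lets {Ψ_1, -} act on the two arguments only; the signs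
come from passing the odd Ψ_2. -/
theorem qHat_koszul (hω : SuppIn (Involves OnL) ω) (hτ : SuppIn (Involves OnL) τ) :
    qHat D S (koszul D S ω τ) = -koszul D S (qHat D S ω) τ - koszul D S (inv ω) (qHat D S τ) := by
  rw [qHat_eq hS (suppIn_koszul D S ω τ), koszul_eq hS hω hτ,
    koszul_eq hS (suppIn_qHat D S ω) hτ, koszul_eq hS hω.inv (suppIn_qHat D S τ), qHat_eq hS hω,
    qHat_eq hS hτ, (par_psi hS 1).jacobi_odd D, (par_psi hS 1).jacobi_odd D, psi_one_two hS,
    evenBr_zero_left, zero_add, (par_psi hS 2).inv_eq_neg, evenBr_neg_left, evenBr_neg_left,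
    inv_evenBr, (par_psi hS 2).inv_eq_neg, evenBr_neg_left, evenBr_neg_left, sub_eq_add_neg]

/-- Functions on 𝓛 commute, so the Jacobi identity for {Ψ_2, {τ, ω}} = 0 relates {{Ψ_2, τ}, ω} to
{τ, {Ψ_2, ω}}, and skew-symmetry turns the latter into [ω, τ]. -/
theorem koszul_symm {e f : Bool} (hω : SuppIn (Involves OnL) ω) (hτ : SuppIn (Involves OnL) τ)
    (he : Par e ω) (hf : Par f τ) : koszul D S ω τ = sg (e && f) • koszul D S τ ω := by
  rw [koszul_eq hS hω hτ, koszul_eq hS hτ hω]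
  have h1 := (par_psi hS 2).evenBr D he
  have h2 := evenBr_skew D h1 τ
  have h3 := (par_psi hS 2).jacobi_odd D τ ω
  rw [evenBr_onL D hτ hω, evenBr_zero_right] at h3
  rw [h2, hf.tw_eq, evenBr_zsmul_left]
  rw [hf, evenBr_zsmul_left] at h3
  have h4 := eq_neg_of_add_eq_zero_left h3.symm
  rw [h4]
  cases e <;> cases f <;> simp

theorem koszul_mul {e : Bool} (hω : SuppIn (Involves OnL) ω) (hτ : SuppIn (Involves OnL) τ)
    (hσ : SuppIn (Involves OnL) σ) (he : Par e ω) :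
    koszul D S ω (τ * σ) = koszul D S ω τ * σ + tw (!e) τ * koszul D S ω σ := by
  rw [koszul_eq hS hω (hτ.mul_involves hσ), koszul_eq hS hω hτ, koszul_eq hS hω hσ,
    evenBr_mul_right D ((par_psi hS 2).evenBr D he), Bool.true_xor]

/-- With a = {Ψ_2, ω} and b = {Ψ_2, τ}, the last two terms are, up to sign, {b, {a, σ}} and {a, {b,
σ}}, which by the Jacobi identity of the even bracket combine to {{a, b}, σ}. The first term is
{{Ψ_2, {a, τ}}, σ}; it differs from {{a, b}, σ} by a contribution of {Ψ_2, a} = ½{{Ψ_2, Ψ_2}, ω} =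
-{{Ψ_1, Ψ_3}, ω}, up to the sign of exchanging odd factors. As {Ψ_1, -} kills the cocycles, this
contribution is Q̂ of the ternary bracket. -/
theorem koszul_jacobi {e f g : Bool} (hω : SuppIn (Involves OnL) ω)
    (hτ : SuppIn (Involves OnL) τ) (hσ : SuppIn (Involves OnL) σ) (he : Par e ω) (hf : Par f τ)
    (hg : Par g σ) (hω' : qHat D S ω = 0) (hτ' : qHat D S τ = 0) (hσ' : qHat D S σ = 0) :
    koszul D S (koszul D S ω τ) σ + sg (f && g) • koszul D S (koszul D S ω σ) τ +
      sg (e && (f ^^ g)) • koszul D S (koszul D S τ σ) ω =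
    qHat D S (-ternary D S ω τ σ) := by
  have p1 := par_psi hS 1
  have p2 := par_psi hS 2
  -- Symmetry puts the nested bracket on the right, so that both terms become double brackets of a
  -- and b with σ.
  have s1 : koszul D S (koszul D S ω σ) τ = sg ((e ^^ g ^^ true) && f) •
      koszul D S τ (koszul D S ω σ) :=
    koszul_symm hS (suppIn_koszul D S _ _) hτ (par_koszul hS he hg) hf
  have s2 : koszul D S (koszul D S τ σ) ω = sg ((f ^^ g ^^ true) && e) •
      koszul D S ω (koszul D S τ σ) :=
    koszul_symm hS (suppIn_koszul D S _ _) hω (par_koszul hS hf hg) he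
  rw [s1, s2, qHat_neg, qHat_eq hS (suppIn_ternary hS hω hτ hσ),
    koszul_eq hS (suppIn_koszul D S ω τ) hσ, koszul_eq hS hτ (suppIn_koszul D S ω σ),
    koszul_eq hS hω (suppIn_koszul D S τ σ), koszul_eq hS hω hτ, koszul_eq hS hτ hσ,
    koszul_eq hS hω hσ]
  rw [qHat_eq hS hω] at hω'
  rw [qHat_eq hS hτ] at hτ'
  rw [qHat_eq hS hσ] at hσ'
  set a := evenBr D (psiAt D S 2) ω with ha
  set b := evenBr D (psiAt D S 2) τ with hb
  have pa : Par (true ^^ e) a := p2.evenBr D he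
  have pb : Par (true ^^ f) b := p2.evenBr D hf
  -- {Ψ₁, {Ψ₃, ω}} + {Ψ₂, a} = 0
  have h1 : evenBr D (psiAt D S 1) (evenBr D (psiAt D S 3) ω) + evenBr D (psiAt D S 2) a = 0 := by
    have e1 := p1.jacobi_odd D (psiAt D S 3) ω
    rw [hω', evenBr_zero_right, add_zero] at e1
    have e2 := p2.jacobi_odd D (psiAt D S 2) ω
    rw [p2.inv_eq_neg, evenBr_neg_left, ← ha] at e2
    have e3 := congrArg (fun x => evenBr D x ω) (psi_one_three hS)
    simp only [evenBr_add_left, evenBr_zero_left, ← e1] at e3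
    -- The relation between Ψ_1, Ψ_2 and Ψ_3 carries a factor two, so twice the claim is what can be
    -- read off.
    apply eq_zero_of_add_self
    rw [← sub_eq_add_neg, eq_sub_iff_add_eq] at e2
    rw [← e3, ← e2]
    abel
  -- {Ψ₁, {{Ψ₃, ω}, τ}} + {Ψ₂, {a, τ}} = {inv a, b}
  have h2 : evenBr D (psiAt D S 1) (evenBr D (evenBr D (psiAt D S 3) ω) τ) +
      evenBr D (psiAt D S 2) (evenBr D a τ) = evenBr D (inv a) b := by
    rw [p1.jacobi_odd D, hτ', evenBr_zero_right, add_zero, p2.jacobi_odd D, ← add_assoc,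
      ← evenBr_add_left, h1, evenBr_zero_left, zero_add]
  have h3 : evenBr D (psiAt D S 1) (ternary D S ω τ σ) +
      evenBr D (evenBr D (psiAt D S 2) (evenBr D a τ)) σ = evenBr D (evenBr D (inv a) b) σ := by
    rw [ternary, p1.jacobi_odd D, hσ', evenBr_zero_right, add_zero, ← evenBr_add_left, h2]
  -- The Jacobi identity for a and b splits the right-hand side into the two double brackets; only a
  -- comparison of signs for the eight parities remains.
  rw [pa, evenBr_zsmul_left, evenBr_zsmul_left, evenBr_jacobi_homogeneous D pa pb] at h3
  rw [← sub_eq_zero, sub_neg_eq_add, add_comm, ← add_assoc, ← add_assoc, h3]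
  cases e <;> cases f <;> cases g <;> simp <;> abel

/-- On functions on 𝓛 the exterior differential is {Δ, -}, and Ψ_1 = {Δ, S^1} commutes with Δ. -/
theorem qHat_extD (hω : SuppIn (Involves OnL) ω) (h : qHat D S ω = 0) :
    qHat D S (extD D ω) = 0 := by
  have hd : SuppIn (Involves OnL) (extD D ω) := by
    rw [extD]
    exact SuppIn.sum fun A _ => SuppIn.zsmul
      ((SuppIn.gen_involves (by simp [OnL])).mul_involves
        (hω.pd_involves D (isDer_zero D) _)) _
  rw [qHat_eq hS hω] at h
  rw [qHat_eq hS hd, extD_eq D hω, (par_psi hS 1).jacobi_odd D, h, evenBr_zero_right, add_zero,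
    evenBr_skew D (par_psi hS 1), tw_true, par_delta.inv_eq_neg]
  simp only [evenBr_neg_left, evenBr_delta_psi, evenBr_zero_left, neg_zero]

end Cocycles

/-! ### The interior product in a chart -/

section Interior

variable {D : Fin m → K → K} [IsDer D] {S : ℕ → Loc m r s K} (hS : LocalMaster D S)
  {ω τ σ X Y : Loc m r s K}

theorem interior_eq (hX : SuppIn (fun I n => wt momDeg I n = 1) X)
    (hω : SuppIn (Involves OnL) ω) : interior D X ω = evenBr D (inv X) ω := by
  rw [interior_eq_restr]
  exact (hX.inv.evenBr_wt D (isDer_zero D) momDeg_base momDeg_conj hω.momDeg_zero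
    (by norm_num)).involves_onL.restr_eq_self

theorem interior_add_left (X Y ω : Loc m r s K) :
    interior D (X + Y) ω = interior D X ω + interior D Y ω := by
  simp only [interior_eq_restr, inv_add, evenBr_add_left, restr_add]

theorem interior_add_right (X ω τ : Loc m r s K) :
    interior D X (ω + τ) = interior D X ω + interior D X τ := by
  simp only [interior_eq_restr, evenBr_add_right, restr_add]

theorem interior_sub_left (X Y ω : Loc m r s K) :
    interior D (X - Y) ω = interior D X ω - interior D Y ω := by
  simp only [interior_eq_restr, inv_sub, evenBr_sub_left, restr_sub]

theorem interior_sub_right (X ω τ : Loc m r s K) :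
    interior D X (ω - τ) = interior D X ω - interior D X τ := by
  simp only [interior_eq_restr, evenBr_sub_right, restr_sub]

theorem interior_smul_left (a : ℝ) (X ω : Loc m r s K) :
    interior D (a • X) ω = a • interior D X ω := by
  simp only [interior_eq_restr, inv_smul, evenBr_smul_left, restr_smul]

theorem interior_smul_right (a : ℝ) (X ω : Loc m r s K) :
    interior D X (a • ω) = a • interior D X ω := by
  simp only [interior_eq_restr, evenBr_smul_right, restr_smul]

/-- `f` and `ω` both live on 𝓛, so `f` passes out of the bracket; the sign (-1)^X in the definition
of the interior product leaves the parity involution on `f`. -/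
theorem interior_mul_left {f : Loc m r s K} (hf : SuppIn (Involves OnL) f)
    (hω : SuppIn (Involves OnL) ω) : interior D (f * X) ω = inv f * interior D X ω := by
  rw [interior_eq_restr, interior_eq_restr, inv_mul, evenBr_mul_left D (pd_onL_or D hf.inv hω),
    restr_mul, hf.inv.restr_eq_self]

/-- Functions on 𝓝 commute for the even bracket, so the Jacobi identity makes the two operators
supercommute. -/
theorem interior_comm {e f : Bool} (hX : SuppIn (fun I n => wt momDeg I n = 1) X)
    (hY : SuppIn (fun I n => wt momDeg I n = 1) Y) (hX' : SuppIn (Involves OnN) X)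
    (hY' : SuppIn (Involves OnN) Y) (hω : SuppIn (Involves OnL) ω) (he : Par e X) (hf : Par f Y) :
    interior D X (interior D Y ω) = sg (e && f) • interior D Y (interior D X ω) := by
  rw [interior_eq hX (suppIn_interior D Y ω), interior_eq hY (suppIn_interior D X ω),
    interior_eq hX hω, interior_eq hY hω]
  rw [evenBr_jacobi D he.inv, evenBr_onN D hX'.inv hY'.inv, evenBr_zero_left, zero_add,
    hf.inv.tw_eq, evenBr_zsmul_left, Bool.and_comm]

/-- A vector field of ghost number one has total degree one, which the bracket takes away again. -/
theorem totDeg_interior (hX : SuppIn (fun I n => wt momDeg I n = 1) X)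
    (hX' : SuppIn (Involves OnN) X) (hX'' : SuppIn (fun I n => wt ghost I n = 1) X)
    (hω : SuppIn (Involves OnL) ω) {d : ℤ} (h : SuppIn (fun I n => wt totDeg I n = d) ω) :
    SuppIn (fun I n => wt totDeg I n = d) (interior D X ω) := by
  rw [interior_eq hX hω]
  have h1 : SuppIn (fun I n => wt totDeg I n = 1) X := (hX'.and hX'').mono fun I n h => by
    rw [show totDeg = fun v : Var m r s => ghost v + dDeg v from rfl, wt_add, h.2,
      wt_eq_zero_of_involves (fun v hv => ?_) h.1, add_zero]
    rcases v with ⟨_ | _ | _ | _, A⟩ <;> simp_all [OnN, dDeg]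
  exact h1.inv.evenBr_wt D (isDer_zero D) totDeg_base totDeg_conj h (by ring)

include hS

theorem oddBr_master_eq (hX : SuppIn (Involves OnN) X) :
    oddBr D (S 1) X = evenBr D (psiAt D S 1) X :=
  oddBr_eq D (hS.par 1) (hS.onN 1) hX

/-- QX = {Ψ_1, X}, so a Q-cocycle commutes with Ψ_1 and the Jacobi identity gives the claim. -/
theorem qHat_interior (hX : SuppIn (fun I n => wt momDeg I n = 1) X)
    (hX' : SuppIn (Involves OnN) X) (hQ : oddBr D (S 1) X = 0)
    (hω : SuppIn (Involves OnL) ω) (h : qHat D S ω = 0) : qHat D S (interior D X ω) = 0 := by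
  rw [oddBr_master_eq hS hX'] at hQ
  rw [qHat_eq hS hω] at h
  have h1 : evenBr D (psiAt D S 1) (inv X) = 0 := by
    have := inv_evenBr D (psiAt D S 1) X
    rw [hQ, inv_zero, (par_psi hS 1).inv_eq_neg, evenBr_neg_left] at this
    exact neg_eq_zero.1 this.symm
  rw [qHat_eq hS (suppIn_interior D X ω), interior_eq hX hω, (par_psi hS 1).jacobi_odd D, h1, h,
    evenBr_zero_left, evenBr_zero_right, add_zero]

/-- A function on 𝓜 lives both on 𝓛, where Q̂-closedness gives {Ψ_1, f} = 0, and on 𝓝, where its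
product with a vector field is again a vector field. -/
theorem oddBr_master_mul {f : Loc m r s K} (hf : SuppIn (Involves OnExt) f)
    (hX' : SuppIn (Involves OnN) X) (hQ : oddBr D (S 1) X = 0) (h : qHat D S f = 0) :
    oddBr D (S 1) (f * X) = 0 := by
  have h1 : SuppIn (Involves OnL) f := hf.mono fun _ _ h => h.imp fun v hv => by
    rcases v with ⟨_ | _ | _ | _, A⟩ <;> simp_all [OnL, OnExt]
  have h2 : SuppIn (Involves OnN) f := hf.mono fun _ _ h => h.imp fun v hv => by
    rcases v with ⟨_ | _ | _ | _, A⟩ <;> simp_all [OnN, OnExt]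
  rw [oddBr_master_eq hS hX'] at hQ
  rw [qHat_eq hS h1] at h
  rw [oddBr_master_eq hS (h2.mul_involves hX'), evenBr_mul_right D (par_psi hS 1), h, hQ, zero_mul,
    mul_zero, add_zero]

theorem oddBr_master_add (hX : SuppIn (Involves OnN) X) (hY : SuppIn (Involves OnN) Y) :
    oddBr D (S 1) (X + Y) = oddBr D (S 1) X + oddBr D (S 1) Y := by
  rw [oddBr_master_eq hS hX, oddBr_master_eq hS hY, oddBr_master_eq hS (hX.add hY),
    evenBr_add_right]

theorem oddBr_master_smul (a : ℝ) (hX : SuppIn (Involves OnN) X) :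
    oddBr D (S 1) (a • X) = a • oddBr D (S 1) X := by
  rw [oddBr_master_eq hS hX, oddBr_master_eq hS (hX.smul a), evenBr_smul_right]

end Interior

/-! ### Restriction to `M` -/

section RestrictM

variable {D : Fin m → K → K} [IsDer D] {S : ℕ → Loc m r s K} (hS : LocalMaster D S)
  {ω τ X : Loc m r s K}

theorem onTM_iff (v : Var m r s) : OnTM v ↔ OnL v ∧ trDeg v = 0 := by
  rcases v with ⟨_ | _ | _ | _, _ | _⟩ <;> simp [OnTM, OnL, trDeg]

/-- The number of factors `c`, `dc`. -/
def ghostDeg : Var m r s → ℤ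
  | (.fld, .inr (.inr _)) => 1
  | (.vel, .inr (.inr _)) => 1
  | _ => 0

/-- The number of factors `x*`-transverse momenta `η*`, `c*`. -/
def trMomDeg : Var m r s → ℤ
  | (.mom, .inr _) => 1
  | _ => 0

/-- The number of factors `η*`. -/
def etaMomDeg : Var m r s → ℤ
  | (.mom, .inr (.inl _)) => 1
  | _ => 0

theorem trDeg_ge_zero (F : Loc m r s K) : SuppIn (fun I n => 0 ≤ wt trDeg I n) F :=
  fun I n _ => add_nonneg (Finset.sum_nonneg fun v _ => trDeg_nonneg _)
    (Finset.sum_nonneg fun e _ => mul_nonneg (by positivity) (trDeg_nonneg _))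

/-- A function on `𝓛` of total degree zero agrees with its restriction to `ΠTM` up to second
order. -/
theorem trDeg_sub_restr (hω : SuppIn (Involves OnL) ω)
    (h : SuppIn (fun I n => wt totDeg I n = 0) ω) :
    SuppIn (fun I n => 2 ≤ wt trDeg I n) (ω - restr OnTM ω) := by
  refine (((hω.and h).sub_restr OnTM).and (trDeg_ge_zero _)).mono ?_
  rintro I n ⟨⟨⟨h1, h2⟩, h3⟩, h4⟩
  -- On 𝓛, c and dc have total degree 1, η and dη have -1, x and dx have 0. Hence the transverse
  -- degree is even when the total degree is zero, and a nonzero value is at least two.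
  have e : wt trDeg I n + wt totDeg I n = wt ghostDeg I n + wt ghostDeg I n := by
    rw [← wt_add, ← wt_add]
    refine wt_congr (fun v hv => ?_) h1
    rcases v with ⟨_ | _ | _ | _, _ | _ | _⟩ <;>
      simp_all [OnL, trDeg, totDeg, ghost, Idx.ghost, dDeg, ghostDeg]
  have h5 : wt trDeg I n ≠ 0 := fun h0 => h3 <| by
    have := involves_of_wt_eq_zero trDeg_nonneg h0
    exact ⟨fun v hv => (onTM_iff _).2 ⟨h1.1 v hv, this.1 v hv⟩,
      fun v hv => (onTM_iff _).2 ⟨h1.2 v hv, this.2 v hv⟩⟩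
  rw [h2] at e
  omega

/-- A monomial without η and c contains exactly one momentum and no other fibre coordinate. Ghost
number one forces this momentum to be x*, as η* and c* have ghost numbers 2 and 0. -/
theorem trDeg_sub_restr_vector (hX : SuppIn (fun I n => wt momDeg I n = 1) X)
    (hX' : SuppIn (Involves OnN) X) (hX'' : SuppIn (fun I n => wt ghost I n = 1) X) :
    SuppIn (fun I n => 1 ≤ wt trDeg I n) (X - restr OnTsM X) := by
  refine ((((hX.and hX').and hX'').sub_restr OnTsM).and (trDeg_ge_zero _)).mono ?_
  rintro I n ⟨⟨⟨⟨h1, h2⟩, h3⟩, h4⟩, h5⟩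
  by_contra h6
  have h0 : wt trDeg I n = 0 := by omega
  have h7 := involves_of_wt_eq_zero trDeg_nonneg h0
  have h8 : Involves (fun v => OnN v ∧ trDeg v = 0) I n :=
    ⟨fun v hv => ⟨h2.1 v hv, h7.1 v hv⟩, fun v hv => ⟨h2.2 v hv, h7.2 v hv⟩⟩
  -- Checked on x*, η*, c*, of ghost numbers 1, 2, 0. With ghost number and momentum degree both
  -- one, the number of transverse momenta becomes even; being at most one, it is zero.
  have e : wt trMomDeg I n + wt ghost I n =
      (wt etaMomDeg I n + wt etaMomDeg I n) + wt momDeg I n := by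
    rw [← wt_add, ← wt_add, ← wt_add]
    refine wt_congr (fun v hv => ?_) h8
    rcases v with ⟨_ | _ | _ | _, _ | _ | _⟩ <;>
      simp_all [OnN, trDeg, ghost, Idx.ghost, trMomDeg, etaMomDeg, momDeg]
  have h9 : wt trMomDeg I n ≤ wt momDeg I n := wt_le_wt (fun v hv => by
    rcases v with ⟨_ | _ | _ | _, _ | _ | _⟩ <;> simp [trMomDeg, momDeg]) h8
  have hnn : ∀ v : Var m r s, 0 ≤ trMomDeg v := fun v => by
    rcases v with ⟨_ | _ | _ | _, _ | _ | _⟩ <;> simp [trMomDeg]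
  have h10 : 0 ≤ wt trMomDeg I n := add_nonneg (Finset.sum_nonneg fun v _ => hnn _)
    (Finset.sum_nonneg fun e _ => mul_nonneg (by positivity) (hnn _))
  have h11 : wt trMomDeg I n = 0 := by omega
  have h12 := involves_of_wt_eq_zero hnn h11
  have key : ∀ v : Var m r s, (OnN v ∧ trDeg v = 0) → trMomDeg v = 0 → OnTsM v := by
    intro v h1 h2
    rcases v with ⟨_ | _ | _ | _, _ | _ | _⟩ <;> simp_all [OnN, OnTsM, trDeg, trMomDeg]
  exact h4 ⟨fun v hv => key _ (h8.1 v hv) (h12.1 v hv), fun v hv => key _ (h8.2 v hv) (h12.2 v hv)⟩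

theorem restr_eq_zero_of_trDeg (h : SuppIn (fun I n => 1 ≤ wt trDeg I n) ω) :
    restr OnTM ω = 0 :=
  SuppIn.restr_eq_zero <| h.mono fun I n h1 h2 => by
    rw [wt_eq_zero_of_involves (fun v hv => ((onTM_iff v).1 hv).2) h2] at h1
    omega

/-- A nonzero term differentiates `ω` along 𝓛, hence `F` by a momentum φ* or dφ*, whose transverse
degree is zero. So `F` loses no order, and the loss is entirely that of the derivatives of `ω`. -/
theorem trDeg_evenBr (F : Loc m r s K) {a b d : ℤ} (hF : SuppIn (fun I n => a ≤ wt trDeg I n) F)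
    (hω : SuppIn (Involves OnL) ω)
    (h : ∀ v, OnL v → SuppIn (fun I n => b ≤ wt trDeg I n) (pd D v ω))
    (hd : d ≤ a + b) : SuppIn (fun I n => d ≤ wt trDeg I n) (evenBr D F ω) := by
  rw [evenBr_eq]
  refine SuppIn.sum fun v _ => SuppIn.zsmul ?_ _
  by_cases hv : OnL (conj v)
  · have h0 : trDeg v = 0 := by
      rcases v with ⟨_ | _ | _ | _, _ | _⟩ <;> simp_all [OnL, conj, trDeg]
    have h1 := hF.pd_wt_ge D (isDer_zero D) trDeg_base v
    rw [h0, sub_zero] at h1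
    exact ((h1.tw _).mul_wt_ge (h _ hv)).mono fun _ _ e => hd.trans e
  · rw [pd_onL D hω _ hv, mul_zero]
    exact SuppIn.zero

theorem trDeg_evenBr_left (F : Loc m r s K) {a : ℤ}
    (hF : SuppIn (fun I n => a ≤ wt trDeg I n) F) (hω : SuppIn (Involves OnL) ω) :
    SuppIn (fun I n => a ≤ wt trDeg I n) (evenBr D F ω) :=
  trDeg_evenBr F hF hω (fun _ _ => trDeg_ge_zero _) (by simp)

theorem trDeg_evenBr_right (F : Loc m r s K) (hω : SuppIn (Involves OnL) ω)
    (h : SuppIn (fun I n => 2 ≤ wt trDeg I n) ω) :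
    SuppIn (fun I n => 1 ≤ wt trDeg I n) (evenBr D F ω) :=
  trDeg_evenBr F (trDeg_ge_zero F) hω (b := 1) (fun v _ =>
    (h.pd_wt_ge D (isDer_zero D) trDeg_base v).mono fun _ _ e => by
      have : trDeg v ≤ 1 := by rcases v with ⟨_ | _ | _ | _, _ | _⟩ <;> simp [trDeg]
      omega) (by simp)

theorem suppIn_onL_of_onTM (h : SuppIn (Involves OnTM) ω) : SuppIn (Involves OnL) ω :=
  h.mono fun _ _ h => h.imp fun v hv => ((onTM_iff v).1 hv).1

theorem suppIn_restr_onTM (ω : Loc m r s K) : SuppIn (Involves OnL) (restr OnTM ω) :=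
  suppIn_onL_of_onTM (suppIn_restr _ _)

/-- The part of `X` outside ΠT*M has transverse order one and contributes nothing on ΠTM. The part
of `ω` outside ΠTM has order two, and the one derivative it undergoes leaves order one. What remains
involves only x and dx. -/
theorem restr_interior (hX : SuppIn (fun I n => wt momDeg I n = 1) X)
    (hX' : SuppIn (Involves OnN) X) (hX'' : SuppIn (fun I n => wt ghost I n = 1) X)
    (hω : SuppIn (Involves OnL) ω) (h : SuppIn (fun I n => wt totDeg I n = 0) ω) :
    restr OnTM (interior D X ω) = interior D (restr OnTsM X) (restr OnTM ω) := by
  have h1 : restr OnTM (interior D (X - restr OnTsM X) ω) = 0 := by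
    rw [interior_eq ((hX.sub ((hX.restr OnTsM).mono fun _ _ h => h.1))) hω]
    exact restr_eq_zero_of_trDeg
      (trDeg_evenBr_left _ (trDeg_sub_restr_vector hX hX' hX'').inv hω)
  have h2 : restr OnTM (interior D (restr OnTsM X) (ω - restr OnTM ω)) = 0 := by
    have h3 := hω.sub (suppIn_restr_onTM ω)
    rw [interior_eq ((hX.restr OnTsM).mono fun _ _ h => h.1) h3]
    exact restr_eq_zero_of_trDeg (trDeg_evenBr_right _ h3 (trDeg_sub_restr hω h))
  rw [interior_sub_left, restr_sub, sub_eq_zero] at h1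
  rw [interior_sub_right, restr_sub, sub_eq_zero] at h2
  rw [h1, h2]
  refine SuppIn.restr_eq_self ?_
  rw [interior_eq ((hX.restr OnTsM).mono fun _ _ h => h.1) (suppIn_restr_onTM ω), evenBr_eq]
  refine SuppIn.sum fun v _ => SuppIn.zsmul ?_ _
  by_cases hv : OnL (conj v)
  · have h4 : SuppIn (Involves OnTsM) (rpd D v (inv (restr OnTsM X))) :=
      ((suppIn_restr OnTsM X).inv.pd_involves D (isDer_zero D) v).tw _
    have h5 : SuppIn (fun I n => wt momDeg I n = 0) (rpd D v (inv (restr OnTsM X))) := by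
      have := ((((hX.restr OnTsM).mono fun _ _ h => h.1).inv).pd_wt D (isDer_zero D) momDeg_base
        v).tw (Var.odd v)
      refine this.mono fun _ _ e => ?_
      rw [e]
      rcases v with ⟨_ | _ | _ | _, _ | _⟩ <;> simp_all [OnL, conj, momDeg]
    have h6 : SuppIn (Involves OnTM) (rpd D v (inv (restr OnTsM X))) :=
      (h4.and h5.involves_onL).mono fun I n h => by
        refine ⟨fun u hu => ?_, fun u hu => ?_⟩
        · have a1 := h.1.1 u hu
          have a2 := h.2.1 u hu
          rcases u with ⟨⟨_ | _ | _ | _, _ | _⟩, _⟩ <;> simp_all [OnL, OnTsM, OnTM]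
        · have a1 := h.1.2 u hu
          have a2 := h.2.2 u hu
          rcases u with ⟨⟨_ | _ | _ | _, _ | _⟩, _⟩ <;> simp_all [OnL, OnTsM, OnTM]
    exact h6.mul_involves ((suppIn_restr OnTM ω).pd_involves D (isDer_zero D) _)
  · rw [pd_onL D (suppIn_restr_onTM ω) _ hv, mul_zero]
    exact SuppIn.zero

theorem extD_sub (ω τ : Loc m r s K) : extD D (ω - τ) = extD D ω - extD D τ := by
  simp only [extD, pd_sub, mul_sub, smul_sub, Finset.sum_sub_distrib]

theorem suppIn_extD (hω : SuppIn (Involves OnL) ω) : SuppIn (Involves OnL) (extD D ω) := by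
  rw [extD]
  exact SuppIn.sum fun A _ => SuppIn.zsmul
    ((SuppIn.gen_involves (by simp [OnL])).mul_involves
      (hω.pd_involves D (isDer_zero D) _)) _

theorem totDeg_extD (hω : SuppIn (Involves OnL) ω)
    (h : SuppIn (fun I n => wt totDeg I n = 0) ω) :
    SuppIn (fun I n => wt totDeg I n = 0) (extD D ω) := by
  rw [extD_eq D hω]
  exact (suppIn_delta totDeg 1 fun A => by simp [totDeg, ghost, dDeg]).evenBr_wt D (isDer_zero D)
    totDeg_base totDeg_conj h (by ring)

theorem suppIn_extD_onTM (hω : SuppIn (Involves OnTM) ω) : SuppIn (Involves OnTM) (extD D ω) := by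
  rw [extD]
  refine SuppIn.sum fun A _ => SuppIn.zsmul ?_ _
  rcases A with i | A
  · exact (SuppIn.gen_involves (by simp [OnTM])).mul_involves
      (hω.pd_involves D (isDer_zero D) _)
  · rw [pd_eq_zero_of_involves D hω rfl (by simp [OnTM]), mul_zero]
    exact SuppIn.zero

/-- The remainder of second transverse order loses at most one order under {Δ, -}. -/
theorem restr_extD (hω : SuppIn (Involves OnL) ω)
    (h : SuppIn (fun I n => wt totDeg I n = 0) ω) :
    restr OnTM (extD D ω) = extD D (restr OnTM ω) := by
  have h1 : restr OnTM (extD D (ω - restr OnTM ω)) = 0 := by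
    refine restr_eq_zero_of_trDeg ?_
    rw [extD_eq D (hω.sub (suppIn_restr_onTM ω))]
    exact trDeg_evenBr_right _ (hω.sub (suppIn_restr_onTM ω)) (trDeg_sub_restr hω h)
  rw [extD_sub, restr_sub, sub_eq_zero] at h1
  rw [h1]
  exact (suppIn_extD_onTM (suppIn_restr _ _)).restr_eq_self

/-- Q̂ preserves the form degree, because Ψ_1 contains one differential and the bracket removes one;
so the part of form degree zero of a cocycle is a cocycle. It provides functions on 𝓜 that can
multiply vector fields. -/
theorem qHat_restr_onExt (hS : LocalMaster D S) (hω : SuppIn (Involves OnL) ω)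
    (h : qHat D S ω = 0) : qHat D S (restr OnExt ω) = 0 := by
  have hE : ∀ v : Var m r s, OnExt v → OnL v := fun v hv => by
    rcases v with ⟨_ | _ | _ | _, A⟩ <;> simp_all [OnL, OnExt]
  have h1 : SuppIn (Involves OnL) (restr OnExt ω) :=
    (suppIn_restr OnExt ω).mono fun _ _ h => h.imp hE
  have h2 : SuppIn (fun I n => wt dDeg I n = 0) (qHat D S (restr OnExt ω)) := by
    rw [qHat_eq hS h1]
    refine (dDeg_psi hS 1).evenBr_wt D (isDer_zero D) dDeg_base dDeg_conj (e := 0)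
      ((suppIn_restr OnExt ω).mono fun _ _ h => wt_eq_zero_of_involves (fun v hv => ?_) h)
      (by norm_num)
    rcases v with ⟨_ | _ | _ | _, A⟩ <;> simp_all [dDeg, OnExt]
  have h3 : SuppIn (fun I n => wt dDeg I n ≠ 0) (qHat D S (restr OnExt ω)) := by
    have e : qHat D S (restr OnExt ω) = -qHat D S (ω - restr OnExt ω) := by
      have := qHat_add (D := D) (S := S) (ω - restr OnExt ω) (restr OnExt ω)
      rw [sub_add_cancel, h] at this
      exact eq_neg_of_add_eq_zero_right this.symm
    rw [e, qHat_eq hS (hω.sub h1)]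
    refine SuppIn.neg ?_
    have hnn : ∀ v : Var m r s, 0 ≤ dDeg v := fun v => by
      rcases v with ⟨_ | _ | _ | _, A⟩ <;> simp [dDeg]
    have h4 : SuppIn (fun I n => 1 ≤ wt dDeg I n) (ω - restr OnExt ω) :=
      (hω.sub_restr OnExt).mono fun I n h => by
        have h5 : 0 ≤ wt dDeg I n := add_nonneg (Finset.sum_nonneg fun v _ => hnn _)
          (Finset.sum_nonneg fun e _ => mul_nonneg (by positivity) (hnn _))
        by_contra h6
        have h7 := involves_of_wt_eq_zero hnn (show wt dDeg I n = 0 by omega)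
        have key : ∀ v : Var m r s, OnL v → dDeg v = 0 → OnExt v := fun v h1 h2 => by
          rcases v with ⟨_ | _ | _ | _, A⟩ <;> simp_all [OnL, OnExt, dDeg]
        exact h.2 ⟨fun v hv => key _ (h.1.1 v hv) (h7.1 v hv),
          fun v hv => key _ (h.1.2 v hv) (h7.2 v hv)⟩
    rw [evenBr_eq]
    refine SuppIn.sum fun v _ => SuppIn.zsmul ?_ _
    refine ((((dDeg_psi hS 1).pd_wt D (isDer_zero D) dDeg_base v).mono
      fun _ _ e => e.ge).tw (Var.odd v) |>.mul_wt_ge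
      (h4.pd_wt_ge D (isDer_zero D) dDeg_base (conj v))).mono fun _ _ e => ?_
    have := dDeg_conj v
    omega
  exact (h2.and h3).eq_zero fun _ _ h => h.2 h.1

include hS

/-- Replacing an argument by its restriction is an error of second transverse order. The derived
bracket differentiates each argument once, so an error of first order remains and vanishes on ΠTM.
Hence the weak Koszul bracket is the restriction of the bracket of any extensions. -/
theorem restr_koszul {Ω T : Loc m r s K} (hΩ : SuppIn (Involves OnL) Ω)
    (hT : SuppIn (Involves OnL) T) (h : SuppIn (fun I n => wt totDeg I n = 0) Ω)
    (h' : SuppIn (fun I n => wt totDeg I n = 0) T) :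
    restr OnTM (koszul D S (restr OnTM Ω) (restr OnTM T)) = restr OnTM (koszul D S Ω T) := by
  have h1 : restr OnTM (koszul D S (Ω - restr OnTM Ω) T) = 0 := by
    rw [koszul_eq hS (hΩ.sub (suppIn_restr_onTM Ω)) hT]
    exact restr_eq_zero_of_trDeg (trDeg_evenBr_left _
      (trDeg_evenBr_right _ (hΩ.sub (suppIn_restr_onTM Ω)) (trDeg_sub_restr hΩ h)) hT)
  have h2 : restr OnTM (koszul D S (restr OnTM Ω) (T - restr OnTM T)) = 0 := by
    rw [koszul_eq hS (suppIn_restr_onTM Ω) (hT.sub (suppIn_restr_onTM T))]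
    exact restr_eq_zero_of_trDeg (trDeg_evenBr_right _
      (hT.sub (suppIn_restr_onTM T)) (trDeg_sub_restr hT h'))
  rw [koszul_eq_restr, evenBr_sub_right, evenBr_sub_left, restr_sub, restr_sub, ← koszul_eq_restr,
    ← koszul_eq_restr, sub_eq_zero] at h1
  rw [koszul_eq_restr, evenBr_sub_right, restr_sub, restr_sub, ← koszul_eq_restr,
    ← koszul_eq_restr, sub_eq_zero] at h2
  rw [h1, h2]

end RestrictM

end

end WeakKoszul


open scoped Manifold

namespace WeakKoszul

noncomputable section

set_option linter.unusedSectionVars false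

/-! ### Partial derivatives in a chart -/

section Analysis

variable {m : ℕ} {M : Type*} [TopologicalSpace M] [ChartedSpace (EuclideanSpace ℝ (Fin m)) M]

/-- The partial derivatives in the coordinates `x`. -/
def xD (x : OpenPartialHomeomorph M (EuclideanSpace ℝ (Fin m))) (i : Fin m) (f : M → ℝ) : M → ℝ :=
  fun p => fderiv ℝ (f ∘ x.symm) (x p) (EuclideanSpace.single i 1)

variable (m) in
/-- Smoothness on a subset of `M`. -/
abbrev SmoothOn (U : Set M) (g : M → ℝ) : Prop :=
  ContMDiffOn (𝓡 m) 𝓘(ℝ, ℝ) ((⊤ : ℕ∞) : WithTop ℕ∞) g U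

variable {x y : OpenPartialHomeomorph M (EuclideanSpace ℝ (Fin m))} {U : Set M} {f g : M → ℝ}

theorem isOpen_image_chart (hU : IsOpen U) : IsOpen (x.target ∩ x.symm ⁻¹' U) :=
  x.isOpen_inter_preimage_symm hU

theorem mem_image_chart (hUx : U ⊆ x.source) {p : M} (hp : p ∈ U) :
    x p ∈ x.target ∩ x.symm ⁻¹' U :=
  ⟨x.map_source (hUx hp), by simpa [x.left_inv (hUx hp)] using hp⟩

/-- Over an open set the derivative depends only on germs, so values outside `U` are irrelevant. -/
theorem xD_congr (hU : IsOpen U) (hUx : U ⊆ x.source) (h : ∀ p ∈ U, f p = g p) {p : M}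
    (hp : p ∈ U) (i : Fin m) : xD x i f p = xD x i g p := by
  have : f ∘ x.symm =ᶠ[nhds (x p)] g ∘ x.symm := by
    filter_upwards [(isOpen_image_chart hU).mem_nhds (mem_image_chart hUx hp)] with q hq
    exact h _ hq.2
  rw [xD, xD, this.fderiv_eq]

variable [IsManifold (𝓡 m) ((⊤ : ℕ∞) : WithTop ℕ∞) M]

theorem SmoothOn.contDiffOn (hx : x ∈ atlas (EuclideanSpace ℝ (Fin m)) M) (hg : SmoothOn m U g) :
    ContDiffOn ℝ ((⊤ : ℕ∞) : WithTop ℕ∞) (g ∘ x.symm) (x.target ∩ x.symm ⁻¹' U) := by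
  have h1 := contMDiffOn_symm_of_mem_maximalAtlas (I := 𝓡 m) (n := ((⊤ : ℕ∞) : WithTop ℕ∞))
    (IsManifold.subset_maximalAtlas hx)
  have h2 := hg.comp (h1.mono Set.inter_subset_left) (fun q hq => hq.2)
  exact contMDiffOn_iff_contDiffOn.1 h2

theorem smoothOn_comp_chart (hx : x ∈ atlas (EuclideanSpace ℝ (Fin m)) M) (hUx : U ⊆ x.source)
    {h : EuclideanSpace ℝ (Fin m) → ℝ}
    (hh : ContDiffOn ℝ ((⊤ : ℕ∞) : WithTop ℕ∞) h (x.target ∩ x.symm ⁻¹' U)) :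
    SmoothOn m U (h ∘ x) := by
  have h1 := contMDiffOn_of_mem_maximalAtlas (I := 𝓡 m) (n := ((⊤ : ℕ∞) : WithTop ℕ∞))
    (IsManifold.subset_maximalAtlas hx)
  exact (contMDiffOn_iff_contDiffOn.2 hh).comp (h1.mono hUx) fun p hp => mem_image_chart hUx hp

theorem SmoothOn.differentiableAt (hx : x ∈ atlas (EuclideanSpace ℝ (Fin m)) M) (hU : IsOpen U)
    (hUx : U ⊆ x.source) (hg : SmoothOn m U g) {p : M} (hp : p ∈ U) :
    DifferentiableAt ℝ (g ∘ x.symm) (x p) :=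
  ((hg.contDiffOn hx).differentiableOn (by simp)).differentiableAt
    ((isOpen_image_chart hU).mem_nhds (mem_image_chart hUx hp))

theorem SmoothOn.xD (hx : x ∈ atlas (EuclideanSpace ℝ (Fin m)) M) (hU : IsOpen U)
    (hUx : U ⊆ x.source) (hg : SmoothOn m U g) (i : Fin m) : SmoothOn m U (xD x i g) := by
  have h1 : ContDiffOn ℝ ((⊤ : ℕ∞) : WithTop ℕ∞)
      (fun q => fderiv ℝ (g ∘ x.symm) q (EuclideanSpace.single i 1))
      (x.target ∩ x.symm ⁻¹' U) :=
    ((hg.contDiffOn hx).fderiv_of_isOpen (isOpen_image_chart hU) (by simp)).clm_apply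
      contDiffOn_const
  exact smoothOn_comp_chart hx hUx h1

theorem xD_add (hx : x ∈ atlas (EuclideanSpace ℝ (Fin m)) M) (hU : IsOpen U)
    (hUx : U ⊆ x.source) (hf : SmoothOn m U f) (hg : SmoothOn m U g) (i : Fin m) {p : M}
    (hp : p ∈ U) : xD x i (f + g) p = xD x i f p + xD x i g p := by
  rw [xD, show (f + g) ∘ x.symm = f ∘ x.symm + g ∘ x.symm from rfl,
    fderiv_add (hf.differentiableAt hx hU hUx hp) (hg.differentiableAt hx hU hUx hp)]
  rfl

theorem xD_smul (hx : x ∈ atlas (EuclideanSpace ℝ (Fin m)) M) (hU : IsOpen U)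
    (hUx : U ⊆ x.source) (a : ℝ) (hf : SmoothOn m U f) (i : Fin m) {p : M}
    (hp : p ∈ U) : xD x i (a • f) p = a * xD x i f p := by
  rw [xD, show (a • f) ∘ x.symm = a • (f ∘ x.symm) from rfl,
    fderiv_const_smul (hf.differentiableAt hx hU hUx hp)]
  rfl

theorem xD_mul (hx : x ∈ atlas (EuclideanSpace ℝ (Fin m)) M) (hU : IsOpen U)
    (hUx : U ⊆ x.source) (hf : SmoothOn m U f) (hg : SmoothOn m U g) (i : Fin m) {p : M}
    (hp : p ∈ U) : xD x i (f * g) p = xD x i f p * g p + f p * xD x i g p := by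
  rw [xD, show (f * g) ∘ x.symm = (f ∘ x.symm) * (g ∘ x.symm) from rfl,
    fderiv_mul (hf.differentiableAt hx hU hUx hp) (hg.differentiableAt hx hU hUx hp)]
  simp [xD, x.left_inv (hUx hp)]
  ring

/-- Both sides are values of the second derivative in the chart, which is symmetric for smooth
functions. -/
theorem xD_comm (hx : x ∈ atlas (EuclideanSpace ℝ (Fin m)) M) (hU : IsOpen U)
    (hUx : U ⊆ x.source) (hf : SmoothOn m U f) (i j : Fin m) {p : M} (hp : p ∈ U) :
    xD x i (xD x j f) p = xD x j (xD x i f) p := by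
  set V := x.target ∩ x.symm ⁻¹' U
  have hV : V ∈ nhds (x p) := (isOpen_image_chart hU).mem_nhds (mem_image_chart hUx hp)
  have hc := hf.contDiffOn hx
  have key : ∀ i j, xD x i (xD x j f) p = fderiv ℝ (fderiv ℝ (f ∘ x.symm)) (x p)
      (EuclideanSpace.single i 1) (EuclideanSpace.single j 1) := by
    intro i j
    have e : (xD x j f) ∘ x.symm =ᶠ[nhds (x p)]
        fun q => fderiv ℝ (f ∘ x.symm) q (EuclideanSpace.single j 1) := by
      filter_upwards [hV] with q hq
      simp [xD, x.right_inv hq.1]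
    have hd : DifferentiableAt ℝ (fderiv ℝ (f ∘ x.symm)) (x p) :=
      ((hc.fderiv_of_isOpen (m := ((⊤ : ℕ∞) : WithTop ℕ∞)) (isOpen_image_chart hU)
        (by simp)).differentiableOn (by simp)).differentiableAt hV
    rw [xD, e.fderiv_eq, fderiv_clm_apply hd (differentiableAt_const _)]
    simp
  rw [key, key]
  have hs : IsSymmSndFDerivAt ℝ (f ∘ x.symm) (x p) :=
    (hc.contDiffAt hV).isSymmSndFDerivAt (by
      simp only [minSmoothness_of_isRCLikeNormedField]
      exact WithTop.coe_le_coe.2 (le_top : (2 : ℕ∞) ≤ ⊤))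
  exact hs _ _

/-- The chain rule. -/
theorem xD_chain (hx : x ∈ atlas (EuclideanSpace ℝ (Fin m)) M)
    (hy : y ∈ atlas (EuclideanSpace ℝ (Fin m)) M) (hU : IsOpen U)
    (hUx : U ⊆ x.source) (hUy : U ⊆ y.source) (hf : SmoothOn m U f) (i : Fin m) {p : M}
    (hp : p ∈ U) : xD y i f p = ∑ j, xD y i (fun q => x q j) p * xD x j f p := by
  have hcx : ContDiffOn ℝ ((⊤ : ℕ∞) : WithTop ℕ∞) (x ∘ y.symm) (y.target ∩ y.symm ⁻¹' U) := by
    have h1 := contMDiffOn_symm_of_mem_maximalAtlas (I := 𝓡 m) (n := ((⊤ : ℕ∞) : WithTop ℕ∞))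
      (IsManifold.subset_maximalAtlas hy)
    have h2 := contMDiffOn_of_mem_maximalAtlas (I := 𝓡 m) (n := ((⊤ : ℕ∞) : WithTop ℕ∞))
      (IsManifold.subset_maximalAtlas hx)
    exact contMDiffOn_iff_contDiffOn.1
      ((h2.mono hUx).comp (h1.mono Set.inter_subset_left) (fun q hq => hq.2))
  have hV : y.target ∩ y.symm ⁻¹' U ∈ nhds (y p) :=
    (isOpen_image_chart hU).mem_nhds (mem_image_chart hUy hp)
  have hd : DifferentiableAt ℝ (x ∘ y.symm) (y p) :=
    (hcx.differentiableOn (by simp)).differentiableAt hV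
  have e : f ∘ y.symm =ᶠ[nhds (y p)] (f ∘ x.symm) ∘ (x ∘ y.symm) := by
    filter_upwards [hV] with q hq
    simp [x.left_inv (hUx hq.2)]
  have hxp : (x ∘ y.symm) (y p) = x p := by simp [y.left_inv (hUy hp)]
  have hdf : DifferentiableAt ℝ (f ∘ x.symm) ((x ∘ y.symm) (y p)) := by
    rw [hxp]; exact hf.differentiableAt hx hU hUx hp
  have hcomp : ∀ j, xD y i (fun q => x q j) p =
      fderiv ℝ (x ∘ y.symm) (y p) (EuclideanSpace.single i 1) j := by
    intro j
    have : (fun q => x q j) ∘ y.symm = (EuclideanSpace.proj j : _ →L[ℝ] ℝ) ∘ (x ∘ y.symm) := rfl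
    rw [xD, this, fderiv_comp _ (ContinuousLinearMap.differentiableAt _) hd,
      ContinuousLinearMap.fderiv]
    rfl
  rw [xD, e.fderiv_eq, fderiv_comp _ hdf hd, hxp]
  set w := fderiv ℝ (x ∘ y.symm) (y p) (EuclideanSpace.single i 1) with hw
  have hsum : w = ∑ j, w j • EuclideanSpace.single j (1 : ℝ) := by
    ext k
    simp [Pi.single_apply]
  rw [ContinuousLinearMap.comp_apply, ← hw]
  conv_lhs => rw [hsum]
  rw [map_sum]
  refine Finset.sum_congr rfl fun j _ => ?_
  rw [map_smul, hcomp, smul_eq_mul]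
  rfl

theorem smoothOn_coord (hx : x ∈ atlas (EuclideanSpace ℝ (Fin m)) M) (hUx : U ⊆ x.source)
    (i : Fin m) : SmoothOn m U fun p => x p i :=
  smoothOn_comp_chart (h := fun q => q i) hx hUx
    ((EuclideanSpace.proj i : _ →L[ℝ] ℝ).contDiff.contDiffOn)

theorem xD_coord (hU : IsOpen U) (hUx : U ⊆ x.source) (i j : Fin m) {p : M} (hp : p ∈ U) :
    xD x i (fun q => x q j) p = if i = j then 1 else 0 := by
  have hV : x.target ∩ x.symm ⁻¹' U ∈ nhds (x p) :=
    (isOpen_image_chart hU).mem_nhds (mem_image_chart hUx hp)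
  have e : (fun q => x q j) ∘ x.symm =ᶠ[nhds (x p)] (EuclideanSpace.proj j : _ →L[ℝ] ℝ) := by
    filter_upwards [hV] with q hq
    simp [x.right_inv hq.1]
  rw [xD, e.fderiv_eq, ContinuousLinearMap.fderiv]
  simp [eq_comm]

end Analysis

end

end WeakKoszul


open scoped Manifold

namespace WeakKoszul

noncomputable section

set_option linter.unusedSectionVars false

/-! ### Local functions with smooth coefficients -/

section Smooth

variable {m r s : ℕ} {M : Type*} [TopologicalSpace M] [ChartedSpace (EuclideanSpace ℝ (Fin m)) M]

variable (m) in
/-- The algebra of smooth functions on `U`. -/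
def smoothAlg (U : Set M) : Subalgebra ℝ (U → ℝ) where
  carrier := {f | ∃ g : M → ℝ, SmoothOn m U g ∧ ∀ p : U, f p = g p}
  mul_mem' := by
    rintro _ _ ⟨g, hg, h⟩ ⟨g', hg', h'⟩
    exact ⟨g * g', hg.mul hg', fun p => by simp [h, h']⟩
  add_mem' := by
    rintro _ _ ⟨g, hg, h⟩ ⟨g', hg', h'⟩
    exact ⟨g + g', hg.add hg', fun p => by simp [h, h']⟩
  algebraMap_mem' a := ⟨fun _ => a, contMDiffOn_const, fun p => rfl⟩

variable {U : Set M}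

/-- Restriction of functions to `U`. -/
def resHom (U : Set M) : (M → ℝ) →+* (U → ℝ) := RingHom.pi fun p => Pi.evalRingHom _ p.1

/-- Smooth functions on `U` as functions. -/
def inclHom (m : ℕ) [ChartedSpace (EuclideanSpace ℝ (Fin m)) M] (U : Set M) :
    smoothAlg m U →+* (U → ℝ) := (smoothAlg m U).val.toRingHom

/-- A smooth function on `M`, restricted to `U`. -/
def toSmooth (g : M → ℝ) (hg : SmoothOn m U g) : smoothAlg m U := ⟨fun p => g p, g, hg, fun _ => rfl⟩

/-- An extension of a smooth function on `U` to `M`. -/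
def smoothExt (a : smoothAlg m U) : M → ℝ := a.2.choose

theorem smoothOn_smoothExt (a : smoothAlg m U) : SmoothOn m U (smoothExt a) := a.2.choose_spec.1

theorem smoothExt_apply (a : smoothAlg m U) (p : U) : smoothExt a p = a.1 p :=
  (a.2.choose_spec.2 p).symm

/-- `F` is the restriction of `f` to `U`. -/
def Rep (f : Loc m r s (M → ℝ)) (F : Loc m r s (smoothAlg m U)) : Prop :=
  locMap (resHom U) f = locMap (inclHom m U) F

variable {f g : Loc m r s (M → ℝ)} {F G : Loc m r s (smoothAlg m U)}

theorem rep_iff : Rep f F ↔ ∀ I n (p : U), (f I).coeff n p = ((F I).coeff n).1 p := by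
  constructor
  · intro h I n p
    have := congrFun h I
    have := congrArg (MvPolynomial.coeff n) this
    rw [coeff_locMap, coeff_locMap] at this
    exact congrFun this p
  · intro h
    refine Loc.ext' fun I => ?_
    ext n p
    rw [coeff_locMap, coeff_locMap]
    exact h I n p

theorem Rep.smooth (h : Rep f F) (I : Finset (OddVar m r s)) (n : EvenVar m r s →₀ ℕ) :
    SmoothOn m U ((f I).coeff n) :=
  (smoothOn_smoothExt ((F I).coeff n)).congr fun p hp => by
    rw [rep_iff.1 h I n ⟨p, hp⟩]; exact (smoothExt_apply _ ⟨p, hp⟩).symm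

theorem exists_rep (h : ∀ I n, SmoothOn m U ((f I).coeff n)) :
    ∃ F : Loc m r s (smoothAlg m U), Rep f F := by
  refine ⟨fun I => ∑ n ∈ (f I).support, MvPolynomial.monomial n (toSmooth _ (h I n)),
    rep_iff.2 fun I n p => ?_⟩
  simp only [MvPolynomial.coeff_sum, MvPolynomial.coeff_monomial]
  rw [Finset.sum_ite_eq']
  split_ifs with hn
  · rfl
  · rw [MvPolynomial.notMem_support_iff.1 hn]; rfl

/-- Turns the equality over `U` used in the definitions into an honest identity over `smoothAlg`,
where the algebraic calculus applies. -/
theorem Rep.eqOver_iff (hf : Rep f F) (hg : Rep g G) : EqOver U f g ↔ F = G := by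
  rw [rep_iff] at hf hg
  constructor
  · intro h
    refine Loc.ext' fun I => ?_
    ext n p
    rw [← hf, ← hg]
    exact h I n p p.2
  · rintro rfl I n p hp
    rw [hf I n ⟨p, hp⟩, hg I n ⟨p, hp⟩]

theorem Rep.congr (hf : Rep f F) (h : EqOver U g f) : Rep g F :=
  rep_iff.2 fun I n p => by rw [h I n p p.2]; exact rep_iff.1 hf I n p

theorem Rep.suppOver_iff (hf : Rep f F)
    {P : Finset (OddVar m r s) → (EvenVar m r s →₀ ℕ) → Prop} :
    SuppOver U P f ↔ SuppIn P F := by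
  rw [rep_iff] at hf
  constructor
  · intro h I n hn
    have : ∃ p : U, ((F I).coeff n).1 p ≠ 0 := by
      by_contra h0
      push Not at h0
      exact hn (Subtype.ext (funext h0))
    obtain ⟨p, hp⟩ := this
    exact h I n p p.2 (by rw [hf I n p]; exact hp)
  · intro h I n p hp hn
    refine h I n fun h0 => hn ?_
    rw [hf I n ⟨p, hp⟩, h0]; rfl

theorem Rep.zero : Rep (0 : Loc m r s (M → ℝ)) (0 : Loc m r s (smoothAlg m U)) := by
  rw [Rep, map_zero, map_zero]

theorem Rep.one : Rep (1 : Loc m r s (M → ℝ)) (1 : Loc m r s (smoothAlg m U)) := by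
  rw [Rep, map_one, map_one]

theorem Rep.add (hf : Rep f F) (hg : Rep g G) : Rep (f + g) (F + G) := by
  rw [Rep, map_add, map_add, hf, hg]

theorem Rep.sub (hf : Rep f F) (hg : Rep g G) : Rep (f - g) (F - G) := by
  rw [Rep, map_sub, map_sub, hf, hg]

theorem Rep.mul (hf : Rep f F) (hg : Rep g G) : Rep (f * g) (F * G) := by
  rw [Rep, map_mul, map_mul, hf, hg]

theorem Rep.zsmul (k : ℤ) (hf : Rep f F) : Rep (k • f) (k • F) := by
  rw [Rep, map_zsmul, map_zsmul, hf]

theorem Rep.smul (k : ℝ) (hf : Rep f F) : Rep (k • f) (k • F) :=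
  rep_iff.2 fun I n p => by
    have := rep_iff.1 hf I n p
    rw [Loc.smul_apply, Loc.smul_apply, MvPolynomial.coeff_smul, MvPolynomial.coeff_smul]
    change k * _ = k * _
    rw [this]

theorem Rep.sum {ι : Type*} {t : Finset ι} {f : ι → Loc m r s (M → ℝ)}
    {F : ι → Loc m r s (smoothAlg m U)} (h : ∀ i ∈ t, Rep (f i) (F i)) :
    Rep (∑ i ∈ t, f i) (∑ i ∈ t, F i) := by
  rw [Rep, map_sum, map_sum]
  exact Finset.sum_congr rfl h

theorem Rep.inv (hf : Rep f F) : Rep (inv f) (inv F) := by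
  rw [Rep, locMap_inv, locMap_inv, hf]

theorem Rep.tw (hf : Rep f F) (b : Bool) : Rep (tw b f) (tw b F) := by
  cases b
  · exact hf
  · exact hf.inv

theorem Rep.restr (hf : Rep f F) (p : Var m r s → Prop) : Rep (restr p f) (restr p F) := by
  rw [Rep, locMap_restr, locMap_restr, hf]

theorem Rep.gen (v : Var m r s) :
    Rep (gen v : Loc m r s (M → ℝ)) (gen v : Loc m r s (smoothAlg m U)) := by
  rw [Rep, locMap_gen, locMap_gen]

theorem Rep.coef {a : M → ℝ} {b : smoothAlg m U} (h : ∀ p : U, a p = b.1 p) :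
    Rep (coef a : Loc m r s (M → ℝ)) (coef b : Loc m r s (smoothAlg m U)) := by
  rw [Rep, locMap_coef, locMap_coef]
  exact congrArg _ (funext h)

theorem Rep.delta : Rep (delta : Loc m r s (M → ℝ)) (delta : Loc m r s (smoothAlg m U)) :=
  Rep.sum fun _ _ => ((Rep.gen _).mul (Rep.gen _)).zsmul _

theorem Rep.subst (hf : Rep f F) {θ : Var m r s → Loc m r s (M → ℝ)}
    {Θ : Var m r s → Loc m r s (smoothAlg m U)} (h : ∀ v, Rep (θ v) (Θ v)) :
    Rep (subst θ f) (subst Θ F) := by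
  rw [Rep, locMap_subst, locMap_subst, hf]
  congr 1
  exact funext h

variable [IsManifold (𝓡 m) ((⊤ : ℕ∞) : WithTop ℕ∞) M]

/-- A coordinate system on a neighbourhood of the open set `U`. -/
structure ChartOver (m : ℕ) [ChartedSpace (EuclideanSpace ℝ (Fin m)) M] (U : Set M) where
  /-- the coordinates -/
  x : OpenPartialHomeomorph M (EuclideanSpace ℝ (Fin m))
  mem_x : x ∈ atlas (EuclideanSpace ℝ (Fin m)) M
  isOpen : IsOpen U
  subset : U ⊆ x.source

/-- The partial derivatives of smooth functions on `U`. -/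
def ChartOver.D (c : ChartOver m U) (i : Fin m) (a : smoothAlg m U) : smoothAlg m U :=
  toSmooth (xD c.x i (smoothExt a)) ((smoothOn_smoothExt a).xD c.mem_x c.isOpen c.subset i)

theorem ChartOver.D_apply (c : ChartOver m U) (i : Fin m) {a : smoothAlg m U} {g : M → ℝ}
    (h : ∀ p : U, g p = a.1 p) (p : U) : (c.D i a).1 p = xD c.x i g p :=
  xD_congr c.isOpen c.subset (fun q hq => by
    rw [h ⟨q, hq⟩]; exact smoothExt_apply a ⟨q, hq⟩) p.2 i

/-- This is the reason for `smoothAlg`: on arbitrary functions `fderiv` takes default values where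
the derivative does not exist, and the derivation rules fail. -/
instance (c : ChartOver m U) : IsDer c.D where
  add i a b := by
    ext p
    rw [c.D_apply i (g := smoothExt a + smoothExt b) (fun p => by simp [smoothExt_apply])]
    exact xD_add c.mem_x c.isOpen c.subset (smoothOn_smoothExt a) (smoothOn_smoothExt b) i p.2
  smul i t a := by
    ext p
    rw [c.D_apply i (g := t • smoothExt a) (fun p => by simp [smoothExt_apply])]
    exact xD_smul c.mem_x c.isOpen c.subset t (smoothOn_smoothExt a) i p.2
  mul i a b := by
    ext p
    rw [c.D_apply i (g := smoothExt a * smoothExt b) (fun p => by simp [smoothExt_apply])]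
    rw [xD_mul c.mem_x c.isOpen c.subset (smoothOn_smoothExt a) (smoothOn_smoothExt b) i p.2,
      smoothExt_apply, smoothExt_apply]
    rfl
  comm i j a := by
    ext p
    rw [c.D_apply i (g := xD c.x j (smoothExt a)) (fun p => rfl),
      c.D_apply j (g := xD c.x i (smoothExt a)) (fun p => rfl)]
    exact xD_comm c.mem_x c.isOpen c.subset (smoothOn_smoothExt a) i j p.2

/-- The coordinate functions. -/
def ChartOver.coord (c : ChartOver m U) (i : Fin m) : smoothAlg m U :=
  toSmooth (fun p => c.x p i) (smoothOn_coord c.mem_x c.subset i)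

theorem ChartOver.D_coord (c : ChartOver m U) (i j : Fin m) :
    c.D i (c.coord j) = if i = j then 1 else 0 := by
  ext p
  rw [c.D_apply i (g := fun p => c.x p j) (fun _ => rfl), xD_coord c.isOpen c.subset i j p.2]
  split_ifs <;> rfl

theorem ChartOver.chain (c c' : ChartOver m U) (i : Fin m) (a : smoothAlg m U) :
    c'.D i a = ∑ j, c'.D i (c.coord j) * c.D j a := by
  ext p
  rw [c'.D_apply i (g := smoothExt a) (smoothExt_apply a),
    xD_chain c.mem_x c'.mem_x c.isOpen c.subset c'.subset (smoothOn_smoothExt a) i p.2]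
  simp only [AddSubmonoidClass.coe_finsetSum, Finset.sum_apply, MulMemClass.coe_mul, Pi.mul_apply]
  refine Finset.sum_congr rfl fun j _ => ?_
  rw [c'.D_apply i (g := fun p => c.x p j) (fun _ => rfl),
    c.D_apply j (g := smoothExt a) (smoothExt_apply a)]

theorem xD_zero (x : OpenPartialHomeomorph M (EuclideanSpace ℝ (Fin m))) (i : Fin m) :
    xD x i 0 = 0 := by
  funext p
  have : (0 : M → ℝ) ∘ x.symm = fun _ => (0 : ℝ) := rfl
  simp [xD, this]

theorem Rep.pd (c : ChartOver m U) (hf : Rep f F) (v : Var m r s) :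
    Rep (pd (xD c.x) v f) (pd c.D v F) := by
  rcases var_cases v with h | ⟨h, hb⟩ | ⟨i, rfl⟩
  · rw [pd_odd _ h, pd_odd _ h, Rep]
    have hf' : ∀ I, MvPolynomial.map (resHom U) (f I) = MvPolynomial.map (inclHom m U) (F I) :=
      fun I => congrFun hf I
    refine Loc.ext' fun I => ?_
    rw [locMap_apply, locMap_apply, pdOdd_apply, pdOdd_apply]
    split_ifs
    · simp
    · rw [map_zsmul, map_zsmul, hf']
  · rw [pd_even _ h hb, pd_even _ h hb, rep_iff]
    intro I n p
    simp only [pdEven, MvPolynomial.coeff_pderiv]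
    have := rep_iff.1 hf I (n + Finsupp.single ⟨v, h, hb⟩ 1) p
    simp [this]
  · rw [pd_fld_inl, pd_fld_inl, rep_iff]
    intro I n p
    rw [coeff_pdBase (xD_zero c.x i), coeff_pdBase (IsDer.zero c.D i)]
    exact (c.D_apply i (rep_iff.1 hf I n) p).symm

theorem Rep.rpd (c : ChartOver m U) (hf : Rep f F) (v : Var m r s) :
    Rep (rpd (xD c.x) v f) (rpd c.D v F) := (hf.pd c v).tw _

theorem Rep.evenBr (c : ChartOver m U) (hf : Rep f F) (hg : Rep g G) :
    Rep (evenBr (xD c.x) f g) (evenBr c.D F G) := by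
  rw [evenBr_eq, evenBr_eq]
  exact Rep.sum fun v _ => ((hf.rpd c v).mul (hg.pd c _)).zsmul _

theorem Rep.oddBr (c : ChartOver m U) (hf : Rep f F) (hg : Rep g G) :
    Rep (oddBr (xD c.x) f g) (oddBr c.D F G) :=
  Rep.sum fun _ _ => ((hf.rpd c _).mul (hg.pd c _)).sub ((hf.rpd c _).mul (hg.pd c _))

theorem Rep.extD (c : ChartOver m U) (hf : Rep f F) : Rep (extD (xD c.x) f) (extD c.D F) :=
  Rep.sum fun _ _ => ((Rep.gen _).mul (hf.pd c _)).zsmul _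

theorem Rep.homog (hf : Rep f F) (k n : ℕ) : Rep (homog k f n) (homog k F n) := by
  by_cases h : n = k
  · subst h; simpa [WeakKoszul.homog] using hf
  · simpa [WeakKoszul.homog, h] using Rep.zero

theorem Rep.evenBrF (c : ChartOver m U) {f g : ℕ → Loc m r s (M → ℝ)}
    {F G : ℕ → Loc m r s (smoothAlg m U)} (hf : ∀ k, Rep (f k) (F k)) (hg : ∀ k, Rep (g k) (G k))
    (n : ℕ) : Rep (evenBrF (xD c.x) f g n) (evenBrF c.D F G n) :=
  Rep.sum fun _ _ => (hf _).evenBr c (hg _)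

theorem Rep.oddBrF (c : ChartOver m U) {f g : ℕ → Loc m r s (M → ℝ)}
    {F G : ℕ → Loc m r s (smoothAlg m U)} (hf : ∀ k, Rep (f k) (F k)) (hg : ∀ k, Rep (g k) (G k))
    (n : ℕ) : Rep (oddBrF (xD c.x) f g n) (oddBrF c.D F G n) :=
  Rep.sum fun _ _ => (hf _).oddBr c (hg _)

theorem Rep.psi (c : ChartOver m U) {S : ℕ → Loc m r s (M → ℝ)}
    {T : ℕ → Loc m r s (smoothAlg m U)} (hS : ∀ k, Rep (S k) (T k)) (n : ℕ) :
    Rep (psi (xD c.x) S n) (psi c.D T n) :=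
  Rep.evenBrF c (fun k => Rep.delta.homog 1 k) hS n

theorem Rep.qHat (c : ChartOver m U) {S : ℕ → Loc m r s (M → ℝ)}
    {T : ℕ → Loc m r s (smoothAlg m U)} (hS : ∀ k, Rep (S k) (T k)) (hf : Rep f F) :
    Rep (qHat (xD c.x) S f) (qHat c.D T F) :=
  (Rep.evenBrF c (Rep.psi c hS) (fun k => hf.homog 0 k) 0).restr _

theorem Rep.koszul (c : ChartOver m U) {S : ℕ → Loc m r s (M → ℝ)}
    {T : ℕ → Loc m r s (smoothAlg m U)} (hS : ∀ k, Rep (S k) (T k)) (hf : Rep f F) (hg : Rep g G) :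
    Rep (koszul (xD c.x) S f g) (koszul c.D T F G) :=
  (Rep.evenBrF c (Rep.evenBrF c (Rep.psi c hS) (fun k => hf.homog 0 k))
    (fun k => hg.homog 0 k) 0).restr _

theorem Rep.interior (c : ChartOver m U) (hf : Rep f F) (hg : Rep g G) :
    Rep (interior (xD c.x) f g) (interior c.D F G) :=
  (Rep.evenBrF c (fun k => hf.inv.homog 1 k) (fun k => hg.homog 0 k) 0).restr _

theorem Rep.psiAt (c : ChartOver m U) {S : ℕ → Loc m r s (M → ℝ)}
    {T : ℕ → Loc m r s (smoothAlg m U)} (hS : ∀ k, Rep (S k) (T k)) (n : ℕ) :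
    Rep (psiAt (xD c.x) S n) (psiAt c.D T n) := Rep.delta.evenBr c (hS n)

theorem Rep.ternary (c : ChartOver m U) {S : ℕ → Loc m r s (M → ℝ)}
    {T : ℕ → Loc m r s (smoothAlg m U)} (hS : ∀ k, Rep (S k) (T k)) (hf : Rep f F) (hg : Rep g G)
    {h : Loc m r s (M → ℝ)} {H : Loc m r s (smoothAlg m U)} (hh : Rep h H) :
    Rep (ternary (xD c.x) S f g h) (ternary c.D T F G H) :=
  (((Rep.psiAt c hS 3).evenBr c hf).evenBr c hg).evenBr c hh

end Smooth

end

end WeakKoszul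


open scoped Manifold

namespace WeakKoszul

noncomputable section

set_option linter.unusedSectionVars false

/-! ### Changes of coordinates -/

section Transition

variable {m r s : ℕ} {K : Type*} [CommRing K] [Algebra ℝ K]

/-- A function on `𝓝` all of whose momentum derivatives vanish does not depend on the momenta. -/
theorem eq_zero_of_pd_mom (D : Fin m → K → K) {F : Loc m r s K} (hN : SuppIn (Involves OnN) F)
    (h1 : SuppIn (fun I n => wt momDeg I n = 1) F) (h : ∀ A, pd D (.mom, A) F = 0) : F = 0 := by
  refine (hN.and h1 |>.and fun I n hn => hn).eq_zero fun I n ⟨⟨hI, hw⟩, hn⟩ => ?_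
  have : ¬ ∀ v, momDeg v = 1 → (∀ ho, (⟨v, ho⟩ : OddVar m r s) ∉ I) ∧ ∀ he, n (⟨v, he⟩ : EvenVar m r s) = 0 := by
    intro h0
    have : wt momDeg I n = 0 := by
      refine wt_eq_zero_of_involves (p := fun v => momDeg v = 0) (fun _ h => h) ⟨?_, ?_⟩
      · intro v hv
        by_contra h2
        have : momDeg v.1 = 1 := by
          rcases v with ⟨⟨_ | _ | _ | _, A⟩, ho⟩ <;> simp_all [momDeg]
        exact (h0 _ this).1 v.2 hv
      · intro v hv
        by_contra h2
        have : momDeg v.1 = 1 := by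
          rcases v with ⟨⟨_ | _ | _ | _, A⟩, ho⟩ <;> simp_all [momDeg]
        exact Finsupp.mem_support_iff.1 hv ((h0 _ this).2 v.2)
    omega
  refine this fun v hv => ?_
  rcases v with ⟨_ | _ | _ | _, A⟩
  · simp [momDeg] at hv
  · have hA := h A
    refine ⟨fun ho hv => hn ?_, fun he => ?_⟩
    · have := congrFun hA (I.erase ⟨(.mom, A), ho⟩)
      rw [pd_odd D ho, pdOdd_apply, if_neg (by simp), Finset.insert_erase hv, Loc.zero_apply] at this
      have h3 : F I = 0 := by
        rw [before] at this
        rcases neg_one_pow_eq_or ℤ ((I.erase ⟨(.mom, A), ho⟩).filter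
          fun w => pos w < pos ⟨(.mom, A), ho⟩).card with h | h <;> rw [h] at this <;> simpa using this
      rw [h3, MvPolynomial.coeff_zero]
    · by_contra h0
      refine hn ?_
      have := congrArg (MvPolynomial.coeff (n - Finsupp.single ⟨(.mom, A), he⟩ 1)) (congrFun hA I)
      rw [pd_even D he.1 he.2, pdEven, MvPolynomial.coeff_pderiv, Loc.zero_apply,
        MvPolynomial.coeff_zero, tsub_add_cancel_of_le
          (Finsupp.single_le_iff.2 (Nat.one_le_iff_ne_zero.2 h0))] at this
      generalize (n - Finsupp.single (⟨(.mom, A), he⟩ : EvenVar m r s) 1 : EvenVar m r s →₀ ℕ)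
        ⟨(.mom, A), he⟩ = k at this
      -- The derivative multiplies the coefficient by the exponent k + 1, which is invertible in a
      -- real algebra.
      have h4 : ((k : ℝ) + 1) • (F I).coeff n = 0 := by
        rw [Algebra.smul_def, mul_comm, map_add, map_natCast, map_one]
        exact this
      have h5 : ((k : ℝ) + 1) ≠ 0 := by positivity
      have := congrArg (fun y => ((k : ℝ) + 1)⁻¹ • y) h4
      simpa [smul_smul, h5] using this
  · simp [momDeg] at hv
  · refine ⟨fun ho hv => ?_, fun he => ?_⟩
    · simpa [OnN] using hI.1 _ hv
    · by_contra h0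
      simpa [OnN] using hI.2 _ (Finsupp.mem_support_iff.2 h0)

theorem pd_delta (D : Fin m → K → K) [IsDer D] (A : Idx m r s) (k : Kind)
    (hk : k = .fld ∨ k = .mom) : pd D (k, A) (delta : Loc m r s K) = 0 := by
  rw [delta, pd_sum]
  refine Finset.sum_eq_zero fun B _ => ?_
  rw [pd_zsmul, pd_mul, pd_gen D _ _ rfl, pd_gen D _ _ rfl]
  rcases hk with rfl | rfl <;> simp

theorem sg_mul_self (b : Bool) : sg b * sg b = 1 := by cases b <;> rfl

/-- Two coordinate systems on the base, old and new, with inverse transition matrices of the odd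
fibre coordinates. The fields are the derivations by the coordinates, the coordinates themselves,
the matrix from the old to the new fibre coordinates, and its inverse. -/
structure Transition (m r s : ℕ) (K : Type*) [CommRing K] [Algebra ℝ K] where
  D : Fin m → K → K
  D' : Fin m → K → K
  x : Fin m → K
  x' : Fin m → K
  T : Fin r ⊕ Fin s → Fin r ⊕ Fin s → K
  T' : Fin r ⊕ Fin s → Fin r ⊕ Fin s → K
  isDer : IsDer D
  isDer' : IsDer D'
  D_x : ∀ i j, D i (x j) = if i = j then 1 else 0
  D'_x' : ∀ i j, D' i (x' j) = if i = j then 1 else 0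
  chain : ∀ i a, D i a = ∑ j, D i (x' j) * D' j a
  chain' : ∀ i a, D' i a = ∑ j, D' i (x j) * D j a
  T_mul_T' : ∀ A C, ∑ B, T A B * T' B C = if A = C then 1 else 0
  T'_mul_T : ∀ A C, ∑ B, T' A B * T B C = if A = C then 1 else 0

namespace Transition

variable (t : Transition m r s K)

instance : IsDer t.D := t.isDer
instance : IsDer t.D' := t.isDer'

/-- The new coordinates. -/
def newFld : Idx m r s → Loc m r s K
  | .inl i => coef (t.x' i)
  | .inr A => ∑ B, coef (t.T A B) * gen (.fld, .inr B)

/-- The new momenta. -/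
def newMom : Idx m r s → Loc m r s K
  | .inl i => ∑ j, coef (t.D' i (t.x j)) * gen (.mom, .inl j)
      + ∑ B, ∑ A, coef (t.D' i (t.T' B A)) * t.newFld (.inr A) * gen (.mom, .inr B)
  | .inr A => ∑ B, coef (t.T' B A) * gen (.mom, .inr B)

/-- The new coordinates of `ΠT𝓝`. -/
def newVar : Var m r s → Loc m r s K
  | (.fld, A) => t.newFld A
  | (.mom, A) => t.newMom A
  | (.vel, A) => Idx.sign A • evenBr t.D delta (t.newFld A)
  | (.mvel, A) => (-Idx.sign A) • evenBr t.D delta (t.newMom A)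

theorem par_newFld (A : Idx m r s) : Par (Idx.odd A) (t.newFld A) := by
  rcases A with i | A
  · exact par_coef _
  · exact Par.sum fun B _ => (par_coef _).mul (par_gen _)

theorem par_newMom (A : Idx m r s) : Par (!Idx.odd A) (t.newMom A) := by
  rcases A with i | A
  · refine Par.add (Par.sum fun B _ => ?_) (Par.sum fun B _ => Par.sum fun C _ => ?_)
    · exact (par_coef _).mul (par_gen _)
    · exact ((par_coef _).mul (t.par_newFld (.inr C))).mul (par_gen _)
  · exact Par.sum fun B _ => (par_coef _).mul (par_gen _)

theorem par_newVar (v : Var m r s) : Par (Var.odd v) (t.newVar v) := by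
  rcases v with ⟨_ | _ | _ | _, A⟩
  · exact t.par_newFld A
  · exact t.par_newMom A
  · convert (par_delta.evenBr t.D (t.par_newFld A)).zsmul (Idx.sign A) using 1
    · simp [Var.odd]
    · rfl
  · convert (par_delta.evenBr t.D (t.par_newMom A)).zsmul (-Idx.sign A) using 1
    · simp [Var.odd]
    · rfl

theorem suppIn_newFld (A : Idx m r s) : SuppIn (Involves OnExt) (t.newFld A) := by
  rcases A with i | A
  · exact SuppIn.coef _ (involves_empty _)
  · exact SuppIn.sum fun B _ =>
      (SuppIn.coef _ (involves_empty _)).mul_involves (SuppIn.gen_involves trivial)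

theorem newFld_onN (A : Idx m r s) : SuppIn (Involves OnN) (t.newFld A) :=
  (t.suppIn_newFld A).mono fun _ _ h => h.imp fun v hv => by
    rcases v with ⟨_ | _ | _ | _, A⟩ <;> simp_all [OnN, OnExt]

theorem newFld_onL (A : Idx m r s) : SuppIn (Involves OnL) (t.newFld A) :=
  (t.suppIn_newFld A).mono fun _ _ h => h.imp fun v hv => by
    rcases v with ⟨_ | _ | _ | _, A⟩ <;> simp_all [OnL, OnExt]

theorem newMom_onN (A : Idx m r s) : SuppIn (Involves OnN) (t.newMom A) := by
  have hc : ∀ a : K, SuppIn (Involves OnN) (coef a : Loc m r s K) := fun a =>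
    SuppIn.coef _ (involves_empty _)
  rcases A with i | A
  · refine (SuppIn.sum fun j _ => ?_).add (SuppIn.sum fun B _ => SuppIn.sum fun C _ => ?_)
    · exact (hc _).mul_involves (SuppIn.gen_involves trivial)
    · exact ((hc _).mul_involves (t.newFld_onN _)).mul_involves (SuppIn.gen_involves trivial)
  · exact SuppIn.sum fun B _ => (hc _).mul_involves (SuppIn.gen_involves trivial)

theorem newMom_momDeg (A : Idx m r s) : SuppIn (fun I n => wt momDeg I n = 1) (t.newMom A) := by
  have hc : ∀ a : K, SuppIn (fun I n => wt momDeg I n = 0) (coef a : Loc m r s K) := fun a =>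
    SuppIn.coef _ (wt_empty _)
  rcases A with i | A
  · refine (SuppIn.sum fun j _ => ?_).add (SuppIn.sum fun B _ => SuppIn.sum fun C _ => ?_)
    · exact (hc _).mul_wt (SuppIn.gen_wt momDeg _)
    · exact ((hc _).mul_wt (t.newFld_onL _).momDeg_zero).mul_wt (SuppIn.gen_wt momDeg _)
  · exact SuppIn.sum fun B _ => (hc _).mul_wt (SuppIn.gen_wt momDeg _)

/-- The derivatives by the new coordinates, on functions of `x`. -/
def baseD : Idx m r s → K → K
  | .inl i, a => t.D' i a
  | .inr _, _ => 0

theorem baseD_comm (A B : Idx m r s) (a : K) : t.baseD A (t.baseD B a) = t.baseD B (t.baseD A a) := by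
  rcases A with i | A <;> rcases B with j | B
  · exact IsDer.comm (D := t.D') i j a
  · exact IsDer.zero t.D' i
  · exact (IsDer.zero t.D' j).symm
  · rfl

theorem pd_coef_mul_gen {v u : Var m r s} (hv : Var.base v = false) (hu : Var.base u = false)
    (a : K) : pd t.D v (coef a * gen u) = if u = v then coef a else 0 := by
  rw [pd_coef_mul, pd_coef t.D hv, zero_mul, zero_add, pd_gen t.D v u hu]
  split_ifs <;> simp

theorem pd_mom_newFld_mul (C : Idx m r s) (B A : Fin r ⊕ Fin s) (a : K) :
    pd t.D (.mom, C) (coef a * t.newFld (.inr A) * gen (.mom, .inr B)) =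
      if .inr B = C then coef a * t.newFld (.inr A) else 0 := by
  have h : pd t.D (.mom, C) (coef a * t.newFld (.inr A)) = 0 :=
    pd_onL t.D ((SuppIn.coef a (involves_empty _)).mul_involves (t.newFld_onL _)) _ (by simp [OnL])
  rw [pd_mul, h, zero_mul, zero_add, pd_gen t.D _ _ rfl]
  split_ifs with h1 h2 h2
  · rw [Prod.mk.injEq] at h1
    rcases C with i | C
    · simp at h1
    · rw [mul_one]; rfl
  · exact absurd (Prod.mk.inj h1).2 h2
  · exact absurd (by rw [h2]) h1
  · rw [mul_zero]

/-- The coefficient of x*_j in the new momentum is ∂x^j/∂φ'^A: a momentum is the coordinate vector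
field ∂/∂φ'^A read as a function on 𝓝. -/
theorem pd_mom_newMom_inl (A : Idx m r s) (j : Fin m) :
    pd t.D (.mom, .inl j) (t.newMom A) = coef (t.baseD A (t.x j)) := by
  rcases A with i | A
  · rw [newMom, pd_add, pd_sum, pd_sum, Finset.sum_eq_single j]
    · rw [t.pd_coef_mul_gen rfl rfl, if_pos rfl, Finset.sum_eq_zero, add_zero]
      · rfl
      · intro B _
        rw [pd_sum]
        refine Finset.sum_eq_zero fun C _ => ?_
        rw [t.pd_mom_newFld_mul, if_neg (by simp)]
    · intro k _ hk
      rw [t.pd_coef_mul_gen rfl rfl, if_neg (by simp [hk])]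
    · simp
  · rw [newMom, pd_sum, Finset.sum_eq_zero]
    · exact coef_zero.symm
    · intro B _
      rw [t.pd_coef_mul_gen rfl rfl, if_neg (by simp)]

theorem pd_mom_newMom_inr_inl (i : Fin m) (C : Fin r ⊕ Fin s) :
    pd t.D (.mom, .inr C) (t.newMom (.inl i)) =
      ∑ A, coef (t.D' i (t.T' C A)) * t.newFld (.inr A) := by
  rw [newMom, pd_add, pd_sum, pd_sum, Finset.sum_eq_zero, zero_add, Finset.sum_eq_single C]
  · rw [pd_sum]
    refine Finset.sum_congr rfl fun A _ => ?_
    rw [t.pd_mom_newFld_mul, if_pos rfl]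
  · intro B _ hB
    rw [pd_sum]
    refine Finset.sum_eq_zero fun A _ => ?_
    rw [t.pd_mom_newFld_mul, if_neg (by simp [hB])]
  · simp
  · intro j _
    rw [t.pd_coef_mul_gen rfl rfl, if_neg (by simp)]

theorem pd_mom_newMom_inr_inr (A C : Fin r ⊕ Fin s) :
    pd t.D (.mom, .inr C) (t.newMom (.inr A)) = coef (t.T' C A) := by
  rw [newMom, pd_sum, Finset.sum_eq_single C]
  · rw [t.pd_coef_mul_gen rfl rfl, if_pos rfl]
  · intro B _ hB
    rw [t.pd_coef_mul_gen rfl rfl, if_neg (by simp [hB])]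
  · simp

theorem sum_coef_mul_newFld (a : Fin r ⊕ Fin s → K) :
    ∑ B, coef (a B) * t.newFld (.inr B) = ∑ C, coef (∑ B, a B * t.T B C) * gen (.fld, .inr C) := by
  simp only [newFld, Finset.mul_sum, coef_sum, Finset.sum_mul]
  rw [Finset.sum_comm]
  refine Finset.sum_congr rfl fun C _ => Finset.sum_congr rfl fun B _ => ?_
  rw [coef_mul, mul_assoc]

theorem old_fld (A : Fin r ⊕ Fin s) :
    (gen (.fld, .inr A) : Loc m r s K) = ∑ B, coef (t.T' A B) * t.newFld (.inr B) := by
  rw [t.sum_coef_mul_newFld, Finset.sum_eq_single A]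
  · rw [t.T'_mul_T, if_pos rfl, coef_one, one_mul]
  · intro C _ hC
    rw [t.T'_mul_T, if_neg hC.symm, coef_zero, zero_mul]
  · simp

/-- `{d F, f}` for a function `F` on `𝓝` and a function `f` of `x`. -/
theorem derived_coef {F : Loc m r s K} (hF : SuppIn (Involves OnN) F) (a : K) :
    evenBr t.D (evenBr t.D delta F) (coef a) =
      -∑ i, pd t.D (.mom, .inl i) F * coef (t.D i a) := by
  rw [evenBr_coef_right, ← Finset.sum_neg_distrib]
  refine Finset.sum_congr rfl fun i _ => ?_
  rw [rpd_mvel_evenBr_delta t.D hF]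
  simp [sign_eq_sg, Idx.odd]

/-- `{d F, z}` for a function `F` on `𝓝` and an odd coordinate `z`. -/
theorem derived_fld {F : Loc m r s K} (hF : SuppIn (Involves OnN) F) (A : Fin r ⊕ Fin s) :
    evenBr t.D (evenBr t.D delta F) (gen (.fld, .inr A)) = pd t.D (.mom, .inr A) (inv F) := by
  rw [evenBr_gen_right t.D _ _ rfl, conj, rpd_mvel_evenBr_delta t.D hF]
  simp [sign_eq_sg, Idx.odd, eps]

/-- The Hamiltonian derivation of the differential of a new momentum. -/
def mov (A : Idx m r s) : Loc m r s K → Loc m r s K :=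
  evenBr t.D (evenBr t.D delta (t.newMom A))

theorem par_dMom (A : Idx m r s) : Par (Idx.odd A) (evenBr t.D delta (t.newMom A)) := by
  convert par_delta.evenBr t.D (t.par_newMom A) using 1
  simp

theorem mov_coef (A : Idx m r s) (a : K) : t.mov A (coef a) = -coef (t.baseD A a) := by
  rw [mov, t.derived_coef (t.newMom_onN A)]
  congr 1
  simp only [t.pd_mom_newMom_inl, ← coef_mul, ← coef_sum]
  congr 1
  rcases A with i | A
  · exact (t.chain' i a).symm
  · simp [baseD]

/-- Up to sign `mov A` is ∂/∂φ'^A. For an even index and an odd coordinate, the x-dependence of the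
transition matrix is cancelled by the inhomogeneous term of the new momentum. -/
theorem mov_newFld (A B : Idx m r s) :
    t.mov A (t.newFld B) = if A = B then (-Idx.sign A) • 1 else 0 := by
  rcases B with j | B
  · rw [newFld, mov_coef]
    rcases A with i | A
    · rw [baseD, t.D'_x']
      by_cases h : i = j
      · subst h; simp [Idx.sign, Idx.odd, coef_one]
      · simp [h, coef_zero]
    · simp [baseD, coef_zero]
  · have h1 : t.mov A (t.newFld (.inr B)) = ∑ C, (-coef (t.baseD A (t.T B C)) * gen (.fld, .inr C)
        + coef (t.T B C) * t.mov A (gen (.fld, .inr C))) := by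
      rw [newFld, mov, evenBr_sum_right]
      refine Finset.sum_congr rfl fun C _ => ?_
      rw [evenBr_mul_right t.D (t.par_dMom A), tw_coef, ← mov, mov_coef]
    rw [h1]
    simp only [mov, t.derived_fld (t.newMom_onN _)]
    rcases A with i | A
    · have h2 : inv (t.newMom (.inl i)) = -t.newMom (.inl i) := (t.par_newMom (.inl i)).inv_eq_neg
      simp only [h2, pd_neg, t.pd_mom_newMom_inr_inl]
      rw [if_neg (by simp)]
      simp only [mul_neg, ← neg_add, neg_mul, Finset.sum_neg_distrib, neg_eq_zero,
        Finset.sum_add_distrib, Finset.mul_sum, ← mul_assoc, ← coef_mul]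
      rw [Finset.sum_comm (f := fun C A => coef (t.T B C * t.D' i (t.T' C A)) * t.newFld (.inr A))]
      simp only [← Finset.sum_mul, ← coef_sum]
      -- Differentiate T T' = 1.
      have h3 : ∀ A, ∑ C, t.T B C * t.D' i (t.T' C A) = -∑ C, t.D' i (t.T B C) * t.T' C A := by
        intro A
        have := congrArg (t.D' i) (t.T_mul_T' B A)
        rw [IsDer.sum t.D'] at this
        simp only [IsDer.mul, Finset.sum_add_distrib] at this
        rw [eq_neg_iff_add_eq_zero, add_comm, this]
        split_ifs
        · exact IsDer.one t.D' i
        · exact IsDer.zero t.D' i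
      simp only [h3, coef_neg, neg_mul, Finset.sum_neg_distrib]
      rw [t.sum_coef_mul_newFld, ← sub_eq_add_neg, sub_eq_zero]
      refine Finset.sum_congr rfl fun C _ => ?_
      congr 2
      simp only [Finset.sum_mul, mul_assoc]
      rw [Finset.sum_comm]
      simp only [← Finset.mul_sum, t.T'_mul_T]
      simp [baseD]
    · have h2 : inv (t.newMom (.inr A)) = t.newMom (.inr A) := (t.par_newMom (.inr A)).inv_eq_self
      simp only [h2, t.pd_mom_newMom_inr_inr, baseD, coef_zero, neg_zero, zero_mul, zero_add,
        ← coef_mul, ← coef_sum, t.T_mul_T']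
      by_cases h : A = B
      · subst h; simp [Idx.sign, Idx.odd, coef_one]
      · rw [if_neg (Ne.symm h), if_neg (by simp [h]), coef_zero]

theorem d_d (F : Loc m r s K) : evenBr t.D delta (evenBr t.D delta F) = 0 :=
  par_delta.evenBr_evenBr_self t.D (evenBr_delta_delta t.D) F

theorem evenBr_one (D : Fin m → K → K) [IsDer D] (F : Loc m r s K) : evenBr D F 1 = 0 := by
  rw [← coef_one, evenBr_coef_right]
  exact Finset.sum_eq_zero fun i _ => by rw [IsDer.one D i, coef_zero, mul_zero]

/-- `{dF, dG} = ± d{dF, G}`. -/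
theorem evenBr_d_d (F G : Loc m r s K) :
    evenBr t.D (inv (evenBr t.D delta F)) (evenBr t.D delta G) =
      evenBr t.D delta (evenBr t.D (evenBr t.D delta F) G) := by
  rw [par_delta.jacobi_odd t.D, t.d_d, evenBr_zero_left, zero_add]

/-- The derivation derived from {dφ*'_A, φ*'_B} is, up to sign, the supercommutator of `mov A` and
`mov B`. For two odd indices this is an anticommutator, for which commuting is not enough; hence the
second hypothesis. -/
theorem mov_mov (A B : Idx m r s) (H : Loc m r s K)
    (h : t.mov A (t.mov B H) = t.mov B (t.mov A H)) (h' : Idx.odd A = true → Idx.odd B = true →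
      t.mov A (t.mov B H) = 0) :
    evenBr t.D (evenBr t.D delta (t.mov A (t.newMom B))) H = 0 := by
  have h1 := t.evenBr_d_d (t.newMom A) (t.newMom B)
  rw [mov, ← h1, t.par_dMom A, evenBr_zsmul_left, evenBr_zsmul_left,
    evenBr_jacobi_homogeneous t.D (t.par_dMom A) (t.par_dMom B)]
  change _ • (t.mov A (t.mov B H) - _ • t.mov B (t.mov A H)) = 0
  rw [← h]
  rcases hA : Idx.odd A with _ | _
  · simp
  · rcases hB : Idx.odd B with _ | _
    · simp
    · rw [h' hA hB]; simp

theorem mov_zero (A : Idx m r s) : t.mov A 0 = 0 := evenBr_zero_right _ _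

theorem mov_mov_newFld (A B C : Idx m r s) : t.mov A (t.mov B (t.newFld C)) = 0 := by
  rw [mov_newFld]
  split_ifs
  · rw [mov, evenBr_zsmul_right, evenBr_one, smul_zero]
  · exact t.mov_zero A

theorem mov_mov_coef (A B : Idx m r s) (a : K) :
    t.mov A (t.mov B (coef a)) = coef (t.baseD A (t.baseD B a)) := by
  rw [mov_coef, mov, evenBr_neg_right, ← mov, mov_coef, neg_neg]

/-- The coordinate vector fields ∂/∂φ'^A supercommute. Their bracket is linear in the momenta and,
as a derivation, kills the coefficients and the new odd coordinates, hence also the old ones; by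
`eq_zero_of_pd_mom` it is zero. -/
theorem mov_newMom (A B : Idx m r s) : t.mov A (t.newMom B) = 0 := by
  have hd : SuppIn (fun I n => wt dDeg I n = 0) (t.mov A (t.newMom B)) := by
    have h : ∀ C, SuppIn (fun I n => wt dDeg I n = 0) (t.newMom C) := fun C =>
      (t.newMom_onN C).mono fun _ _ h => wt_eq_zero_of_involves (fun v hv => by
        rcases v with ⟨_ | _ | _ | _, A⟩ <;> simp_all [OnN, dDeg]) h
    refine SuppIn.evenBr_wt t.D (isDer_zero t.D) dDeg_base dDeg_conj (d := 1) ?_ (h B) (by ring)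
    exact (suppIn_delta dDeg 2 fun _ => rfl).evenBr_wt t.D (isDer_zero t.D) dDeg_base dDeg_conj
      (h A) (by ring)
  have hm : SuppIn (fun I n => wt momDeg I n = 1) (t.mov A (t.newMom B)) := by
    refine SuppIn.evenBr_wt t.D (isDer_zero t.D) momDeg_base momDeg_conj (d := 1) ?_
      (t.newMom_momDeg B) (by ring)
    exact (suppIn_delta momDeg 1 fun _ => rfl).evenBr_wt t.D (isDer_zero t.D) momDeg_base
      momDeg_conj (t.newMom_momDeg A) (by ring)
  have hN : SuppIn (Involves OnN) (t.mov A (t.newMom B)) := hd.mono fun _ _ h =>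
    (involves_of_wt_eq_zero (fun v => by
      rcases v with ⟨_ | _ | _ | _, A⟩ <;> simp [dDeg]) h).imp fun v hv => by
        rcases v with ⟨_ | _ | _ | _, A⟩ <;> simp_all [dDeg, OnN]
  have hc : ∀ a : K, evenBr t.D (evenBr t.D delta (t.mov A (t.newMom B))) (coef a) = 0 := by
    intro a
    refine t.mov_mov A B _ ?_ fun hA hB => ?_
    · rw [mov_mov_coef, mov_mov_coef, baseD_comm]
    · rw [mov_mov_coef]
      rcases A with i | A
      · simp [Idx.odd] at hA
      · exact coef_zero
  have hf : ∀ C, evenBr t.D (evenBr t.D delta (t.mov A (t.newMom B))) (t.newFld C) = 0 := by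
    intro C
    refine t.mov_mov A B _ ?_ fun hA hB => ?_ <;> simp only [mov_mov_newFld]
  refine eq_zero_of_pd_mom t.D hN hm fun C => ?_
  rcases C with j | C
  · have := hc (t.x j)
    rw [t.derived_coef hN, neg_eq_zero, Finset.sum_eq_single j] at this
    · rwa [t.D_x, if_pos rfl, coef_one, mul_one] at this
    · intro i _ hi
      rw [t.D_x, if_neg hi, coef_zero, mul_zero]
    · simp
  · have hp : Par (Idx.odd A ^^ !Idx.odd B) (t.mov A (t.newMom B)) :=
      (t.par_dMom A).evenBr t.D (t.par_newMom B)
    have hpd : Par (true ^^ (Idx.odd A ^^ !Idx.odd B))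
        (evenBr t.D delta (t.mov A (t.newMom B))) := par_delta.evenBr t.D hp
    have h0 : evenBr t.D (evenBr t.D delta (t.mov A (t.newMom B))) (gen (.fld, .inr C)) = 0 := by
      rw [t.old_fld, evenBr_sum_right]
      refine Finset.sum_eq_zero fun E _ => ?_
      rw [evenBr_mul_right t.D hpd, hc, hf, zero_mul, mul_zero, add_zero]
    rw [t.derived_fld hN] at h0
    have h1 : inv (inv (pd t.D (.mom, .inr C) (t.mov A (t.newMom B)))) = 0 := by
      rw [inv_pd, h0, smul_zero, inv_zero]
    rwa [inv_inv] at h1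

theorem dFld_onL (A : Idx m r s) : SuppIn (Involves OnL) (evenBr t.D delta (t.newFld A)) := by
  rw [← extD_eq t.D (t.newFld_onL A)]
  exact suppIn_extD (t.newFld_onL A)

theorem evenBr_comm {p q : Bool} {F G : Loc m r s K} (hF : Par p F) (hG : Par q G) :
    evenBr t.D F G = -(sg (q && p) • evenBr t.D G F) := by
  rw [evenBr_skew t.D hF, hG.tw_eq, evenBr_zsmul_left]

/-- Since φ' and φ*' commute on 𝓝, the Jacobi identity with Δ trades {dφ', φ*'} for {φ', dφ*'},
which `mov_newFld` computes. -/
theorem dFld_newMom (A B : Idx m r s) :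
    evenBr t.D (evenBr t.D delta (t.newFld A)) (t.newMom B) =
      if A = B then (-Idx.sign A) • 1 else 0 := by
  have h1 := par_delta.jacobi_odd t.D (t.newFld A) (t.newMom B)
  rw [evenBr_onN t.D (t.newFld_onN A) (t.newMom_onN B), evenBr_zero_right, t.par_newFld A,
    evenBr_zsmul_left, t.evenBr_comm (t.par_newFld A) (t.par_dMom B)] at h1
  rw [eq_neg_of_add_eq_zero_left h1.symm, ← mov, mov_newFld]
  by_cases h : A = B
  · subst h
    rw [if_pos rfl, sign_eq_sg]
    cases Idx.odd A <;> simp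
  · rw [if_neg h, if_neg (Ne.symm h)]; simp

/-- For the velocities, a bracket of two differentials is the differential of a bracket, which is
constant; so it vanishes. -/
theorem evenBr_newVar_mov (A : Idx m r s) (u : Var m r s) :
    t.mov A (t.newVar u) = if u = (.fld, A) then (-Idx.sign A) • 1 else 0 := by
  rcases u with ⟨_ | _ | _ | _, B⟩
  · rw [newVar, mov_newFld]
    by_cases h : A = B
    · simp [h]
    · simp [h, Ne.symm h]
  · rw [newVar, mov_newMom, if_neg (by simp)]
  · have h := t.evenBr_d_d (t.newMom A) (t.newFld B)
    rw [← mov, mov_newFld] at h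
    -- Inserting the square of a sign produces the parity involution in the first slot, the form in
    -- which `evenBr_d_d` applies.
    rw [newVar, mov, evenBr_zsmul_right, if_neg (by simp), ← one_smul ℤ (evenBr t.D delta (t.newMom A)),
      ← sg_mul_self (Idx.odd A), mul_smul, ← t.par_dMom A, evenBr_zsmul_left, h]
    split_ifs
    · rw [evenBr_zsmul_right, evenBr_one]; simp
    · rw [evenBr_zero_right]; simp
  · have h := t.evenBr_d_d (t.newMom A) (t.newMom B)
    rw [← mov, mov_newMom, evenBr_zero_right] at h
    rw [newVar, mov, evenBr_zsmul_right, if_neg (by simp), ← one_smul ℤ (evenBr t.D delta (t.newMom A)),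
      ← sg_mul_self (Idx.odd A), mul_smul, ← t.par_dMom A, evenBr_zsmul_left, h]
    simp

/-- The velocities dφ*' are left out because their brackets follow from `evenBr_newVar_mov` by
skew-symmetry. -/
theorem evenBr_newVar_dFld (A : Idx m r s) (u : Var m r s) (hu : ∀ B, u ≠ (.mvel, B)) :
    evenBr t.D (evenBr t.D delta (t.newFld A)) (t.newVar u) =
      if u = (.mom, A) then (-Idx.sign A) • 1 else 0 := by
  rcases u with ⟨_ | _ | _ | _, B⟩
  · rw [newVar, evenBr_onL t.D (t.dFld_onL A) (t.newFld_onL B), if_neg (by simp)]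
  · rw [newVar, dFld_newMom]
    by_cases h : A = B
    · simp [h]
    · simp [h, Ne.symm h]
  · rw [newVar, evenBr_zsmul_right, evenBr_onL t.D (t.dFld_onL A) (t.dFld_onL B),
      if_neg (by simp), smul_zero]
  · exact absurd rfl (hu B)

theorem evenBr_newVar_swap {v u : Var m r s}
    (h : evenBr t.D (t.newVar u) (t.newVar v) = if v = conj u then eps u • 1 else 0) :
    evenBr t.D (t.newVar v) (t.newVar u) = if u = conj v then eps v • 1 else 0 := by
  rw [t.evenBr_comm (t.par_newVar v) (t.par_newVar u), h]
  by_cases h1 : v = conj u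
  · subst h1
    rw [if_pos rfl, if_pos (conj_conj u).symm, eps_conj, odd_conj]
    cases Var.odd u <;> simp
  · rw [if_neg h1, if_neg, smul_zero, neg_zero]
    rintro rfl
    exact h1 (conj_conj v).symm

theorem evenBr_newVar_mvel (A : Idx m r s) (u : Var m r s) :
    evenBr t.D (t.newVar (.mvel, A)) (t.newVar u) =
      if u = conj (.mvel, A) then eps ((.mvel, A) : Var m r s) • 1 else 0 := by
  rw [newVar, evenBr_zsmul_left, ← mov, evenBr_newVar_mov, conj, eps]
  split_ifs
  · rw [smul_smul, sign_eq_sg]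
    cases Idx.odd A <;> simp
  · rw [smul_zero]

theorem evenBr_newVar_vel (A : Idx m r s) (u : Var m r s) :
    evenBr t.D (t.newVar (.vel, A)) (t.newVar u) =
      if u = conj (.vel, A) then eps ((.vel, A) : Var m r s) • 1 else 0 := by
  by_cases h : ∃ B, u = (.mvel, B)
  · obtain ⟨B, rfl⟩ := h
    exact t.evenBr_newVar_swap (t.evenBr_newVar_mvel B _)
  · rw [newVar, evenBr_zsmul_left, evenBr_newVar_dFld _ _ _ (by simpa using h), conj, eps]
    split_ifs
    · rw [smul_smul, sign_eq_sg]
      cases Idx.odd A <;> simp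
    · rw [smul_zero]

theorem newVar_onN {v : Var m r s} (hv : OnN v) : SuppIn (Involves OnN) (t.newVar v) := by
  rcases v with ⟨_ | _ | _ | _, A⟩
  · exact t.newFld_onN A
  · exact t.newMom_onN A
  · exact hv.elim
  · exact hv.elim

/-- The new coordinates are canonical. -/
theorem evenBr_newVar (v u : Var m r s) :
    evenBr t.D (t.newVar v) (t.newVar u) = if u = conj v then eps v • 1 else 0 := by
  by_cases hv : OnN v
  · by_cases hu : OnN u
    · rw [evenBr_onN t.D (t.newVar_onN hv) (t.newVar_onN hu), if_neg]
      rintro rfl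
      rcases v with ⟨_ | _ | _ | _, A⟩ <;> simp_all [OnN, conj]
    · refine t.evenBr_newVar_swap ?_
      rcases u with ⟨_ | _ | _ | _, A⟩
      · exact (hu trivial).elim
      · exact (hu trivial).elim
      · exact t.evenBr_newVar_vel A v
      · exact t.evenBr_newVar_mvel A v
  · rcases v with ⟨_ | _ | _ | _, A⟩
    · exact (hv trivial).elim
    · exact (hv trivial).elim
    · exact t.evenBr_newVar_vel A u
    · exact t.evenBr_newVar_mvel A u

theorem evenBr_newVar_coef (v : Var m r s) (a : K) :
    evenBr t.D (t.newVar v) (coef a) = eps v • pd t.D' (conj v) (coef a) := by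
  have hN : SuppIn (Involves OnN) (coef a : Loc m r s K) := SuppIn.coef a (involves_empty _)
  have hL : SuppIn (Involves OnL) (coef a : Loc m r s K) := SuppIn.coef a (involves_empty _)
  rcases v with ⟨_ | _ | _ | _, A⟩
  · rw [newVar, evenBr_onN t.D (t.newFld_onN A) hN, conj, pd_coef _ rfl, smul_zero]
  · rw [newVar, evenBr_onN t.D (t.newMom_onN A) hN, conj, pd_coef _ rfl, smul_zero]
  · rw [newVar, evenBr_zsmul_left, evenBr_onL t.D (t.dFld_onL A) hL, conj, pd_coef _ rfl, smul_zero,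
      smul_zero]
  · rw [newVar, evenBr_zsmul_left, ← mov, mov_coef, conj, eps]
    rcases A with i | A
    · rw [pd_fld_inl_coef]
      simp [Idx.sign, Idx.odd, baseD]
    · rw [pd_coef _ rfl, baseD, coef_zero]; simp

theorem subst_newVar_gen (v : Var m r s) (hv : Var.base v = false) :
    subst t.newVar (gen v) = t.newVar v := subst_gen (fun v _ => t.par_newVar v) v hv

theorem subst_newVar_coef (a : K) : subst t.newVar (coef a) = coef a :=
  subst_coef a

theorem subst_newVar_mul (F G : Loc m r s K) :
    subst t.newVar (F * G) = subst t.newVar F * subst t.newVar G :=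
  subst_mul (fun v _ => t.par_newVar v) F G

theorem subst_newVar_inv (F : Loc m r s K) : inv (subst t.newVar F) = subst t.newVar (inv F) :=
  inv_subst (fun v _ => t.par_newVar v) F

theorem subst_newVar_tw (b : Bool) (F : Loc m r s K) :
    tw b (subst t.newVar F) = subst t.newVar (tw b F) := by
  cases b
  · rfl
  · exact t.subst_newVar_inv F

theorem subst_newVar_zsmul (k : ℤ) (F : Loc m r s K) :
    subst t.newVar (k • F) = k • subst t.newVar F :=
  map_zsmul (substHom t.newVar fun v _ => t.par_newVar v) k F

theorem subst_newVar_sum {ι : Type*} (u : Finset ι) (F : ι → Loc m r s K) :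
    subst t.newVar (∑ i ∈ u, F i) = ∑ i ∈ u, subst t.newVar (F i) :=
  map_sum (substHom t.newVar fun v _ => t.par_newVar v) F u

theorem par_subst {p : Bool} {F : Loc m r s K} (hF : Par p F) : Par p (subst t.newVar F) := by
  rw [Par, t.subst_newVar_inv, hF, subst_newVar_zsmul]

/-- Both sides are derivations in `G` along the substitution, so they agree once they agree on
coefficients and generators. -/
theorem evenBr_subst_of_gen {p : Bool} {F : Loc m r s K} (hF : Par p F)
    (hc : ∀ a, evenBr t.D (subst t.newVar F) (coef a) = subst t.newVar (evenBr t.D' F (coef a)))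
    (hg : ∀ v, Var.base v = false →
      evenBr t.D (subst t.newVar F) (t.newVar v) = subst t.newVar (evenBr t.D' F (gen v)))
    (G : Loc m r s K) :
    evenBr t.D (subst t.newVar F) (subst t.newVar G) = subst t.newVar (evenBr t.D' F G) := by
  induction G using Loc.induction with
  | hc a => rw [subst_newVar_coef, hc]
  | hadd G₁ G₂ h₁ h₂ => rw [subst_add, evenBr_add_right, evenBr_add_right, h₁, h₂, subst_add]
  | hgen v hv G h =>
    rw [t.subst_newVar_mul, evenBr_mul_right t.D (t.par_subst hF), h, t.subst_newVar_gen v hv, hg v hv,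
      evenBr_mul_right t.D' hF, subst_add, t.subst_newVar_mul, t.subst_newVar_mul,
      ← t.subst_newVar_tw, t.subst_newVar_gen v hv]

/-- Brackets of an arbitrary function with coefficients or generators are, by skew-symmetry,
brackets with these in the first slot. So this case and `evenBr_subst_gen` come before the general
statement. -/
theorem evenBr_subst_coef (a : K) (G : Loc m r s K) :
    evenBr t.D (coef a) (subst t.newVar G) = subst t.newVar (evenBr t.D' (coef a) G) := by
  have h0 : subst t.newVar (0 : Loc m r s K) = 0 := by
    rw [← coef_zero, subst_newVar_coef]
  have hL : ∀ b : K, SuppIn (Involves OnL) (coef b : Loc m r s K) := fun b =>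
    SuppIn.coef b (involves_empty _)
  have := t.evenBr_subst_of_gen (par_coef a) (fun b => ?_) (fun v hv => ?_) G
  · rwa [subst_newVar_coef] at this
  · rw [subst_newVar_coef, evenBr_onL t.D (hL a) (hL b), evenBr_onL t.D' (hL a) (hL b), h0]
  · rw [subst_newVar_coef, evenBr_skew t.D (par_coef a), evenBr_skew t.D' (par_coef a), tw_false,
      tw_false, evenBr_newVar_coef, evenBr_gen_left t.D' v hv]
    by_cases hb : Var.base (conj v) = false
    · rw [pd_coef _ hb, smul_zero, neg_zero, h0]
    · obtain ⟨i, hi⟩ := eq_fld_inl_of_base (by simpa using hb)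
      rw [hi, pd_fld_inl_coef, ← neg_smul, subst_newVar_zsmul, subst_newVar_coef]

theorem evenBr_subst_gen (v : Var m r s) (hv : Var.base v = false) (G : Loc m r s K) :
    evenBr t.D (t.newVar v) (subst t.newVar G) = subst t.newVar (evenBr t.D' (gen v) G) := by
  have h0 : subst t.newVar (0 : Loc m r s K) = 0 := by
    rw [← coef_zero, subst_newVar_coef]
  have := t.evenBr_subst_of_gen (par_gen v) (fun b => ?_) (fun u hu => ?_) G
  · rwa [t.subst_newVar_gen v hv] at this
  · rw [t.subst_newVar_gen v hv, evenBr_skew t.D (t.par_newVar v), tw_coef,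
      ← t.subst_newVar_gen v hv, evenBr_subst_coef, evenBr_skew t.D' (par_gen v), tw_coef,
      ← neg_one_smul ℤ, ← neg_one_smul ℤ (evenBr t.D' _ _), subst_newVar_zsmul]
  · rw [t.subst_newVar_gen v hv, evenBr_newVar, evenBr_gen_left t.D' v hv, pd_gen _ _ _ hu,
      subst_newVar_zsmul]
    split_ifs
    · rw [← coef_one, subst_newVar_coef]
    · rw [h0, smul_zero]

/-- A change of coordinates preserves the even bracket. -/
theorem evenBr_subst (F G : Loc m r s K) :
    evenBr t.D (subst t.newVar F) (subst t.newVar G) = subst t.newVar (evenBr t.D' F G) := by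
  induction F using parity_induction with
  | hadd F₁ F₂ h₁ h₂ => rw [subst_add, evenBr_add_left, evenBr_add_left, h₁, h₂, subst_add]
  | hpar p F hF =>
    refine t.evenBr_subst_of_gen hF (fun a => ?_) (fun v hv => ?_) G
    · rw [evenBr_skew t.D (t.par_subst hF), tw_coef, evenBr_subst_coef,
        evenBr_skew t.D' hF, tw_coef, ← neg_one_smul ℤ, ← neg_one_smul ℤ (evenBr t.D' _ _),
        subst_newVar_zsmul]
    · rw [evenBr_skew t.D (t.par_subst hF), (t.par_newVar v).tw_eq, evenBr_zsmul_left,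
        t.evenBr_subst_gen v hv, evenBr_skew t.D' hF, (par_gen v).tw_eq, evenBr_zsmul_left,
        ← neg_one_smul ℤ, ← neg_one_smul ℤ (_ • evenBr t.D' _ _), subst_newVar_zsmul,
        subst_newVar_zsmul]

theorem evenBr_delta_coef (D : Fin m → K → K) [IsDer D] (a : K) :
    evenBr D delta (coef a : Loc m r s K) = ∑ i, gen (.vel, .inl i) * coef (D i a) := by
  rw [evenBr_coef_right]
  refine Finset.sum_congr rfl fun i _ => ?_
  rw [rpd_delta_mvel]
  simp [Idx.sign, Idx.odd]

/-- A change of coordinates commutes with the differential `{Δ, -}`. -/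
theorem evenBr_delta_subst (F : Loc m r s K) :
    evenBr t.D delta (subst t.newVar F) = subst t.newVar (evenBr t.D' delta F) := by
  induction F using Loc.induction with
  | hc a =>
    rw [subst_newVar_coef, evenBr_delta_coef, evenBr_delta_coef, subst_newVar_sum]
    have hg : ∀ i, subst t.newVar (gen (.vel, .inl i) : Loc m r s K) = t.newVar (.vel, .inl i) :=
      fun i => t.subst_newVar_gen _ rfl
    simp only [t.subst_newVar_mul, t.subst_newVar_coef, hg, newVar, newFld, evenBr_delta_coef, Idx.sign, Idx.odd, Finset.smul_sum, Finset.sum_mul]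
    rw [Finset.sum_comm]
    refine Finset.sum_congr rfl fun j _ => ?_
    -- The chain rule: dx^j ∂_j a and dx'^i ∂'_i a are the same differential.
    rw [t.chain j a, coef_sum, Finset.mul_sum]
    refine Finset.sum_congr rfl fun i _ => ?_
    simp [coef_mul, mul_assoc]
  | hadd F₁ F₂ h₁ h₂ => rw [subst_add, evenBr_add_right, evenBr_add_right, h₁, h₂, subst_add]
  | hgen v hv F h =>
    have h0 : subst t.newVar (0 : Loc m r s K) = 0 := by
      rw [← coef_zero, subst_newVar_coef]
    have hv' : evenBr t.D delta (t.newVar v) = subst t.newVar (evenBr t.D' delta (gen v)) := by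
      rw [evenBr_gen_right _ _ _ hv, subst_newVar_zsmul]
      rcases v with ⟨_ | _ | _ | _, A⟩
      · rw [conj, eps, rpd_delta_mvel, subst_newVar_zsmul, t.subst_newVar_gen _ rfl, newVar, newVar,
          smul_smul, smul_smul, sign_eq_sg]
        cases Idx.odd A <;> simp
      · rw [conj, eps, rpd_delta_vel, subst_newVar_zsmul, t.subst_newVar_gen _ rfl, newVar, newVar,
          smul_smul, smul_smul, sign_eq_sg]
        cases Idx.odd A <;> simp
      · rw [conj, rpd_eq, pd_delta _ _ _ (by simp), tw_zero, h0, smul_zero, newVar,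
          evenBr_zsmul_right, d_d, smul_zero]
      · rw [conj, rpd_eq, pd_delta _ _ _ (by simp), tw_zero, h0, smul_zero, newVar,
          evenBr_zsmul_right, d_d, smul_zero]
    rw [t.subst_newVar_mul, evenBr_mul_right t.D par_delta, h, t.subst_newVar_gen v hv, hv',
      evenBr_mul_right t.D' par_delta, subst_add, t.subst_newVar_mul, t.subst_newVar_mul,
      ← t.subst_newVar_tw, t.subst_newVar_gen v hv]

/-! ### Submanifolds independent of the choice of coordinates -/

/-- The number of odd coordinates, with momenta counted negatively. -/
def fibDeg : Var m r s → ℤ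
  | (.fld, .inr _) => 1
  | (.vel, .inr _) => 1
  | (.mom, .inr _) => -1
  | (.mvel, .inr _) => -1
  | _ => 0

/-- The momenta are counted negatively so that conjugate pairs have degree zero; the bracket, and
with Δ also {Δ, -}, then preserves this degree. -/
theorem fibDeg_conj (v : Var m r s) : fibDeg v + fibDeg (conj v) = 0 := by
  rcases v with ⟨_ | _ | _ | _, _ | _⟩ <;> rfl

theorem newMom_not_onL (A : Idx m r s) : SuppIn (fun I n => ¬Involves OnL I n) (t.newMom A) :=
  (t.newMom_momDeg A).mono fun I n h h' => by
    rw [wt_eq_zero_of_involves (fun v hv => (momDeg_eq_zero_iff v).2 hv) h'] at h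
    exact absurd h (by norm_num)

theorem dMom_not_onL (A : Idx m r s) :
    SuppIn (fun I n => ¬Involves OnL I n) (evenBr t.D delta (t.newMom A)) :=
  ((suppIn_delta momDeg 1 fun _ => rfl).evenBr_wt t.D (isDer_zero t.D) momDeg_base
    momDeg_conj (t.newMom_momDeg A) (f := 1) (by ring)).mono fun I n h h' => by
    rw [wt_eq_zero_of_involves (fun v hv => (momDeg_eq_zero_iff v).2 hv) h'] at h
    exact absurd h (by norm_num)

theorem dFld_dDeg (A : Idx m r s) :
    SuppIn (fun I n => wt dDeg I n = 1) (evenBr t.D delta (t.newFld A)) :=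
  (suppIn_delta dDeg 2 fun _ => rfl).evenBr_wt t.D (isDer_zero t.D) dDeg_base dDeg_conj
    ((t.newFld_onN A).mono fun _ _ h => wt_eq_zero_of_involves (fun v hv => by
        rcases v with ⟨_ | _ | _ | _, A⟩ <;> simp_all [OnN, dDeg]) h) (by ring)

theorem newFld_fibDeg (A : Fin r ⊕ Fin s) :
    SuppIn (fun I n => wt fibDeg I n = 1) (t.newFld (.inr A)) :=
  SuppIn.sum fun _ _ =>
    (SuppIn.coef (P := fun I n => wt fibDeg I n = 0) _ (wt_empty _)).mul_wt (SuppIn.gen_wt fibDeg _)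

theorem dFld_fibDeg (A : Fin r ⊕ Fin s) :
    SuppIn (fun I n => wt fibDeg I n = 1) (evenBr t.D delta (t.newFld (.inr A))) :=
  (suppIn_delta fibDeg 0 fun A => by rcases A with i | A <;> rfl).evenBr_wt t.D (isDer_zero t.D)
    (fun _ => rfl) fibDeg_conj (t.newFld_fibDeg A) (by ring)

theorem not_onTM_of_fibDeg {F : Loc m r s K} (h : SuppIn (fun I n => wt fibDeg I n = 1) F) :
    SuppIn (fun I n => ¬Involves OnTM I n) F :=
  h.mono fun I n h h' => by
    rw [wt_eq_zero_of_involves (fun v hv => by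
      rcases v with ⟨_ | _ | _ | _, _ | _⟩ <;> simp_all [OnTM, fibDeg]) h'] at h
    exact absurd h (by norm_num)

/-- Submanifolds that do not depend on the choice of coordinates. -/
def Invariant (p : Var m r s → Prop) : Prop :=
  ∀ F : Loc m r s K, restr p (subst t.newVar F) = subst t.newVar (restr p F)

/-- The new coordinates that survive on the submanifold must involve only surviving old ones, and
every monomial of a vanishing new coordinate must contain a vanishing old one. -/
theorem invariant_of {p : Var m r s → Prop}
    (h1 : ∀ v, Var.base v = false → p v → SuppIn (Involves p) (t.newVar v))
    (h2 : ∀ v, Var.base v = false → ¬p v → SuppIn (fun I n => ¬Involves p I n) (t.newVar v)) :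
    t.Invariant p := fun F =>
  restr_subst (fun v _ => t.par_newVar v) p (fun v hb hv => (h1 v hb hv).restr_eq_self)
    (fun v hb hv => (h2 v hb hv).restr_eq_zero) F

theorem invariant_onL : t.Invariant OnL := by
  refine t.invariant_of (fun v _ hv => ?_) fun v _ hv => ?_
  · rcases v with ⟨_ | _ | _ | _, A⟩
    · exact t.newFld_onL A
    · exact hv.elim
    · exact (t.dFld_onL A).zsmul _
    · exact hv.elim
  · rcases v with ⟨_ | _ | _ | _, A⟩
    · exact (hv trivial).elim
    · exact t.newMom_not_onL A
    · exact (hv trivial).elim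
    · exact (t.dMom_not_onL A).zsmul _

theorem invariant_onExt : t.Invariant OnExt := by
  have hE : ∀ {I : Finset (OddVar m r s)} {n}, Involves OnExt I n → Involves OnL I n :=
    fun h => h.imp fun v hv => by rcases v with ⟨_ | _ | _ | _, A⟩ <;> simp_all [OnL, OnExt]
  refine t.invariant_of (fun v _ hv => ?_) fun v _ hv => ?_
  · rcases v with ⟨_ | _ | _ | _, A⟩
    · exact t.suppIn_newFld A
    · exact hv.elim
    · exact hv.elim
    · exact hv.elim
  · rcases v with ⟨_ | _ | _ | _, A⟩
    · exact (hv trivial).elim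
    · exact (t.newMom_not_onL A).mono fun I n h h' => h (hE h')
    · refine ((t.dFld_dDeg A).mono fun I n h h' => ?_).zsmul _
      rw [wt_eq_zero_of_involves (fun v hv => by
        rcases v with ⟨_ | _ | _ | _, A⟩ <;> simp_all [OnExt, dDeg]) h'] at h
      exact absurd h (by norm_num)
    · exact ((t.dMom_not_onL A).mono fun I n h h' => h (hE h')).zsmul _

theorem invariant_onTM : t.Invariant OnTM := by
  have hE : ∀ {I : Finset (OddVar m r s)} {n}, Involves OnTM I n → Involves OnL I n :=
    fun h => h.imp fun v hv => by rcases v with ⟨_ | _ | _ | _, _ | _⟩ <;> simp_all [OnL, OnTM]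
  refine t.invariant_of (fun v hb hv => ?_) fun v _ hv => ?_
  · rcases v with ⟨_ | _ | _ | _, i | A⟩
    · simp [Var.base] at hb
    · exact hv.elim
    · exact hv.elim
    · exact hv.elim
    · rw [newVar, newFld, evenBr_delta_coef]
      exact (SuppIn.sum fun j _ => (SuppIn.gen_involves trivial).mul_involves
        (SuppIn.coef _ (involves_empty _))).zsmul _
    · exact hv.elim
    · exact hv.elim
    · exact hv.elim
  · rcases v with ⟨_ | _ | _ | _, A⟩
    · rcases A with i | A
      · exact (hv trivial).elim
      · exact not_onTM_of_fibDeg (t.newFld_fibDeg A)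
    · exact (t.newMom_not_onL A).mono fun I n h h' => h (hE h')
    · rcases A with i | A
      · exact (hv trivial).elim
      · exact (not_onTM_of_fibDeg (t.dFld_fibDeg A)).zsmul _
    · exact ((t.dMom_not_onL A).mono fun I n h h' => h (hE h')).zsmul _

end Transition

end Transition

end

end WeakKoszul


open scoped Manifold

namespace WeakKoszul

noncomputable section

set_option linter.unusedSectionVars false

/-! ### Transition functions of charts -/

section Bundle

variable {m k : ℕ} {M : Type*} [TopologicalSpace M] [ChartedSpace (EuclideanSpace ℝ (Fin m)) M]
  {E : M → Type*} [TopologicalSpace (Bundle.TotalSpace (Fin k → ℝ) E)]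
  [∀ p, AddCommGroup (E p)] [∀ p, Module ℝ (E p)]
  [∀ p, TopologicalSpace (E p)] [FiberBundle (Fin k → ℝ) E] [VectorBundle ℝ (Fin k → ℝ) E]
  (e e' : Bundle.Trivialization (Fin k → ℝ)
    (Bundle.TotalSpace.proj : Bundle.TotalSpace (Fin k → ℝ) E → M))
  [MemTrivializationAtlas e] [MemTrivializationAtlas e']

theorem coordChange_eq {p : M} (hp : p ∈ e.baseSet ∩ e'.baseSet) (v : Fin k → ℝ) :
    e.coordChange e' p v = e.coordChangeL ℝ e' p v :=
  (e.coordChangeL_apply' e' hp v).symm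

theorem smoothOn_coordChange [ContMDiffVectorBundle ((⊤ : ℕ∞) : WithTop ℕ∞) (Fin k → ℝ) E (𝓡 m)]
    (a b : Fin k) :
    SmoothOn m (e.baseSet ∩ e'.baseSet) fun p => e.coordChange e' p (Pi.single b 1) a := by
  have h := contMDiffOn_coordChangeL (IB := 𝓡 m) (n := ((⊤ : ℕ∞) : WithTop ℕ∞)) e e'
  let φ : ((Fin k → ℝ) →L[ℝ] (Fin k → ℝ)) →L[ℝ] ℝ :=
    (ContinuousLinearMap.proj a).comp (ContinuousLinearMap.apply ℝ (Fin k → ℝ) (Pi.single b 1))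
  have h2 := (φ.contMDiff (n := ((⊤ : ℕ∞) : WithTop ℕ∞))).comp_contMDiffOn h
  refine h2.congr fun p hp => ?_
  rw [coordChange_eq e e' hp]
  rfl

/-- The two coordinate changes are inverse linear maps; expanding in the standard basis gives
inverse matrices. -/
theorem coordChange_mul {p : M} (hp : p ∈ e.baseSet ∩ e'.baseSet) (a c : Fin k) :
    ∑ b, e.coordChange e' p (Pi.single b 1) a * e'.coordChange e p (Pi.single c 1) b =
      if a = c then 1 else 0 := by
  have h1 : e.coordChange e' p (e'.coordChange e p (Pi.single c 1)) = Pi.single c 1 := by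
    rw [e'.coordChange_coordChange e e' hp.2 hp.1, e'.coordChange_same_apply hp.2]
  generalize e'.coordChange e p (Pi.single c 1) = v at h1
  have h2 : v = ∑ b, v b • (Pi.single b 1 : Fin k → ℝ) := by
    ext i
    simp [Finset.sum_apply, Pi.single_apply]
  rw [h2, coordChange_eq e e' hp, map_sum] at h1
  have h3 := congrFun h1 a
  simp only [map_smul, Finset.sum_apply, Pi.smul_apply, smul_eq_mul, Pi.single_apply] at h3
  rw [← h3]
  refine Finset.sum_congr rfl fun b _ => ?_
  rw [coordChange_eq e e' hp, mul_comm]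

end Bundle

/-! ### Charts as transition data over the intersections of their domains -/

section Charts

variable {m r s : ℕ}
  {M : Type*} [TopologicalSpace M] [ChartedSpace (EuclideanSpace ℝ (Fin m)) M]
  [IsManifold (𝓡 m) ((⊤ : ℕ∞) : WithTop ℕ∞) M]
  {E : M → Type*} [TopologicalSpace (Bundle.TotalSpace (Fin r → ℝ) E)]
  [∀ p, AddCommGroup (E p)] [∀ p, Module ℝ (E p)]
  [∀ p, TopologicalSpace (E p)] [FiberBundle (Fin r → ℝ) E]
  [VectorBundle ℝ (Fin r → ℝ) E]
  [ContMDiffVectorBundle ((⊤ : ℕ∞) : WithTop ℕ∞) (Fin r → ℝ) E (𝓡 m)]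
  {F : M → Type*} [TopologicalSpace (Bundle.TotalSpace (Fin s → ℝ) F)]
  [∀ p, AddCommGroup (F p)] [∀ p, Module ℝ (F p)]
  [∀ p, TopologicalSpace (F p)] [FiberBundle (Fin s → ℝ) F]
  [VectorBundle ℝ (Fin s → ℝ) F]
  [ContMDiffVectorBundle ((⊤ : ℕ∞) : WithTop ℕ∞) (Fin s → ℝ) F (𝓡 m)]
  {U : Set M} (c c' : Chart (m := m) (r := r) (s := s) M E F)

theorem Chart.isOpen_dom : IsOpen c.dom :=
  (c.x.open_source.inter c.trE.open_baseSet).inter c.trF.open_baseSet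

theorem Chart.dom_subset : c.dom ⊆ c.x.source := fun _ h => h.1.1

/-- The coordinates of a chart over an open subset of its domain. -/
def Chart.over (hU : IsOpen U) (h : U ⊆ c.dom) : ChartOver m U where
  x := c.x
  mem_x := c.mem_x
  isOpen := hU
  subset := h.trans c.dom_subset

/-- The coordinates of a chart over its domain. -/
def Chart.self : ChartOver m c.dom := c.over c.isOpen_dom le_rfl

theorem Chart.smoothOn_trans (h : U ⊆ c.dom) (h' : U ⊆ c'.dom) (A B : Fin r ⊕ Fin s) :
    SmoothOn m U (c.trans c' A B) := by
  have := c.mem_trE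
  have := c'.mem_trE
  have := c.mem_trF
  have := c'.mem_trF
  rcases A with a | a <;> rcases B with b | b
  · exact (smoothOn_coordChange c.trE c'.trE a b).mono fun p hp => ⟨(h hp).1.2, (h' hp).1.2⟩
  · exact contMDiffOn_const (c := (0 : ℝ))
  · exact contMDiffOn_const (c := (0 : ℝ))
  · exact (smoothOn_coordChange c.trF c'.trF a b).mono fun p hp => ⟨(h hp).2, (h' hp).2⟩

theorem Chart.trans_mul_trans {p : M} (h : p ∈ c.dom) (h' : p ∈ c'.dom) (A C : Fin r ⊕ Fin s) :
    ∑ B, c.trans c' A B p * c'.trans c B C p = if A = C then 1 else 0 := by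
  have := c.mem_trE
  have := c'.mem_trE
  have := c.mem_trF
  have := c'.mem_trF
  rw [Fintype.sum_sum_type]
  rcases A with a | a <;> rcases C with d | d
  · have := coordChange_mul c.trE c'.trE ⟨h.1.2, h'.1.2⟩ a d
    simpa [Chart.trans] using this
  · simp [Chart.trans]
  · simp [Chart.trans]
  · have := coordChange_mul c.trF c'.trF ⟨h.2, h'.2⟩ a d
    simpa [Chart.trans] using this

/-- The change of coordinates between two charts. -/
def Chart.transition (hU : IsOpen U) (h : U ⊆ c.dom) (h' : U ⊆ c'.dom) :
    Transition m r s (smoothAlg m U) where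
  D := (c.over hU h).D
  D' := (c'.over hU h').D
  x := (c.over hU h).coord
  x' := (c'.over hU h').coord
  T A B := toSmooth (c.trans c' A B) (c.smoothOn_trans c' h h' A B)
  T' A B := toSmooth (c'.trans c A B) (c'.smoothOn_trans c h' h A B)
  isDer := inferInstance
  isDer' := inferInstance
  D_x := (c.over hU h).D_coord
  D'_x' := (c'.over hU h').D_coord
  chain := (c'.over hU h').chain (c.over hU h)
  chain' := (c.over hU h).chain (c'.over hU h')
  T_mul_T' A C := by
    ext p
    have := c.trans_mul_trans c' (h p.2) (h' p.2) A C
    simp only [AddSubmonoidClass.coe_finsetSum, Finset.sum_apply, MulMemClass.coe_mul, Pi.mul_apply]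
    refine this.trans ?_
    split_ifs <;> rfl
  T'_mul_T A C := by
    ext p
    have := c'.trans_mul_trans c (h' p.2) (h p.2) A C
    simp only [AddSubmonoidClass.coe_finsetSum, Finset.sum_apply, MulMemClass.coe_mul, Pi.mul_apply]
    refine this.trans ?_
    split_ifs <;> rfl

theorem Chart.rep_newFld (hU : IsOpen U) (h : U ⊆ c.dom) (h' : U ⊆ c'.dom) (A : Idx m r s) :
    Rep (c.newFld c' A) ((c.transition c' hU h h').newFld A) := by
  rcases A with i | A
  · exact Rep.coef fun _ => rfl
  · exact Rep.sum fun B _ => (Rep.coef fun _ => rfl).mul (Rep.gen _)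

theorem Chart.rep_newMom (hU : IsOpen U) (h : U ⊆ c.dom) (h' : U ⊆ c'.dom) (A : Idx m r s) :
    Rep (c.newMom c' A) ((c.transition c' hU h h').newMom A) := by
  have hD : ∀ (i : Fin m) (g : M → ℝ) (hg : SmoothOn m U g) (p : U),
      c'.D i g p = ((c'.over hU h').D i (toSmooth g hg)).1 p := fun i g hg p =>
    ((c'.over hU h').D_apply i (fun _ => rfl) p).symm
  rcases A with i | A
  · refine (Rep.sum fun j _ => ?_).add (Rep.sum fun B _ => Rep.sum fun C _ => ?_)
    · exact (Rep.coef (hD i _ (smoothOn_coord c.mem_x (h.trans c.dom_subset) j))).mul (Rep.gen _)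
    · exact ((Rep.coef (hD i _ (c'.smoothOn_trans c h' h B C))).mul (c.rep_newFld c' hU h h' _)).mul (Rep.gen _)
  · exact Rep.sum fun B _ => (Rep.coef fun _ => rfl).mul (Rep.gen _)

theorem Chart.rep_newVar (hU : IsOpen U) (h : U ⊆ c.dom) (h' : U ⊆ c'.dom) (v : Var m r s) :
    Rep (c.newVar c' v) ((c.transition c' hU h h').newVar v) := by
  rcases v with ⟨_ | _ | _ | _, A⟩
  · exact c.rep_newFld c' hU h h' A
  · exact c.rep_newMom c' hU h h' A
  · exact (Rep.delta.evenBr (c.over hU h) (c.rep_newFld c' hU h h' A)).zsmul _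
  · exact (Rep.delta.evenBr (c.over hU h) (c.rep_newMom c' hU h h' A)).zsmul _

/-! ### Global functions -/

variable {f g ω τ X : Fam m r s M E F}

/-- The local expressions over the intersection of two charts. -/
structure Overlap (f : Fam m r s M E F) (c c' : Chart (m := m) (r := r) (s := s) M E F)
    (t : Transition m r s (smoothAlg m (c.dom ∩ c'.dom)))
    (G G' : Loc m r s (smoothAlg m (c.dom ∩ c'.dom))) : Prop where
  rep : Rep (f c) G
  rep' : Rep (f c') G'
  eq : G = subst t.newVar G'

/-- The change of coordinates on the intersection of two charts. -/
abbrev Chart.tr (c c' : Chart (m := m) (r := r) (s := s) M E F) :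
    Transition m r s (smoothAlg m (c.dom ∩ c'.dom)) :=
  c.transition c' (c.isOpen_dom.inter c'.isOpen_dom) Set.inter_subset_left Set.inter_subset_right

/-- Turns the pointwise definition of a global function into identities over `smoothAlg`, to which
the results on `Transition` apply. -/
theorem isGlobal_iff : IsGlobal f ↔ (∀ c : Chart (m := m) (r := r) (s := s) M E F,
      ∃ G : Loc m r s (smoothAlg m c.dom), Rep (f c) G) ∧
    ∀ c c', ∃ G G', Overlap f c c' (c.tr c') G G' := by
  constructor
  · rintro ⟨h1, h2⟩
    refine ⟨fun c => exists_rep (h1 c), fun c c' => ?_⟩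
    obtain ⟨G, hG⟩ := exists_rep (f := f c) (U := c.dom ∩ c'.dom) fun I n =>
      (h1 c I n).mono Set.inter_subset_left
    obtain ⟨G', hG'⟩ := exists_rep (f := f c') (U := c.dom ∩ c'.dom) fun I n =>
      (h1 c' I n).mono Set.inter_subset_right
    refine ⟨G, G', hG, hG', ?_⟩
    exact (hG.eqOver_iff (hG'.subst fun v => c.rep_newVar c' _ _ _ v)).1 (h2 c c')
  · rintro ⟨h1, h2⟩
    refine ⟨fun c I n => ?_, fun c c' => ?_⟩
    · obtain ⟨G, hG⟩ := h1 c
      exact hG.smooth I n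
    · obtain ⟨G, G', h, h', e⟩ := h2 c c'
      exact (h.eqOver_iff (h'.subst fun v => c.rep_newVar c' _ _ _ v)).2 e

theorem IsGlobal.rep (h : IsGlobal f) (c : Chart (m := m) (r := r) (s := s) M E F) :
    ∃ G : Loc m r s (smoothAlg m c.dom), Rep (f c) G := (isGlobal_iff.1 h).1 c

/-- An operation that is defined in each chart and commutes with changes of coordinates
preserves global functions. -/
theorem IsGlobal.map₂ (hf : IsGlobal f) (hg : IsGlobal g) {h : Fam m r s M E F}
    (φ : ∀ {U : Set M}, ChartOver m U → Loc m r s (smoothAlg m U) → Loc m r s (smoothAlg m U) →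
      Loc m r s (smoothAlg m U))
    (hrep : ∀ (c : Chart (m := m) (r := r) (s := s) M E F) {U : Set M} (hU : IsOpen U)
      (hUc : U ⊆ c.dom) {G H : Loc m r s (smoothAlg m U)}, Rep (f c) G → Rep (g c) H →
      Rep (h c) (φ (c.over hU hUc) G H))
    (hφ : ∀ (c c' : Chart (m := m) (r := r) (s := s) M E F)
      (G H : Loc m r s (smoothAlg m (c.dom ∩ c'.dom))),
      φ (c.over (c.isOpen_dom.inter c'.isOpen_dom) Set.inter_subset_left)
          (subst (c.tr c').newVar G) (subst (c.tr c').newVar H) =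
        subst (c.tr c').newVar
          (φ (c'.over (c.isOpen_dom.inter c'.isOpen_dom) Set.inter_subset_right) G H)) :
    IsGlobal h := by
  rw [isGlobal_iff] at *
  refine ⟨fun c => ?_, fun c c' => ?_⟩
  · obtain ⟨G, hG⟩ := hf.1 c
    obtain ⟨H, hH⟩ := hg.1 c
    exact ⟨_, hrep c c.isOpen_dom le_rfl hG hH⟩
  · obtain ⟨G, G', h1, h1', e1⟩ := hf.2 c c'
    obtain ⟨H, H', h2, h2', e2⟩ := hg.2 c c'
    have hO := c.isOpen_dom.inter c'.isOpen_dom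
    refine ⟨_, _, hrep c hO Set.inter_subset_left h1 h2, hrep c' hO Set.inter_subset_right h1' h2', ?_⟩
    rw [e1, e2]
    exact hφ c c' _ _

theorem IsGlobal.add (hf : IsGlobal f) (hg : IsGlobal g) : IsGlobal (f + g) :=
  hf.map₂ hg (fun _ G H => G + H) (fun _ _ _ _ _ _ h1 h2 => h1.add h2) fun _ _ G H =>
    (subst_add _ G H).symm

theorem IsGlobal.mul (hf : IsGlobal f) (hg : IsGlobal g) : IsGlobal (fmul f g) :=
  hf.map₂ hg (fun _ G H => G * H) (fun _ _ _ _ _ _ h1 h2 => h1.mul h2) fun c c' G H =>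
    ((c.tr c').subst_newVar_mul G H).symm

theorem IsGlobal.evenBr (hf : IsGlobal f) (hg : IsGlobal g) :
    IsGlobal fun c => evenBr c.D (f c) (g c) :=
  hf.map₂ hg (fun c G H => WeakKoszul.evenBr c.D G H)
    (fun c _ hU hUc _ _ h1 h2 => h1.evenBr (c.over hU hUc) h2) fun c c' G H =>
    (c.tr c').evenBr_subst G H

theorem IsGlobal.d (hf : IsGlobal f) : IsGlobal fun c => WeakKoszul.evenBr c.D delta (f c) :=
  hf.map₂ hf (fun c G _ => WeakKoszul.evenBr c.D delta G)
    (fun c _ hU hUc _ _ h1 _ => Rep.delta.evenBr (c.over hU hUc) h1) fun c c' G _ =>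
    (c.tr c').evenBr_delta_subst G

theorem IsGlobal.inv (hf : IsGlobal f) : IsGlobal (finv f) :=
  hf.map₂ hf (fun _ G _ => WeakKoszul.inv G) (fun _ _ _ _ _ _ h1 _ => h1.inv) fun c c' G _ =>
    (c.tr c').subst_newVar_inv G

theorem IsGlobal.restr (hf : IsGlobal f) {p : Var m r s → Prop}
    (hp : ∀ c c' : Chart (m := m) (r := r) (s := s) M E F, (c.tr c').Invariant p) :
    IsGlobal (frestr p f) :=
  hf.map₂ hf (fun _ G _ => WeakKoszul.restr p G) (fun _ _ _ _ _ _ h1 _ => h1.restr p)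
    fun c c' G _ => hp c c' G

theorem isGlobal_const (a : ℝ) : IsGlobal (fun _ => a • 1 : Fam m r s M E F) := by
  have e : ∀ {U : Set M}, (a • 1 : Loc m r s (smoothAlg m U)) = coef (a • 1) := by
    intro U
    refine Loc.ext' fun I => ?_
    rw [Loc.smul_apply]
    change a • (if I = ∅ then MvPolynomial.C 1 else 0) = if I = ∅ then MvPolynomial.C (a • 1) else 0
    split_ifs
    · ext n
      rw [MvPolynomial.coeff_smul, MvPolynomial.coeff_C, MvPolynomial.coeff_C]
      split_ifs <;> simp
    · simp
  refine isGlobal_iff.2 ⟨fun c => ⟨_, Rep.one.smul a⟩, fun c c' =>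
    ⟨_, _, Rep.one.smul a, Rep.one.smul a, ?_⟩⟩
  rw [e, Transition.subst_newVar_coef]

theorem IsGlobal.smul (a : ℝ) (hf : IsGlobal f) : IsGlobal (a • f) := by
  have h := (isGlobal_const a).mul hf
  have : fmul (fun _ => a • 1) f = a • f := by
    funext c
    change (a • 1) * f c = a • f c
    rw [smul_mul_assoc, one_mul]
  rwa [this] at h

theorem isGlobal_one : IsGlobal (fone : Fam m r s M E F) := by
  have h := isGlobal_const (m := m) (r := r) (s := s) (M := M) (E := E) (F := F) 1
  simp only [one_smul] at h
  exact h

theorem IsGlobal.congr (hf : IsGlobal f) (h : Same g f) : IsGlobal g := by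
  rw [isGlobal_iff] at *
  refine ⟨fun c => ?_, fun c c' => ?_⟩
  · obtain ⟨G, hG⟩ := hf.1 c
    exact ⟨G, hG.congr (h c)⟩
  · obtain ⟨G, G', h1, h1', e1⟩ := hf.2 c c'
    exact ⟨G, G', h1.congr fun I n p hp => h c I n p hp.1, h1'.congr fun I n p hp => h c' I n p hp.2, e1⟩

end Charts

end

end WeakKoszul


open scoped Manifold

namespace WeakKoszul

noncomputable section

set_option linter.unusedSectionVars false

/-! ### Parity -/

section Parity

variable {m r s : ℕ} {K : Type*} [CommRing K] [Algebra ℝ K]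

theorem sg_bodd (n : ℕ) : sg n.bodd = (-1) ^ n := by
  induction n with
  | zero => rfl
  | succ n ih =>
    rw [Nat.bodd_succ, pow_succ, ← ih]
    cases n.bodd <;> rfl

theorem neg_one_pow_smul (n : ℕ) (F : Loc m r s K) : (-1 : ℝ) ^ n • F = sg n.bodd • F := by
  rw [sg_bodd]
  rcases neg_one_pow_eq_or ℤ n with h | h
  · rw [h, one_smul]
    have : (-1 : ℝ) ^ n = 1 := by exact_mod_cast h
    rw [this, one_smul]
  · rw [h, neg_one_smul]
    have : (-1 : ℝ) ^ n = -1 := by exact_mod_cast h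
    rw [this, neg_one_smul]

theorem neg_one_pow_eq_iff (a b : ℕ) : (-1 : ℤ) ^ a = (-1) ^ b ↔ a % 2 = b % 2 := by
  rcases Nat.even_or_odd a with ha | ha <;> rcases Nat.even_or_odd b with hb | hb <;>
    simp [ha.neg_one_pow, hb.neg_one_pow] <;> grind

/-- A coefficient of the wrong parity equals its own negative, hence vanishes as two is invertible.
-/
theorem par_iff {F : Loc m r s K} (e : ℕ) :
    SuppIn (fun I _ => I.card % 2 = e % 2) F ↔ Par e.bodd F := by
  constructor
  · intro h
    refine Loc.ext' fun I => ?_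
    ext n
    rw [Loc.zsmul_apply, WeakKoszul.inv, MvPolynomial.coeff_smul, MvPolynomial.coeff_smul, sg_bodd]
    by_cases h0 : (F I).coeff n = 0
    · rw [h0, smul_zero, smul_zero]
    · rw [(neg_one_pow_eq_iff _ _).2 (h I n h0)]
  · intro h I n h0
    by_contra hne
    have h1 := congrArg (MvPolynomial.coeff n) (congrFun h I)
    rw [Loc.zsmul_apply, WeakKoszul.inv, MvPolynomial.coeff_smul, MvPolynomial.coeff_smul,
      sg_bodd] at h1
    rw [← neg_one_pow_eq_iff] at hne
    have h2 : (F I).coeff n = -(F I).coeff n := by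
      rcases neg_one_pow_eq_or ℤ I.card with ha | ha <;>
        rcases neg_one_pow_eq_or ℤ e with hb | hb
      · exact absurd (ha.trans hb.symm) hne
      · rw [ha, hb] at h1; simpa using h1
      · rw [ha, hb] at h1; simpa using h1.symm
      · exact absurd (ha.trans hb.symm) hne
    have h3 : (2 : ℝ) • (F I).coeff n = 0 := by
      rw [two_smul]; nth_rewrite 2 [h2]; simp
    exact h0 (by simpa [smul_smul] using congrArg (fun y => (1 / 2 : ℝ) • y) h3)

/-- The part of parity `e`. -/
def parPart (e : ℕ) (F : Loc m r s K) : Loc m r s K := (1 / 2 : ℝ) • (F + (-1 : ℝ) ^ e • inv F)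

theorem par_parPart (e : ℕ) (F : Loc m r s K) : Par e.bodd (parPart e F) := by
  rw [parPart, neg_one_pow_smul]
  refine Par.smul ?_ _
  rw [Par, inv_add, inv_zsmul, inv_inv, smul_add, smul_smul, sg_mul_self, one_smul,
    add_comm]

theorem parPart_eq {e : ℕ} {F : Loc m r s K} (h : Par e.bodd F) : parPart e F = F := by
  rw [parPart, neg_one_pow_smul, h, smul_smul, sg_mul_self, one_smul, ← two_smul ℝ F,
    smul_smul]
  norm_num

theorem restr_parPart (p : Var m r s → Prop) (e : ℕ) (F : Loc m r s K) :
    restr p (parPart e F) = parPart e (restr p F) := by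
  rw [parPart, parPart, restr_smul, restr_add, restr_smul, inv_restr]

/-- Restriction never touches the coefficients, so base coordinates are exempt from the condition.
-/
theorem restr_restr {p q u : Var m r s → Prop} (h : ∀ v, Var.base v = false → (p v ∧ q v ↔ u v))
    (F : Loc m r s K) : restr p (restr q F) = restr u F := by
  classical
  refine Loc.ext' fun I => ?_
  ext n
  have hI : ∀ v : OddVar m r s, Var.base v.1 = false := fun v => base_of_odd v.2
  have : (Involves p I n ∧ Involves q I n) ↔ Involves u I n := by
    constructor
    · rintro ⟨h1, h2⟩
      exact ⟨fun v hv => (h _ (hI v)).1 ⟨h1.1 v hv, h2.1 v hv⟩,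
        fun v hv => (h _ v.2.2).1 ⟨h1.2 v hv, h2.2 v hv⟩⟩
    · intro h1
      exact ⟨⟨fun v hv => ((h _ (hI v)).2 (h1.1 v hv)).1, fun v hv => ((h _ v.2.2).2 (h1.2 v hv)).1⟩,
        ⟨fun v hv => ((h _ (hI v)).2 (h1.1 v hv)).2, fun v hv => ((h _ v.2.2).2 (h1.2 v hv)).2⟩⟩
  rw [coeff_restr, coeff_restr, coeff_restr]
  split_ifs <;> tauto

/-- On 𝓛 the number of differentials is the form degree. -/
theorem wt_totDeg {I : Finset (OddVar m r s)} {n : EvenVar m r s →₀ ℕ} (h : Involves OnL I n) :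
    wt totDeg I n = wt ghost I n + wt formDeg I n := by
  rw [← wt_add]
  refine wt_congr (p := OnL) ?_ h
  intro v hv
  rcases v with ⟨_ | _ | _ | _, A⟩ <;> simp_all [OnL, totDeg, dDeg, formDeg]

end Parity

/-! ### From global functions to representatives in a chart -/

section Global

variable {m r s : ℕ}
  {M : Type*} [TopologicalSpace M] [ChartedSpace (EuclideanSpace ℝ (Fin m)) M]
  [IsManifold (𝓡 m) ((⊤ : ℕ∞) : WithTop ℕ∞) M]
  {E : M → Type*} [TopologicalSpace (Bundle.TotalSpace (Fin r → ℝ) E)]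
  [∀ p, AddCommGroup (E p)] [∀ p, Module ℝ (E p)]
  [∀ p, TopologicalSpace (E p)] [FiberBundle (Fin r → ℝ) E]
  [VectorBundle ℝ (Fin r → ℝ) E]
  [ContMDiffVectorBundle ((⊤ : ℕ∞) : WithTop ℕ∞) (Fin r → ℝ) E (𝓡 m)]
  {F : M → Type*} [TopologicalSpace (Bundle.TotalSpace (Fin s → ℝ) F)]
  [∀ p, AddCommGroup (F p)] [∀ p, Module ℝ (F p)]
  [∀ p, TopologicalSpace (F p)] [FiberBundle (Fin s → ℝ) F]
  [VectorBundle ℝ (Fin s → ℝ) F]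
  [ContMDiffVectorBundle ((⊤ : ℕ∞) : WithTop ℕ∞) (Fin s → ℝ) F (𝓡 m)]
  {f g ω τ σ Ω X Y lam : Fam m r s M E F} {S : ℕ → Fam m r s M E F}
  {p q : Var m r s → Prop}

theorem Same.symm (h : Same f g) : Same g f := fun c I n p hp => (h c I n p hp).symm

theorem Same.trans {h : Fam m r s M E F} (h1 : Same f g) (h2 : Same g h) : Same f h :=
  fun c I n p hp => (h1 c I n p hp).trans (h2 c I n p hp)

theorem Same.of_rep (h : ∀ c : Chart (m := m) (r := r) (s := s) M E F,
    ∃ G : Loc m r s (smoothAlg m c.dom), Rep (f c) G ∧ Rep (g c) G) : Same f g := fun c => by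
  obtain ⟨G, h1, h2⟩ := h c
  exact (h1.eqOver_iff h2).2 rfl

theorem Supp.congr {P : Finset (OddVar m r s) → (EvenVar m r s →₀ ℕ) → Prop} (hf : Supp P f)
    (h : Same g f) : Supp P g := fun c I n p hp hn => hf c I n p hp (by rwa [← h c I n p hp])

theorem IsFun.congr (hf : IsFun p f) (h : Same g f) : IsFun p g := ⟨hf.1.congr h, hf.2.congr h⟩

theorem supp_of_rep {P : Finset (OddVar m r s) → (EvenVar m r s →₀ ℕ) → Prop}
    (h : ∀ c : Chart (m := m) (r := r) (s := s) M E F,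
      ∃ G : Loc m r s (smoothAlg m c.dom), Rep (f c) G ∧ SuppIn P G) : Supp P f := fun c => by
  obtain ⟨G, h1, h2⟩ := h c
  exact h1.suppOver_iff.2 h2

theorem IsFun.loc (h : IsFun p f) (c : Chart (m := m) (r := r) (s := s) M E F) :
    ∃ G : Loc m r s (smoothAlg m c.dom), Rep (f c) G ∧ SuppIn (Involves p) G := by
  obtain ⟨G, hG⟩ := h.1.rep c
  exact ⟨G, hG, hG.suppOver_iff.1 (h.2 c)⟩

/-- The master function in a chart. -/
structure MasterAt (S : ℕ → Fam m r s M E F) (c : Chart (m := m) (r := r) (s := s) M E F)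
    (T : ℕ → Loc m r s (smoothAlg m c.dom)) : Prop where
  rep : ∀ k, Rep (S k c) (T k)
  loc : LocalMaster c.self.D T

theorem IsMaster.loc (hS : IsMaster S) (c : Chart (m := m) (r := r) (s := s) M E F) :
    ∃ T, MasterAt S c T := by
  choose T hT hN using fun k => (hS.isFun k).loc c
  refine ⟨T, hT, fun k => ?_, hN, fun k => (hT k).suppOver_iff.1 (hS.ghost_eq k c),
    fun k => (hT k).suppOver_iff.1 (hS.momDeg_eq k c), ((hT 0).eqOver_iff Rep.zero).1 (hS.momDeg_pos c),
    fun n => ((Rep.oddBrF c.self hT hT n).eqOver_iff Rep.zero).1 (hS.master n c)⟩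
  exact (par_iff 0).1 ((hT k).suppOver_iff.1 (hS.parity_eq k c))

theorem HasParity.loc {e : ℕ} (h : HasParity f e) {c : Chart (m := m) (r := r) (s := s) M E F}
    {G : Loc m r s (smoothAlg m c.dom)} (hG : Rep (f c) G) : Par e.bodd G :=
  (par_iff e).1 (hG.suppOver_iff.1 (h c))

theorem Supp.loc {P : Finset (OddVar m r s) → (EvenVar m r s →₀ ℕ) → Prop} (h : Supp P f)
    {c : Chart (m := m) (r := r) (s := s) M E F}
    {G : Loc m r s (smoothAlg m c.dom)} (hG : Rep (f c) G) : SuppIn P G :=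
  hG.suppOver_iff.1 (h c)

theorem Same.loc (h : Same f g) {c : Chart (m := m) (r := r) (s := s) M E F}
    {G H : Loc m r s (smoothAlg m c.dom)} (hG : Rep (f c) G) (hH : Rep (g c) H) : G = H :=
  (hG.eqOver_iff hH).1 (h c)

/-! ### Closure of the global functions on `𝓛` -/

theorem IsFun.add (hf : IsFun p f) (hg : IsFun p g) : IsFun p (f + g) :=
  ⟨hf.1.add hg.1, supp_of_rep fun c => by
    obtain ⟨G, h1, h2⟩ := hf.loc c
    obtain ⟨H, h3, h4⟩ := hg.loc c
    exact ⟨_, h1.add h3, h2.add h4⟩⟩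

theorem IsFun.smul (a : ℝ) (hf : IsFun p f) : IsFun p (a • f) :=
  ⟨hf.1.smul a, supp_of_rep fun c => by
    obtain ⟨G, h1, h2⟩ := hf.loc c
    exact ⟨_, h1.smul a, h2.smul a⟩⟩

theorem IsFun.mul (hf : IsFun p f) (hg : IsFun p g) : IsFun p (fmul f g) :=
  ⟨hf.1.mul hg.1, supp_of_rep fun c => by
    obtain ⟨G, h1, h2⟩ := hf.loc c
    obtain ⟨H, h3, h4⟩ := hg.loc c
    exact ⟨_, h1.mul h3, h2.mul_involves h4⟩⟩

theorem IsFun.inv (hf : IsFun p f) : IsFun p (finv f) :=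
  ⟨hf.1.inv, supp_of_rep fun c => by
    obtain ⟨G, h1, h2⟩ := hf.loc c
    exact ⟨_, h1.inv, h2.inv⟩⟩

theorem isFun_one : IsFun p (fone : Fam m r s M E F) :=
  ⟨isGlobal_one, supp_of_rep fun _ => ⟨_, Rep.one, suppIn_one _⟩⟩

theorem IsGlobal.isFun_restr (hf : IsGlobal f)
    (hp : ∀ c c' : Chart (m := m) (r := r) (s := s) M E F, (c.tr c').Invariant p) :
    IsFun p (frestr p f) :=
  ⟨hf.restr hp, supp_of_rep fun c => by
    obtain ⟨G, hG⟩ := hf.rep c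
    exact ⟨_, hG.restr p, suppIn_restr _ _⟩⟩

/-- Written as the restriction of {{Δ, S^1}, ω} to 𝓛, the operation is composed of
coordinate-independent ones; the bracket on 𝓛 is treated alike with S^2. -/
theorem IsFun.qhat (hS : IsMaster S) (hω : IsFun OnL ω) : IsFun OnL (Qhat S ω) := by
  refine (((hS.isFun 1).1.d.evenBr hω.1).isFun_restr fun c c' =>
    (c.tr c').invariant_onL).congr (Same.of_rep fun c => ?_)
  obtain ⟨T, hT⟩ := hS.loc c
  obtain ⟨W, hW, -⟩ := hω.loc c
  refine ⟨_, Rep.qHat c.self hT.rep hW, ?_⟩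
  rw [qHat_eq_restr]
  exact ((Rep.delta.evenBr c.self (hT.rep 1)).evenBr c.self hW).restr _

theorem IsFun.bracketL (hS : IsMaster S) (hω : IsFun OnL ω) (hτ : IsFun OnL τ) :
    IsFun OnL (bracketL S ω τ) := by
  refine ((((hS.isFun 2).1.d.evenBr hω.1).evenBr hτ.1).isFun_restr fun c c' =>
    (c.tr c').invariant_onL).congr (Same.of_rep fun c => ?_)
  obtain ⟨T, hT⟩ := hS.loc c
  obtain ⟨W, hW, -⟩ := hω.loc c
  obtain ⟨V, hV, -⟩ := hτ.loc c
  refine ⟨_, Rep.koszul c.self hT.rep hW hV, ?_⟩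
  rw [koszul_eq_restr]
  exact (((Rep.delta.evenBr c.self (hT.rep 2)).evenBr c.self hW).evenBr c.self hV).restr _

theorem IsFun.finner (hX : IsGlobal X) (hω : IsFun OnL ω) : IsFun OnL (finner X ω) := by
  refine ((hX.inv.evenBr hω.1).isFun_restr fun c c' =>
    (c.tr c').invariant_onL).congr (Same.of_rep fun c => ?_)
  obtain ⟨G, hG⟩ := hX.rep c
  obtain ⟨W, hW, -⟩ := hω.loc c
  refine ⟨_, Rep.interior c.self hG hW, ?_⟩
  rw [interior_eq_restr]
  exact (hG.inv.evenBr c.self hW).restr _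

/-- Invariance is inherited from {Δ, -}, with which the coordinate expression of d agrees on
functions on 𝓛. -/
theorem IsFun.fd (hω : IsFun OnL ω) : IsFun OnL (fd ω) := by
  have h : Same (WeakKoszul.fd ω) fun c => evenBr c.D delta (ω c) := Same.of_rep fun c => by
    obtain ⟨W, hW, hL⟩ := hω.loc c
    refine ⟨_, hW.extD c.self, ?_⟩
    rw [extD_eq _ hL]
    exact Rep.delta.evenBr c.self hW
  refine ⟨hω.1.d.congr h, supp_of_rep fun c => ?_⟩
  obtain ⟨W, hW, hL⟩ := hω.loc c
  exact ⟨_, hW.extD c.self, suppIn_extD hL⟩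

/-- The ternary bracket. -/
def bracket₃ (S : ℕ → Fam m r s M E F) (ω τ σ : Fam m r s M E F) : Fam m r s M E F :=
  fun c => ternary c.D (fun k => S k c) (ω c) (τ c) (σ c)

theorem IsFun.bracket₃ (hS : IsMaster S) (hω : IsFun OnL ω) (hτ : IsFun OnL τ) (hσ : IsFun OnL σ) :
    IsFun OnL (bracket₃ S ω τ σ) := by
  refine ⟨(((hS.isFun 3).1.d.evenBr hω.1).evenBr hτ.1).evenBr hσ.1, supp_of_rep fun c => ?_⟩
  obtain ⟨T, hT⟩ := hS.loc c
  obtain ⟨W, hW, h1⟩ := hω.loc c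
  obtain ⟨V, hV, h2⟩ := hτ.loc c
  obtain ⟨R, hR, h3⟩ := hσ.loc c
  exact ⟨_, Rep.ternary c.self hT.rep hW hV hR, suppIn_ternary hT.loc h1 h2 h3⟩

end Global

end

end WeakKoszul


open scoped Manifold

namespace WeakKoszul

noncomputable section

set_option linter.unusedSectionVars false

/-! ### Cocycles on `𝓛` -/

section CocyclesL

variable {m r s : ℕ}
  {M : Type*} [TopologicalSpace M] [ChartedSpace (EuclideanSpace ℝ (Fin m)) M]
  [IsManifold (𝓡 m) ((⊤ : ℕ∞) : WithTop ℕ∞) M]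
  {E : M → Type*} [TopologicalSpace (Bundle.TotalSpace (Fin r → ℝ) E)]
  [∀ p, AddCommGroup (E p)] [∀ p, Module ℝ (E p)]
  [∀ p, TopologicalSpace (E p)] [FiberBundle (Fin r → ℝ) E]
  [VectorBundle ℝ (Fin r → ℝ) E]
  [ContMDiffVectorBundle ((⊤ : ℕ∞) : WithTop ℕ∞) (Fin r → ℝ) E (𝓡 m)]
  {F : M → Type*} [TopologicalSpace (Bundle.TotalSpace (Fin s → ℝ) F)]
  [∀ p, AddCommGroup (F p)] [∀ p, Module ℝ (F p)]
  [∀ p, TopologicalSpace (F p)] [FiberBundle (Fin s → ℝ) F]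
  [VectorBundle ℝ (Fin s → ℝ) F]
  [ContMDiffVectorBundle ((⊤ : ℕ∞) : WithTop ℕ∞) (Fin s → ℝ) F (𝓡 m)]
  {f g ω τ σ Ω X Y lam : Fam m r s M E F} {S : ℕ → Fam m r s M E F}
  {p q : Var m r s → Prop}


/-- Reduces closedness of a global function to an identity of the local calculus in each chart. -/
theorem mem_cocyclesL_of (hS : IsMaster S) (hf : IsFun OnL f)
    (h : ∀ (c : Chart (m := m) (r := r) (s := s) M E F) T, MasterAt S c T →
      ∃ W, Rep (f c) W ∧ qHat c.self.D T W = 0) : f ∈ cocyclesL S := by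
  refine ⟨hf, Same.of_rep fun c => ?_⟩
  obtain ⟨T, hT⟩ := hS.loc c
  obtain ⟨W, hW, h0⟩ := h c T hT
  refine ⟨_, Rep.qHat c.self hT.rep hW, ?_⟩
  rw [h0]
  exact Rep.zero

theorem cocyclesL_loc (h : ω ∈ cocyclesL S) {c : Chart (m := m) (r := r) (s := s) M E F}
    {T : ℕ → Loc m r s (smoothAlg m c.dom)} (hT : MasterAt S c T) :
    ∃ W, Rep (ω c) W ∧ SuppIn (Involves OnL) W ∧ qHat c.self.D T W = 0 := by
  obtain ⟨W, hW, hL⟩ := h.1.loc c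
  exact ⟨W, hW, hL, h.2.loc (Rep.qHat c.self hT.rep hW) Rep.zero⟩

theorem cocyclesL_one (hS : IsMaster S) : fone ∈ cocyclesL S :=
  mem_cocyclesL_of hS isFun_one fun _ _ hT => ⟨_, Rep.one, qHat_one hT.loc⟩

theorem cocyclesL_add (hS : IsMaster S) (hω : ω ∈ cocyclesL S) (hτ : τ ∈ cocyclesL S) :
    ω + τ ∈ cocyclesL S :=
  mem_cocyclesL_of hS (hω.1.add hτ.1) fun c T hT => by
    obtain ⟨W, hW, -, h0⟩ := cocyclesL_loc hω hT
    obtain ⟨V, hV, -, h1⟩ := cocyclesL_loc hτ hT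
    exact ⟨_, hW.add hV, by rw [qHat_add, h0, h1, add_zero]⟩

theorem cocyclesL_smul (hS : IsMaster S) (a : ℝ) (hω : ω ∈ cocyclesL S) : a • ω ∈ cocyclesL S :=
  mem_cocyclesL_of hS (hω.1.smul a) fun c T hT => by
    obtain ⟨W, hW, -, h0⟩ := cocyclesL_loc hω hT
    exact ⟨_, hW.smul a, by rw [qHat_smul, h0, smul_zero]⟩

theorem cocyclesL_mul (hS : IsMaster S) (hω : ω ∈ cocyclesL S) (hτ : τ ∈ cocyclesL S) :
    fmul ω τ ∈ cocyclesL S :=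
  mem_cocyclesL_of hS (hω.1.mul hτ.1) fun c T hT => by
    obtain ⟨W, hW, hWL, h0⟩ := cocyclesL_loc hω hT
    obtain ⟨V, hV, hVL, h1⟩ := cocyclesL_loc hτ hT
    exact ⟨_, hW.mul hV, by rw [qHat_mul hT.loc hWL hVL, h0, h1, zero_mul, mul_zero, add_zero]⟩

theorem cocyclesL_bracket (hS : IsMaster S) (hω : ω ∈ cocyclesL S) (hτ : τ ∈ cocyclesL S) :
    bracketL S ω τ ∈ cocyclesL S :=
  mem_cocyclesL_of hS (hω.1.bracketL hS hτ.1) fun c T hT => by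
    obtain ⟨W, hW, hWL, h0⟩ := cocyclesL_loc hω hT
    obtain ⟨V, hV, hVL, h1⟩ := cocyclesL_loc hτ hT
    exact ⟨_, Rep.koszul c.self hT.rep hW hV, by
      rw [qHat_koszul hT.loc hWL hVL, h0, h1, koszul_zero_left, koszul_zero_right]; simp⟩

theorem cocyclesL_inv (hS : IsMaster S) (hω : ω ∈ cocyclesL S) : finv ω ∈ cocyclesL S :=
  mem_cocyclesL_of hS hω.1.inv fun c T hT => by
    obtain ⟨W, hW, hWL, h0⟩ := cocyclesL_loc hω hT
    refine ⟨_, hW.inv, ?_⟩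
    have := inv_qHat hT.loc W
    rw [h0, inv_zero] at this
    exact neg_eq_zero.1 this.symm

theorem cocyclesL_fd (hS : IsMaster S) (hω : ω ∈ cocyclesL S) : fd ω ∈ cocyclesL S :=
  mem_cocyclesL_of hS hω.1.fd fun c T hT => by
    obtain ⟨W, hW, hWL, h0⟩ := cocyclesL_loc hω hT
    exact ⟨_, hW.extD c.self, qHat_extD hT.loc hWL h0⟩

theorem qhat_mem_cocyclesL (hS : IsMaster S) (h : IsFun OnL lam) : Qhat S lam ∈ cocyclesL S :=
  mem_cocyclesL_of hS (h.qhat hS) fun c T hT => by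
    obtain ⟨W, hW, hWL⟩ := h.loc c
    exact ⟨_, Rep.qHat c.self hT.rep hW, qHat_qHat hT.loc hWL⟩

theorem cocyclesL_congr (hS : IsMaster S) (hω : ω ∈ cocyclesL S) (h : Same τ ω) :
    τ ∈ cocyclesL S :=
  mem_cocyclesL_of hS (hω.1.congr h) fun c T hT => by
    obtain ⟨W, hW, hWL, h0⟩ := cocyclesL_loc hω hT
    exact ⟨W, hW.congr (h c), h0⟩

theorem bracketL_add (hS : IsMaster S) (hω : IsFun OnL ω) (hτ : IsFun OnL τ) (hσ : IsFun OnL σ) :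
    Same (bracketL S ω (τ + σ)) (bracketL S ω τ + bracketL S ω σ) := Same.of_rep fun c => by
  obtain ⟨T, hT⟩ := hS.loc c
  obtain ⟨W, hW, -⟩ := hω.loc c
  obtain ⟨V, hV, -⟩ := hτ.loc c
  obtain ⟨R, hR, -⟩ := hσ.loc c
  refine ⟨_, Rep.koszul c.self hT.rep hW (hV.add hR), ?_⟩
  rw [koszul_add]
  exact (Rep.koszul c.self hT.rep hW hV).add (Rep.koszul c.self hT.rep hW hR)

theorem bracketL_smul (hS : IsMaster S) (a : ℝ) (hω : IsFun OnL ω) (hτ : IsFun OnL τ) :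
    Same (bracketL S ω (a • τ)) (a • bracketL S ω τ) := Same.of_rep fun c => by
  obtain ⟨T, hT⟩ := hS.loc c
  obtain ⟨W, hW, -⟩ := hω.loc c
  obtain ⟨V, hV, -⟩ := hτ.loc c
  refine ⟨_, Rep.koszul c.self hT.rep hW (hV.smul a), ?_⟩
  rw [koszul_smul]
  exact (Rep.koszul c.self hT.rep hW hV).smul a

theorem bracketL_odd (hS : IsMaster S) (hω : IsFun OnL ω) (hτ : IsFun OnL τ) {e f : ℕ}
    (he : HasParity ω e) (hf : HasParity τ f) : HasParity (bracketL S ω τ) (e + f + 1) :=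
  supp_of_rep fun c => by
    obtain ⟨T, hT⟩ := hS.loc c
    obtain ⟨W, hW, -⟩ := hω.loc c
    obtain ⟨V, hV, -⟩ := hτ.loc c
    refine ⟨_, Rep.koszul c.self hT.rep hW hV, (par_iff _).2 ?_⟩
    have := par_koszul hT.loc (he.loc hW) (hf.loc hV)
    simpa [Nat.bodd_add] using this

theorem bracketL_symm (hS : IsMaster S) (hω : IsFun OnL ω) (hτ : IsFun OnL τ) {e f : ℕ}
    (he : HasParity ω e) (hf : HasParity τ f) :
    Same (bracketL S ω τ) ((-1 : ℝ) ^ (e * f) • bracketL S τ ω) := Same.of_rep fun c => by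
  obtain ⟨T, hT⟩ := hS.loc c
  obtain ⟨W, hW, hWL⟩ := hω.loc c
  obtain ⟨V, hV, hVL⟩ := hτ.loc c
  refine ⟨_, Rep.koszul c.self hT.rep hW hV, ?_⟩
  rw [koszul_symm hT.loc hWL hVL (he.loc hW) (hf.loc hV), ← Nat.bodd_mul, ← neg_one_pow_smul]
  exact (Rep.koszul c.self hT.rep hV hW).smul _

theorem bracketL_leibniz (hS : IsMaster S) (hω : IsFun OnL ω) (hτ : IsFun OnL τ)
    (hσ : IsFun OnL σ) {e f : ℕ} (he : HasParity ω e) (hf : HasParity τ f) :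
    Same (bracketL S ω (fmul τ σ))
      (fmul (bracketL S ω τ) σ + (-1 : ℝ) ^ ((e + 1) * f) • fmul τ (bracketL S ω σ)) :=
  Same.of_rep fun c => by
    obtain ⟨T, hT⟩ := hS.loc c
    obtain ⟨W, hW, hWL⟩ := hω.loc c
    obtain ⟨V, hV, hVL⟩ := hτ.loc c
    obtain ⟨R, hR, hRL⟩ := hσ.loc c
    refine ⟨_, Rep.koszul c.self hT.rep hW (hV.mul hR), ?_⟩
    have hb : (Nat.bodd f && !Nat.bodd e) = Nat.bodd ((e + 1) * f) := by
      rw [Nat.bodd_mul, Nat.bodd_succ, Bool.and_comm]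
    rw [koszul_mul hT.loc hWL hVL hRL (he.loc hW), (hf.loc hV).tw_eq, hb, smul_mul_assoc,
      ← neg_one_pow_smul]
    exact ((Rep.koszul c.self hT.rep hW hV).mul hR).add
      ((hV.mul (Rep.koszul c.self hT.rep hW hR)).smul _)

/-- The Jacobiator is the coboundary of the ternary bracket. -/
theorem bracketL_jacobi (hS : IsMaster S) (hω : ω ∈ cocyclesL S) (hτ : τ ∈ cocyclesL S)
    (hσ : σ ∈ cocyclesL S) {e f g : ℕ} (he : HasParity ω e) (hf : HasParity τ f)
    (hg : HasParity σ g) :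
    Same (bracketL S (bracketL S ω τ) σ + (-1 : ℝ) ^ (f * g) • bracketL S (bracketL S ω σ) τ +
        (-1 : ℝ) ^ (e * (f + g)) • bracketL S (bracketL S τ σ) ω)
      (Qhat S ((-1 : ℝ) • bracket₃ S ω τ σ)) := Same.of_rep fun c => by
  obtain ⟨T, hT⟩ := hS.loc c
  obtain ⟨W, hW, hWL, h1⟩ := cocyclesL_loc hω hT
  obtain ⟨V, hV, hVL, h2⟩ := cocyclesL_loc hτ hT
  obtain ⟨R, hR, hRL, h3⟩ := cocyclesL_loc hσ hT
  have h := koszul_jacobi hT.loc hWL hVL hRL (he.loc hW) (hf.loc hV) (hg.loc hR) h1 h2 h3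
  rw [← Nat.bodd_mul, ← Nat.bodd_add, ← Nat.bodd_mul, ← neg_one_pow_smul, ← neg_one_pow_smul,
    ← neg_one_smul ℝ (ternary _ _ _ _ _)] at h
  refine ⟨_, ((Rep.koszul c.self hT.rep (Rep.koszul c.self hT.rep hW hV) hR).add
    ((Rep.koszul c.self hT.rep (Rep.koszul c.self hT.rep hW hR) hV).smul _)).add
    ((Rep.koszul c.self hT.rep (Rep.koszul c.self hT.rep hV hR) hW).smul _), ?_⟩
  rw [h]
  exact Rep.qHat c.self hT.rep ((Rep.ternary c.self hT.rep hW hV hR).smul (-1))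

theorem qhat_add (hS : IsMaster S) (hω : IsFun OnL ω) (hτ : IsFun OnL τ) :
    Same (Qhat S (ω + τ)) (Qhat S ω + Qhat S τ) := Same.of_rep fun c => by
  obtain ⟨T, hT⟩ := hS.loc c
  obtain ⟨W, hW, -⟩ := hω.loc c
  obtain ⟨V, hV, -⟩ := hτ.loc c
  refine ⟨_, Rep.qHat c.self hT.rep (hW.add hV), ?_⟩
  rw [qHat_add]
  exact (Rep.qHat c.self hT.rep hW).add (Rep.qHat c.self hT.rep hV)

theorem qhat_mul (hS : IsMaster S) (hω : IsFun OnL ω) (hτ : τ ∈ cocyclesL S) :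
    Same (fmul (Qhat S ω) τ) (Qhat S (fmul ω τ)) := Same.of_rep fun c => by
  obtain ⟨T, hT⟩ := hS.loc c
  obtain ⟨W, hW, hWL⟩ := hω.loc c
  obtain ⟨V, hV, hVL, h0⟩ := cocyclesL_loc hτ hT
  refine ⟨_, (Rep.qHat c.self hT.rep hW).mul hV, ?_⟩
  have h := qHat_mul hT.loc hWL hVL
  rw [h0, mul_zero, add_zero] at h
  rw [← h]
  exact Rep.qHat c.self hT.rep (hW.mul hV)

/-- Bracketing with a cocycle anticommutes with Q̂, so minus the bracket of the primitive is a
primitive. -/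
theorem qhat_bracketL (hS : IsMaster S) (hω : IsFun OnL ω) (hτ : τ ∈ cocyclesL S) :
    Same (bracketL S (Qhat S ω) τ) (Qhat S ((-1 : ℝ) • bracketL S ω τ)) := Same.of_rep fun c => by
  obtain ⟨T, hT⟩ := hS.loc c
  obtain ⟨W, hW, hWL⟩ := hω.loc c
  obtain ⟨V, hV, hVL, h0⟩ := cocyclesL_loc hτ hT
  refine ⟨_, Rep.koszul c.self hT.rep (Rep.qHat c.self hT.rep hW) hV, ?_⟩
  have h := qHat_koszul hT.loc hWL hVL
  rw [h0, koszul_zero_right, sub_zero, eq_neg_iff_add_eq_zero, add_comm, ← eq_neg_iff_add_eq_zero,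
    ← qHat_neg, ← neg_one_smul ℝ] at h
  rw [h]
  exact Rep.qHat c.self hT.rep ((Rep.koszul c.self hT.rep hW hV).smul (-1))

theorem bracketL_congr (hS : IsMaster S) {ω' τ' : Fam m r s M E F} (hω : IsFun OnL ω)
    (hτ : IsFun OnL τ) (h : Same ω' ω) (h' : Same τ' τ) :
    Same (bracketL S ω' τ') (bracketL S ω τ) := Same.of_rep fun c => by
  obtain ⟨T, hT⟩ := hS.loc c
  obtain ⟨W, hW, -⟩ := hω.loc c
  obtain ⟨V, hV, -⟩ := hτ.loc c
  exact ⟨_, Rep.koszul c.self hT.rep (hW.congr (h c)) (hV.congr (h' c)),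
    Rep.koszul c.self hT.rep hW hV⟩

theorem fmul_congr {f' g' : Fam m r s M E F} (hf : IsGlobal f) (hg : IsGlobal g) (h : Same f' f)
    (h' : Same g' g) : Same (fmul f' g') (fmul f g) := Same.of_rep fun c => by
  obtain ⟨W, hW⟩ := hf.rep c
  obtain ⟨V, hV⟩ := hg.rep c
  exact ⟨_, (hW.congr (h c)).mul (hV.congr (h' c)), hW.mul hV⟩

theorem Same.add {f' g' : Fam m r s M E F} (h : Same f' f) (h' : Same g' g) :
    Same (f' + g') (f + g) := fun c I n p hp => by
  change ((f' c + g' c) I).coeff n p = ((f c + g c) I).coeff n p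
  rw [Loc.add_apply, Loc.add_apply, MvPolynomial.coeff_add, MvPolynomial.coeff_add, Pi.add_apply,
    Pi.add_apply, h c I n p hp, h' c I n p hp]

theorem Same.smul (a : ℝ) (h : Same g f) : Same (a • g) (a • f) := fun c I n p hp => by
  change ((a • g c) I).coeff n p = ((a • f c) I).coeff n p
  rw [Loc.smul_apply, Loc.smul_apply, MvPolynomial.coeff_smul, MvPolynomial.coeff_smul, Pi.smul_apply,
    Pi.smul_apply, h c I n p hp]

theorem same_refl (f : Fam m r s M E F) : Same f f := fun _ _ _ _ _ => rfl

theorem isWeakOddPoisson_cocyclesL (hS : IsMaster S) :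
    IsWeakOddPoisson (cocyclesL S) (coboundariesL S) (bracketL S) where
  one_mem := cocyclesL_one hS
  add_mem _ hω _ hτ := cocyclesL_add hS hω hτ
  smul_mem a _ hω := cocyclesL_smul hS a hω
  mul_mem _ hω _ hτ := cocyclesL_mul hS hω hτ
  bracket_mem _ hω _ hτ := cocyclesL_bracket hS hω hτ
  bracket_add _ hω _ hτ _ hσ := bracketL_add hS hω.1 hτ.1 hσ.1
  bracket_smul a _ hω _ hτ := bracketL_smul hS a hω.1 hτ.1
  bracket_odd _ hω _ hτ _ _ he hf := bracketL_odd hS hω.1 hτ.1 he hf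
  bracket_symm _ hω _ hτ _ _ he hf := bracketL_symm hS hω.1 hτ.1 he hf
  leibniz _ hω _ hτ _ hσ _ _ he hf := bracketL_leibniz hS hω.1 hτ.1 hσ.1 he hf
  jacobi _ hω _ hτ _ hσ _ _ _ he hf hg :=
    ⟨_, (hω.1.bracket₃ hS hτ.1 hσ.1).smul (-1), bracketL_jacobi hS hω hτ hσ he hf hg⟩
  trivial_mem := fun _ ⟨_, h1, h2⟩ => cocyclesL_congr hS (qhat_mem_cocyclesL hS h1) h2
  trivial_add := fun _ ⟨_, h1, h2⟩ _ ⟨_, h3, h4⟩ =>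
    ⟨_, h1.add h3, (h2.add h4).trans (qhat_add hS h1 h3).symm⟩
  trivial_mul := fun _ ⟨_, h1, h2⟩ _ hτ =>
    ⟨_, h1.mul hτ.1, (fmul_congr (h1.qhat hS).1 hτ.1.1 h2 (same_refl _)).trans (qhat_mul hS h1 hτ)⟩
  trivial_bracket := fun _ ⟨_, h1, h2⟩ _ hτ =>
    ⟨_, (h1.bracketL hS hτ.1).smul (-1), (bracketL_congr hS (h1.qhat hS) hτ.1 h2 (same_refl _)).trans
      (qhat_bracketL hS h1 hτ)⟩

/-! ### Vector fields on `𝓜` -/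

theorem vectorsL_loc (hX : X ∈ vectorsL S) {c : Chart (m := m) (r := r) (s := s) M E F}
    {T : ℕ → Loc m r s (smoothAlg m c.dom)} (hT : MasterAt S c T) :
    ∃ G, Rep (X c) G ∧ SuppIn (Involves OnN) G ∧ SuppIn (fun I n => wt momDeg I n = 1) G ∧
      oddBr c.self.D (T 1) G = 0 := by
  obtain ⟨G, hG, hN⟩ := hX.1.loc c
  exact ⟨G, hG, hN, hX.2.1.loc hG, hX.2.2.loc ((hT.rep 1).oddBr c.self hG) Rep.zero⟩

theorem mem_vectorsL_of (hS : IsMaster S) (hX : IsFun OnN X)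
    (h : ∀ (c : Chart (m := m) (r := r) (s := s) M E F) T, MasterAt S c T →
      ∃ G, Rep (X c) G ∧ SuppIn (fun I n => wt momDeg I n = 1) G ∧ oddBr c.self.D (T 1) G = 0) :
    X ∈ vectorsL S := by
  refine ⟨hX, supp_of_rep fun c => ?_, Same.of_rep fun c => ?_⟩
  · obtain ⟨T, hT⟩ := hS.loc c
    obtain ⟨G, h1, h2, -⟩ := h c T hT
    exact ⟨G, h1, h2⟩
  · obtain ⟨T, hT⟩ := hS.loc c
    obtain ⟨G, h1, -, h2⟩ := h c T hT
    refine ⟨_, (hT.rep 1).oddBr c.self h1, ?_⟩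
    rw [h2]
    exact Rep.zero

theorem vectorsL_add (hS : IsMaster S) (hX : X ∈ vectorsL S) (hY : Y ∈ vectorsL S) :
    X + Y ∈ vectorsL S :=
  mem_vectorsL_of hS (hX.1.add hY.1) fun c T hT => by
    obtain ⟨G, hG, hGN, hGm, hG0⟩ := vectorsL_loc hX hT
    obtain ⟨H, hH, hHN, hHm, hH0⟩ := vectorsL_loc hY hT
    exact ⟨_, hG.add hH, hGm.add hHm, by rw [oddBr_master_add hT.loc hGN hHN, hG0, hH0, add_zero]⟩

theorem vectorsL_smul (hS : IsMaster S) (a : ℝ) (hX : X ∈ vectorsL S) : a • X ∈ vectorsL S :=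
  mem_vectorsL_of hS (hX.1.smul a) fun c T hT => by
    obtain ⟨G, hG, hGN, hGm, hG0⟩ := vectorsL_loc hX hT
    exact ⟨_, hG.smul a, hGm.smul a, by rw [oddBr_master_smul hT.loc a hGN, hG0, smul_zero]⟩

theorem isFun_onN_of_onExt (hf : IsFun OnExt f) : IsFun OnN f :=
  ⟨hf.1, fun c I n p hp h => (hf.2 c I n p hp h).imp fun v hv => by
    rcases v with ⟨_ | _ | _ | _, A⟩ <;> simp_all [OnN, OnExt]⟩

theorem vectorsL_mul (hS : IsMaster S) (hf : f ∈ cocyclesL S) (hf' : IsFun OnExt f)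
    (hX : X ∈ vectorsL S) : fmul f X ∈ vectorsL S :=
  mem_vectorsL_of hS ((isFun_onN_of_onExt hf').mul hX.1) fun c T hT => by
    obtain ⟨G, hG, hGN, hGm, hG0⟩ := vectorsL_loc hX hT
    obtain ⟨W, hW, hWL, h0⟩ := cocyclesL_loc hf hT
    refine ⟨_, hW.mul hG, ?_, oddBr_master_mul hT.loc (hf'.2.loc hW) hGN hG0 h0⟩
    simpa using hWL.momDeg_zero.mul_wt hGm

theorem cocyclesL_finner (hS : IsMaster S) (hX : X ∈ vectorsL S) (hω : ω ∈ cocyclesL S) :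
    finner X ω ∈ cocyclesL S :=
  mem_cocyclesL_of hS (hω.1.finner hX.1.1) fun c T hT => by
    obtain ⟨G, hG, hGN, hGm, hG0⟩ := vectorsL_loc hX hT
    obtain ⟨W, hW, hWL, h0⟩ := cocyclesL_loc hω hT
    exact ⟨_, Rep.interior c.self hG hW, qHat_interior hT.loc hGm hGN hG0 hWL h0⟩

theorem isInnerModule_cocyclesL (hS : IsMaster S) :
    IsInnerModule (vectorsL S) {f | f ∈ cocyclesL S ∧ IsFun OnExt f} (cocyclesL S) finner where
  inner_mem _ hX _ hω := cocyclesL_finner hS hX hω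
  vec_add_mem _ hX _ hY := vectorsL_add hS hX hY
  vec_smul_mem a _ hX := vectorsL_smul hS a hX
  vec_mul_mem _ hf _ hX := vectorsL_mul hS hf.1 hf.2 hX
  add_inner X hX Y hY ω hω := Same.of_rep fun c => by
    obtain ⟨G, hG, -⟩ := hX.1.loc c
    obtain ⟨H, hH, -⟩ := hY.1.loc c
    obtain ⟨W, hW, -⟩ := hω.1.loc c
    refine ⟨_, Rep.interior c.self (hG.add hH) hW, ?_⟩
    rw [interior_add_left]
    exact (Rep.interior c.self hG hW).add (Rep.interior c.self hH hW)
  inner_add X hX ω hω τ hτ := Same.of_rep fun c => by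
    obtain ⟨G, hG, -⟩ := hX.1.loc c
    obtain ⟨V, hV, -⟩ := hτ.1.loc c
    obtain ⟨W, hW, -⟩ := hω.1.loc c
    refine ⟨_, Rep.interior c.self hG (hW.add hV), ?_⟩
    rw [interior_add_right]
    exact (Rep.interior c.self hG hW).add (Rep.interior c.self hG hV)
  smul_inner a X hX ω hω := Same.of_rep fun c => by
    obtain ⟨G, hG, -⟩ := hX.1.loc c
    obtain ⟨W, hW, -⟩ := hω.1.loc c
    refine ⟨_, Rep.interior c.self (hG.smul a) hW, ?_⟩
    rw [interior_smul_left]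
    exact (Rep.interior c.self hG hW).smul a
  inner_smul a X hX ω hω := Same.of_rep fun c => by
    obtain ⟨G, hG, -⟩ := hX.1.loc c
    obtain ⟨W, hW, -⟩ := hω.1.loc c
    refine ⟨_, Rep.interior c.self hG (hW.smul a), ?_⟩
    rw [interior_smul_right]
    exact (Rep.interior c.self hG hW).smul a
  mul_inner f hf X hX ω hω := Same.of_rep fun c => by
    obtain ⟨G, hG, -⟩ := hX.1.loc c
    obtain ⟨V, hV, hVL⟩ := hf.1.1.loc c
    obtain ⟨W, hW, hWL⟩ := hω.1.loc c
    refine ⟨_, Rep.interior c.self (hV.mul hG) hW, ?_⟩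
    rw [interior_mul_left hVL hWL]
    exact hV.inv.mul (Rep.interior c.self hG hW)
  inner_comm X hX Y hY ω hω e f he hf := Same.of_rep fun c => by
    obtain ⟨G, hG, hGN⟩ := hX.1.loc c
    obtain ⟨H, hH, hHN⟩ := hY.1.loc c
    obtain ⟨W, hW, hWL⟩ := hω.1.loc c
    refine ⟨_, Rep.interior c.self hG (Rep.interior c.self hH hW), ?_⟩
    rw [interior_comm (hX.2.1.loc hG) (hY.2.1.loc hH) hGN hHN hWL (he.loc hG) (hf.loc hH),
      ← Nat.bodd_mul, ← neg_one_pow_smul]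
    exact (Rep.interior c.self hH (Rep.interior c.self hG hW)).smul _

end CocyclesL

end

end WeakKoszul


open scoped Manifold

namespace WeakKoszul

noncomputable section

set_option linter.unusedSectionVars false

/-! ### Projectible forms and vector fields on `M` -/

section Projectible

variable {m r s : ℕ}
  {M : Type*} [TopologicalSpace M] [ChartedSpace (EuclideanSpace ℝ (Fin m)) M]
  [IsManifold (𝓡 m) ((⊤ : ℕ∞) : WithTop ℕ∞) M]
  {E : M → Type*} [TopologicalSpace (Bundle.TotalSpace (Fin r → ℝ) E)]
  [∀ p, AddCommGroup (E p)] [∀ p, Module ℝ (E p)]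
  [∀ p, TopologicalSpace (E p)] [FiberBundle (Fin r → ℝ) E]
  [VectorBundle ℝ (Fin r → ℝ) E]
  [ContMDiffVectorBundle ((⊤ : ℕ∞) : WithTop ℕ∞) (Fin r → ℝ) E (𝓡 m)]
  {F : M → Type*} [TopologicalSpace (Bundle.TotalSpace (Fin s → ℝ) F)]
  [∀ p, AddCommGroup (F p)] [∀ p, Module ℝ (F p)]
  [∀ p, TopologicalSpace (F p)] [FiberBundle (Fin s → ℝ) F]
  [VectorBundle ℝ (Fin s → ℝ) F]
  [ContMDiffVectorBundle ((⊤ : ℕ∞) : WithTop ℕ∞) (Fin s → ℝ) F (𝓡 m)]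
  {f g ω τ σ Ω X Y lam : Fam m r s M E F} {S : ℕ → Fam m r s M E F}
  {p q : Var m r s → Prop}


/-- `Ω` is a cocycle on `𝓛` that extends `ω`. -/
structure Lift (S : ℕ → Fam m r s M E F) (ω Ω : Fam m r s M E F) : Prop where
  mem : Ω ∈ cocyclesL S
  deg : Supp (fun I n => wt totDeg I n = 0) Ω
  restr : Same (frestr OnTM Ω) ω

/-- Restates the ghost number conditions by total degree: d = 0 for extensions of forms, d = -1 for
the λ in `trivialM`. -/
theorem supp_ghost_iff (hL : Supp (Involves OnL) f) (d : ℤ) :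
    Supp (fun I n => wt ghost I n = -wt formDeg I n + d) f ↔
      Supp (fun I n => wt totDeg I n = d) f := by
  constructor <;> intro h c I n p hp hn <;> have := wt_totDeg (hL c I n p hp hn) <;>
    have := h c I n p hp hn <;> dsimp only at * <;> omega

theorem isFun_frestr_onTM (hf : IsGlobal f) : IsFun OnTM (frestr OnTM f) :=
  hf.isFun_restr fun c c' => (c.tr c').invariant_onTM

/-- That ω is a function on ΠTM is automatic, as the restriction of a global function to an
invariant submanifold. -/
theorem mem_formsM_iff : ω ∈ formsM S ↔ ∃ Ω, Lift S ω Ω := by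
  constructor
  · rintro ⟨-, Ω, h, h0⟩
    refine ⟨Ω, ⟨h.isFun, h0⟩, (supp_ghost_iff h.isFun.2 0).1 ?_, h.restr_eq⟩
    simpa using h.ghost_eq
  · rintro ⟨Ω, h⟩
    refine ⟨(isFun_frestr_onTM h.mem.1.1).congr h.restr.symm, Ω, ⟨h.mem.1, ?_, h.restr⟩, h.mem.2⟩
    simpa using (supp_ghost_iff h.mem.1.2 0).2 h.deg

theorem mem_trivialM_iff : ω ∈ trivialM S ↔ ∃ lam, IsFun OnL lam ∧
    Supp (fun I n => wt totDeg I n = -1) lam ∧ Same ω (frestr OnTM (Qhat S lam)) := by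
  constructor
  · rintro ⟨lam, h1, h2, h3⟩
    exact ⟨lam, h1, (supp_ghost_iff h1.2 (-1)).1 h2, h3⟩
  · rintro ⟨lam, h1, h2, h3⟩
    exact ⟨lam, h1, (supp_ghost_iff h1.2 (-1)).2 h2, h3⟩

theorem Lift.loc (h : Lift S ω Ω) {c : Chart (m := m) (r := r) (s := s) M E F}
    {T : ℕ → Loc m r s (smoothAlg m c.dom)} (hT : MasterAt S c T) :
    ∃ V, Rep (Ω c) V ∧ SuppIn (Involves OnL) V ∧ SuppIn (fun I n => wt totDeg I n = 0) V ∧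
      qHat c.self.D T V = 0 ∧ Rep (ω c) (WeakKoszul.restr OnTM V) := by
  obtain ⟨V, hV, hL, h0⟩ := cocyclesL_loc h.mem hT
  exact ⟨V, hV, hL, h.deg.loc hV, h0, (hV.restr OnTM).congr (h.restr.symm c)⟩

theorem isFun_onL_of_onTM (h : IsFun OnTM ω) : IsFun OnL ω :=
  ⟨h.1, fun c I n p hp hn => (h.2 c I n p hp hn).imp fun v hv => ((onTM_iff v).1 hv).1⟩

variable {Τ : Fam m r s M E F}

theorem Lift.one (hS : IsMaster S) : Lift S fone fone where
  mem := cocyclesL_one hS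
  deg := supp_of_rep fun c => ⟨_, Rep.one, SuppIn.coef 1 (wt_empty _)⟩
  restr := Same.of_rep fun c => ⟨_, Rep.one.restr _, by
    rw [(suppIn_one _).restr_eq_self]; exact Rep.one⟩

theorem Lift.add (hS : IsMaster S) (hω : Lift S ω Ω) (hτ : Lift S τ Τ) :
    Lift S (ω + τ) (Ω + Τ) where
  mem := cocyclesL_add hS hω.mem hτ.mem
  deg := supp_of_rep fun c => by
    obtain ⟨T, hT⟩ := hS.loc c
    obtain ⟨V, hV, -, h1, -⟩ := hω.loc hT
    obtain ⟨W, hW, -, h2, -⟩ := hτ.loc hT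
    exact ⟨_, hV.add hW, h1.add h2⟩
  restr := Same.of_rep fun c => by
    obtain ⟨T, hT⟩ := hS.loc c
    obtain ⟨V, hV, -, -, -, h1⟩ := hω.loc hT
    obtain ⟨W, hW, -, -, -, h2⟩ := hτ.loc hT
    refine ⟨_, (hV.add hW).restr _, ?_⟩
    rw [restr_add]
    exact h1.add h2

theorem Lift.smul (hS : IsMaster S) (a : ℝ) (hω : Lift S ω Ω) : Lift S (a • ω) (a • Ω) where
  mem := cocyclesL_smul hS a hω.mem
  deg := supp_of_rep fun c => by
    obtain ⟨T, hT⟩ := hS.loc c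
    obtain ⟨V, hV, -, h1, -⟩ := hω.loc hT
    exact ⟨_, hV.smul a, h1.smul a⟩
  restr := Same.of_rep fun c => by
    obtain ⟨T, hT⟩ := hS.loc c
    obtain ⟨V, hV, -, -, -, h1⟩ := hω.loc hT
    refine ⟨_, (hV.smul a).restr _, ?_⟩
    rw [restr_smul]
    exact h1.smul a

theorem Lift.mul (hS : IsMaster S) (hω : Lift S ω Ω) (hτ : Lift S τ Τ) :
    Lift S (fmul ω τ) (fmul Ω Τ) where
  mem := cocyclesL_mul hS hω.mem hτ.mem
  deg := supp_of_rep fun c => by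
    obtain ⟨T, hT⟩ := hS.loc c
    obtain ⟨V, hV, -, h1, -⟩ := hω.loc hT
    obtain ⟨W, hW, -, h2, -⟩ := hτ.loc hT
    exact ⟨_, hV.mul hW, by simpa using h1.mul_wt h2⟩
  restr := Same.of_rep fun c => by
    obtain ⟨T, hT⟩ := hS.loc c
    obtain ⟨V, hV, -, -, -, h1⟩ := hω.loc hT
    obtain ⟨W, hW, -, -, -, h2⟩ := hτ.loc hT
    refine ⟨_, (hV.mul hW).restr _, ?_⟩
    rw [restr_mul]
    exact h1.mul h2

/-- The bracket of extensions extends the weak Koszul bracket, by `restr_koszul`; iterated brackets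
on M therefore lift to iterated brackets on 𝓛. -/
theorem Lift.bracket (hS : IsMaster S) (hω : Lift S ω Ω) (hτ : Lift S τ Τ) :
    Lift S (bracketM S ω τ) (bracketL S Ω Τ) where
  mem := cocyclesL_bracket hS hω.mem hτ.mem
  deg := supp_of_rep fun c => by
    obtain ⟨T, hT⟩ := hS.loc c
    obtain ⟨V, hV, hVL, h1, -⟩ := hω.loc hT
    obtain ⟨W, hW, hWL, h2, -⟩ := hτ.loc hT
    exact ⟨_, Rep.koszul c.self hT.rep hV hW, by simpa using totDeg_koszul hT.loc hVL hWL h1 h2⟩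
  restr := Same.of_rep fun c => by
    obtain ⟨T, hT⟩ := hS.loc c
    obtain ⟨V, hV, hVL, h1, -, h3⟩ := hω.loc hT
    obtain ⟨W, hW, hWL, h2, -, h4⟩ := hτ.loc hT
    refine ⟨_, (Rep.koszul c.self hT.rep hV hW).restr _, ?_⟩
    rw [← restr_koszul hT.loc hVL hWL h1 h2]
    exact (Rep.koszul c.self hT.rep h3 h4).restr _

theorem Lift.fd (hS : IsMaster S) (hω : Lift S ω Ω) : Lift S (fd ω) (fd Ω) where
  mem := cocyclesL_fd hS hω.mem
  deg := supp_of_rep fun c => by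
    obtain ⟨T, hT⟩ := hS.loc c
    obtain ⟨V, hV, hVL, h1, -⟩ := hω.loc hT
    exact ⟨_, hV.extD c.self, totDeg_extD hVL h1⟩
  restr := Same.of_rep fun c => by
    obtain ⟨T, hT⟩ := hS.loc c
    obtain ⟨V, hV, hVL, h1, -, h3⟩ := hω.loc hT
    refine ⟨_, (hV.extD c.self).restr _, ?_⟩
    rw [restr_extD hVL h1]
    exact h3.extD c.self

/-- The extension of a form of given parity may be chosen of the same parity. -/
theorem Lift.exists_parity (hS : IsMaster S) (hω : Lift S ω Ω) {e : ℕ} (he : HasParity ω e) :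
    ∃ Ω', Lift S ω Ω' ∧ HasParity Ω' e := by
  -- The part of parity `e`. The involution preserves cocycles and total degree and commutes with
  -- restriction, so taking this part leaves ω unchanged.
  refine ⟨(1 / 2 : ℝ) • (Ω + (-1 : ℝ) ^ e • finv Ω), ⟨?_, supp_of_rep fun c => ?_,
    Same.of_rep fun c => ?_⟩, supp_of_rep fun c => ?_⟩
  · exact cocyclesL_smul hS _ (cocyclesL_add hS hω.mem
      (cocyclesL_smul hS _ (cocyclesL_inv hS hω.mem)))
  · obtain ⟨T, hT⟩ := hS.loc c
    obtain ⟨V, hV, -, h1, -⟩ := hω.loc hT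
    exact ⟨_, (hV.add (hV.inv.smul _)).smul _, (h1.add (h1.inv.smul _)).smul _⟩
  · obtain ⟨T, hT⟩ := hS.loc c
    obtain ⟨V, hV, -, -, -, h1⟩ := hω.loc hT
    refine ⟨_, ((hV.add (hV.inv.smul _)).smul _).restr _, ?_⟩
    change Rep (ω c) (WeakKoszul.restr OnTM (parPart e V))
    rw [restr_parPart, parPart_eq (he.loc h1)]
    exact h1
  · obtain ⟨T, hT⟩ := hS.loc c
    obtain ⟨V, hV, -⟩ := hω.loc hT
    exact ⟨_, (hV.add (hV.inv.smul _)).smul _, (par_iff e).2 (par_parPart e V)⟩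

theorem frestr_congr (p : Var m r s → Prop) (h : Same g f) : Same (frestr p g) (frestr p f) := by
  classical
  intro c I n x hx
  change ((restr p (g c)) I).coeff n x = ((restr p (f c)) I).coeff n x
  rw [coeff_restr, coeff_restr]
  split_ifs
  · exact h c I n x hx
  · rfl

theorem frestr_add (p : Var m r s → Prop) (f g : Fam m r s M E F) :
    frestr p (f + g) = frestr p f + frestr p g := funext fun c => restr_add p (f c) (g c)

theorem frestr_smul (p : Var m r s → Prop) (a : ℝ) (f : Fam m r s M E F) :
    frestr p (a • f) = a • frestr p f := funext fun c => restr_smul p a (f c)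

theorem frestr_fmul (p : Var m r s → Prop) (f g : Fam m r s M E F) :
    frestr p (fmul f g) = fmul (frestr p f) (frestr p g) := funext fun c => restr_mul p (f c) (g c)

theorem frestr_same (h : IsFun p f) : Same (frestr p f) f := Same.of_rep fun c => by
  obtain ⟨G, hG, hL⟩ := h.loc c
  refine ⟨_, hG.restr p, ?_⟩
  rw [hL.restr_eq_self]
  exact hG

theorem Supp.frestr {P : Finset (OddVar m r s) → (EvenVar m r s →₀ ℕ) → Prop} (h : Supp P f)
    (p : Var m r s → Prop) : Supp P (frestr p f) := by
  classical
  intro c I n x hx hn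
  change ((restr p (f c)) I).coeff n x ≠ 0 at hn
  rw [coeff_restr] at hn
  split_ifs at hn
  · exact h c I n x hx hn
  · exact absurd rfl hn

theorem Lift.of_trivial (hS : IsMaster S) (h1 : IsFun OnL lam)
    (h2 : Supp (fun I n => wt totDeg I n = -1) lam) :
    Lift S (frestr OnTM (Qhat S lam)) (Qhat S lam) where
  mem := qhat_mem_cocyclesL hS h1
  deg := supp_of_rep fun c => by
    obtain ⟨T, hT⟩ := hS.loc c
    obtain ⟨W, hW, hWL⟩ := h1.loc c
    exact ⟨_, Rep.qHat c.self hT.rep hW, by simpa using totDeg_qHat hT.loc hWL (h2.loc hW)⟩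
  restr := same_refl _

theorem Lift.congr (h : Lift S ω Ω) (h' : Same τ ω) : Lift S τ Ω :=
  ⟨h.mem, h.deg, h.restr.trans h'.symm⟩

theorem formsM_isFun_onL (h : ω ∈ formsM S) : IsFun OnL ω := isFun_onL_of_onTM h.1

/-- Lifts of the same parities carry the identity from 𝓛 to M. The ternary bracket of the lifts has
total degree -1, so its coboundary restricts to an element of `trivialM`. -/
theorem bracketM_jacobi (hS : IsMaster S) (hω : ω ∈ formsM S) (hτ : τ ∈ formsM S)
    (hσ : σ ∈ formsM S) {e f g : ℕ} (he : HasParity ω e) (hf : HasParity τ f)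
    (hg : HasParity σ g) :
    bracketM S (bracketM S ω τ) σ + (-1 : ℝ) ^ (f * g) • bracketM S (bracketM S ω σ) τ +
      (-1 : ℝ) ^ (e * (f + g)) • bracketM S (bracketM S τ σ) ω ∈ trivialM S := by
  obtain ⟨Ω₀, h1⟩ := mem_formsM_iff.1 hω
  obtain ⟨Τ₀, h2⟩ := mem_formsM_iff.1 hτ
  obtain ⟨Λ₀, h3⟩ := mem_formsM_iff.1 hσ
  obtain ⟨Ω, h1, he'⟩ := h1.exists_parity hS he
  obtain ⟨Τ, h2, hf'⟩ := h2.exists_parity hS hf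
  obtain ⟨Λ, h3, hg'⟩ := h3.exists_parity hS hg
  refine mem_trivialM_iff.2 ⟨(-1 : ℝ) • bracket₃ S Ω Τ Λ,
    (h1.mem.1.bracket₃ hS h2.mem.1 h3.mem.1).smul (-1), supp_of_rep fun c => ?_, ?_⟩
  · obtain ⟨T, hT⟩ := hS.loc c
    obtain ⟨V, hV, -, d1, -⟩ := h1.loc hT
    obtain ⟨W, hW, -, d2, -⟩ := h2.loc hT
    obtain ⟨R, hR, -, d3, -⟩ := h3.loc hT
    exact ⟨_, (Rep.ternary c.self hT.rep hV hW hR).smul (-1),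
      (totDeg_ternary hT.loc d1 d2 d3).smul _⟩
  · refine Same.trans ?_
      (frestr_congr OnTM (bracketL_jacobi hS h1.mem h2.mem h3.mem he' hf' hg'))
    rw [frestr_add, frestr_add, frestr_smul, frestr_smul]
    exact (((h1.bracket hS h2).bracket hS h3).restr.symm.add
      (((h1.bracket hS h3).bracket hS h2).restr.symm.smul _)).add
      (((h2.bracket hS h3).bracket hS h1).restr.symm.smul _)

theorem isWeakOddPoisson_formsM (hS : IsMaster S) :
    IsWeakOddPoisson (formsM S) (trivialM S) (bracketM S) where
  one_mem := mem_formsM_iff.2 ⟨_, Lift.one hS⟩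
  add_mem _ hω _ hτ := by
    obtain ⟨Ω, h1⟩ := mem_formsM_iff.1 hω
    obtain ⟨Τ, h2⟩ := mem_formsM_iff.1 hτ
    exact mem_formsM_iff.2 ⟨_, h1.add hS h2⟩
  smul_mem a _ hω := by
    obtain ⟨Ω, h1⟩ := mem_formsM_iff.1 hω
    exact mem_formsM_iff.2 ⟨_, h1.smul hS a⟩
  mul_mem _ hω _ hτ := by
    obtain ⟨Ω, h1⟩ := mem_formsM_iff.1 hω
    obtain ⟨Τ, h2⟩ := mem_formsM_iff.1 hτ
    exact mem_formsM_iff.2 ⟨_, h1.mul hS h2⟩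
  bracket_mem _ hω _ hτ := by
    obtain ⟨Ω, h1⟩ := mem_formsM_iff.1 hω
    obtain ⟨Τ, h2⟩ := mem_formsM_iff.1 hτ
    exact mem_formsM_iff.2 ⟨_, h1.bracket hS h2⟩
  -- From here to the Leibniz rule no lift is needed: these identities hold for all functions on 𝓛,
  -- hence for forms on M regarded as such, and are simply restricted.
  bracket_add ω hω τ hτ σ hσ := by
    have := frestr_congr OnTM (bracketL_add hS (formsM_isFun_onL hω) (formsM_isFun_onL hτ)
      (formsM_isFun_onL hσ))
    rwa [frestr_add] at this
  bracket_smul a ω hω τ hτ := by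
    have := frestr_congr OnTM (bracketL_smul hS a (formsM_isFun_onL hω) (formsM_isFun_onL hτ))
    rwa [frestr_smul] at this
  bracket_odd ω hω τ hτ e f he hf :=
    (bracketL_odd hS (formsM_isFun_onL hω) (formsM_isFun_onL hτ) he hf).frestr OnTM
  bracket_symm ω hω τ hτ e f he hf := by
    have := frestr_congr OnTM (bracketL_symm hS (formsM_isFun_onL hω) (formsM_isFun_onL hτ) he hf)
    rwa [frestr_smul] at this
  leibniz ω hω τ hτ σ hσ e f he hf := by
    have hω' := formsM_isFun_onL hω
    have hτ' := formsM_isFun_onL hτ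
    have hσ' := formsM_isFun_onL hσ
    have h := frestr_congr OnTM (bracketL_leibniz hS hω' hτ' hσ' he hf)
    rw [frestr_add, frestr_smul, frestr_fmul, frestr_fmul] at h
    refine h.trans (Same.add ?_ (Same.smul _ ?_))
    · exact fmul_congr (isFun_frestr_onTM (hω'.bracketL hS hτ').1).1 hσ.1.1 (same_refl _)
        (frestr_same hσ.1)
    · exact fmul_congr hτ.1.1 (isFun_frestr_onTM (hω'.bracketL hS hσ').1).1 (frestr_same hτ.1)
        (same_refl _)
  jacobi _ hω _ hτ _ hσ _ _ _ he hf hg := bracketM_jacobi hS hω hτ hσ he hf hg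
  trivial_mem := fun ω hω => by
    obtain ⟨lam, h1, h2, h3⟩ := mem_trivialM_iff.1 hω
    exact mem_formsM_iff.2 ⟨_, (Lift.of_trivial hS h1 h2).congr h3⟩
  trivial_add ω hω τ hτ := by
    obtain ⟨lam, h1, h2, h3⟩ := mem_trivialM_iff.1 hω
    obtain ⟨mu, h4, h5, h6⟩ := mem_trivialM_iff.1 hτ
    refine mem_trivialM_iff.2 ⟨_, h1.add h4, supp_of_rep fun c => ?_, ?_⟩
    · obtain ⟨W, hW, -⟩ := h1.loc c
      obtain ⟨V, hV, -⟩ := h4.loc c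
      exact ⟨_, hW.add hV, (h2.loc hW).add (h5.loc hV)⟩
    · refine (h3.add h6).trans ?_
      rw [← frestr_add]
      exact frestr_congr _ (qhat_add hS h1 h4).symm
  trivial_mul ω hω τ hτ := by
    obtain ⟨lam, h1, h2, h3⟩ := mem_trivialM_iff.1 hω
    obtain ⟨Τ, h4⟩ := mem_formsM_iff.1 hτ
    refine mem_trivialM_iff.2 ⟨_, h1.mul h4.mem.1, supp_of_rep fun c => ?_, ?_⟩
    · obtain ⟨W, hW, -⟩ := h1.loc c
      obtain ⟨V, hV, -⟩ := h4.mem.1.loc c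
      exact ⟨_, hW.mul hV, by simpa using (h2.loc hW).mul_wt (h4.deg.loc hV)⟩
    · refine (fmul_congr (isFun_frestr_onTM (h1.qhat hS).1).1 (isFun_frestr_onTM h4.mem.1.1).1 h3
        h4.restr.symm).trans ?_
      rw [← frestr_fmul]
      exact frestr_congr _ (qhat_mul hS h1 h4.mem)
  trivial_bracket ω hω τ hτ := by
    obtain ⟨lam, h1, h2, h3⟩ := mem_trivialM_iff.1 hω
    obtain ⟨Τ, h4⟩ := mem_formsM_iff.1 hτ
    refine mem_trivialM_iff.2 ⟨_, (h1.bracketL hS h4.mem.1).smul (-1), supp_of_rep fun c => ?_, ?_⟩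
    · obtain ⟨T, hT⟩ := hS.loc c
      obtain ⟨W, hW, hWL⟩ := h1.loc c
      obtain ⟨V, hV, hVL⟩ := h4.mem.1.loc c
      exact ⟨_, (Rep.koszul c.self hT.rep hW hV).smul (-1), by
        simpa using (totDeg_koszul hT.loc hWL hVL (h2.loc hW) (h4.deg.loc hV)).smul (-1)⟩
    · exact (((Lift.of_trivial hS h1 h2).congr h3).bracket hS h4).restr.symm.trans
        (frestr_congr _ (qhat_bracketL hS h1 h4.mem))

/-! ### Vector fields on `M` -/

theorem vectorsM_loc (hX : X ∈ vectorsM S) (hS : IsMaster S)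
    (c : Chart (m := m) (r := r) (s := s) M E F) :
    ∃ G : Loc m r s (smoothAlg m c.dom), Rep (X c) G ∧ SuppIn (Involves OnN) G ∧
      SuppIn (fun I n => wt momDeg I n = 1) G := by
  obtain ⟨Y, hY, -, h⟩ := hX
  obtain ⟨T, hT⟩ := hS.loc c
  obtain ⟨G, hG, hN, hm, -⟩ := vectorsL_loc hY hT
  exact ⟨_, (hG.restr OnTsM).congr (h c), (hN.restr _).mono fun _ _ h => h.1,
    (hm.restr _).mono fun _ _ h => h.1⟩

theorem Lift.finner (hS : IsMaster S) (hω : Lift S ω Ω) (hY : Y ∈ vectorsL S)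
    (hg : Supp (fun I n => wt ghost I n = 1) Y) (hX : Same X (frestr OnTsM Y)) :
    Lift S (finner X ω) (finner Y Ω) where
  mem := cocyclesL_finner hS hY hω.mem
  deg := supp_of_rep fun c => by
    obtain ⟨T, hT⟩ := hS.loc c
    obtain ⟨V, hV, hVL, h1, -⟩ := hω.loc hT
    obtain ⟨G, hG, hN, hm, -⟩ := vectorsL_loc hY hT
    exact ⟨_, Rep.interior c.self hG hV, totDeg_interior hm hN (hg.loc hG) hVL h1⟩
  restr := Same.of_rep fun c => by
    obtain ⟨T, hT⟩ := hS.loc c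
    obtain ⟨V, hV, hVL, h1, -, h3⟩ := hω.loc hT
    obtain ⟨G, hG, hN, hm, -⟩ := vectorsL_loc hY hT
    refine ⟨_, (Rep.interior c.self hG hV).restr _, ?_⟩
    rw [restr_interior hm hN (hg.loc hG) hVL h1]
    exact Rep.interior c.self ((hG.restr OnTsM).congr (hX c)) h3

/-- A lift of `f` may contain dφ and so cannot multiply a vector field on 𝓜. Its part of form degree
zero can: it is still a cocycle, and its ghost number is zero, so the product keeps ghost number
one. -/
theorem vectorsM_mul (hS : IsMaster S) (hf : f ∈ formsM S) (hf' : IsFun OnExt f)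
    (hX : X ∈ vectorsM S) : fmul f X ∈ vectorsM S := by
  obtain ⟨Ω, h1⟩ := mem_formsM_iff.1 hf
  obtain ⟨Y, hY, hg, hXY⟩ := hX
  have hE : IsFun OnExt (frestr OnExt Ω) :=
    h1.mem.1.1.isFun_restr fun c c' => (c.tr c').invariant_onExt
  have hmem : frestr OnExt Ω ∈ cocyclesL S := by
    refine mem_cocyclesL_of hS ⟨hE.1, fun c I n p hp hn => (hE.2 c I n p hp hn).imp fun v hv => by
      rcases v with ⟨_ | _ | _ | _, A⟩ <;> simp_all [OnL, OnExt]⟩ fun c T hT => ?_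
    obtain ⟨V, hV, hVL, -, h0, -⟩ := h1.loc hT
    exact ⟨_, hV.restr _, qHat_restr_onExt hT.loc hVL h0⟩
  refine ⟨_, vectorsL_mul hS hmem hE hY, supp_of_rep fun c => ?_, Same.of_rep fun c => ?_⟩
  · obtain ⟨T, hT⟩ := hS.loc c
    obtain ⟨V, hV, hVL, hd, -⟩ := h1.loc hT
    obtain ⟨G, hG, -⟩ := vectorsL_loc hY hT
    refine ⟨_, (hV.restr OnExt).mul hG, ?_⟩
    have h0 : SuppIn (fun I n => wt ghost I n = 0) (restr OnExt V) :=
      (hd.restr OnExt).mono fun I n h => by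
        rw [← h.1]
        refine wt_congr (p := OnExt) (fun v hv => ?_) h.2
        rcases v with ⟨_ | _ | _ | _, A⟩ <;> simp_all [OnExt, totDeg, dDeg]
    simpa using h0.mul_wt (hg.loc hG)
  · obtain ⟨T, hT⟩ := hS.loc c
    obtain ⟨V, hV, hVL, -, -, h3⟩ := h1.loc hT
    obtain ⟨G, hG, -⟩ := vectorsL_loc hY hT
    refine ⟨_, h3.mul ((hG.restr OnTsM).congr (hXY c)), ?_⟩
    -- Both sides are the part of `V` without fibre coordinates; on the right because `restr OnTM V`
    -- represents `f`, which contains no dx.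
    have e : restr OnTsM (restr OnExt V) = restr OnTM V := by
      rw [← (hf'.2.loc h3).restr_eq_self, restr_restr (u := fun _ => False), restr_restr (u := fun _ => False)]
      · rintro ⟨_ | _ | _ | _, _ | _⟩ h <;> simp_all [OnTM, OnExt, Var.base]
      · rintro ⟨_ | _ | _ | _, _ | _⟩ h <;> simp_all [OnTsM, OnExt, Var.base]
    rw [← e, ← restr_mul]
    exact ((hV.restr OnExt).mul hG).restr _

theorem isInnerModule_formsM (hS : IsMaster S) :
    IsInnerModule (vectorsM S) {f | f ∈ formsM S ∧ IsFun OnExt f} (formsM S) finner where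
  inner_mem X hX ω hω := by
    obtain ⟨Ω, h1⟩ := mem_formsM_iff.1 hω
    obtain ⟨Y, hY, hg, hXY⟩ := hX
    exact mem_formsM_iff.2 ⟨_, h1.finner hS hY hg hXY⟩
  vec_add_mem X hX Y hY := by
    obtain ⟨X', h1, h2, h3⟩ := hX
    obtain ⟨Y', h4, h5, h6⟩ := hY
    refine ⟨_, vectorsL_add hS h1 h4, supp_of_rep fun c => ?_, ?_⟩
    · obtain ⟨G, hG, -⟩ := h1.1.loc c
      obtain ⟨H, hH, -⟩ := h4.1.loc c
      exact ⟨_, hG.add hH, (h2.loc hG).add (h5.loc hH)⟩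
    · rw [frestr_add]
      exact h3.add h6
  vec_smul_mem a X hX := by
    obtain ⟨X', h1, h2, h3⟩ := hX
    refine ⟨_, vectorsL_smul hS a h1, supp_of_rep fun c => ?_, ?_⟩
    · obtain ⟨G, hG, -⟩ := h1.1.loc c
      exact ⟨_, hG.smul a, (h2.loc hG).smul a⟩
    · rw [frestr_smul]
      exact h3.smul a
  vec_mul_mem f hf X hX := vectorsM_mul hS hf.1 hf.2 hX
  add_inner X hX Y hY ω hω := Same.of_rep fun c => by
    obtain ⟨G, hG, -⟩ := vectorsM_loc hX hS c
    obtain ⟨H, hH, -⟩ := vectorsM_loc hY hS c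
    obtain ⟨W, hW, -⟩ := hω.1.loc c
    refine ⟨_, Rep.interior c.self (hG.add hH) hW, ?_⟩
    rw [interior_add_left]
    exact (Rep.interior c.self hG hW).add (Rep.interior c.self hH hW)
  inner_add X hX ω hω τ hτ := Same.of_rep fun c => by
    obtain ⟨G, hG, -⟩ := vectorsM_loc hX hS c
    obtain ⟨V, hV, -⟩ := hτ.1.loc c
    obtain ⟨W, hW, -⟩ := hω.1.loc c
    refine ⟨_, Rep.interior c.self hG (hW.add hV), ?_⟩
    rw [interior_add_right]
    exact (Rep.interior c.self hG hW).add (Rep.interior c.self hG hV)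
  smul_inner a X hX ω hω := Same.of_rep fun c => by
    obtain ⟨G, hG, -⟩ := vectorsM_loc hX hS c
    obtain ⟨W, hW, -⟩ := hω.1.loc c
    refine ⟨_, Rep.interior c.self (hG.smul a) hW, ?_⟩
    rw [interior_smul_left]
    exact (Rep.interior c.self hG hW).smul a
  inner_smul a X hX ω hω := Same.of_rep fun c => by
    obtain ⟨G, hG, -⟩ := vectorsM_loc hX hS c
    obtain ⟨W, hW, -⟩ := hω.1.loc c
    refine ⟨_, Rep.interior c.self hG (hW.smul a), ?_⟩
    rw [interior_smul_right]
    exact (Rep.interior c.self hG hW).smul a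
  mul_inner f hf X hX ω hω := Same.of_rep fun c => by
    obtain ⟨G, hG, -⟩ := vectorsM_loc hX hS c
    obtain ⟨V, hV, hVL⟩ := (formsM_isFun_onL hf.1).loc c
    obtain ⟨W, hW, hWL⟩ := (formsM_isFun_onL hω).loc c
    refine ⟨_, Rep.interior c.self (hV.mul hG) hW, ?_⟩
    rw [interior_mul_left hVL hWL]
    exact hV.inv.mul (Rep.interior c.self hG hW)
  inner_comm X hX Y hY ω hω e f he hf := Same.of_rep fun c => by
    obtain ⟨G, hG, hGN, hGm⟩ := vectorsM_loc hX hS c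
    obtain ⟨H, hH, hHN, hHm⟩ := vectorsM_loc hY hS c
    obtain ⟨W, hW, hWL⟩ := (formsM_isFun_onL hω).loc c
    refine ⟨_, Rep.interior c.self hG (Rep.interior c.self hH hW), ?_⟩
    rw [interior_comm hGm hHm hGN hHN hWL (he.loc hG) (hf.loc hH),
      ← Nat.bodd_mul, ← neg_one_pow_smul]
    exact (Rep.interior c.self hH (Rep.interior c.self hG hW)).smul _

theorem fd_mem_formsM (hS : IsMaster S) (hω : ω ∈ formsM S) : fd ω ∈ formsM S := by
  obtain ⟨Ω, h1⟩ := mem_formsM_iff.1 hω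
  exact mem_formsM_iff.2 ⟨_, h1.fd hS⟩

end Projectible

end

end WeakKoszul

/-! ### The main theorem -/

open scoped Manifold in
open WeakKoszul in
theorem proposition2 {m r s : ℕ}
    {M : Type*} [TopologicalSpace M] [ChartedSpace (EuclideanSpace ℝ (Fin m)) M]
    [IsManifold (𝓡 m) ((⊤ : ℕ∞) : WithTop ℕ∞) M]
    {E : M → Type*} [TopologicalSpace (Bundle.TotalSpace (Fin r → ℝ) E)]
    [∀ p, AddCommGroup (E p)] [∀ p, Module ℝ (E p)]
    [∀ p, TopologicalSpace (E p)] [FiberBundle (Fin r → ℝ) E]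
    [VectorBundle ℝ (Fin r → ℝ) E] [ContMDiffVectorBundle ((⊤ : ℕ∞) : WithTop ℕ∞) (Fin r → ℝ) E (𝓡 m)]
    {F : M → Type*} [TopologicalSpace (Bundle.TotalSpace (Fin s → ℝ) F)]
    [∀ p, AddCommGroup (F p)] [∀ p, Module ℝ (F p)]
    [∀ p, TopologicalSpace (F p)] [FiberBundle (Fin s → ℝ) F]
    [VectorBundle ℝ (Fin s → ℝ) F] [ContMDiffVectorBundle ((⊤ : ℕ∞) : WithTop ℕ∞) (Fin s → ℝ) F (𝓡 m)]
    (S : ℕ → Fam m r s M E F) (hS : IsMaster S) :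
    -- the odd binary bracket, on cocycles over `𝓛` and on projectible forms on `M`
    (IsWeakOddPoisson (cocyclesL S) (coboundariesL S) (bracketL S) ∧
      IsWeakOddPoisson (formsM S) (trivialM S) (bracketM S)) ∧
    -- the exterior differential
    ((∀ ω ∈ cocyclesL S, fd ω ∈ cocyclesL S) ∧ ∀ ω ∈ formsM S, fd ω ∈ formsM S) ∧
    -- the interior product
    (IsInnerModule (vectorsL S) {f | f ∈ cocyclesL S ∧ IsFun OnExt f} (cocyclesL S) finner ∧
      IsInnerModule (vectorsM S) {f | f ∈ formsM S ∧ IsFun OnExt f} (formsM S)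
        finner) := 
  ⟨⟨isWeakOddPoisson_cocyclesL hS, isWeakOddPoisson_formsM hS⟩,
    ⟨fun _ hω => cocyclesL_fd hS hω, fun _ hω => fd_mem_formsM hS hω⟩,
    isInnerModule_cocyclesL hS, isInnerModule_formsM hS⟩
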